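/- **Setting.** In the I/O-model an internal memory holds $M$ records and external memory consists of blocks of $B$ records, with $B\ge 1$ and $M \ge 2B$; an I/O transfers one block (and takes $B$ units of time), and internally records are moved and compared in unit time. Write $\mathrm{sort}(k)=\frac kB\log_{M/B}\frac kB$ when counting I/Os and $\mathrm{sort}(k)=k\log k$ when counting time. A priority queue in this model (using at most a fixed fraction of $M$) is called *I/O-efficient*, with constants $0<c$ and $C$, if every sequence of at most $k$ insertions and deletions of the minimum costs at most $C\,\mathrm{sort}(k)$ I/Os (for $k>M$) and time (for $k\ge2$), every sequence of $k$ operations uses at most $Ck$ external space, and every sequence that at some moment has $k$ records stored and finally empties the queue costs at least $c\,\mathrm{sort}(k)$ I/Os (for $k\ge 2M$) and time. Let $O$ be a singly-rooted ordered (not necessarily reduced) binary decision diagram with $N'$ nodes, stored as a transposed file of arcs (the output of the outer Apply sweep), and $X$ a finite set of variables. Nested sweeping computes $\exists X: O$ as follows. The outer Reduce sweep reduces $O$ level by level, bottom-up, and accumulates the reduced nodes in a file. At each level $x_j$ with $x_j\in X$, every arc $s\to t'$ from above $x_j$ to a reduced node $t'$ on level $x_j$ becomes a request to connect $s$ to $\mathrm{low}(t')\vee\mathrm{high}(t')$,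 and every arc from above $x_j$ to a reduced $t'$ below $x_j$ (including those that previous inner sweeps gave back) becomes a request to keep $t'$. Then one inner Apply sweep (the top-down product construction for $\vee$ on the accumulated file, starting from all these requests, with its requests in priority queues) and one inner Reduce sweep (bottom-up, with a priority queue for the reduced targets and sorters for the nodes on a level) are run; the reduced output replaces the accumulated file, and the arcs that cross $x_j$ are given back to the outer sweep or to the next inner sweep. Let $T_j$ be the number of nodes in the accumulated file when the inner sweeps are invoked at $x_j$. The cost of the invocation is that of the operations on its priority queues and sorters (including the insertion of the initial requests), all implemented by one and the same kind of priority queue, plus that of the scans of its files. The outer file counts towards the space. **Lemma.** I/O-efficient priority queues exist: there are constants $K$, $0<c$ and $C$ such that for all $B\ge1$ and $M\ge K B$ there is one with these constants. Moreover, for any constants $0<c$ and $C$, when the sweeps use I/O-efficient priority queues with these constants, a single invocation of the inner Apply and Reduce sweeps at $x_j$ costs, in the worst case, $\Theta(\mathrm{sort}(N'+T_j^2))$ I/Os and time, and it uses $O(N'+T_j^2)$ space. Precisely: 1. There is a constant $C'$, depending only on $c$ and $C$, such that for all $M$, $B$, all $O$, $X$ and $x_j\in X$ the invocation at $x_j$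 costs at most $C'\,\mathrm{sort}(N'+T_j^2)$ I/Os if $N'+T_j^2>M$, takes at most $C'\,\mathrm{sort}(N'+T_j^2)$ time if $N'+T_j^2\ge2$, and uses at most $C'\,(N'+T_j^2)$ space. 2. For every $d\in\mathbb N$ there is a constant $c'>0$, depending only on $c$, $C$ and $d$, such that for all $M$, $B$ and all natural numbers $n,t$ with $t\le n^d$ and $n+t^2\ge 2$ there are $O$, $X$ and $x_j\in X$ with $N'\le n$ and $T_j\le t$ for which the invocation at $x_j$ takes at least $c'\,\mathrm{sort}(n+t^2)$ time and, if $n+t^2>M$, costs at least $c'\,\mathrm{sort}(n+t^2)$ I/Os. -/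

import Mathlib

/-! ## The I/O-model

Internal memory, external memory divided into blocks of `B` records, and programs that may only
move and compare records.  A program learns something about the records only through comparisons. -/

namespace IOModel

/-- Programs over an internal memory of `m` records (cells `2, …, m + 1`) together with an input port
(cell `0`) and an output port (cell `1`), and an external memory of blocks of `B` records.
A program ends by returning a control state in `σ`. -/
inductive Prog (m B : ℕ) (σ : Type) : Type
  /-- stop -/
  | done (s : σ)
  /-- copy the content of cell `i` to cell `j` -/
  | move (i j : Fin (m + 2)) (k : Prog m B σ)
  /-- make cell `i` empty -/
  | clear (i : Fin (m + 2)) (k : Prog m B σ)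
  /-- compare the contents of the cells `i` and `j` -/
  | cmp (i j : Fin (m + 2)) (k : Bool → Prog m B σ)
  /-- an I/O: copy the cells `p 0, …, p (B - 1)` to the external block `a` -/
  | output (a : ℕ) (p : Fin B → Fin (m + 2)) (k : Prog m B σ)
  /-- an I/O: copy external block `a` to internal memory; cell `i` receives position `q` of the block
  when `p i = some q` and is left alone when `p i = none` -/
  | input (a : ℕ) (p : Fin (m + 2) → Option (Fin B)) (k : Prog m B σ)

/-- Contents of internal and external memory; `⊤` marks an empty place. -/
structure Config (m B : ℕ) (α : Type) where
  mem : Fin (m + 2) → WithTop α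
  disk : ℕ → Fin B → WithTop α

/-- Result of an execution, with the number of I/Os, the time and the set of blocks accessed. -/
structure Outcome (m B : ℕ) (σ α : Type) where
  state : σ
  cfg : Config m B α
  ios : ℕ
  time : ℕ
  blocks : Finset ℕ

/-- Execution.  Moving, clearing and comparing take one unit of time and no I/O; transferring a block
of `B` records is one I/O and takes `B` units of time. -/
def Prog.exec {m B : ℕ} {σ α : Type} [LinearOrder α] :
    Prog m B σ → Config m B α → Outcome m B σ α
  | .done s, c => ⟨s, c, 0, 0, ∅⟩
  | .move i j k, c =>
      let r := k.exec { c with mem := Function.update c.mem j (c.mem i) }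
      { r with time := r.time + 1 }
  | .clear i k, c =>
      let r := k.exec { c with mem := Function.update c.mem i ⊤ }
      { r with time := r.time + 1 }
  | .cmp i j k, c =>
      let r := (k (decide (c.mem i ≤ c.mem j))).exec c
      { r with time := r.time + 1 }
  | .output a p k, c =>
      let r := k.exec { c with disk := Function.update c.disk a (fun q => c.mem (p q)) }
      { r with ios := r.ios + 1, time := r.time + B, blocks := insert a r.blocks }
  | .input a p k, c =>
      let r := k.exec { c with mem := fun i => ((p i).map (c.disk a)).getD (c.mem i) }
      { r with ios := r.ios + 1, time := r.time + B, blocks := insert a r.blocks }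

/-- The operations on a priority queue. -/
inductive Op (α : Type) : Type
  | insert (x : α)
  | deleteMin

/-- The abstract effect of one operation on the multiset of stored records. -/
def Op.apply {α : Type} [LinearOrder α] (s : Multiset α) : Op α → Multiset α
  | .insert x => x ::ₘ s
  | .deleteMin =>
      match (s.map (fun x => (x : WithTop α))).inf with
      | none => s
      | some x => s.erase x

/-- The records stored after a sequence of operations on an initially empty queue. -/
def contents {α : Type} [LinearOrder α] (ops : List (Op α)) : Multiset α :=
  ops.foldl Op.apply 0

/-- An implementation of a priority queue with an internal memory of `m` records. A record that is
inserted arrives in the input port. -/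
structure ExtPQ (m B : ℕ) where
  Ctrl : Type
  init : Ctrl
  insert : Ctrl → Prog m B Ctrl
  deleteMin : Ctrl → Prog m B Ctrl

namespace ExtPQ

variable {m B : ℕ} (P : ExtPQ m B)

/-- Execution of one further operation. -/
def step {α : Type} [LinearOrder α] (o : Outcome m B P.Ctrl α) (op : Op α) :
    Outcome m B P.Ctrl α :=
  let r := match op with
    | .insert x => (P.insert o.state).exec { o.cfg with mem := Function.update o.cfg.mem 0 x }
    | .deleteMin => (P.deleteMin o.state).exec o.cfg
  { r with
    ios := o.ios + r.ios
    time := o.time + r.time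
    blocks := o.blocks ∪ r.blocks }

/-- Execution of a sequence of operations, from an empty queue and an empty memory. -/
def run {α : Type} [LinearOrder α] (ops : List (Op α)) : Outcome m B P.Ctrl α :=
  ops.foldl P.step ⟨P.init, ⟨fun _ => ⊤, fun _ _ => ⊤⟩, 0, 0, ∅⟩

/-- After every sequence of operations the output port shows the smallest stored record. -/
def Correct : Prop :=
  ∀ (α : Type) [LinearOrder α] (ops : List (Op α)),
    (P.run ops).cfg.mem 1 = ((contents ops).map (fun x => (x : WithTop α))).inf

end ExtPQ

/-- `sort(k) = (k / B) log_{M / B} (k / B)`, for counting I/Os. -/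
noncomputable def sortIO (M B k : ℕ) : ℝ :=
  (k : ℝ) / B * Real.logb ((M : ℝ) / B) ((k : ℝ) / B)

/-- `sort(k) = k log k`, for counting time. -/
noncomputable def sortTime (k : ℕ) : ℝ := (k : ℝ) * Real.log k

/-- An I/O-efficient priority queue, with constants `c` and `C`, on a machine with internal memory `M`:
`k` insertions and deletions cost `O(sort(k))` I/Os and time and `O(k)` space, and it costs
`Ω(sort(k))` I/Os and time to have `k` records stored simultaneously and to retrieve all of them in
sorted order.  The bounds on the I/Os are for `k` exceeding the internal memory. -/
structure ExtPQ.Efficient {m B : ℕ} (P : ExtPQ m B) (M : ℕ) (c C : ℝ) : Prop where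
  correct : P.Correct
  ios_le : ∀ (α : Type) [LinearOrder α] (ops : List (Op α)) (k : ℕ),
    ops.length ≤ k → M < k → ((P.run ops).ios : ℝ) ≤ C * sortIO M B k
  time_le : ∀ (α : Type) [LinearOrder α] (ops : List (Op α)) (k : ℕ),
    ops.length ≤ k → 2 ≤ k → ((P.run ops).time : ℝ) ≤ C * sortTime k
  space_le : ∀ (α : Type) [LinearOrder α] (ops : List (Op α)),
    (((P.run ops).blocks.card * B : ℕ) : ℝ) ≤ C * (ops.length : ℝ)
  le_ios : ∀ (α : Type) [LinearOrder α] (pre ops : List (Op α)) (k : ℕ),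
    pre <+: ops → k ≤ (contents pre).card → contents ops = 0 → 2 * M ≤ k →
      c * sortIO M B k ≤ ((P.run ops).ios : ℝ)
  le_time : ∀ (α : Type) [LinearOrder α] (pre ops : List (Op α)) (k : ℕ),
    pre <+: ops → k ≤ (contents pre).card → contents ops = 0 →
      c * sortTime k ≤ ((P.run ops).time : ℝ)

end IOModel

/-! ## Decision diagrams as files of nodes and of arcs -/

namespace NestedSweep

open IOModel

/-- Unique identifier of a node: its level and its index on that level.  The variable order is the
identity, so that level `i` is the level of the variable `x_i`. -/
abbrev Uid := ℕ × ℕ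

/-- A node or one of the two terminals. -/
inductive Ptr
  | node (u : Uid)
  | term (b : Bool)
  deriving DecidableEq

/-- Does the pointer lead to a node on level `ℓ`? -/
def Ptr.onLevel (ℓ : ℕ) : Ptr → Bool
  | .node u => u.1 == ℓ
  | .term _ => false

def Ptr.isTerm : Ptr → Bool
  | .node _ => false
  | .term _ => true

structure Node where
  uid : Uid
  low : Ptr
  high : Ptr
  deriving DecidableEq

/-- The start of an arc: a node and whether it is the high arc; `none` for the arc into the root. -/
abbrev Src := Option (Uid × Bool)

structure Arc where
  src : Src
  tgt : Ptr
  deriving DecidableEq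

/-- Level of the start of an arc; the arc into the root starts above all levels. -/
def srcLevel : Src → WithBot ℕ
  | none => ⊥
  | some (u, _) => (u.1 : ℕ)

/-- Keys by which records are ordered, lexicographically: nodes come levelised, before terminals.
All keys in one queue have the same constant length. -/
abbrev Key := List ℤ

def uidKey (u : Uid) : Key := [(u.1 : ℤ), (u.2 : ℤ)]

def Ptr.key : Ptr → Key
  | .node u => 0 :: uidKey u
  | .term b => [1, if b then 1 else 0, 0]

def srcKey : Src → Key
  | none => [-1, 0, 0]
  | some (u, h) => uidKey u ++ [if h then 1 else 0]

/-- Reversal of the order on keys of the same length, for bottom-up sweeps. -/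
def revKey (k : Key) : Key := k.map (fun z => -z)

def sortBy {ρ : Type} (key : ρ → Key) (l : List ρ) : List ρ :=
  l.mergeSort (fun a b => decide (key a ≤ key b))

/-- A file of nodes with a root; see `Obdd.WF`. -/
structure Obdd where
  nodes : List Node
  root : Ptr

/-- The nodes of the file are the nodes of a singly-rooted ordered (not necessarily reduced) binary
decision diagram, in levelised order. -/
structure Obdd.WF (O : Obdd) : Prop where
  sorted : O.nodes.Pairwise (fun a b => uidKey a.uid < uidKey b.uid)
  /-- the variables occur in order on each path -/
  ordered : ∀ n ∈ O.nodes, ∀ u : Uid, (n.low = .node u ∨ n.high = .node u) → n.uid.1 < u.1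
  closed : ∀ n ∈ O.nodes, ∀ u : Uid, (n.low = .node u ∨ n.high = .node u) →
    ∃ n' ∈ O.nodes, n'.uid = u
  root_mem : ∀ u : Uid, O.root = .node u → ∃ n ∈ O.nodes, n.uid = u
  /-- the root is the only source -/
  rooted : ∀ n ∈ O.nodes, O.root = .node n.uid ∨
    ∃ n' ∈ O.nodes, n'.low = .node n.uid ∨ n'.high = .node n.uid

/-- All arcs, including the one into the root. -/
def Obdd.allArcs (O : Obdd) : List Arc :=
  ⟨none, O.root⟩ ::
    O.nodes.flatMap (fun n => [⟨some (n.uid, false), n.low⟩, ⟨some (n.uid, true), n.high⟩])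

/-- The transposed diagram: the arcs between nodes, sorted by their target. -/
def Obdd.arcs (O : Obdd) : List Arc :=
  sortBy (fun a => a.tgt.key ++ srcKey a.src) (O.allArcs.filter (fun a => !a.tgt.isTerm))

/-- The arcs to terminals. -/
def Obdd.terms (O : Obdd) : List Arc := O.allArcs.filter (fun a => a.tgt.isTerm)

/-! ## Reducing one level -/

/-- The nodes on level `ℓ`, obtained from their outgoing arcs. -/
def collect (ℓ : ℕ) (as : List Arc) : List Node :=
  let uids := (as.filterMap (fun a => a.src.map Prod.fst)).filter (fun u => u.1 == ℓ)
  let tgt : Uid → Bool → Ptr := fun u h =>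
    ((as.find? (fun a => a.src == some (u, h))).map Arc.tgt).getD (.term false)
  (sortBy uidKey uids).dedup.map (fun u => ⟨u, tgt u false, tgt u true⟩)

/-- The children of the nodes that are not redundant, sorted and without duplicates. -/
def kids (L : List Node) : List (Ptr × Ptr) :=
  (sortBy (fun p => p.1.key ++ p.2.key)
    ((L.filter (fun n => n.low != n.high)).map (fun n => (n.low, n.high)))).dedup

/-- The reduced nodes on level `ℓ`. -/
def newNodes (ℓ : ℕ) (L : List Node) : List Node :=
  (kids L).zipIdx.map (fun p => ⟨(ℓ, p.2), p.1.1, p.1.2⟩)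

/-- The result of reducing the node `u` of level `ℓ`: a redundant node is replaced by its child, and
duplicates are merged. -/
def image (ℓ : ℕ) (L : List Node) (u : Uid) : Ptr :=
  match L.find? (fun n => n.uid == u) with
  | none => .term false
  | some n => if n.low = n.high then n.low else .node (ℓ, (kids L).idxOf (n.low, n.high))

/-- The arcs of a transposed file into level `ℓ`, read backwards and with their reduced targets. -/
def forward (arcs : List Arc) (ℓ : ℕ) (L : List Node) : List Arc :=
  (arcs.reverse.filter (fun a => a.tgt.onLevel ℓ)).map (fun a =>
    match a.tgt with
    | .node u => ⟨a.src, image ℓ L u⟩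
    | .term b => ⟨a.src, .term b⟩)

/-! ## Inner Apply -/

/-- A request for the disjunction of `fst` and `snd`, to be the target of the arc starting in `src`. -/
structure Req where
  src : Src
  fst : Ptr
  snd : Ptr
  deriving DecidableEq

def Req.key (r : Req) : Key := r.fst.key ++ r.snd.key ++ srcKey r.src

/-- Normal form of the disjunction of two pointers: the smaller one first; the first one is a terminal
exactly if the disjunction is resolved to that terminal. -/
def orTarget (a b : Ptr) : Ptr × Ptr :=
  if a = .term true ∨ b = .term true then (.term true, .term false)
  else if a.key ≤ b.key then (a, b) else (b, a)

def orReq (s : Src) (a b : Ptr) : Req := ⟨s, (orTarget a b).1, (orTarget a b).2⟩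

/-- A request that preserves the subtree of `t`. -/
def keepReq (a : Arc) : Req := orReq a.src a.tgt (.term false)

/-- A request `req` with two different nodes on the same level, together with the children of the first
one, which has been read already. -/
structure Fwd where
  req : Req
  low : Ptr
  high : Ptr

def Fwd.key (w : Fwd) : Key := w.req.snd.key ++ w.req.fst.key ++ srcKey w.req.src

/-- State of the inner Apply sweep: the content of its two priority queues, the operations that have
been executed on them, and the output file (arcs between nodes and arcs to terminals). -/
structure ApplyState where
  q₁ : List Req
  q₂ : List Fwd
  ops₁ : List (Op Key)
  ops₂ : List (Op Key)
  arcs : List Arc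
  terms : List Arc
  fresh : ℕ → ℕ

/-- Create a node on level `ℓ` that answers the requests `rs`; requests for its two children `lo` and
`hi` are placed in the first priority queue, or output if they are resolved to a terminal. -/
def ApplyState.emit (st : ApplyState) (ℓ : ℕ) (rs : List Req) (lo hi : Ptr × Ptr) : ApplyState :=
  let u : Uid := (ℓ, st.fresh ℓ)
  let ks : List Req := [orReq (some (u, false)) lo.1 lo.2, orReq (some (u, true)) hi.1 hi.2]
  let inner := ks.filter (fun r => !r.fst.isTerm)
  { st with
    fresh := Function.update st.fresh ℓ (st.fresh ℓ + 1)
    arcs := st.arcs ++ rs.map (fun r => ⟨r.src, .node u⟩)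
    terms := st.terms ++ (ks.filter (fun r => r.fst.isTerm)).map (fun r => ⟨r.src, r.fst⟩)
    q₁ := st.q₁ ++ inner
    ops₁ := st.ops₁ ++ inner.map (fun r => Op.insert r.key) }

/-- Process all requests for the pair `p`, whose first component is the node `n`. -/
def ApplyState.first (n : Node) (st : ApplyState) (p : Ptr × Ptr) : ApplyState :=
  let g := sortBy Req.key (st.q₁.filter (fun r => (r.fst, r.snd) == p))
  let st' := { st with
    q₁ := st.q₁.filter (fun r => (r.fst, r.snd) != p)
    ops₁ := st.ops₁ ++ g.map (fun _ => Op.deleteMin) }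
  if p.2 = p.1 then
    st'.emit n.uid.1 g (n.low, n.low) (n.high, n.high)
  else if p.2.onLevel n.uid.1 then
    let w := g.map (fun r => (⟨r, n.low, n.high⟩ : Fwd))
    { st' with
      q₂ := st'.q₂ ++ w
      ops₂ := st'.ops₂ ++ w.map (fun r => Op.insert r.key) }
  else
    st'.emit n.uid.1 g (n.low, p.2) (n.high, p.2)

/-- Process all forwarded requests for the pair `p`, whose second component is the node `n`. -/
def ApplyState.second (n : Node) (st : ApplyState) (p : Ptr × Ptr) : ApplyState :=
  let g := sortBy Fwd.key (st.q₂.filter (fun w => (w.req.fst, w.req.snd) == p))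
  let st' := { st with
    q₂ := st.q₂.filter (fun w => (w.req.fst, w.req.snd) != p)
    ops₂ := st.ops₂ ++ g.map (fun _ => Op.deleteMin) }
  match g with
  | [] => st'
  | w :: _ => st'.emit n.uid.1 (g.map Fwd.req) (w.low, n.low) (w.high, n.high)

/-- Read the node `n` and process all requests that wait for it. -/
def ApplyState.read (st : ApplyState) (n : Node) : ApplyState :=
  let ps := ((sortBy Req.key (st.q₁.filter (fun r => r.fst == .node n.uid))).map
    (fun r => (r.fst, r.snd))).dedup
  let st := ps.foldl (ApplyState.first n) st
  let ps := ((sortBy Fwd.key (st.q₂.filter (fun w => w.req.snd == .node n.uid))).map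
    (fun w => (w.req.fst, w.req.snd))).dedup
  ps.foldl (ApplyState.second n) st

/-- At the end the requests for terminals are output. -/
def ApplyState.finish (st : ApplyState) : ApplyState :=
  let g := sortBy Req.key st.q₁
  { st with
    q₁ := []
    ops₁ := st.ops₁ ++ g.map (fun _ => Op.deleteMin)
    terms := st.terms ++ g.map (fun r => ⟨r.src, r.fst⟩) }

/-- The inner Apply sweep: the priority queue is populated with the requests `rs`, and the nodes of
the accumulated reduced file are read top-down. -/
def innerApply (file : List Node) (rs : List Req) : ApplyState :=
  (file.foldl ApplyState.read
    ⟨rs, [], rs.map (fun r => Op.insert r.key), [], [], [], fun _ => 0⟩).finish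

/-! ## Inner Reduce -/

/-- State of the inner Reduce sweep: content of its priority queue, the reduced nodes, the arcs that
are given back to the outer sweep, the operations on the priority queue, on the sorter of the nodes by
their children, on the sorter of the reduced nodes by the original uid and on the receiving queue,
and the number of redundant nodes. -/
structure ReduceState where
  q : List Arc
  out : List Node
  back : List Arc
  opsUp : List (Op Key)
  opsKids : List (Op Key)
  opsUid : List (Op Key)
  opsBack : List (Op Key)
  redundant : ℕ

/-- Reduce level `ℓ` of the file with arcs `arcs` and `terms` in the inner Reduce sweep at `x_j`. -/
def ReduceState.level (j : ℕ) (arcs terms : List Arc) (ℓ : ℕ) (st : ReduceState) : ReduceState :=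
  let here := st.q.filter (fun a => srcLevel a.src = ℓ)
  let L := collect ℓ (here ++ terms)
  let L' := L.filter (fun n => n.low != n.high)
  let fw := forward arcs ℓ L
  let stay := fw.filter (fun a => (j : WithBot ℕ) < srcLevel a.src)
  let back := fw.filter (fun a => ¬ (j : WithBot ℕ) < srcLevel a.src)
  { q := st.q.filter (fun a => srcLevel a.src ≠ ℓ) ++ stay
    out := newNodes ℓ L ++ st.out
    back := st.back ++ back
    opsUp := st.opsUp ++ here.map (fun _ => Op.deleteMin) ++
      stay.map (fun a => Op.insert (revKey (srcKey a.src ++ a.tgt.key)))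
    opsKids := st.opsKids ++ L'.map (fun n => Op.insert (n.low.key ++ n.high.key ++ uidKey n.uid)) ++
      L'.map (fun _ => Op.deleteMin)
    opsUid := st.opsUid ++
      (sortBy (fun n => n.low.key ++ n.high.key ++ uidKey n.uid) L').map (fun n =>
        Op.insert (revKey (uidKey n.uid ++ (image ℓ L n.uid).key))) ++
      L'.map (fun _ => Op.deleteMin)
    opsBack := st.opsBack ++
      back.map (fun a => Op.insert (revKey (srcKey a.src ++ a.tgt.key)))
    redundant := st.redundant + (L.length - L'.length) }

/-- The first `i` steps of the inner Reduce sweep at `x_j`, which start with level `j + k` and go up. -/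
def innerReduceSteps (j k : ℕ) (arcs terms : List Arc) : ℕ → ReduceState
  | 0 =>
    let back := terms.filter (fun a => ¬ (j : WithBot ℕ) < srcLevel a.src)
    ⟨[], [], back, [], [], [],
      back.map (fun a => Op.insert (revKey (srcKey a.src ++ a.tgt.key))), 0⟩
  | i + 1 => (innerReduceSteps j k arcs terms i).level j arcs terms (j + k - i)

/-- The inner Reduce sweep at `x_j`, over the levels `j + k, …, j + 1`. -/
def innerReduce (j k : ℕ) (arcs terms : List Arc) : ReduceState :=
  innerReduceSteps j k arcs terms k

/-! ## Nested sweeping for `exists` -/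

/-- State of nested sweeping: the accumulated reduced file, the content of the priority queue of the
outer Reduce sweep and the requests for the next inner Apply sweep. -/
structure State where
  file : List Node
  up : List Arc
  down : List Req

/-- All levels that occur are below this number. -/
def depth (O : Obdd) (X : Finset ℕ) : ℕ :=
  max ((O.nodes.map (fun n => n.uid.1 + 1)).foldr max 0) (X.sup (fun x => x + 1))

/-- Does an arc with this start go to the queue of the outer Reduce sweep after level `ℓ`?  Otherwise
it spans across the next quantified level above `ℓ`. -/
def staysUp (X : Finset ℕ) (ℓ : ℕ) (s : Src) : Bool :=
  decide ((X.filter (fun x => x < ℓ)).max ≤ srcLevel s)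

/-- The unreduced nodes of level `ℓ`, with reduced children, when the outer Reduce sweep gets there. -/
def levelNodes (O : Obdd) (ℓ : ℕ) (s : State) : List Node := collect ℓ (s.up ++ O.terms)

/-- The requests when the inner Apply sweep is invoked at `x_ℓ`: an arc to a reduced node of
level `ℓ` becomes a request for the disjunction of the children of that node. -/
def requestsAt (O : Obdd) (ℓ : ℕ) (s : State) : List Req :=
  let L := levelNodes O ℓ s
  s.down ++ (forward O.arcs ℓ L).map (fun a =>
    match (newNodes ℓ L).find? (fun n => a.tgt == .node n.uid) with
    | some n => orReq a.src n.low n.high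
    | none => keepReq a)

/-- The outer Reduce sweep on level `ℓ`, with the inner sweeps if `x_ℓ` is to be quantified. -/
def outerLevel (O : Obdd) (X : Finset ℕ) (ℓ : ℕ) (s : State) : State :=
  if ℓ ∈ X then
    let A := innerApply s.file (requestsAt O ℓ s)
    let R := innerReduce ℓ (depth O X - 1 - ℓ) A.arcs A.terms
    { file := R.out
      up := R.back.filter (fun a => staysUp X ℓ a.src)
      down := (R.back.filter (fun a => !staysUp X ℓ a.src)).map keepReq }
  else
    let L := levelNodes O ℓ s
    let fw := forward O.arcs ℓ L
    { file := newNodes ℓ L ++ s.file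
      up := s.up.filter (fun a => srcLevel a.src ≠ ℓ) ++ fw.filter (fun a => staysUp X ℓ a.src)
      down := s.down ++ (fw.filter (fun a => !staysUp X ℓ a.src)).map keepReq }

/-- The state of nested sweeping after the `i` deepest levels have been processed. -/
def stateAfter (O : Obdd) (X : Finset ℕ) : ℕ → State
  | 0 => ⟨[], [], []⟩
  | i + 1 => outerLevel O X (depth O X - 1 - i) (stateAfter O X i)

/-- The state when the outer Reduce sweep gets to level `j`. -/
def stateAt (O : Obdd) (X : Finset ℕ) (j : ℕ) : State := stateAfter O X (depth O X - 1 - j)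

/-- `N'`: the size of the output `O` of the outer Apply sweep. -/
def Obdd.size (O : Obdd) : ℕ := O.nodes.length

/-- `T_j`: the size of the accumulated reduced file when the inner sweeps are invoked at `x_j`. -/
def accumulated (O : Obdd) (X : Finset ℕ) (j : ℕ) : ℕ := (stateAt O X j).file.length

/-- The inner Apply sweep that is invoked at `x_j`. -/
def applyAt (O : Obdd) (X : Finset ℕ) (j : ℕ) : ApplyState :=
  innerApply (stateAt O X j).file (requestsAt O j (stateAt O X j))

/-- The inner Reduce sweep that is invoked at `x_j`. -/
def reduceAt (O : Obdd) (X : Finset ℕ) (j : ℕ) : ReduceState :=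
  innerReduce j (depth O X - 1 - j) (applyAt O X j).arcs (applyAt O X j).terms

/-! ## The cost of one invocation of the inner sweeps -/

/-- The sequences of operations on the priority queues and sorters of the inner sweeps at `x_j`. -/
def traces (O : Obdd) (X : Finset ℕ) (j : ℕ) : List (List (Op Key)) :=
  let A := applyAt O X j
  let R := reduceAt O X j
  [A.ops₁, A.ops₂, R.opsUp, R.opsKids, R.opsUid, R.opsBack]

/-- The sizes of the files of the inner sweeps at `x_j`: the accumulated reduced file, the arcs
between nodes and the arcs to terminals of the unreduced output, the redundant nodes and the
reduced output. -/
def fileSizes (O : Obdd) (X : Finset ℕ) (j : ℕ) : List ℕ :=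
  let A := applyAt O X j
  let R := reduceAt O X j
  [accumulated O X j, A.arcs.length, A.terms.length, R.redundant, R.out.length]

variable {m B : ℕ} (P : ExtPQ m B)

/-- The number of I/Os: those of the queues, and two scans of each file (to write and to read it). -/
def sweepIOs (O : Obdd) (X : Finset ℕ) (j : ℕ) : ℕ :=
  ((traces O X j).map (fun ops => (P.run ops).ios)).sum +
    ((fileSizes O X j).map (fun l => 2 * (l ⌈/⌉ B))).sum

/-- The time: that of the queues, and a unit for each operation on a queue and for each record that is
written to or read from a file. -/
def sweepTime (O : Obdd) (X : Finset ℕ) (j : ℕ) : ℕ :=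
  ((traces O X j).map (fun ops => (P.run ops).time + ops.length)).sum +
    ((fileSizes O X j).map (fun l => 2 * l)).sum

/-- The space in external memory: that of the queues, of the files of the inner sweeps, and of the
file of arcs from the outer Apply sweep. -/
def sweepSpace (O : Obdd) (X : Finset ℕ) (j : ℕ) : ℕ :=
  ((traces O X j).map (fun ops => (P.run ops).blocks.card * B)).sum +
    (fileSizes O X j).sum + 2 * O.size

end NestedSweep

namespace NestedSweep

open IOModel

/-! ## Orders on keys, and lists -/

/-! Upper bounds. While the inner Apply sweep reads a node, every pair of pointers that it processes
has this node as one component; the other component is one of the T_j nodes of the file or one of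
the two terminals. So at most T_j (2 T_j + 4) nodes are created (`ApplyInv.read`,
`innerApply_spec`). The initial requests are no more numerous than the arcs of O, however many inner
sweeps came before: the multiset of the starts and meanings of all arcs in transit always equals
that of the arcs of O that cross the current level (`StateInv`, `StateInv.step`,
`StateInv.requests_ok`). Every queue operation and every file record is charged to a request or to
an arc of a created node, so each trace and each file has length at most 24 (N' + T_j²)
(`traces_files_le`), and sort changes by a constant factor only when its argument does.

Meanings are Boolean functions. The invariants of Apply and Reduce carry a set S, closed under the
cofactors that occur, that contains the meanings of all nodes. For the upper bounds S is everything.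
For the lower bound it is a small explicit family, and since reduced diagrams are canonical
(`den_injective`), the size of that family bounds the number of nodes of a reduced file.

Lower bounds. If n dominates t², a chain whose arcs mostly lead to the deepest level yields n
requests over an empty file; they are all stored at once and then deleted (`large_chain`). Otherwise
take p with 2^p about t. The ladder has 6 p + 1 nodes, which is at most n because t is polynomial in
n and n is large. After the sweep at x_1 the file holds diagrams for the two halves of the
disjunction of the a_k ∧ c_k over k < 2 p, each of size O(2^p) (`accumulated_ladder_le`). All a_k
precede all c_k in the order, so the diagram of the whole disjunction must remember which a_k were
true: it has 2^(2p-1) nodes on a single level, and the sorter of that level stores them all at the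
same time (`large_ladder`). If such a set is too small for the I/O lower bound of the queue,
scanning it is already enough (`Large.le_sweepIOs`). Bounded n and t are covered by any positive
cost (`lower_bounds`).

Existence of queues. A heap of sorted nodes is kept on disk, each with d children and an area of 2 d
blocks, where d is of order M/B; an insertion buffer and a deletion buffer stay in internal memory.
A full insertion buffer becomes a new leaf after its records have been exchanged with those on the
path from the root, at a cost proportional to d B times the depth (`Queue.flush_spec`). An underfull
node is refilled by a multiway merge of its children (`pull_spec`). This is paid for by a potential:
the sum of the depths of the records plus d B for each node with a non-empty proper descendant. A
merge that delivers d B records lowers the first term, and a merge that delivers fewer exhausts the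
subtree and lowers the second (`Pulled.potential_add_le`, `refill_spec`). The total depth of the
nodes is then of order sort(k) (`ios_depths_le`, `time_depths_le`). The required lower bounds on the
cost of the queue are enforced by artificial delays (`ExtPQ.run_padded`, `efficient_heapQueue`). -/

theorem uidKey_lt {u v : Uid} : uidKey u < uidKey v ↔ u.1 < v.1 ∨ u.1 = v.1 ∧ u.2 < v.2 := by
  simp [uidKey, List.cons_lt_cons_iff]

theorem uidKey_injective : Function.Injective uidKey := by
  rintro ⟨a, b⟩ ⟨c, d⟩ h
  simpa [uidKey] using h

theorem level_le_of_uidKey_le {u v : Uid} (h : uidKey u ≤ uidKey v) : u.1 ≤ v.1 := by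
  by_contra hlt
  exact absurd (uidKey_lt.2 (Or.inl (not_le.1 hlt))) (not_lt.2 h)

theorem node_key_lt {u v : Uid} : (Ptr.node u).key < (Ptr.node v).key ↔ uidKey u < uidKey v := by
  simp [Ptr.key]

theorem node_key_le {u v : Uid} : (Ptr.node u).key ≤ (Ptr.node v).key ↔ uidKey u ≤ uidKey v := by
  rw [← not_lt, ← not_lt, node_key_lt]

theorem sortBy_perm {ρ : Type} (key : ρ → Key) (l : List ρ) : (sortBy key l).Perm l :=
  List.mergeSort_perm _ _

theorem mem_sortBy {ρ : Type} {key : ρ → Key} {l : List ρ} {x : ρ} : x ∈ sortBy key l ↔ x ∈ l :=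
  (sortBy_perm key l).mem_iff

theorem length_sortBy {ρ : Type} (key : ρ → Key) (l : List ρ) : (sortBy key l).length = l.length :=
  (sortBy_perm key l).length_eq

/-- This is how a border moves by one level: the arcs that end beyond the new border are those that
end beyond the old one together with those that end on the level in between. -/
theorem filter_perm_append {α : Type*} (p q r : α → Bool) (l : List α)
    (h : ∀ a ∈ l, p a = (q a || r a)) (h' : ∀ a ∈ l, ¬ (q a = true ∧ r a = true)) :
    (l.filter p).Perm (l.filter q ++ l.filter r) := by
  induction l with
  | nil => simp
  | cons a l ih =>
    have ih' := ih (fun b hb => h b (List.mem_cons_of_mem _ hb))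
      (fun b hb => h' b (List.mem_cons_of_mem _ hb))
    have h1 := h a List.mem_cons_self
    have h2 := h' a List.mem_cons_self
    rcases hq : q a with _ | _ <;> rcases hr : r a with _ | _ <;> simp_all
    exact (List.Perm.cons a ih').trans List.perm_middle.symm

/-- The list of all values that are not removed and of those that are removed. -/
theorem filter_not_perm {α : Type*} (p : α → Bool) (l : List α) :
    l.Perm (l.filter (fun a => !p a) ++ l.filter p) := by
  have := filter_perm_append (fun _ => true) (fun a => !p a) p l (by simp) (by simp)
  simpa using this

/-! ## The meaning of a file of nodes -/

/-- Boolean functions of the variables `x₀, x₁, …`. -/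
abbrev BoolFn := (ℕ → Bool) → Bool

/-- The pointer leads to a terminal or to a node of the file. -/
def Has (F : List Node) (p : Ptr) : Prop := ∀ u, p = .node u → ∃ n ∈ F, n.uid = u

/-- If the pointer leads to a node, then this is below level `ℓ`. -/
def Below (ℓ : ℕ) (p : Ptr) : Prop := ∀ u, p = .node u → ℓ < u.1

/-- The function represented by a pointer into a file, with the variables in `X` quantified. -/
def den (X : Finset ℕ) : List Node → Ptr → BoolFn
  | [], p, _ => decide (p = .term true)
  | n :: F, p, v =>
    if p = .node n.uid then
      if n.uid.1 ∈ X then den X F n.low v || den X F n.high v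
      else den X F (if v n.uid.1 then n.high else n.low) v
    else den X F p v

/-- Files of nodes in levelised order, closed under taking children. -/
structure FileOK (F : List Node) : Prop where
  sorted : F.Pairwise (fun a b => uidKey a.uid < uidKey b.uid)
  low_below : ∀ n ∈ F, Below n.uid.1 n.low
  high_below : ∀ n ∈ F, Below n.uid.1 n.high
  low_has : ∀ n ∈ F, Has F n.low
  high_has : ∀ n ∈ F, Has F n.high

theorem Has.term (F : List Node) (b : Bool) : Has F (.term b) := by
  intro u h; cases h

theorem Below.term (ℓ : ℕ) (b : Bool) : Below ℓ (.term b) := by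
  intro u h; cases h

theorem Below.mono {ℓ ℓ' : ℕ} {p : Ptr} (h : Below ℓ p) (hl : ℓ' ≤ ℓ) : Below ℓ' p :=
  fun u hu => lt_of_le_of_lt hl (h u hu)

theorem has_node {F : List Node} {n : Node} (h : n ∈ F) : Has F (.node n.uid) := by
  intro u hu; cases hu; exact ⟨n, h, rfl⟩

theorem Has.mono {F G : List Node} {p : Ptr} (h : Has F p) (hs : F ⊆ G) : Has G p := by
  intro u hu; obtain ⟨n, hn, e⟩ := h u hu; exact ⟨n, hs hn, e⟩

theorem FileOK.nil : FileOK [] := ⟨List.Pairwise.nil, by simp, by simp, by simp, by simp⟩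

theorem FileOK.eq_of_uid {F : List Node} (h : FileOK F) {a b : Node} (ha : a ∈ F) (hb : b ∈ F)
    (e : a.uid = b.uid) : a = b := by
  have := h.sorted
  clear h
  induction F with
  | nil => cases ha
  | cons n F ih =>
    rw [List.pairwise_cons] at this
    rcases List.mem_cons.1 ha with h1 | h1 <;> rcases List.mem_cons.1 hb with h2 | h2
    · rw [h1, h2]
    · exact absurd (this.1 b h2) (by rw [← h1, e]; exact lt_irrefl _)
    · exact absurd (this.1 a h1) (by rw [← h2, e]; exact lt_irrefl _)
    · exact ih h1 h2 this.2

theorem FileOK.has_tail {n : Node} {F : List Node} {p : Ptr} {ℓ : ℕ}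
    (hp : Has (n :: F) p) (hb : Below ℓ p) (hl : n.uid.1 ≤ ℓ) : Has F p := by
  intro u hu
  obtain ⟨m, hm, rfl⟩ := hp u hu
  rcases List.mem_cons.1 hm with rfl | hm
  · exact absurd (hb _ hu) (by omega)
  · exact ⟨m, hm, rfl⟩

theorem FileOK.tail {n : Node} {F : List Node} (h : FileOK (n :: F)) : FileOK F := by
  have hs := List.pairwise_cons.1 h.sorted
  have hl : ∀ m ∈ F, n.uid.1 ≤ m.uid.1 := fun m hm => level_le_of_uidKey_le (hs.1 m hm).le
  exact ⟨hs.2, fun m hm => h.low_below m (List.mem_cons_of_mem _ hm),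
    fun m hm => h.high_below m (List.mem_cons_of_mem _ hm),
    fun m hm => FileOK.has_tail (h.low_has m (List.mem_cons_of_mem _ hm))
      (h.low_below m (List.mem_cons_of_mem _ hm)) (hl m hm),
    fun m hm => FileOK.has_tail (h.high_has m (List.mem_cons_of_mem _ hm))
      (h.high_below m (List.mem_cons_of_mem _ hm)) (hl m hm)⟩

theorem FileOK.low_has_tail {n : Node} {F : List Node} (h : FileOK (n :: F)) : Has F n.low :=
  FileOK.has_tail (h.low_has n List.mem_cons_self) (h.low_below n List.mem_cons_self) le_rfl

theorem FileOK.high_has_tail {n : Node} {F : List Node} (h : FileOK (n :: F)) : Has F n.high :=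
  FileOK.has_tail (h.high_has n List.mem_cons_self) (h.high_below n List.mem_cons_self) le_rfl

@[simp] theorem den_term (X : Finset ℕ) (F : List Node) (b : Bool) (v : ℕ → Bool) :
    den X F (.term b) v = b := by
  induction F with
  | nil => cases b <;> simp [den]
  | cons n F ih => simp [den, ih]

theorem den_cons_of_ne {X : Finset ℕ} {n : Node} {F : List Node} {p : Ptr} (h : p ≠ .node n.uid) :
    den X (n :: F) p = den X F p := by
  funext v; simp [den, h]

theorem den_cons_of_below {X : Finset ℕ} {n : Node} {F : List Node} {p : Ptr}
    (h : Below n.uid.1 p) : den X (n :: F) p = den X F p :=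
  den_cons_of_ne (fun e => absurd (h _ e) (lt_irrefl _))

theorem den_append_of_not_mem {X : Finset ℕ} {N F : List Node} {p : Ptr}
    (h : ∀ n ∈ N, p ≠ .node n.uid) : den X (N ++ F) p = den X F p := by
  induction N with
  | nil => rfl
  | cons n N ih =>
    rw [List.cons_append, den_cons_of_ne (h n List.mem_cons_self),
      ih (fun m hm => h m (List.mem_cons_of_mem _ hm))]

/-- The recursion of `den` looks for the children only in the remainder of the list. In a levelised
file children come strictly later, so the nodes that are skipped do not matter and the usual
recursion holds with respect to the whole file. -/
theorem FileOK.den_node {X : Finset ℕ} {F : List Node} (h : FileOK F) {n : Node} (hn : n ∈ F)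
    (v : ℕ → Bool) : den X F (.node n.uid) v =
      if n.uid.1 ∈ X then den X F n.low v || den X F n.high v
      else den X F (if v n.uid.1 then n.high else n.low) v := by
  induction F with
  | nil => cases hn
  | cons m F ih =>
    have hle : m.uid.1 ≤ n.uid.1 := by
      rcases List.mem_cons.1 hn with rfl | hn
      · exact le_rfl
      · exact level_le_of_uidKey_le ((List.pairwise_cons.1 h.sorted).1 n hn).le
    have hlo := (h.low_below n hn).mono hle
    have hhi := (h.high_below n hn).mono hle
    have hif : Below m.uid.1 (if v n.uid.1 then n.high else n.low) := by split <;> assumption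
    rw [den_cons_of_below hlo, den_cons_of_below hhi, den_cons_of_below hif]
    rcases List.mem_cons.1 hn with rfl | hn
    · simp [den]
    · rw [den_cons_of_ne, ih h.tail hn]
      intro e
      have := (List.pairwise_cons.1 h.sorted).1 n hn
      rw [Ptr.node.injEq] at e
      rw [e] at this
      exact lt_irrefl _ this

/-- Levels increase along arcs, so no path from `p` tests a variable before `ℓ`. -/
theorem FileOK.den_congr {X : Finset ℕ} {F : List Node} (h : FileOK F) {p : Ptr} {ℓ : ℕ}
    (hp : ∀ u, p = .node u → ℓ ≤ u.1) {v w : ℕ → Bool} (hv : ∀ i, ℓ ≤ i → v i = w i) :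
    den X F p v = den X F p w := by
  induction F generalizing p with
  | nil => rfl
  | cons n F ih =>
    by_cases e : p = .node n.uid
    · have hl := hp _ e
      have h1 : ∀ u, n.low = .node u → ℓ ≤ u.1 := fun u hu =>
        hl.trans (h.low_below n List.mem_cons_self u hu).le
      have h2 : ∀ u, n.high = .node u → ℓ ≤ u.1 := fun u hu =>
        hl.trans (h.high_below n List.mem_cons_self u hu).le
      simp only [den, e, if_true, ih h.tail h1, ih h.tail h2, hv _ hl]
      split_ifs
      · rfl
      · rw [ih h.tail h2]
      · rw [ih h.tail h1]
    · rw [den_cons_of_ne e]; exact ih h.tail hp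

theorem FileOK.den_update {X : Finset ℕ} {F : List Node} (h : FileOK F) {p : Ptr} {ℓ : ℕ}
    (hp : Below ℓ p) (v : ℕ → Bool) (b : Bool) :
    den X F p (Function.update v ℓ b) = den X F p v :=
  h.den_congr (ℓ := ℓ + 1) (fun u hu => hp u hu) (fun i hi => by
    rw [Function.update_of_ne (by omega)])

/-- The cofactor of a function. -/
def cof (f : BoolFn) (ℓ : ℕ) (b : Bool) : BoolFn := fun v => f (Function.update v ℓ b)

theorem cof_self (f : BoolFn) (ℓ : ℕ) (v : ℕ → Bool) : cof f ℓ (v ℓ) v = f v := by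
  simp [cof]

/-- Fixing the variable of a node selects one of its children, and a child lies below that variable
and ignores it. -/
theorem FileOK.cof_node {F : List Node} (h : FileOK F) {n : Node} (hn : n ∈ F) (b : Bool) :
    cof (den ∅ F (.node n.uid)) n.uid.1 b = den ∅ F (if b then n.high else n.low) := by
  funext v
  rw [cof, h.den_node hn]
  cases b <;> simp [h.den_update (h.low_below n hn), h.den_update (h.high_below n hn)]

theorem FileOK.cof_below {F : List Node} (h : FileOK F) {p : Ptr} {ℓ : ℕ} (hp : Below ℓ p) (b : Bool) :
    cof (den ∅ F p) ℓ b = den ∅ F p := by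
  funext v; exact h.den_update hp v b

/-- No redundant nodes and no duplicates. -/
structure Reduced (F : List Node) : Prop where
  ne : ∀ n ∈ F, n.low ≠ n.high
  inj : ∀ n ∈ F, ∀ m ∈ F, n.uid.1 = m.uid.1 → n.low = m.low → n.high = m.high → n = m

theorem Reduced.tail {n : Node} {F : List Node} (h : Reduced (n :: F)) : Reduced F :=
  ⟨fun m hm => h.ne m (List.mem_cons_of_mem _ hm), fun m hm m' hm' =>
    h.inj m (List.mem_cons_of_mem _ hm) m' (List.mem_cons_of_mem _ hm')⟩

/-- Reduced diagrams are canonical. -/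
theorem den_injective {F : List Node} (h : FileOK F) (hr : Reduced F) {p q : Ptr}
    (hp : Has F p) (hq : Has F q) (e : den ∅ F p = den ∅ F q) : p = q := by
  induction F generalizing p q with
  | nil =>
    have ht : ∀ p, Has [] p → ∃ b, p = .term b := by
      intro p hp
      cases p with
      | node u => obtain ⟨n, hn, _⟩ := hp u rfl; cases hn
      | term b => exact ⟨b, rfl⟩
    obtain ⟨b, rfl⟩ := ht p hp
    obtain ⟨c, rfl⟩ := ht q hq
    have := congrFun e (fun _ => false)
    simp at this
    rw [this]
  | cons n F ih =>
    -- The topmost node `n` is compared with any other pointer `q`. If `q` leads below the level of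
    -- `n`, both cofactors agree, so by induction `n` is redundant. If `q` is another node on that
    -- level, the children agree by induction, so `n` is a duplicate.
    have key : ∀ q, Has (n :: F) q → den ∅ (n :: F) (.node n.uid) = den ∅ (n :: F) q →
        q = .node n.uid := by
      intro q hq e
      by_contra hne
      have hn : n ∈ n :: F := List.mem_cons_self
      have hlo : den ∅ F n.low = cof (den ∅ (n :: F) (.node n.uid)) n.uid.1 false := by
        rw [h.cof_node hn]; simp [den_cons_of_below (h.low_below n hn)]
      have hhi : den ∅ F n.high = cof (den ∅ (n :: F) (.node n.uid)) n.uid.1 true := by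
        rw [h.cof_node hn]; simp [den_cons_of_below (h.high_below n hn)]
      rw [e] at hlo hhi
      by_cases hb : Below n.uid.1 q
      · rw [h.cof_below hb] at hlo hhi
        exact hr.ne n hn (ih h.tail hr.tail h.low_has_tail h.high_has_tail (hlo.trans hhi.symm))
      · unfold Below at hb
        push Not at hb
        obtain ⟨u, rfl, hu⟩ := hb
        obtain ⟨m, hm, rfl⟩ := hq u rfl
        rcases List.mem_cons.1 hm with rfl | hmF
        · exact hne rfl
        have hlev : n.uid.1 = m.uid.1 := le_antisymm
          (level_le_of_uidKey_le ((List.pairwise_cons.1 h.sorted).1 m hmF).le) hu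
        rw [hlev, h.cof_node hm] at hlo hhi
        simp only [if_true, Bool.false_eq_true, if_false] at hlo hhi
        rw [den_cons_of_below ((h.low_below m hm).mono hlev.le)] at hlo
        rw [den_cons_of_below ((h.high_below m hm).mono hlev.le)] at hhi
        have e1 := ih h.tail hr.tail h.low_has_tail (h.tail.low_has m hmF) hlo
        have e2 := ih h.tail hr.tail h.high_has_tail (h.tail.high_has m hmF) hhi
        exact hne (by rw [hr.inj n hn m hm hlev e1 e2])
    by_cases hp' : p = .node n.uid
    · subst hp'; exact (key q hq e).symm
    by_cases hq' : q = .node n.uid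
    · subst hq'; exact key p hp e.symm
    have hF : ∀ p, Has (n :: F) p → p ≠ .node n.uid → Has F p := by
      intro p hp hne u hu
      obtain ⟨m, hm, rfl⟩ := hp u hu
      rcases List.mem_cons.1 hm with rfl | hm
      · exact absurd hu hne
      · exact ⟨m, hm, rfl⟩
    rw [den_cons_of_ne hp', den_cons_of_ne hq'] at e
    exact ih h.tail hr.tail (hF p hp hp') (hF q hq hq') e

end NestedSweep

namespace NestedSweep

open IOModel

/-! ## The inner Apply sweep -/

/-- The disjunction of two pointers into a file. -/
def orSem (F : List Node) (p q : Ptr) : BoolFn := fun v => den ∅ F p v || den ∅ F q v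

/-- Requests in normal form, with pointers into the file. -/
structure ReqOK (F : List Node) (p q : Ptr) : Prop where
  fst_has : Has F p
  snd_has : Has F q
  norm : (∃ b, p = .term b ∧ q = .term false) ∨
    ∃ u, p = .node u ∧ (q = .term false ∨ ∃ w, q = .node w ∧ uidKey u ≤ uidKey w)

theorem orTarget_ok {F : List Node} {a b : Ptr} (ha : Has F a) (hb : Has F b) :
    ReqOK F (orTarget a b).1 (orTarget a b).2 := by
  unfold orTarget
  split_ifs with h1 h2
  · exact ⟨Has.term _ _, Has.term _ _, Or.inl ⟨true, rfl, rfl⟩⟩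
  · refine ⟨ha, hb, ?_⟩
    rcases a with u | _ | _ <;> rcases b with w | _ | _ <;> simp_all [node_key_le]
    exact absurd h2 (not_le.2 (by simp [Ptr.key, List.cons_lt_cons_iff]))
  · refine ⟨hb, ha, ?_⟩
    replace h2 := (not_le.1 h2).le
    rcases a with u | _ | _ <;> rcases b with w | _ | _ <;> simp_all [node_key_le]
    exact absurd h2 (not_le.2 (by simp [Ptr.key, List.cons_lt_cons_iff]))

theorem orSem_orTarget (F : List Node) (a b : Ptr) :
    orSem F (orTarget a b).1 (orTarget a b).2 = orSem F a b := by
  funext v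
  unfold orTarget orSem
  split_ifs with h1 h2
  · rcases h1 with rfl | rfl <;> simp
  · rfl
  · exact Bool.or_comm _ _

theorem orTarget_below {a b : Ptr} {ℓ : ℕ} (ha : Below ℓ a) (hb : Below ℓ b) :
    Below ℓ (orTarget a b).1 := by
  unfold orTarget
  split_ifs
  · exact Below.term _ _
  · exact ha
  · exact hb

/-- The meaning of a pointer into an unreduced file, given the meaning of the nodes. -/
def val (g : Uid → BoolFn) : Ptr → BoolFn
  | .node u => g u
  | .term b => fun _ => b

/-- The starts and the meanings of the two arcs of a node. -/
def childItems (g : Uid → BoolFn) (u : Uid) : List (Src × BoolFn) :=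
  [(some (u, false), cof (g u) u.1 false), (some (u, true), cof (g u) u.1 true)]

/-- The currency of the bookkeeping: arcs and requests are counted with multiplicity by start and
meaning. One equality of such multisets gives both the number of arcs and the correctness of their
targets. -/
def arcItems (g : Uid → BoolFn) (l : List Arc) : Multiset (Src × BoolFn) :=
  (l.map (fun a => (a.src, val g a.tgt)) : List _)

def reqItems (F : List Node) (l : List Req) : Multiset (Src × BoolFn) :=
  (l.map (fun r => (r.src, orSem F r.fst r.snd)) : List _)

/-- The set of functions is closed under the cofactors that occur in a diagram. -/
def CofClosed (S : Set BoolFn) : Prop :=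
  ∀ f ∈ S, ∀ ℓ b, (∀ v w : ℕ → Bool, (∀ i, ℓ ≤ i → v i = w i) → f v = f w) → cof f ℓ b ∈ S

/-- The invariant of the inner Apply sweep over the file `F`, of which the nodes `rest` have not yet
been processed: `cr` are the nodes that were created, `g` is their meaning, the requests `pend` are
pending, and `I` are the starts and meanings of the initial requests. -/
structure ApplyInv (F rest : List Node) (S : Set BoolFn) (I : Multiset (Src × BoolFn))
    (pend : List Req) (g : Uid → BoolFn) (cr : List Uid) (st : ApplyState) : Prop where
  q₁_ok : ∀ r ∈ st.q₁, ReqOK F r.fst r.snd ∧ Has rest r.fst ∧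
    (∀ u : Uid, r.fst = .node u → srcLevel r.src < (u.1 : ℕ)) ∧ orSem F r.fst r.snd ∈ S
  q₂_ok : ∀ w ∈ st.q₂, ∃ a ∈ F, ∃ b ∈ rest, w.req.fst = .node a.uid ∧ w.req.snd = .node b.uid ∧
    a.uid.1 = b.uid.1 ∧ w.low = a.low ∧ w.high = a.high ∧
    srcLevel w.req.src < (b.uid.1 : ℕ) ∧ orSem F w.req.fst w.req.snd ∈ S
  arcs_ok : ∀ a ∈ st.arcs, ∃ u ∈ cr, a.tgt = .node u ∧ srcLevel a.src < (u.1 : ℕ)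
  terms_ok : ∀ a ∈ st.terms, ∃ b, a.tgt = .term b
  cr_ok : ∀ u ∈ cr, u.2 < st.fresh u.1 ∧ (∃ n ∈ F, n.uid.1 = u.1) ∧ g u ∈ S
  items : arcItems g st.arcs + arcItems g st.terms + reqItems F st.q₁ +
    reqItems F (st.q₂.map Fwd.req) + reqItems F pend = I + (cr.flatMap (childItems g) : List _)
  -- Credits: each initial request and each of the two arcs of a created node is worth two
  -- operations per queue. A request in the first queue has spent one of them there, for its
  -- insertion, and still owns both for the second queue, where it may be inserted and deleted.
  ops₁_len : st.ops₁.length + st.q₁.length ≤ 2 * (I.card + 2 * cr.length)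
  ops₂_len : st.ops₂.length + st.q₂.length + 2 * st.q₁.length ≤
    2 * (I.card + 2 * cr.length)

theorem reqItems_append (F : List Node) (l l' : List Req) :
    reqItems F (l ++ l') = reqItems F l + reqItems F l' := by
  simp [reqItems]

theorem arcItems_append (g : Uid → BoolFn) (l l' : List Arc) :
    arcItems g (l ++ l') = arcItems g l + arcItems g l' := by
  simp [arcItems]

theorem reqItems_perm {F : List Node} {l l' : List Req} (h : l.Perm l') :
    reqItems F l = reqItems F l' := Multiset.coe_eq_coe.2 (h.map _)

theorem arcItems_congr {g g' : Uid → BoolFn} {l : List Arc}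
    (h : ∀ a ∈ l, val g a.tgt = val g' a.tgt) : arcItems g l = arcItems g' l := by
  unfold arcItems
  rw [List.map_congr_left]
  intro a ha
  rw [h a ha]

theorem mem_filter_pair {l : List Req} {p : Ptr × Ptr} {r : Req} :
    r ∈ sortBy Req.key (l.filter (fun r => (r.fst, r.snd) == p)) ↔ r ∈ l ∧ (r.fst, r.snd) = p := by
  simp [mem_sortBy]

variable {F rest : List Node} {S : Set BoolFn} {I : Multiset (Src × BoolFn)}

/-- Creating a node turns the pending requests into arcs to it, which leaves the balance `items`
unchanged. Its two outgoing arcs appear on the left as new requests or as arcs to terminals, and on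
the right as the items of the new node; `orTarget` normalizes a request without changing its
meaning. -/
theorem ApplyInv.emit {pend : List Req} {g : Uid → BoolFn} {cr : List Uid} {st : ApplyState}
    (h : ApplyInv F rest S I pend g cr st) {ℓ : ℕ} {lo hi : Ptr × Ptr} {f : BoolFn}
    (hrest : ∀ p, Has F p → Below ℓ p → Has rest p)
    (hlev : ∃ n ∈ F, n.uid.1 = ℓ) (hf : f ∈ S)
    (hpend : ∀ r ∈ pend, orSem F r.fst r.snd = f ∧ srcLevel r.src < (ℓ : ℕ))
    (hlo : cof f ℓ false = orSem F lo.1 lo.2) (hhi : cof f ℓ true = orSem F hi.1 hi.2)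
    (hloS : cof f ℓ false ∈ S) (hhiS : cof f ℓ true ∈ S)
    (hhas : Has F lo.1 ∧ Has F lo.2 ∧ Has F hi.1 ∧ Has F hi.2)
    (hbel : Below ℓ lo.1 ∧ Below ℓ lo.2 ∧ Below ℓ hi.1 ∧ Below ℓ hi.2) :
    ∃ g', ApplyInv F rest S I [] g' ((ℓ, st.fresh ℓ) :: cr) (st.emit ℓ pend lo hi) ∧
      ∀ r ∈ (st.emit ℓ pend lo hi).q₁, r ∈ st.q₁ ∨ Below ℓ r.fst := by
  set u : Uid := (ℓ, st.fresh ℓ) with hu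
  -- The uid `u` is fresh, so no earlier arc changes its meaning.
  set g' := Function.update g u f with hg'
  have hucr : u ∉ cr := fun hc => absurd (h.cr_ok u hc).1 (lt_irrefl _)
  have hgu : g' u = f := Function.update_self ..
  have hgne : ∀ w ∈ cr, g' w = g w := fun w hw => by
    refine Function.update_of_ne ?_ _ _
    rintro rfl
    exact hucr hw
  set r₀ : Req := orReq (some (u, false)) lo.1 lo.2 with hr₀
  set r₁ : Req := orReq (some (u, true)) hi.1 hi.2 with hr₁
  have hok₀ : ReqOK F r₀.fst r₀.snd := orTarget_ok hhas.1 hhas.2.1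
  have hok₁ : ReqOK F r₁.fst r₁.snd := orTarget_ok hhas.2.2.1 hhas.2.2.2
  have hb₀ : Below ℓ r₀.fst := orTarget_below hbel.1 hbel.2.1
  have hb₁ : Below ℓ r₁.fst := orTarget_below hbel.2.2.1 hbel.2.2.2
  have hs₀ : orSem F r₀.fst r₀.snd = cof f ℓ false := (orSem_orTarget F _ _).trans hlo.symm
  have hs₁ : orSem F r₁.fst r₁.snd = cof f ℓ true := (orSem_orTarget F _ _).trans hhi.symm
  have hks : ∀ r ∈ [r₀, r₁], ReqOK F r.fst r.snd ∧ Below ℓ r.fst ∧ srcLevel r.src = (ℓ : ℕ) ∧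
      orSem F r.fst r.snd ∈ S := by
    intro r hr
    simp only [List.mem_cons, List.not_mem_nil, or_false] at hr
    rcases hr with rfl | rfl
    · exact ⟨hok₀, hb₀, rfl, hs₀ ▸ hloS⟩
    · exact ⟨hok₁, hb₁, rfl, hs₁ ▸ hhiS⟩
  have hq₁ : (st.emit ℓ pend lo hi).q₁ = st.q₁ ++ [r₀, r₁].filter (fun r => !r.fst.isTerm) := rfl
  have hcard : ([r₀, r₁].filter (fun r => !r.fst.isTerm)).length ≤ 2 := List.length_filter_le _ _
  have hval : ∀ a : Arc, (∃ w ∈ cr, a.tgt = .node w) ∨ (∃ b, a.tgt = .term b) →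
      val g a.tgt = val g' a.tgt := by
    rintro a (⟨w, hw, e⟩ | ⟨b, e⟩)
    · rw [e]; exact (hgne w hw).symm
    · rw [e]; rfl
  refine ⟨g', ⟨?_, h.q₂_ok, ?_, ?_, ?_, ?_, ?_, ?_⟩, ?_⟩
  · intro r hr
    rw [hq₁, List.mem_append] at hr
    rcases hr with hr | hr
    · exact h.q₁_ok r hr
    · obtain ⟨h1, h2, h3, h4⟩ := hks r (List.mem_of_mem_filter hr)
      refine ⟨h1, hrest _ h1.fst_has h2, fun w hw => ?_, h4⟩
      rw [h3]; exact_mod_cast h2 w hw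
  · intro a ha
    have ha : a ∈ st.arcs ++ pend.map (fun r => (⟨r.src, .node u⟩ : Arc)) := ha
    rw [List.mem_append, List.mem_map] at ha
    rcases ha with ha | ⟨r, hr, rfl⟩
    · obtain ⟨w, hw, e⟩ := h.arcs_ok a ha
      exact ⟨w, List.mem_cons_of_mem _ hw, e⟩
    · exact ⟨u, List.mem_cons_self, rfl, (hpend r hr).2⟩
  · intro a ha
    have ha : a ∈ st.terms ++ ([r₀, r₁].filter (fun r => r.fst.isTerm)).map
        (fun r => (⟨r.src, r.fst⟩ : Arc)) := ha
    rw [List.mem_append, List.mem_map] at ha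
    rcases ha with ha | ⟨r, hr, rfl⟩
    · exact h.terms_ok a ha
    · have := (List.mem_filter.1 hr).2
      rcases hp : r.fst with w | b
      · rw [hp] at this; cases this
      · exact ⟨b, rfl⟩
  · intro w hw
    change w.2 < Function.update st.fresh ℓ (st.fresh ℓ + 1) w.1 ∧ _
    rcases List.mem_cons.1 hw with rfl | hw
    · rw [hgu]
      exact ⟨by simp [hu], hlev, hf⟩
    · obtain ⟨h1, h2, h3⟩ := h.cr_ok w hw
      rw [hgne w hw]
      refine ⟨?_, h2, h3⟩
      by_cases e : w.1 = ℓ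
      · rw [e] at h1 ⊢; simp; omega
      · rw [Function.update_of_ne e]; exact h1
  · have e1 : arcItems g' (st.emit ℓ pend lo hi).arcs = arcItems g st.arcs + reqItems F pend := by
      change arcItems g' (st.arcs ++ pend.map (fun r => (⟨r.src, .node u⟩ : Arc))) = _
      rw [arcItems_append]
      congr 1
      · refine (arcItems_congr fun a ha => hval a (Or.inl ?_)).symm
        obtain ⟨w, hw, e, _⟩ := h.arcs_ok a ha
        exact ⟨w, hw, e⟩
      · unfold arcItems reqItems
        rw [List.map_map, List.map_congr_left]
        intro r hr
        simp [val, hgu, (hpend r hr).1]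
    have e2 : arcItems g' (st.emit ℓ pend lo hi).terms + reqItems F (st.emit ℓ pend lo hi).q₁ =
        arcItems g st.terms + reqItems F st.q₁ + (childItems g' u : List _) := by
      rw [hq₁]
      change arcItems g' (st.terms ++ ([r₀, r₁].filter (fun r => r.fst.isTerm)).map
        (fun r => (⟨r.src, r.fst⟩ : Arc))) + _ = _
      rw [arcItems_append, reqItems_append]
      have e3 : arcItems g' (([r₀, r₁].filter (fun r => r.fst.isTerm)).map
          (fun r => (⟨r.src, r.fst⟩ : Arc))) =
          reqItems F ([r₀, r₁].filter (fun r => r.fst.isTerm)) := by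
        unfold arcItems reqItems
        rw [List.map_map, List.map_congr_left]
        intro r hr
        obtain ⟨hr, ht⟩ := List.mem_filter.1 hr
        rcases (hks r hr).1.norm with ⟨b, e, e'⟩ | ⟨w, e, _⟩
        · simp only [Function.comp, e, e']
          congr 1
          funext v; simp [val, orSem]
        · rw [e] at ht; cases ht
      have e4 : reqItems F ([r₀, r₁].filter (fun r => !r.fst.isTerm)) +
          reqItems F ([r₀, r₁].filter (fun r => r.fst.isTerm)) = (childItems g' u : List _) := by
        rw [← reqItems_append, ← reqItems_perm (filter_not_perm (fun r => r.fst.isTerm) [r₀, r₁])]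
        simp only [reqItems, childItems, List.map_cons, List.map_nil, hs₀, hs₁, hgu]
        rfl
      have e5 : arcItems g' st.terms = arcItems g st.terms :=
        (arcItems_congr fun a ha => hval a (Or.inr (h.terms_ok a ha))).symm
      rw [e3, e5, ← e4]; abel
    have e6 : ((u :: cr).flatMap (childItems g') : List _) =
        childItems g' u ++ cr.flatMap (childItems g) := by
      rw [List.flatMap_cons]
      congr 1
      refine List.flatMap_congr fun w hw => ?_
      simp [childItems, hgne w hw]
    rw [e6, ← Multiset.coe_add]
    have e7 := h.items
    have e8 : reqItems F [] = 0 := rfl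
    change arcItems g' (st.emit ℓ pend lo hi).arcs + arcItems g' (st.emit ℓ pend lo hi).terms +
      reqItems F (st.emit ℓ pend lo hi).q₁ + reqItems F (st.q₂.map Fwd.req) + _ = _
    calc _ = (arcItems g' (st.emit ℓ pend lo hi).terms + reqItems F (st.emit ℓ pend lo hi).q₁) +
          arcItems g' (st.emit ℓ pend lo hi).arcs + reqItems F (st.q₂.map Fwd.req) := by
            rw [e8]; abel
      _ = (childItems g' u : List _) + (arcItems g st.arcs + arcItems g st.terms +
          reqItems F st.q₁ + reqItems F (st.q₂.map Fwd.req) + reqItems F pend) := by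
            rw [e1, e2]; abel
      _ = _ := by rw [e7]; abel
  · have := h.ops₁_len
    change (st.ops₁ ++ _).length + _ ≤ _
    rw [hq₁]
    simp only [List.length_append, List.length_map, List.length_cons] at *
    change st.ops₁.length + ([r₀, r₁].filter (fun r => !r.fst.isTerm)).length + _ ≤ _
    omega
  · have := h.ops₂_len
    change st.ops₂.length + st.q₂.length + _ ≤ _
    rw [hq₁]
    simp only [List.length_append, List.length_cons] at *
    omega
  · intro r hr
    rw [hq₁, List.mem_append] at hr
    rcases hr with hr | hr
    · exact Or.inl hr
    · exact Or.inr (hks r (List.mem_of_mem_filter hr)).2.1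

theorem length_filter_add {α : Type*} (p : α → Bool) (l : List α) :
    (l.filter (fun a => !p a)).length + (l.filter p).length = l.length := by
  rw [← List.length_append, ← (filter_not_perm p l).length_eq]

theorem indep_orSem (hF : FileOK F) {p q : Ptr} {ℓ : ℕ} (hp : ∀ u, p = .node u → ℓ ≤ u.1)
    (hq : ∀ u, q = .node u → ℓ ≤ u.1) (v w : ℕ → Bool) (h : ∀ i, ℓ ≤ i → v i = w i) :
    orSem F p q v = orSem F p q w := by
  simp only [orSem, hF.den_congr hp h, hF.den_congr hq h]

theorem cof_orSem (p q : Ptr) (ℓ : ℕ) (b : Bool) :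
    cof (orSem F p q) ℓ b = fun v => cof (den ∅ F p) ℓ b v || cof (den ∅ F q) ℓ b v := rfl

/-- What is known about a pair of pointers when its first node is read. -/
structure PairOK (F : List Node) (S : Set BoolFn) (p : Ptr × Ptr) : Prop where
  ok : ReqOK F p.1 p.2
  mem : orSem F p.1 p.2 ∈ S

/-- The cases of the product construction, by the position of the second pointer. If it equals the
first or leads below the level of `n`, both cofactors are known now. If it is another node on the
same level, its children have not been read, and the request moves to the second queue along with
the children of `n`. -/
theorem ApplyInv.first (hF : FileOK F) (hS : CofClosed S) {n : Node} {pre rest : List Node}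
    (hsplit : F = pre ++ n :: rest) {g : Uid → BoolFn} {cr : List Uid} {st : ApplyState}
    (h : ApplyInv F (n :: rest) S I [] g cr st) {p : Ptr × Ptr} (hp : PairOK F S p)
    (hpn : p.1 = .node n.uid)
    (hrest : ∀ p, Has F p → Below n.uid.1 p → Has (n :: rest) p)
    (hrest' : ∀ m ∈ F, uidKey n.uid < uidKey m.uid → m ∈ rest) :
    ∃ g' cr', ApplyInv F (n :: rest) S I [] g' cr' (st.first n p) ∧ cr'.length ≤ cr.length + 1 ∧
      ∀ r ∈ (st.first n p).q₁, (r ∈ st.q₁ ∧ (r.fst, r.snd) ≠ p) ∨ Below n.uid.1 r.fst := by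
  have hnF : n ∈ F := by rw [hsplit]; simp
  set gr := sortBy Req.key (st.q₁.filter (fun r => (r.fst, r.snd) == p)) with hgr
  set st' : ApplyState := { st with
    q₁ := st.q₁.filter (fun r => (r.fst, r.snd) != p)
    ops₁ := st.ops₁ ++ gr.map (fun _ => Op.deleteMin) } with hst'
  have hperm : st.q₁.Perm (st'.q₁ ++ gr) :=
    (filter_not_perm (fun r : Req => (r.fst, r.snd) == p) st.q₁).trans
      ((List.Perm.refl _).append (sortBy_perm _ _).symm)
  have hlen : st'.q₁.length + gr.length = st.q₁.length := by
    rw [hperm.length_eq, List.length_append]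
  have h' : ApplyInv F (n :: rest) S I gr g cr st' := by
    refine ⟨fun r hr => h.q₁_ok r (List.mem_of_mem_filter hr), h.q₂_ok, h.arcs_ok, h.terms_ok,
      h.cr_ok, ?_, ?_, ?_⟩
    · rw [← h.items, reqItems_perm hperm, reqItems_append]
      change _ + _ + _ + reqItems F (st.q₂.map Fwd.req) + _ = _
      have : reqItems F [] = 0 := rfl
      rw [this]
      change arcItems g st.arcs + arcItems g st.terms + _ + _ + _ = _
      abel
    · have := h.ops₁_len
      simp only [hst', List.length_append, List.length_map] at hlen ⊢
      omega
    · have := h.ops₂_len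
      change st.ops₂.length + st.q₂.length + _ ≤ _
      omega
  have hgrmem : ∀ r ∈ gr, r ∈ st.q₁ ∧ (r.fst, r.snd) = p := fun r hr => mem_filter_pair.1 hr
  have hpend : ∀ r ∈ gr, orSem F r.fst r.snd = orSem F p.1 p.2 ∧
      srcLevel r.src < (n.uid.1 : ℕ) := by
    intro r hr
    obtain ⟨h1, h2⟩ := hgrmem r hr
    subst h2
    exact ⟨rfl, (h.q₁_ok r h1).2.2.1 _ hpn⟩
  have hq' : ∀ r ∈ st'.q₁, r ∈ st.q₁ ∧ (r.fst, r.snd) ≠ p := by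
    intro r hr
    simpa [hst'] using hr
  have hlow := hF.low_below n hnF
  have hhigh := hF.high_below n hnF
  have hcn := hF.cof_node hnF
  have hlev1 : ∀ u, p.1 = .node u → n.uid.1 ≤ u.1 := by
    rw [hpn]; rintro u ⟨⟩; exact le_rfl
  have hdef : st.first n p = if p.2 = p.1 then
      st'.emit n.uid.1 gr (n.low, n.low) (n.high, n.high)
    else if p.2.onLevel n.uid.1 then
      { st' with
        q₂ := st'.q₂ ++ gr.map (fun r => (⟨r, n.low, n.high⟩ : Fwd))
        ops₂ := st'.ops₂ ++ (gr.map (fun r => (⟨r, n.low, n.high⟩ : Fwd))).map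
          (fun r => Op.insert r.key) }
    else st'.emit n.uid.1 gr (n.low, p.2) (n.high, p.2) := rfl
  rw [hdef]
  split_ifs with hc1 hc2
  · have hind := indep_orSem hF hlev1 (hc1 ▸ hlev1)
    obtain ⟨g', h1, h2⟩ := h'.emit (lo := (n.low, n.low)) (hi := (n.high, n.high)) hrest
      ⟨n, hnF, rfl⟩ hp.mem hpend
      (by rw [cof_orSem, hc1, hpn, hcn]; rfl) (by rw [cof_orSem, hc1, hpn, hcn]; rfl)
      (hS _ hp.mem _ _ hind) (hS _ hp.mem _ _ hind)
      ⟨hF.low_has n hnF, hF.low_has n hnF, hF.high_has n hnF, hF.high_has n hnF⟩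
      ⟨hlow, hlow, hhigh, hhigh⟩
    exact ⟨g', _, h1, by simp, fun r hr => (h2 r hr).imp_left (hq' r)⟩
  · rcases hp2 : p.2 with w | b
    swap
    · rw [hp2] at hc2; simp [Ptr.onLevel] at hc2
    have hwl : w.1 = n.uid.1 := by rw [hp2] at hc2; simpa [Ptr.onLevel] using hc2
    obtain ⟨m, hm, rfl⟩ := hp.ok.snd_has w hp2
    -- The normal form of requests puts the earlier node first, so the second node is still unread
    -- and the forwarded request will be found when its turn comes.
    have hlt : uidKey n.uid < uidKey m.uid := by
      rcases hp.ok.norm with ⟨b, e, _⟩ | ⟨u, e, e' | ⟨w, e', hle⟩⟩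
      · rw [e] at hpn; cases hpn
      · rw [hp2] at e'; cases e'
      · rw [hpn] at e; cases e
        rw [hp2] at e'; cases e'
        refine lt_of_le_of_ne hle fun e => hc1 ?_
        rw [hp2, hpn, uidKey_injective e]
    have hmr := hrest' m hm hlt
    refine ⟨g, cr, ⟨h'.q₁_ok, ?_, h'.arcs_ok, h'.terms_ok, h'.cr_ok, ?_, h'.ops₁_len, ?_⟩, by simp,
      fun r hr => Or.inl (hq' r hr)⟩
    · intro w hw
      rcases List.mem_append.1 hw with hw | hw
      · exact h'.q₂_ok w hw
      · obtain ⟨r, hr, rfl⟩ := List.mem_map.1 hw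
        obtain ⟨h1, h2⟩ := hgrmem r hr
        refine ⟨n, hnF, m, List.mem_cons_of_mem _ hmr, ?_, ?_, hwl.symm, rfl, rfl, ?_, ?_⟩
        · rw [← hpn, ← h2]
        · rw [← hp2, ← h2]
        · rw [hwl]; exact (hpend r hr).2
        · rw [(hpend r hr).1]; exact hp.mem
    · rw [← h'.items]
      change _ + _ + _ + reqItems F ((st'.q₂ ++ gr.map (fun r => (⟨r, n.low, n.high⟩ : Fwd))).map
        Fwd.req) + reqItems F [] = _
      rw [List.map_append, reqItems_append]
      have e1 : (gr.map (fun r => (⟨r, n.low, n.high⟩ : Fwd))).map Fwd.req = gr := by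
        rw [List.map_map]; exact List.map_id gr
      have e2 : reqItems F [] = 0 := rfl
      rw [e1, e2]
      change arcItems g st'.arcs + arcItems g st'.terms + reqItems F st'.q₁ + _ + _ = _
      abel
    · have := h.ops₂_len
      have e1 : st'.ops₂ = st.ops₂ := rfl
      have e2 : st'.q₂ = st.q₂ := rfl
      simp only [List.length_append, List.length_map, e1, e2] at this ⊢
      omega
  · have hb2 : Below n.uid.1 p.2 := by
      intro w hw
      rcases hp.ok.norm with ⟨b, e, _⟩ | ⟨u, e, e' | ⟨w', e', hle⟩⟩
      · rw [e] at hpn; cases hpn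
      · rw [hw] at e'; cases e'
      · rw [hpn] at e; cases e
        rw [hw] at e'; cases e'
        have := level_le_of_uidKey_le hle
        refine lt_of_le_of_ne this fun e => hc2 ?_
        rw [hw]; simp [Ptr.onLevel, e]
    have hind := indep_orSem hF hlev1 (fun u hu => (hb2 u hu).le)
    obtain ⟨g', h1, h2⟩ := h'.emit (lo := (n.low, p.2)) (hi := (n.high, p.2)) hrest
      ⟨n, hnF, rfl⟩ hp.mem hpend
      (by rw [cof_orSem, hpn, hcn, hF.cof_below hb2]; rfl)
      (by rw [cof_orSem, hpn, hcn, hF.cof_below hb2]; rfl)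
      (hS _ hp.mem _ _ hind) (hS _ hp.mem _ _ hind)
      ⟨hF.low_has n hnF, hp.ok.snd_has, hF.high_has n hnF, hp.ok.snd_has⟩
      ⟨hlow, hb2, hhigh, hb2⟩
    exact ⟨g', _, h1, by simp, fun r hr => (h2 r hr).imp_left (hq' r)⟩

/-- A forwarded request carries the children of its first node; with those of `n` both cofactors of
the disjunction are at hand. -/
theorem ApplyInv.second (hF : FileOK F) (hS : CofClosed S) {n : Node} {rest : List Node}
    (hnF : n ∈ F) {g : Uid → BoolFn} {cr : List Uid} {st : ApplyState}
    (h : ApplyInv F (n :: rest) S I [] g cr st) {p : Ptr × Ptr}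
    (hpn : p.2 = .node n.uid)
    (hrest : ∀ p, Has F p → Below n.uid.1 p → Has (n :: rest) p) :
    ∃ g' cr', ApplyInv F (n :: rest) S I [] g' cr' (st.second n p) ∧ cr'.length ≤ cr.length + 1 ∧
      (∀ r ∈ (st.second n p).q₁, r ∈ st.q₁ ∨ Below n.uid.1 r.fst) ∧
      ∀ w ∈ (st.second n p).q₂, w ∈ st.q₂ ∧ (w.req.fst, w.req.snd) ≠ p := by
  set gr := sortBy Fwd.key (st.q₂.filter (fun w => (w.req.fst, w.req.snd) == p)) with hgr
  set st' : ApplyState := { st with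
    q₂ := st.q₂.filter (fun w => (w.req.fst, w.req.snd) != p)
    ops₂ := st.ops₂ ++ gr.map (fun _ => Op.deleteMin) } with hst'
  have hperm : st.q₂.Perm (st'.q₂ ++ gr) :=
    (filter_not_perm (fun w : Fwd => (w.req.fst, w.req.snd) == p) st.q₂).trans
      ((List.Perm.refl _).append (sortBy_perm _ _).symm)
  have hlen : st'.q₂.length + gr.length = st.q₂.length := by
    rw [hperm.length_eq, List.length_append]
  have hq' : ∀ w ∈ st'.q₂, w ∈ st.q₂ ∧ (w.req.fst, w.req.snd) ≠ p := by
    intro w hw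
    simpa [hst'] using hw
  have hgrmem : ∀ w ∈ gr, w ∈ st.q₂ ∧ (w.req.fst, w.req.snd) = p := by
    intro w hw
    simpa [hgr, mem_sortBy] using hw
  have hitems : reqItems F (st.q₂.map Fwd.req) =
      reqItems F (st'.q₂.map Fwd.req) + reqItems F (gr.map Fwd.req) := by
    rw [reqItems_perm (hperm.map _), List.map_append, reqItems_append]
  have h1 := h.items
  have e0 : reqItems F [] = 0 := rfl
  rw [e0, hitems] at h1
  have hdef : ∀ l, l = gr → st.second n p = match l with
      | [] => st'
      | w :: _ => st'.emit n.uid.1 (gr.map Fwd.req) (w.low, n.low) (w.high, n.high) := by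
    rintro _ rfl; rfl
  rcases hg : gr with _ | ⟨w, gr'⟩
  · rw [hdef [] hg.symm]
    refine ⟨g, cr, ⟨h.q₁_ok, fun w hw => h.q₂_ok w (List.mem_of_mem_filter hw), h.arcs_ok,
      h.terms_ok, h.cr_ok, ?_, h.ops₁_len, ?_⟩, by simp, fun r hr => Or.inl hr, hq'⟩
    · rw [← h1, hg]
      simp only [List.map_nil, e0]
      change arcItems g st.arcs + arcItems g st.terms + reqItems F st.q₁ + _ + 0 = _
      abel
    · have := h.ops₂_len
      have e1 : st'.ops₂.length = st.ops₂.length + gr.length := by simp [hst']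
      have e2 : st'.q₁ = st.q₁ := rfl
      change st'.ops₂.length + st'.q₂.length + 2 * st'.q₁.length ≤ _
      rw [e1, e2]
      omega
  · rw [hdef (w :: gr') hg.symm]
    have hw : w ∈ gr := by rw [hg]; exact List.mem_cons_self
    obtain ⟨hwq, hwp⟩ := hgrmem w hw
    obtain ⟨a, ha, b, hb, ea, eb, elev, elo, ehi, hsrc, hmem⟩ := h.q₂_ok w hwq
    have hp1 : p.1 = .node a.uid := by rw [← hwp]; exact ea
    have hb' : b.uid = n.uid := by
      rw [← hwp] at hpn
      exact Ptr.node.inj (eb.symm.trans hpn)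
    have elev' : a.uid.1 = n.uid.1 := by rw [elev, hb']
    have hmem' : orSem F p.1 p.2 ∈ S := by rw [← hwp]; exact hmem
    have h' : ApplyInv F (n :: rest) S I (gr.map Fwd.req) g cr st' := by
      refine ⟨h.q₁_ok, fun w hw => h.q₂_ok w (List.mem_of_mem_filter hw), h.arcs_ok,
        h.terms_ok, h.cr_ok, ?_, h.ops₁_len, ?_⟩
      · rw [← h1, add_zero, ← add_assoc]
      · have := h.ops₂_len
        have e1 : st'.ops₂.length = st.ops₂.length + gr.length := by simp [hst']
        have e2 : st'.q₁ = st.q₁ := rfl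
        rw [e1, e2]
        omega
    have hpend : ∀ r ∈ gr.map Fwd.req, orSem F r.fst r.snd = orSem F p.1 p.2 ∧
        srcLevel r.src < (n.uid.1 : ℕ) := by
      intro r hr
      obtain ⟨x, hx, rfl⟩ := List.mem_map.1 hr
      obtain ⟨hxq, hxp⟩ := hgrmem x hx
      obtain ⟨a', _, b', _, _, eb', _, _, _, hsrc', _⟩ := h.q₂_ok x hxq
      rw [← hxp]
      refine ⟨rfl, ?_⟩
      rw [← hxp] at hpn
      rwa [Ptr.node.inj (eb'.symm.trans hpn)] at hsrc'
    have hlow := hF.low_below n hnF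
    have hhigh := hF.high_below n hnF
    have hlow' := hF.low_below a ha
    have hhigh' := hF.high_below a ha
    have hca := hF.cof_node ha
    rw [elev'] at hlow' hhigh' hca
    have hcn := hF.cof_node hnF
    have hind : ∀ v w : ℕ → Bool, (∀ i, n.uid.1 ≤ i → v i = w i) →
        orSem F p.1 p.2 v = orSem F p.1 p.2 w := by
      refine indep_orSem hF ?_ ?_
      · rw [hp1]; rintro u ⟨⟩; exact elev'.ge
      · rw [hpn]; rintro u ⟨⟩; exact le_rfl
    obtain ⟨g', k1, k2⟩ := h'.emit (lo := (w.low, n.low)) (hi := (w.high, n.high)) hrest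
      ⟨n, hnF, rfl⟩ hmem' hpend
      (by rw [cof_orSem, hp1, hpn, hcn, hca, elo]; rfl)
      (by rw [cof_orSem, hp1, hpn, hcn, hca, ehi]; rfl)
      (hS _ hmem' _ _ hind) (hS _ hmem' _ _ hind)
      ⟨elo ▸ hF.low_has a ha, hF.low_has n hnF, ehi ▸ hF.high_has a ha, hF.high_has n hnF⟩
      ⟨elo ▸ hlow', hlow, ehi ▸ hhigh', hhigh⟩
    exact ⟨g', _, k1, by simp, k2, hq'⟩

/-- The two terminals account for the summand 2. Applied to the free component of the pairs handled
at one node, this yields the linear factor per node, and hence the quadratic bound. -/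
theorem length_le_of_has {l : List Ptr} (hl : l.Nodup) (h : ∀ p ∈ l, Has F p) :
    l.length ≤ F.length + 2 := by
  have : l ⊆ F.map (fun n => Ptr.node n.uid) ++ [.term false, .term true] := by
    intro p hp
    rcases p with u | b
    · obtain ⟨n, hn, rfl⟩ := h _ hp u rfl
      simp only [List.mem_append, List.mem_map]
      exact Or.inl ⟨n, hn, rfl⟩
    · cases b <;> simp
  simpa using (hl.subperm this).length_le

/-- The pairs handled here have `n` as first component, or as second component of a forwarded
request. Either way the other component determines the pair, so each of the two stages creates at
most `F.length + 2` nodes. -/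
theorem ApplyInv.read (hF : FileOK F) (hS : CofClosed S) {n : Node} {pre rest : List Node}
    (hsplit : F = pre ++ n :: rest) {g : Uid → BoolFn} {cr : List Uid} {st : ApplyState}
    (h : ApplyInv F (n :: rest) S I [] g cr st) :
    ∃ g' cr', ApplyInv F rest S I [] g' cr' (st.read n) ∧
      cr'.length ≤ cr.length + (2 * F.length + 4) := by
  have hnF : n ∈ F := by rw [hsplit]; simp
  have hsort := hF.sorted
  rw [hsplit, List.pairwise_append] at hsort
  have hrest' : ∀ m ∈ F, uidKey n.uid < uidKey m.uid → m ∈ rest := by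
    intro m hm hlt
    rw [hsplit] at hm
    rcases List.mem_append.1 hm with hm | hm
    · exact absurd (hsort.2.2 m hm n List.mem_cons_self) (not_lt.2 hlt.le)
    · rcases List.mem_cons.1 hm with rfl | hm
      · exact absurd hlt (lt_irrefl _)
      · exact hm
  have hrest'' : ∀ p, Has F p → Below n.uid.1 p → Has rest p := by
    intro p hp hb u hu
    obtain ⟨m, hm, rfl⟩ := hp u hu
    exact ⟨m, hrest' m hm (uidKey_lt.2 (Or.inl (hb _ hu))), rfl⟩
  have hrest : ∀ p, Has F p → Below n.uid.1 p → Has (n :: rest) p :=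
    fun p hp hb => (hrest'' p hp hb).mono (List.subset_cons_self _ _)
  have hnb : ∀ p : Ptr, Below n.uid.1 p → p ≠ .node n.uid :=
    fun p hb e => lt_irrefl _ (hb _ e)
  -- the requests whose first node is read
  set ps₁ := ((sortBy Req.key (st.q₁.filter (fun r => r.fst == .node n.uid))).map
    (fun r => (r.fst, r.snd))).dedup with hps₁
  have hps₁m : ∀ p ∈ ps₁, p.1 = .node n.uid ∧ PairOK F S p := by
    intro p hp
    rw [hps₁, List.mem_dedup, List.mem_map] at hp
    obtain ⟨r, hr, rfl⟩ := hp
    rw [mem_sortBy, List.mem_filter] at hr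
    obtain ⟨h1, _, _, h4⟩ := h.q₁_ok r hr.1
    exact ⟨by simpa using hr.2, h1, h4⟩
  have hps₁c : ∀ r ∈ st.q₁, r.fst = .node n.uid → (r.fst, r.snd) ∈ ps₁ := by
    intro r hr e
    rw [hps₁, List.mem_dedup, List.mem_map]
    exact ⟨r, by simp [mem_sortBy, hr, e], rfl⟩
  have hps₁l : ps₁.length ≤ F.length + 2 := by
    rw [← List.length_map (f := Prod.snd)]
    refine length_le_of_has ?_ ?_
    · refine (List.nodup_map_iff_inj_on (List.nodup_dedup _)).2 fun p hp q hq e => ?_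
      exact Prod.ext ((hps₁m p hp).1.trans (hps₁m q hq).1.symm) e
    · intro q hq
      obtain ⟨p, hp, rfl⟩ := List.mem_map.1 hq
      exact (hps₁m p hp).2.ok.snd_has
  have stage₁ : ∀ (ps : List (Ptr × Ptr)) (st : ApplyState) (g : Uid → BoolFn) (cr : List Uid),
      (∀ p ∈ ps, p.1 = .node n.uid ∧ PairOK F S p) →
      ApplyInv F (n :: rest) S I [] g cr st →
      (∀ r ∈ st.q₁, r.fst = .node n.uid → (r.fst, r.snd) ∈ ps) →
      ∃ g' cr', ApplyInv F (n :: rest) S I [] g' cr' (ps.foldl (ApplyState.first n) st) ∧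
        cr'.length ≤ cr.length + ps.length ∧
        ∀ r ∈ (ps.foldl (ApplyState.first n) st).q₁, r.fst ≠ .node n.uid := by
    intro ps
    induction ps with
    | nil =>
      intro st g cr _ h hq
      exact ⟨g, cr, h, by simp, fun r hr e => absurd (hq r hr e) List.not_mem_nil⟩
    | cons p ps ih =>
      intro st g cr hps h hq
      obtain ⟨hp1, hp2⟩ := hps p List.mem_cons_self
      obtain ⟨g', cr', h', hl, hq'⟩ := h.first hF hS hsplit hp2 hp1 hrest hrest'
      obtain ⟨g'', cr'', h'', hl', hq''⟩ := ih (st.first n p) g' cr'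
        (fun q hq => hps q (List.mem_cons_of_mem _ hq)) h' (by
          intro r hr e
          rcases hq' r hr with ⟨h1, h2⟩ | h1
          · rcases List.mem_cons.1 (hq r h1 e) with h3 | h3
            · exact absurd h3 h2
            · exact h3
          · exact absurd e (hnb _ h1))
      exact ⟨g'', cr'', h'', by simp only [List.length_cons]; omega, hq''⟩
  obtain ⟨g₁, cr₁, h₁, hl₁, hq₁⟩ := stage₁ ps₁ st g cr hps₁m h hps₁c
  set st₁ := ps₁.foldl (ApplyState.first n) st with hst₁
  -- the forwarded requests whose second node is read
  set ps₂ := ((sortBy Fwd.key (st₁.q₂.filter (fun w => w.req.snd == .node n.uid))).map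
    (fun w => (w.req.fst, w.req.snd))).dedup with hps₂
  have hps₂m : ∀ p ∈ ps₂, p.2 = .node n.uid ∧ Has F p.1 := by
    intro p hp
    rw [hps₂, List.mem_dedup, List.mem_map] at hp
    obtain ⟨w, hw, rfl⟩ := hp
    rw [mem_sortBy, List.mem_filter] at hw
    obtain ⟨a, ha, b, _, ea, _⟩ := h₁.q₂_ok w hw.1
    exact ⟨by simpa using hw.2, ea ▸ has_node ha⟩
  have hps₂c : ∀ w ∈ st₁.q₂, w.req.snd = .node n.uid → (w.req.fst, w.req.snd) ∈ ps₂ := by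
    intro w hw e
    rw [hps₂, List.mem_dedup, List.mem_map]
    exact ⟨w, by simp [mem_sortBy, hw, e], rfl⟩
  have hps₂l : ps₂.length ≤ F.length + 2 := by
    rw [← List.length_map (f := Prod.fst)]
    refine length_le_of_has ?_ ?_
    · refine (List.nodup_map_iff_inj_on (List.nodup_dedup _)).2 fun p hp q hq e => ?_
      exact Prod.ext e ((hps₂m p hp).1.trans (hps₂m q hq).1.symm)
    · intro q hq
      obtain ⟨p, hp, rfl⟩ := List.mem_map.1 hq
      exact (hps₂m p hp).2
  have stage₂ : ∀ (ps : List (Ptr × Ptr)) (st : ApplyState) (g : Uid → BoolFn) (cr : List Uid),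
      (∀ p ∈ ps, p.2 = .node n.uid) →
      ApplyInv F (n :: rest) S I [] g cr st →
      (∀ r ∈ st.q₁, r.fst ≠ .node n.uid) →
      (∀ w ∈ st.q₂, w.req.snd = .node n.uid → (w.req.fst, w.req.snd) ∈ ps) →
      ∃ g' cr', ApplyInv F (n :: rest) S I [] g' cr' (ps.foldl (ApplyState.second n) st) ∧
        cr'.length ≤ cr.length + ps.length ∧
        (∀ r ∈ (ps.foldl (ApplyState.second n) st).q₁, r.fst ≠ .node n.uid) ∧
        ∀ w ∈ (ps.foldl (ApplyState.second n) st).q₂, w.req.snd ≠ .node n.uid := by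
    intro ps
    induction ps with
    | nil =>
      intro st g cr _ h hq hq₂
      exact ⟨g, cr, h, by simp, hq, fun r hr e => absurd (hq₂ r hr e) List.not_mem_nil⟩
    | cons p ps ih =>
      intro st g cr hps h hq hq₂
      obtain ⟨g', cr', h', hl, hq', hq₂'⟩ := h.second hF hS hnF (hps p List.mem_cons_self) hrest
      obtain ⟨g'', cr'', h'', hl', hq''⟩ := ih (st.second n p) g' cr'
        (fun q hq => hps q (List.mem_cons_of_mem _ hq)) h'
        (fun r hr => (hq' r hr).elim (hq r) (hnb _)) (by
          intro w hw e
          obtain ⟨h1, h2⟩ := hq₂' w hw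
          rcases List.mem_cons.1 (hq₂ w h1 e) with h3 | h3
          · exact absurd h3 h2
          · exact h3)
      exact ⟨g'', cr'', h'', by simp only [List.length_cons]; omega, hq''⟩
  obtain ⟨g₂, cr₂, h₂, hl₂, hq₂, hq₂'⟩ := stage₂ ps₂ st₁ g₁ cr₁ (fun p hp => (hps₂m p hp).1)
    h₁ hq₁ hps₂c
  have hread : st.read n = ps₂.foldl (ApplyState.second n) st₁ := rfl
  rw [hread]
  refine ⟨g₂, cr₂, ⟨fun r hr => ?_, fun w hw => ?_, h₂.arcs_ok, h₂.terms_ok, h₂.cr_ok, h₂.items,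
    h₂.ops₁_len, h₂.ops₂_len⟩, by omega⟩
  · obtain ⟨k1, k2, k3⟩ := h₂.q₁_ok r hr
    refine ⟨k1, fun u hu => ?_, k3⟩
    obtain ⟨m, hm, rfl⟩ := k2 u hu
    rcases List.mem_cons.1 hm with rfl | hm
    · exact absurd hu (hq₂ r hr)
    · exact ⟨m, hm, rfl⟩
  · obtain ⟨a, ha, b, hb, ea, eb, k⟩ := h₂.q₂_ok w hw
    rcases List.mem_cons.1 hb with rfl | hb
    · exact absurd eb (hq₂' w hw)
    · exact ⟨a, ha, b, hb, ea, eb, k⟩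

/-- What the inner Apply sweep delivers: the nodes `cr` with meanings `g`, and an arc for each request
and two for each node. -/
structure ApplySpec (F : List Node) (S : Set BoolFn) (rs : List Req) (g : Uid → BoolFn)
    (cr : List Uid) (st : ApplyState) : Prop where
  arcs_ok : ∀ a ∈ st.arcs, ∃ u ∈ cr, a.tgt = .node u ∧ srcLevel a.src < (u.1 : ℕ)
  terms_ok : ∀ a ∈ st.terms, ∃ b, a.tgt = .term b
  cr_ok : ∀ u ∈ cr, (∃ n ∈ F, n.uid.1 = u.1) ∧ g u ∈ S
  items : arcItems g (st.arcs ++ st.terms) = reqItems F rs + (cr.flatMap (childItems g) : List _)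
  cr_len : cr.length ≤ F.length * (2 * F.length + 4)
  ops₁_len : st.ops₁.length ≤ 2 * (rs.length + 2 * cr.length)
  ops₂_len : st.ops₂.length ≤ 2 * (rs.length + 2 * cr.length)

/-- The invariant is carried through the file. When no unread nodes remain, a request can wait only
for a terminal, so `finish` resolves whatever is left in the first queue. -/
theorem innerApply_spec (hF : FileOK F) (hS : CofClosed S) {rs : List Req}
    (hrs : ∀ r ∈ rs, ReqOK F r.fst r.snd ∧
      (∀ u : Uid, r.fst = .node u → srcLevel r.src < (u.1 : ℕ)) ∧ orSem F r.fst r.snd ∈ S) :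
    ∃ g cr, ApplySpec F S rs g cr (innerApply F rs) := by
  set st₀ : ApplyState := ⟨rs, [], rs.map (fun r => Op.insert r.key), [], [], [], fun _ => 0⟩
    with hst₀
  have h₀ : ApplyInv F F S (reqItems F rs) [] (fun _ _ => false) [] st₀ := by
    refine ⟨fun r hr => ?_, by simp [hst₀], by simp [hst₀], by simp [hst₀], by simp, ?_, ?_, ?_⟩
    · obtain ⟨h1, h2, h3⟩ := hrs r hr
      exact ⟨h1, h1.fst_has, h2, h3⟩
    · simp [hst₀, arcItems, reqItems]
    · simp [hst₀, reqItems]; omega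
    · simp [hst₀, reqItems]
  have main : ∀ (rest pre : List Node) (st : ApplyState) (g : Uid → BoolFn) (cr : List Uid),
      F = pre ++ rest → ApplyInv F rest S (reqItems F rs) [] g cr st →
      ∃ g' cr', ApplyInv F [] S (reqItems F rs) [] g' cr' (rest.foldl ApplyState.read st) ∧
        cr'.length ≤ cr.length + rest.length * (2 * F.length + 4) := by
    intro rest
    induction rest with
    | nil => intro pre st g cr _ h; exact ⟨g, cr, h, by simp⟩
    | cons n rest ih =>
      intro pre st g cr hs h
      obtain ⟨g', cr', h', hl⟩ := h.read hF hS hs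
      obtain ⟨g'', cr'', h'', hl'⟩ := ih (pre ++ [n]) (st.read n) g' cr' (by simp [hs]) h'
      refine ⟨g'', cr'', h'', ?_⟩
      rw [List.length_cons, Nat.add_mul, Nat.one_mul]
      omega
  obtain ⟨g, cr, h, hl⟩ := main F [] st₀ _ _ rfl h₀
  set st := F.foldl ApplyState.read st₀ with hst
  have hA : innerApply F rs = st.finish := rfl
  -- A forwarded request waits for an unread node, and none is left.
  have hq₂ : st.q₂ = [] := by
    rw [List.eq_nil_iff_forall_not_mem]
    intro w hw
    obtain ⟨_, _, b, hb, _⟩ := h.q₂_ok w hw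
    cases hb
  have hq₁ : ∀ r ∈ st.q₁, ∃ b, r.fst = .term b ∧ r.snd = .term false := by
    intro r hr
    obtain ⟨h1, h2, _⟩ := h.q₁_ok r hr
    rcases h1.norm with h3 | ⟨u, e, _⟩
    · exact h3
    · obtain ⟨m, hm, _⟩ := h2 u e
      cases hm
  have hcard : (reqItems F rs).card = rs.length := by simp [reqItems]
  have hterms : st.finish.terms = st.terms ++ (sortBy Req.key st.q₁).map
      (fun r => (⟨r.src, r.fst⟩ : Arc)) := rfl
  refine ⟨g, cr, ?_⟩
  rw [hA]
  refine ⟨h.arcs_ok, fun a ha => ?_, fun u hu => (h.cr_ok u hu).2, ?_, by simpa using hl, ?_, ?_⟩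
  · rw [hterms, List.mem_append, List.mem_map] at ha
    rcases ha with ha | ⟨r, hr, rfl⟩
    · exact h.terms_ok a ha
    · obtain ⟨b, e, _⟩ := hq₁ r (mem_sortBy.1 hr)
      exact ⟨b, e⟩
  · have h1 := h.items
    have e0 : reqItems F [] = 0 := rfl
    rw [hq₂, List.map_nil, e0, add_zero, add_zero] at h1
    rw [← h1, hterms, arcItems_append, arcItems_append, ← reqItems_perm (sortBy_perm Req.key st.q₁),
      ← add_assoc]
    congr 1
    unfold arcItems reqItems
    rw [List.map_map, List.map_congr_left]
    intro r hr
    obtain ⟨b, e, e'⟩ := hq₁ r (mem_sortBy.1 hr)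
    simp only [Function.comp, e, e']
    congr 1
    funext v; simp [val, orSem]
  · have := h.ops₁_len
    change (st.ops₁ ++ (sortBy Req.key st.q₁).map (fun _ => Op.deleteMin)).length ≤ _
    rw [List.length_append, List.length_map, length_sortBy, ← hcard]
    exact this
  · have := h.ops₂_len
    change st.ops₂.length ≤ _
    rw [← hcard]
    omega

end NestedSweep

namespace NestedSweep

open IOModel

/-! ## Reducing one level -/

theorem Has.below {F : List Node} {p : Ptr} {ℓ : ℕ} (h : Has F p) (hF : ∀ n ∈ F, ℓ < n.uid.1) :
    Below ℓ p := by
  intro u hu; obtain ⟨n, hn, rfl⟩ := h u hu; exact hF n hn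

theorem mem_kids {L : List Node} {x : Ptr × Ptr} :
    x ∈ kids L ↔ ∃ n ∈ L, n.low ≠ n.high ∧ (n.low, n.high) = x := by
  simp [kids, mem_sortBy, List.mem_dedup, and_assoc]

theorem nodup_kids (L : List Node) : (kids L).Nodup := List.nodup_dedup _

theorem length_kids_le (L : List Node) :
    (kids L).length ≤ (L.filter (fun n => n.low != n.high)).length := by
  unfold kids
  refine (List.dedup_sublist _).length_le.trans ?_
  rw [length_sortBy, List.length_map]

theorem length_newNodes (ℓ : ℕ) (L : List Node) : (newNodes ℓ L).length = (kids L).length := by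
  simp [newNodes]

theorem mem_newNodes {ℓ : ℕ} {L : List Node} {m : Node} : m ∈ newNodes ℓ L ↔
    m.uid.1 = ℓ ∧ (kids L)[m.uid.2]? = some (m.low, m.high) := by
  unfold newNodes
  rw [List.mem_map]
  constructor
  · rintro ⟨⟨x, i⟩, hx, rfl⟩
    exact ⟨rfl, by simpa using List.mem_zipIdx_iff_getElem?.1 hx⟩
  · rintro ⟨h1, h2⟩
    refine ⟨((m.low, m.high), m.uid.2), List.mem_zipIdx_iff_getElem?.2 h2, ?_⟩
    rw [← h1]

theorem mem_collect {ℓ : ℕ} {as : List Arc} {n : Node} (h : n ∈ collect ℓ as) :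
    n.uid.1 = ℓ ∧ ∃ a ∈ as, ∃ b, a.src = some (n.uid, b) := by
  unfold collect at h
  obtain ⟨u, hu, rfl⟩ := List.mem_map.1 h
  rw [List.mem_dedup, mem_sortBy, List.mem_filter, List.mem_filterMap] at hu
  obtain ⟨⟨a, ha, e⟩, hl⟩ := hu
  refine ⟨by simpa using hl, a, ha, ?_⟩
  rcases hs : a.src with _ | ⟨w, b⟩
  · rw [hs] at e; cases e
  · rw [hs] at e; cases e; exact ⟨b, rfl⟩

theorem exists_mem_collect {ℓ : ℕ} {as : List Arc} {a : Arc} {u : Uid} {b : Bool} (ha : a ∈ as)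
    (e : a.src = some (u, b)) (hu : u.1 = ℓ) : ∃ n ∈ collect ℓ as, n.uid = u := by
  unfold collect
  refine ⟨_, List.mem_map.2 ⟨u, ?_, rfl⟩, rfl⟩
  rw [List.mem_dedup, mem_sortBy, List.mem_filter, List.mem_filterMap]
  exact ⟨⟨a, ha, by simp [e]⟩, by simpa using hu⟩

/-- The child of a collected node is the target of an arc, if there is one. -/
theorem collect_child {ℓ : ℕ} {as : List Arc} {n : Node} (h : n ∈ collect ℓ as) (b : Bool)
    (hex : ∃ a ∈ as, a.src = some (n.uid, b)) :
    ∃ a ∈ as, a.src = some (n.uid, b) ∧ (if b then n.high else n.low) = a.tgt := by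
  unfold collect at h
  obtain ⟨u, _, rfl⟩ := List.mem_map.1 h
  obtain ⟨a, ha, e⟩ := hex
  have : (as.find? (fun a => a.src == some (u, b))).isSome := by
    rw [List.find?_isSome]; exact ⟨a, ha, by simpa using e⟩
  obtain ⟨a', ha'⟩ := Option.isSome_iff_exists.1 this
  refine ⟨a', List.mem_of_find?_eq_some ha', by simpa using List.find?_some ha', ?_⟩
  cases b <;> simp [ha']

theorem collect_uid_inj {ℓ : ℕ} {as : List Arc} {n m : Node} (h : n ∈ collect ℓ as)
    (h' : m ∈ collect ℓ as) (e : n.uid = m.uid) : n = m := by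
  unfold collect at h h'
  obtain ⟨u, _, rfl⟩ := List.mem_map.1 h
  obtain ⟨w, _, rfl⟩ := List.mem_map.1 h'
  have : u = w := e
  rw [this]

theorem length_collect_le (ℓ : ℕ) (as : List Arc) :
    (collect ℓ as).length ≤ (as.filter (fun a => decide (srcLevel a.src = (ℓ : ℕ)))).length := by
  unfold collect
  rw [List.length_map]
  refine (List.dedup_sublist _).length_le.trans ?_
  rw [length_sortBy]
  induction as with
  | nil => simp
  | cons a as ih =>
    rcases hs : a.src with _ | ⟨u, b⟩
    · simpa [hs, srcLevel] using ih
    · by_cases hu : u.1 = ℓ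
      · simpa [hs, srcLevel, hu] using ih
      · simpa [hs, srcLevel, hu] using ih

/-- The nodes `L` of level `ℓ` with children in the reduced file `out`. -/
structure LevelOK (ℓ : ℕ) (L out : List Node) : Prop where
  file : FileOK out
  red : Reduced out
  below : ∀ n ∈ out, ℓ < n.uid.1
  level : ∀ n ∈ L, n.uid.1 = ℓ
  inj : ∀ n ∈ L, ∀ m ∈ L, n.uid = m.uid → n = m
  low_has : ∀ n ∈ L, Has out n.low
  high_has : ∀ n ∈ L, Has out n.high

variable {ℓ : ℕ} {L out : List Node}

theorem LevelOK.child_has (h : LevelOK ℓ L out) {m : Node} (hm : m ∈ newNodes ℓ L) :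
    Has out m.low ∧ Has out m.high ∧ m.low ≠ m.high := by
  have := List.mem_of_getElem? (mem_newNodes.1 hm).2
  obtain ⟨n, hn, hne, e⟩ := mem_kids.1 this
  obtain ⟨e1, e2⟩ := Prod.mk.inj e
  rw [← e1, ← e2]
  exact ⟨h.low_has n hn, h.high_has n hn, hne⟩

theorem LevelOK.den_append (h : LevelOK ℓ L out) (X : Finset ℕ) {p : Ptr} (hp : Has out p) :
    den X (newNodes ℓ L ++ out) p = den X out p := by
  refine den_append_of_not_mem fun n hn e => ?_
  have := hp.below h.below _ e
  rw [(mem_newNodes.1 hn).1] at this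
  exact lt_irrefl _ this

theorem LevelOK.fileOK (h : LevelOK ℓ L out) : FileOK (newNodes ℓ L ++ out) := by
  have hb : ∀ {p}, Has out p → Below ℓ p := fun hp => hp.below h.below
  refine ⟨?_, ?_, ?_, ?_, ?_⟩
  · rw [List.pairwise_append]
    refine ⟨?_, h.file.sorted, fun a ha b hb => ?_⟩
    · rw [List.pairwise_iff_getElem]
      intro i k hi hk hik
      rw [uidKey_lt]
      right
      simpa [newNodes] using hik
    · rw [uidKey_lt]
      left
      rw [(mem_newNodes.1 ha).1]
      exact h.below b hb
  · intro n hn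
    rcases List.mem_append.1 hn with hn | hn
    · rw [(mem_newNodes.1 hn).1]; exact hb (h.child_has hn).1
    · exact h.file.low_below n hn
  · intro n hn
    rcases List.mem_append.1 hn with hn | hn
    · rw [(mem_newNodes.1 hn).1]; exact hb (h.child_has hn).2.1
    · exact h.file.high_below n hn
  · intro n hn
    rcases List.mem_append.1 hn with hn | hn
    · exact (h.child_has hn).1.mono (List.subset_append_right _ _)
    · exact (h.file.low_has n hn).mono (List.subset_append_right _ _)
  · intro n hn
    rcases List.mem_append.1 hn with hn | hn
    · exact (h.child_has hn).2.1.mono (List.subset_append_right _ _)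
    · exact (h.file.high_has n hn).mono (List.subset_append_right _ _)

/-- On the new level the index of a node is the position of its pair of children in a duplicate-free
list, so equal children force equal uids; redundant nodes never enter that list. -/
theorem LevelOK.reduced (h : LevelOK ℓ L out) : Reduced (newNodes ℓ L ++ out) := by
  refine ⟨fun n hn => ?_, fun n hn m hm el e1 e2 => ?_⟩
  · rcases List.mem_append.1 hn with hn | hn
    · exact (h.child_has hn).2.2
    · exact h.red.ne n hn
  · rcases List.mem_append.1 hn with hn | hn <;> rcases List.mem_append.1 hm with hm | hm
    · obtain ⟨a1, a2⟩ := mem_newNodes.1 hn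
      obtain ⟨b1, b2⟩ := mem_newNodes.1 hm
      rw [← e1, ← e2] at b2
      obtain ⟨hi, a3⟩ := List.getElem?_eq_some_iff.1 a2
      obtain ⟨hk, b3⟩ := List.getElem?_eq_some_iff.1 b2
      have : n.uid.2 = m.uid.2 := (nodup_kids L).getElem_inj_iff.1 (a3.trans b3.symm)
      have : n.uid = m.uid := Prod.ext el this
      cases n; cases m; simp_all
    · have := h.below m hm
      rw [(mem_newNodes.1 hn).1] at el
      omega
    · have := h.below n hn
      rw [(mem_newNodes.1 hm).1] at el
      omega
    · exact h.red.inj n hn m hm el e1 e2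

theorem image_eq (hinj : ∀ n ∈ L, ∀ m ∈ L, n.uid = m.uid → n = m) {n : Node} (hn : n ∈ L) :
    image ℓ L n.uid = if n.low = n.high then n.low
      else .node (ℓ, (kids L).idxOf (n.low, n.high)) := by
  unfold image
  have : (L.find? (fun m => m.uid == n.uid)).isSome := by
    rw [List.find?_isSome]; exact ⟨n, hn, by simp⟩
  obtain ⟨m, hm⟩ := Option.isSome_iff_exists.1 this
  have e : m = n := hinj m (List.mem_of_find?_eq_some hm) n hn (by simpa using List.find?_some hm)
  rw [hm, e]

/-- The image of a node is either its child or a new node. -/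
theorem LevelOK.image_cases (h : LevelOK ℓ L out) {n : Node} (hn : n ∈ L) :
    (n.low = n.high ∧ image ℓ L n.uid = n.low) ∨
      ∃ m ∈ newNodes ℓ L, image ℓ L n.uid = .node m.uid ∧ m.low = n.low ∧ m.high = n.high := by
  rw [image_eq h.inj hn]
  split_ifs with e
  · exact Or.inl ⟨e, rfl⟩
  · right
    have hk : (n.low, n.high) ∈ kids L := mem_kids.2 ⟨n, hn, e, rfl⟩
    refine ⟨⟨(ℓ, (kids L).idxOf (n.low, n.high)), n.low, n.high⟩, mem_newNodes.2 ⟨rfl, ?_⟩,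
      rfl, rfl, rfl⟩
    simp [hk]

theorem LevelOK.image_has (h : LevelOK ℓ L out) {n : Node} (hn : n ∈ L) :
    Has (newNodes ℓ L ++ out) (image ℓ L n.uid) := by
  rcases h.image_cases hn with ⟨_, e⟩ | ⟨m, hm, e, _⟩
  · rw [e]; exact (h.low_has n hn).mono (List.subset_append_right _ _)
  · rw [e]; exact has_node (List.mem_append_left _ hm)

theorem LevelOK.den_newNode (h : LevelOK ℓ L out) {m : Node} (hm : m ∈ newNodes ℓ L)
    (v : ℕ → Bool) : den ∅ (newNodes ℓ L ++ out) (.node m.uid) v =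
      if v ℓ then den ∅ out m.high v else den ∅ out m.low v := by
  rw [h.fileOK.den_node (List.mem_append_left _ hm)]
  obtain ⟨h1, h2, _⟩ := h.child_has hm
  rw [← h.den_append ∅ h1, ← h.den_append ∅ h2, (mem_newNodes.1 hm).1]
  simp only [Finset.notMem_empty, if_false]
  split <;> rfl

theorem LevelOK.den_image (h : LevelOK ℓ L out) {n : Node} (hn : n ∈ L) (v : ℕ → Bool) :
    den ∅ (newNodes ℓ L ++ out) (image ℓ L n.uid) v =
      if v ℓ then den ∅ out n.high v else den ∅ out n.low v := by
  rcases h.image_cases hn with ⟨e', e⟩ | ⟨m, hm, e, e1, e2⟩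
  · rw [e, h.den_append ∅ (h.low_has n hn), ← e']; simp
  · rw [e, h.den_newNode hm, e1, e2]

/-- The nodes of `L` represent the functions `g`. -/
theorem LevelOK.den_image_eq (h : LevelOK ℓ L out) {n : Node} (hn : n ∈ L) {f : BoolFn}
    (h0 : den ∅ out n.low = cof f ℓ false) (h1 : den ∅ out n.high = cof f ℓ true) :
    den ∅ (newNodes ℓ L ++ out) (image ℓ L n.uid) = f := by
  funext v
  rw [h.den_image hn, h0, h1]
  conv_rhs => rw [← cof_self f ℓ v]
  cases v ℓ <;> simp

/-- Transfers membership in `S` from the nodes created by the Apply sweep to the nodes of the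
reduced output. -/
theorem LevelOK.exists_of_newNode (h : LevelOK ℓ L out) {m : Node} (hm : m ∈ newNodes ℓ L) :
    ∃ n ∈ L, den ∅ (newNodes ℓ L ++ out) (.node m.uid) =
      den ∅ (newNodes ℓ L ++ out) (image ℓ L n.uid) := by
  obtain ⟨n, hn, _, e⟩ := mem_kids.1 (List.mem_of_getElem? (mem_newNodes.1 hm).2)
  refine ⟨n, hn, ?_⟩
  funext v
  obtain ⟨e1, e2⟩ := Prod.mk.inj e
  rw [h.den_image hn, h.den_newNode hm, e1, e2]

theorem mem_forward {arcs : List Arc} {a : Arc} (h : a ∈ forward arcs ℓ L) :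
    ∃ a' ∈ arcs, ∃ u, a'.tgt = .node u ∧ u.1 = ℓ ∧ a = ⟨a'.src, image ℓ L u⟩ := by
  unfold forward at h
  obtain ⟨a', ha', e⟩ := List.mem_map.1 h
  rw [List.mem_filter, List.mem_reverse] at ha'
  rcases ht : a'.tgt with u | b
  · refine ⟨a', ha'.1, u, ht, ?_, ?_⟩
    · simpa [ht, Ptr.onLevel] using ha'.2
    · rw [← e, ht]
  · rw [ht] at ha'; simp [Ptr.onLevel] at ha'

theorem forward_of_mem {arcs : List Arc} {a : Arc} (h : a ∈ arcs) {u : Uid} (e : a.tgt = .node u)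
    (hu : u.1 = ℓ) : (⟨a.src, image ℓ L u⟩ : Arc) ∈ forward arcs ℓ L := by
  unfold forward
  refine List.mem_map.2 ⟨a, ?_, by rw [e]⟩
  rw [List.mem_filter, List.mem_reverse]
  exact ⟨h, by simp [e, Ptr.onLevel, hu]⟩

/-- The forwarded arcs that satisfy a condition on the start, with a function of their targets. -/
theorem forward_map_perm {β : Type*} (arcs : List Arc) (q : Src → Bool) (φ φ' : Arc → β)
    (hφ : ∀ a ∈ arcs, ∀ u, a.tgt = .node u → u.1 = ℓ → φ ⟨a.src, image ℓ L u⟩ = φ' a) :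
    (((forward arcs ℓ L).filter (fun a => q a.src)).map φ).Perm
      ((arcs.filter (fun a => q a.src && a.tgt.onLevel ℓ)).map φ') := by
  refine List.Perm.trans (List.Perm.of_eq ?_) (((List.reverse_perm arcs).filter _).map _)
  unfold forward
  rw [List.filter_map, List.map_map, List.filter_filter]
  rw [List.filter_congr (q := fun a => q a.src && a.tgt.onLevel ℓ)
    (fun a _ => by rcases ht : a.tgt with u | b <;> simp [Function.comp, ht])]
  refine List.map_congr_left fun a ha => ?_
  rw [List.mem_filter, List.mem_reverse] at ha
  rcases ht : a.tgt with u | b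
  · simp only [Function.comp, ht]
    refine hφ a ha.1 u ht ?_
    have := ha.2
    simp only [ht, Ptr.onLevel, Bool.and_eq_true, beq_iff_eq] at this
    exact this.2
  · have := ha.2
    simp [ht, Ptr.onLevel] at this

end NestedSweep

namespace IOModel

/-! ## The number of stored records -/

section Contents

variable {α : Type} [LinearOrder α]

/-- The smallest of the records; `⊤` if there is none. -/
def least (s : Multiset α) : WithTop α := (s.map WithTop.some).inf

theorem inf_lift_eq_least (s : Multiset α) : (s.map (fun x => (x : WithTop α))).inf = least s := by
  unfold least
  congr 1
  exact (Multiset.map_id _).trans (Multiset.bind_singleton s _)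

theorem exists_least_eq {s : Multiset α} (hs : s ≠ 0) : ∃ x ∈ s, least s = x := by
  induction s using Multiset.induction with
  | empty => exact absurd rfl hs
  | cons a s ih =>
    by_cases h : s = 0
    · subst h; exact ⟨a, by simp, by simp [least]⟩
    · obtain ⟨x, hx, e⟩ := ih h
      unfold least at e ⊢
      rw [Multiset.map_cons, Multiset.inf_cons, e]
      rcases le_total a x with hax | hax
      · exact ⟨a, by simp, inf_eq_left.2 (WithTop.coe_le_coe.2 hax)⟩
      · exact ⟨x, by simp [hx], inf_eq_right.2 (WithTop.coe_le_coe.2 hax)⟩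

theorem apply_deleteMin_of_eq {s : Multiset α} {x : α} (h : least s = x) :
    Op.apply s .deleteMin = s.erase x := by
  simp only [Op.apply, inf_lift_eq_least, h]

theorem apply_deleteMin_zero : Op.apply (0 : Multiset α) .deleteMin = 0 := rfl

theorem card_apply_deleteMin (s : Multiset α) : (Op.apply s .deleteMin).card = s.card - 1 := by
  by_cases hs : s = 0
  · subst hs; rfl
  · obtain ⟨x, hx, e⟩ := exists_least_eq hs
    rw [apply_deleteMin_of_eq e, Multiset.card_erase_of_mem hx, Nat.pred_eq_sub_one]

theorem contents_append (l l' : List (Op α)) :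
    contents (l ++ l') = l'.foldl Op.apply (contents l) := by
  simp [contents]

theorem card_foldl_insert {β : Type} (f : β → α) (l : List β) (s : Multiset α) :
    ((l.map (fun x => Op.insert (f x))).foldl Op.apply s).card = s.card + l.length := by
  induction l generalizing s with
  | nil => simp
  | cons a l ih =>
    simp only [List.map_cons, List.foldl_cons, ih, List.length_cons]
    simp [Op.apply]; omega

theorem card_foldl_deleteMin {β : Type} (l : List β) (s : Multiset α) :
    ((l.map (fun _ => (Op.deleteMin : Op α))).foldl Op.apply s).card = s.card - l.length := by
  induction l generalizing s with
  | nil => simp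
  | cons a l ih =>
    simp only [List.map_cons, List.foldl_cons, ih, List.length_cons, card_apply_deleteMin]
    omega

theorem card_contents_le (l : List (Op α)) : (contents l).card ≤ l.length := by
  induction l using List.reverseRecOn with
  | nil => simp [contents]
  | append_singleton l a ih =>
    rw [contents_append]
    cases a with
    | insert x => simp [Op.apply]; exact ih
    | deleteMin => simp [card_apply_deleteMin]; omega

/-- Inserting some records and deleting equally many. -/
theorem contents_insert_deleteMin {β γ : Type} {l : List (Op α)} (h : contents l = 0) (f : β → α)
    (s : List β) (t : List γ) (hst : s.length ≤ t.length) :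
    contents (l ++ s.map (fun x => Op.insert (f x)) ++ t.map (fun _ => Op.deleteMin)) = 0 ∧
      s.length ≤ (contents (l ++ s.map (fun x => Op.insert (f x)))).card := by
  constructor
  · rw [← Multiset.card_eq_zero, contents_append, card_foldl_deleteMin, contents_append,
      card_foldl_insert, h]
    simp only [Multiset.card_zero, zero_add]
    omega
  · rw [contents_append, card_foldl_insert]; omega

end Contents

end IOModel

namespace NestedSweep

open IOModel

/-! ## The inner Reduce sweep -/

/-- Does the pointer lead to a node below level `b`? -/
def Ptr.under (b : ℕ) : Ptr → Bool
  | .node u => decide (b < u.1)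
  | .term _ => false

/-- The output of the inner Apply sweep at `x_j`, whose nodes are on the levels `j + 1, …, j + k`. -/
structure Unreduced (S : Set BoolFn) (j k : ℕ) (g : Uid → BoolFn) (cr : List Uid)
    (arcs terms : List Arc) : Prop where
  arcs_ok : ∀ a ∈ arcs, ∃ u ∈ cr, a.tgt = .node u ∧ srcLevel a.src < (u.1 : ℕ)
  terms_ok : ∀ a ∈ terms, ∃ b, a.tgt = .term b
  level : ∀ u ∈ cr, j < u.1 ∧ u.1 ≤ j + k
  mem : ∀ u ∈ cr, g u ∈ S
  src_ok : ∀ a ∈ arcs ++ terms, srcLevel a.src ≤ (j : ℕ) ∨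
    ∃ u ∈ cr, ∃ b, a.src = some (u, b) ∧ val g a.tgt = cof (g u) u.1 b
  ex : ∀ u ∈ cr, ∀ b, ∃ a ∈ arcs ++ terms, a.src = some (u, b)

/-- The invariant of the inner Reduce sweep when the levels below `b` have been processed. -/
structure ReduceInv (S : Set BoolFn) (j k b : ℕ) (g : Uid → BoolFn) (cr : List Uid)
    (arcs terms : List Arc) (st : ReduceState) : Prop where
  file : FileOK st.out
  red : Reduced st.out
  level : ∀ n ∈ st.out, b < n.uid.1 ∧ n.uid.1 ≤ j + k
  mem : ∀ n ∈ st.out, den ∅ st.out (.node n.uid) ∈ S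
  q_ok : ∀ a ∈ st.q, ∃ u ∈ cr, ∃ h, a.src = some (u, h) ∧ u.1 ≤ b ∧ Has st.out a.tgt ∧
    den ∅ st.out a.tgt = cof (g u) u.1 h
  q_ex : ∀ a ∈ arcs, a.tgt.under b = true → ∀ u ∈ cr, ∀ h, a.src = some (u, h) → u.1 ≤ b →
    ∃ a' ∈ st.q, a'.src = some (u, h)
  back_has : ∀ a ∈ st.back, Has st.out a.tgt
  back : (st.back.map (fun a => (a.src, den ∅ st.out a.tgt))).Perm
    ((terms.filter (fun a => ¬ (j : WithBot ℕ) < srcLevel a.src) ++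
      arcs.filter (fun a => (! decide ((j : WithBot ℕ) < srcLevel a.src)) && a.tgt.under b)).map
        (fun a => (a.src, val g a.tgt)))
  -- Each node that is collected on a level is paid for by an arc that leaves it: two units, spent
  -- on its insertion and deletion in the sorter or on recording it as redundant. An arc that still
  -- waits in the queue holds its two units.
  kids_len : st.opsKids.length + 2 * st.redundant + 2 * st.q.length ≤
    2 * ((arcs.filter (fun a => a.tgt.under b)).length +
      (terms.filter (fun a => decide ((b : WithBot ℕ) < srcLevel a.src))).length)
  up_len : st.opsUp.length + st.q.length ≤ 2 * (arcs.filter (fun a => a.tgt.under b)).length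
  uid_len : st.opsUid.length = st.opsKids.length
  out_len : 2 * st.out.length ≤ st.opsKids.length
  back_len : st.opsBack.length = st.back.length
  kids_empty : contents st.opsKids = 0
  -- All nodes of a level that are not redundant are in the sorter at one moment. The lower bound
  -- rests on this field and on `kids_empty`.
  peak : ∀ ℓ, ∃ pre, pre <+: st.opsKids ∧
    (st.out.filter (fun n => n.uid.1 == ℓ)).length ≤ (contents pre).card

variable {S : Set BoolFn} {j k : ℕ} {g : Uid → BoolFn} {cr : List Uid} {arcs terms : List Arc}

theorem ReduceInv.init (h : Unreduced S j k g cr arcs terms) :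
    ReduceInv S j k (j + k) g cr arcs terms (innerReduceSteps j k arcs terms 0) := by
  have h0 : arcs.filter (fun a => a.tgt.under (j + k)) = [] := by
    rw [List.filter_eq_nil_iff]
    intro a ha
    obtain ⟨u, hu, e, _⟩ := h.arcs_ok a ha
    have := (h.level u hu).2
    simp [e, Ptr.under]; omega
  have h0' : arcs.filter (fun a => (! decide ((j : WithBot ℕ) < srcLevel a.src)) &&
      a.tgt.under (j + k)) = [] := by
    rw [← List.filter_filter, h0]; rfl
  refine ⟨FileOK.nil, ⟨by simp [innerReduceSteps], by simp [innerReduceSteps]⟩,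
    by simp [innerReduceSteps], by simp [innerReduceSteps], by simp [innerReduceSteps], ?_, ?_, ?_,
    by simp [innerReduceSteps], by simp [innerReduceSteps], rfl, by simp [innerReduceSteps],
    by simp [innerReduceSteps], rfl, fun ℓ => ⟨[], List.prefix_refl _, by simp [innerReduceSteps]⟩⟩
  · intro a ha hu
    have : a ∈ arcs.filter (fun a => a.tgt.under (j + k)) := List.mem_filter.2 ⟨ha, hu⟩
    rw [h0] at this; cases this
  · intro a ha
    obtain ⟨b, e⟩ := h.terms_ok a (List.mem_of_mem_filter ha)
    rw [e]; exact Has.term _ _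
  · rw [h0', List.append_nil]
    refine List.Perm.of_eq (List.map_congr_left fun a ha => ?_)
    obtain ⟨b, e⟩ := h.terms_ok a (List.mem_of_mem_filter ha)
    rw [e]
    congr 1
    funext v; simp [val]

theorem srcLevel_some (u : Uid) (h : Bool) : srcLevel (some (u, h)) = (u.1 : ℕ) := rfl

theorem length_forward (arcs : List Arc) (ℓ : ℕ) (L : List Node) :
    (forward arcs ℓ L).length = (arcs.filter (fun a => a.tgt.onLevel ℓ)).length := by
  simp [forward, List.filter_reverse]

/-- By the time a level is reached, both children of each of its nodes have been reduced and mean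
the two cofactors of its function `g`. Shannon expansion shows that the image of the node means `g`,
so arcs forwarded to the image keep their meaning, whether they stay in the sweep or are given back.
-/
theorem ReduceInv.step (h : Unreduced S j k g cr arcs terms) {b : ℕ} {st : ReduceState}
    (hjb : j ≤ b) (hbk : b + 1 ≤ j + k) (hi : ReduceInv S j k (b + 1) g cr arcs terms st) :
    ReduceInv S j k b g cr arcs terms (st.level j arcs terms (b + 1)) := by
  set ℓ := b + 1 with hℓ
  set here := st.q.filter (fun a => decide (srcLevel a.src = (ℓ : ℕ))) with hhere
  set L := collect ℓ (here ++ terms) with hL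
  set L' := L.filter (fun n => n.low != n.high) with hL'
  set fw := forward arcs ℓ L with hfw
  set stay := fw.filter (fun a => decide ((j : WithBot ℕ) < srcLevel a.src)) with hstay
  set back := fw.filter (fun a => decide (¬ (j : WithBot ℕ) < srcLevel a.src)) with hback
  have eq_q : (st.level j arcs terms ℓ).q =
    st.q.filter (fun a => decide (srcLevel a.src ≠ (ℓ : ℕ))) ++ stay := rfl
  have eq_out : (st.level j arcs terms ℓ).out = newNodes ℓ L ++ st.out := rfl
  have eq_back : (st.level j arcs terms ℓ).back = st.back ++ back := rfl
  have hterm : ∀ a ∈ terms, ∀ u h', a.src = some (u, h') → u.1 = ℓ → u ∈ cr ∧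
      val g a.tgt = cof (g u) u.1 h' := by
    intro a ha u h' e hu
    rcases h.src_ok a (List.mem_append_right _ ha) with h1 | ⟨u', hu', b', e', h2⟩
    · rw [e, srcLevel_some, hu] at h1
      have : ℓ ≤ j := by exact_mod_cast h1
      omega
    · rw [e] at e'; cases e'; exact ⟨hu', h2⟩
  have hhas : ∀ a ∈ here ++ terms, ∀ u h', a.src = some (u, h') → u.1 = ℓ → u ∈ cr ∧
      Has st.out a.tgt ∧ den ∅ st.out a.tgt = cof (g u) ℓ h' := by
    intro a ha u h' e hu
    rcases List.mem_append.1 ha with ha | ha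
    · obtain ⟨u', hu', b', e', _, h1, h2⟩ := hi.q_ok a (List.mem_of_mem_filter ha)
      rw [e] at e'; cases e'
      rw [hu] at h2
      exact ⟨hu', h1, h2⟩
    · obtain ⟨h1, h2⟩ := hterm a ha u h' e hu
      obtain ⟨t, et⟩ := h.terms_ok a ha
      rw [hu] at h2
      refine ⟨h1, et ▸ Has.term _ _, ?_⟩
      rw [← h2, et]
      funext v; simp [val]
  -- Both outgoing arcs of a node on this level are available: an arc to a node ends on a deeper
  -- level and was therefore forwarded to the queue, and the others are in `terms`.
  have hex : ∀ u ∈ cr, u.1 = ℓ → ∀ h', ∃ a ∈ here ++ terms, a.src = some (u, h') := by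
    intro u hu hul h'
    obtain ⟨a, ha, e⟩ := h.ex u hu h'
    rcases List.mem_append.1 ha with ha | ha
    · obtain ⟨w, hw, ew, hlt⟩ := h.arcs_ok a ha
      rw [e, srcLevel_some] at hlt
      have hlt : u.1 < w.1 := by exact_mod_cast hlt
      obtain ⟨a', ha', e'⟩ := hi.q_ex a ha (by rw [ew]; simp [Ptr.under]; omega) u hu h' e hul.le
      exact ⟨a', List.mem_append_left _ (List.mem_filter.2 ⟨ha', by rw [e', srcLevel_some, hul]; simp⟩), e'⟩
    · exact ⟨a, List.mem_append_right _ ha, e⟩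
  have hcr : ∀ n ∈ L, n.uid ∈ cr ∧ n.uid.1 = ℓ := by
    intro n hn
    obtain ⟨h1, a, ha, b', e⟩ := mem_collect hn
    exact ⟨(hhas a ha _ _ e h1).1, h1⟩
  have hchild : ∀ n ∈ L, ∀ h', Has st.out (if h' then n.high else n.low) ∧
      den ∅ st.out (if h' then n.high else n.low) = cof (g n.uid) ℓ h' := by
    intro n hn h'
    obtain ⟨h1, h2⟩ := hcr n hn
    obtain ⟨a, ha, e, e'⟩ := collect_child hn h' (hex n.uid h1 h2 h')
    rw [e']
    exact (hhas a ha _ _ e h2).2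
  have hlev : LevelOK ℓ L st.out :=
    ⟨hi.file, hi.red, fun n hn => (hi.level n hn).1, fun n hn => (hcr n hn).2,
      fun n hn m hm e => collect_uid_inj hn hm e, fun n hn => (hchild n hn false).1,
      fun n hn => (hchild n hn true).1⟩
  have himg : ∀ u ∈ cr, u.1 = ℓ → Has (newNodes ℓ L ++ st.out) (image ℓ L u) ∧
      den ∅ (newNodes ℓ L ++ st.out) (image ℓ L u) = g u := by
    intro u hu hul
    obtain ⟨a, ha, e⟩ := hex u hu hul false
    obtain ⟨n, hn, rfl⟩ := exists_mem_collect ha e hul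
    exact ⟨hlev.image_has hn, hlev.den_image_eq hn (hchild n hn false).2 (hchild n hn true).2⟩
  have hfwm : ∀ a ∈ fw, ∃ a' ∈ arcs, ∃ u ∈ cr, a'.tgt = .node u ∧ u.1 = ℓ ∧
      srcLevel a'.src < (ℓ : ℕ) ∧ a = ⟨a'.src, image ℓ L u⟩ := by
    intro a ha
    obtain ⟨a', ha', u, e, hul, e'⟩ := mem_forward ha
    obtain ⟨w, hw, ew, hlt⟩ := h.arcs_ok a' ha'
    rw [e] at ew; cases ew
    rw [hul] at hlt
    exact ⟨a', ha', u, hw, e, hul, hlt, e'⟩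
  have hlenfw : (arcs.filter (fun a => a.tgt.under b)).length =
      (arcs.filter (fun a => a.tgt.under ℓ)).length + fw.length := by
    rw [hfw, length_forward, ← List.length_append]
    refine (filter_perm_append _ _ _ _ ?_ ?_).length_eq
    · intro a _
      rcases a.tgt with u | t
      · simp only [Ptr.under, Ptr.onLevel]
        rw [Bool.eq_iff_iff]
        simp; omega
      · rfl
    · intro a _
      rcases a.tgt with u | t
      · simp only [Ptr.under, Ptr.onLevel]
        simp; omega
      · simp [Ptr.under]
  have hlenq : (st.q.filter (fun a => decide (srcLevel a.src ≠ (ℓ : ℕ)))).length + here.length =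
      st.q.length := by
    rw [← length_filter_add (fun a : Arc => decide (srcLevel a.src = (ℓ : ℕ))) st.q]
    simp only [decide_not, hhere]
  have hlenstay : stay.length ≤ fw.length := List.length_filter_le _ _
  have hlenL : L.length ≤ here.length +
      (terms.filter (fun a => decide (srcLevel a.src = (ℓ : ℕ)))).length := by
    refine (length_collect_le ℓ (here ++ terms)).trans ?_
    rw [List.filter_append, List.length_append]
    exact Nat.add_le_add_right (List.length_filter_le _ _) _
  have hlenT : (terms.filter (fun a => decide ((b : WithBot ℕ) < srcLevel a.src))).length =
      (terms.filter (fun a => decide ((ℓ : WithBot ℕ) < srcLevel a.src))).length +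
      (terms.filter (fun a => decide (srcLevel a.src = (ℓ : ℕ)))).length := by
    rw [← List.length_append]
    refine (filter_perm_append _ _ _ _ ?_ ?_).length_eq
    · intro a _
      rcases a.src with _ | ⟨u, t⟩
      · simp [srcLevel]
      · rw [Bool.eq_iff_iff]
        simp [srcLevel, -Nat.cast_add]; omega
    · intro a _
      rcases a.src with _ | ⟨u, t⟩
      · simp [srcLevel]
      · simp [srcLevel, -Nat.cast_add]; omega
  have hlenL' : L'.length ≤ L.length := List.length_filter_le _ _
  have hlennew : (newNodes ℓ L).length ≤ L'.length := by
    rw [length_newNodes]; exact length_kids_le L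
  have hsub : st.out ⊆ newNodes ℓ L ++ st.out := List.subset_append_right _ _
  have eq_kids : (st.level j arcs terms ℓ).opsKids = st.opsKids ++
      L'.map (fun n => Op.insert (n.low.key ++ n.high.key ++ uidKey n.uid)) ++
      L'.map (fun _ => Op.deleteMin) := rfl
  have hcont := contents_insert_deleteMin hi.kids_empty
    (fun n : Node => n.low.key ++ n.high.key ++ uidKey n.uid) L' L' le_rfl
  refine ⟨?_, ?_, ?_, ?_, ?_, ?_, ?_, ?_, ?_, ?_, ?_, ?_, ?_, ?_, ?_⟩
  · rw [eq_out]; exact hlev.fileOK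
  · rw [eq_out]; exact hlev.reduced
  · intro n hn
    rw [eq_out, List.mem_append] at hn
    rcases hn with hn | hn
    · rw [(mem_newNodes.1 hn).1]; omega
    · have := hi.level n hn; omega
  · intro n hn
    rw [eq_out] at hn ⊢
    rcases List.mem_append.1 hn with hn | hn
    · obtain ⟨m, hm, e⟩ := hlev.exists_of_newNode hn
      obtain ⟨h1, h2⟩ := hcr m hm
      rw [e, (himg m.uid h1 h2).2]
      exact h.mem _ h1
    · rw [hlev.den_append ∅ (has_node hn)]; exact hi.mem n hn
  · intro a ha
    rw [eq_q, List.mem_append] at ha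
    rw [eq_out]
    rcases ha with ha | ha
    · obtain ⟨ha, hne⟩ := List.mem_filter.1 ha
      obtain ⟨u, hu, h', e, hul, h1, h2⟩ := hi.q_ok a ha
      refine ⟨u, hu, h', e, ?_, h1.mono hsub, ?_⟩
      · rw [e, srcLevel_some] at hne
        have : u.1 ≠ ℓ := by simpa using hne
        omega
      · rw [hlev.den_append ∅ h1, h2]
    · obtain ⟨ha, hj⟩ := List.mem_filter.1 ha
      obtain ⟨a', ha', u, hu, e, hul, hlt, rfl⟩ := hfwm a ha
      rcases h.src_ok a' (List.mem_append_left _ ha') with h1 | ⟨u', hu', h', e', h2⟩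
      · exact absurd h1 (not_le.2 (by simpa using hj))
      · refine ⟨u', hu', h', e', ?_, (himg u hu hul).1, ?_⟩
        · rw [e', srcLevel_some] at hlt
          have : u'.1 < ℓ := by exact_mod_cast hlt
          omega
        · rw [(himg u hu hul).2, ← h2, e]; rfl
  · intro a ha hab u hu h' e hul
    rw [eq_q]
    rcases ht : a.tgt with w | t
    swap
    · rw [ht] at hab; cases hab
    by_cases hw : w.1 = ℓ
    · refine ⟨⟨a.src, image ℓ L w⟩, List.mem_append_right _ (List.mem_filter.2
        ⟨forward_of_mem ha ht hw, ?_⟩), e⟩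
      have := (h.level u hu).1
      simp only [e, srcLevel_some]
      simpa using this
    · have : a.tgt.under ℓ = true := by
        rw [ht] at hab ⊢
        simp only [Ptr.under, decide_eq_true_eq] at hab ⊢
        omega
      obtain ⟨a', ha', e'⟩ := hi.q_ex a ha this u hu h' e (by omega)
      refine ⟨a', List.mem_append_left _ (List.mem_filter.2 ⟨ha', ?_⟩), e'⟩
      rw [e', srcLevel_some]
      simp [-Nat.cast_add]; omega
  · intro a ha
    rw [eq_back, List.mem_append] at ha
    rw [eq_out]
    rcases ha with ha | ha
    · exact (hi.back_has a ha).mono hsub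
    · obtain ⟨a', ha', u, hu, e, hul, hlt, rfl⟩ := hfwm a (List.mem_of_mem_filter ha)
      exact (himg u hu hul).1
  · rw [eq_back, eq_out, List.map_append]
    have e1 : st.back.map (fun a => (a.src, den ∅ (newNodes ℓ L ++ st.out) a.tgt)) =
        st.back.map (fun a => (a.src, den ∅ st.out a.tgt)) :=
      List.map_congr_left fun a ha => by rw [hlev.den_append ∅ (hi.back_has a ha)]
    have e2 := forward_map_perm (ℓ := ℓ) (L := L) arcs
      (fun s => ! decide ((j : WithBot ℕ) < srcLevel s))
      (fun a => (a.src, den ∅ (newNodes ℓ L ++ st.out) a.tgt)) (fun a => (a.src, val g a.tgt)) (by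
        intro a ha u e hul
        obtain ⟨w, hw, ew, _⟩ := h.arcs_ok a ha
        rw [e] at ew; cases ew
        simp only [(himg u hw hul).2, e]
        rfl)
    have e3 : back = fw.filter (fun a => ! decide ((j : WithBot ℕ) < srcLevel a.src)) := by
      rw [hback]; simp only [decide_not]
    rw [e1, e3]
    refine (hi.back.append e2).trans ?_
    rw [← List.map_append, List.append_assoc]
    refine List.Perm.map _ ((List.Perm.refl _).append (filter_perm_append _ _ _ _ ?_ ?_).symm)
    · intro a _
      rcases a.tgt with u | t
      · simp only [Ptr.under, Ptr.onLevel]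
        rw [Bool.eq_iff_iff]
        simp only [Bool.and_eq_true, Bool.or_eq_true, decide_eq_true_eq, beq_iff_eq]
        have : b < u.1 ↔ ℓ < u.1 ∨ u.1 = ℓ := by omega
        rw [this, and_or_left]
      · simp [Ptr.under, Ptr.onLevel]
    · intro a _
      rcases a.tgt with u | t
      · simp only [Ptr.under, Ptr.onLevel, Bool.and_eq_true, decide_eq_true_eq, beq_iff_eq]
        rintro ⟨⟨_, h1⟩, _, h2⟩; omega
      · simp [Ptr.under]
  · have := hi.kids_len
    have e1 : (st.level j arcs terms ℓ).redundant = st.redundant + (L.length - L'.length) := rfl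
    rw [eq_kids, eq_q, e1, hlenT, hlenfw]
    simp only [List.length_append, List.length_map]
    omega
  · have := hi.up_len
    have e1 : (st.level j arcs terms ℓ).opsUp.length = st.opsUp.length + here.length + stay.length := by
      simp [ReduceState.level, ← hhere, ← hstay, ← hfw, ← hL, Nat.add_assoc]
    rw [e1, eq_q, hlenfw]
    simp only [List.length_append]
    omega
  · have := hi.uid_len
    have e1 : (st.level j arcs terms ℓ).opsUid.length = st.opsUid.length + L'.length + L'.length := by
      have : (st.level j arcs terms ℓ).opsUid = st.opsUid ++
        (sortBy (fun n => n.low.key ++ n.high.key ++ uidKey n.uid) L').map (fun n =>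
          Op.insert (revKey (uidKey n.uid ++ (image ℓ L n.uid).key))) ++
          L'.map (fun _ => Op.deleteMin) := rfl
      rw [this]
      simp [length_sortBy, Nat.add_assoc]
    rw [e1, eq_kids]
    simp only [List.length_append, List.length_map]
    omega
  · have := hi.out_len
    rw [eq_out, eq_kids]
    simp only [List.length_append, List.length_map]
    omega
  · have := hi.back_len
    rw [eq_back]
    have e1 : (st.level j arcs terms ℓ).opsBack = st.opsBack ++
      back.map (fun a => Op.insert (revKey (srcKey a.src ++ a.tgt.key))) := rfl
    rw [e1]
    simp only [List.length_append, List.length_map]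
    omega
  · rw [eq_kids]; exact hcont.1
  · intro l
    rw [eq_out, eq_kids, List.filter_append]
    by_cases hl : l = ℓ
    · refine ⟨_, List.prefix_append _ _, ?_⟩
      have e1 : st.out.filter (fun n => n.uid.1 == l) = [] := by
        rw [List.filter_eq_nil_iff]
        intro n hn
        have := (hi.level n hn).1
        simp; omega
      rw [e1, List.append_nil]
      exact (List.length_filter_le _ _).trans (hlennew.trans hcont.2)
    · obtain ⟨pre, h1, h2⟩ := hi.peak l
      refine ⟨pre, (h1.trans (List.prefix_append _ _)).trans (List.prefix_append _ _), ?_⟩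
      have e1 : (newNodes ℓ L).filter (fun n => n.uid.1 == l) = [] := by
        rw [List.filter_eq_nil_iff]
        intro n hn
        rw [(mem_newNodes.1 hn).1]
        simp; omega
      rw [e1, List.nil_append]
      exact h2

theorem innerReduceSteps_inv (h : Unreduced S j k g cr arcs terms) (i : ℕ) (hik : i ≤ k) :
    ReduceInv S j k (j + (k - i)) g cr arcs terms (innerReduceSteps j k arcs terms i) := by
  induction i with
  | zero => exact ReduceInv.init h
  | succ i ih =>
    have e : j + (k - i) = j + (k - (i + 1)) + 1 := by omega
    have e' : j + k - i = j + (k - (i + 1)) + 1 := by omega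
    have := ih (by omega)
    rw [e] at this
    change ReduceInv S j k _ g cr arcs terms
      ((innerReduceSteps j k arcs terms i).level j arcs terms (j + k - i))
    rw [e']
    exact this.step h (by omega) (by omega)

end NestedSweep

namespace NestedSweep

open IOModel

/-! ## One invocation of the inner sweeps -/

/-- The starts and meanings of arcs into a file. -/
def ptrItems (F : List Node) (l : List Arc) : Multiset (Src × BoolFn) :=
  (l.map (fun a => (a.src, den ∅ F a.tgt)) : List _)

theorem ptrItems_append (F : List Node) (l l' : List Arc) :
    ptrItems F (l ++ l') = ptrItems F l + ptrItems F l' := by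
  simp [ptrItems]

theorem ptrItems_perm {F : List Node} {l l' : List Arc} (h : l.Perm l') :
    ptrItems F l = ptrItems F l' := Multiset.coe_eq_coe.2 (h.map _)

/-- The balance `items` is read as a statement about membership: an arc of the output either answers
a request, and then starts on level `j` or above, or is one of the two arcs of a created node. -/
theorem ApplySpec.unreduced {F : List Node} {S : Set BoolFn} {rs : List Req} {g : Uid → BoolFn}
    {cr : List Uid} {A : ApplyState} (h : ApplySpec F S rs g cr A) {j k : ℕ}
    (hlev : ∀ n ∈ F, j < n.uid.1 ∧ n.uid.1 ≤ j + k) (hrs : ∀ r ∈ rs, srcLevel r.src ≤ (j : ℕ)) :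
    Unreduced S j k g cr A.arcs A.terms := by
  have hmem : ∀ x : Src × BoolFn, (∃ a ∈ A.arcs ++ A.terms, (a.src, val g a.tgt) = x) ↔
      (∃ r ∈ rs, (r.src, orSem F r.fst r.snd) = x) ∨ ∃ u ∈ cr, x ∈ childItems g u := by
    intro x
    have := congrArg (x ∈ ·) h.items
    simpa [arcItems, reqItems, List.mem_flatMap, or_and_right, exists_or] using this
  refine ⟨h.arcs_ok, h.terms_ok, ?_, fun u hu => (h.cr_ok u hu).2, ?_, ?_⟩
  · intro u hu
    obtain ⟨⟨n, hn, e⟩, _⟩ := h.cr_ok u hu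
    rw [← e]; exact hlev n hn
  · intro a ha
    rcases (hmem _).1 ⟨a, ha, rfl⟩ with ⟨r, hr, e⟩ | ⟨u, hu, hx⟩
    · left
      rw [← (Prod.mk.inj e).1]; exact hrs r hr
    · right
      simp only [childItems, List.mem_cons, List.not_mem_nil, or_false] at hx
      rcases hx with hx | hx
      · exact ⟨u, hu, false, Prod.mk.inj hx⟩
      · exact ⟨u, hu, true, Prod.mk.inj hx⟩
  · intro u hu b
    obtain ⟨a, ha, e⟩ := (hmem (some (u, b), cof (g u) u.1 b)).2
      (Or.inr ⟨u, hu, by cases b <;> simp [childItems]⟩)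
    exact ⟨a, ha, (Prod.mk.inj e).1⟩

/-- What the inner sweeps over the file `F` with the requests `rs` deliver. -/
structure SweepSpec (F : List Node) (S : Set BoolFn) (j k : ℕ) (rs : List Req)
    (A : ApplyState) (R : ReduceState) : Prop where
  file : FileOK R.out
  red : Reduced R.out
  level : ∀ n ∈ R.out, j < n.uid.1 ∧ n.uid.1 ≤ j + k
  mem : ∀ n ∈ R.out, den ∅ R.out (.node n.uid) ∈ S
  back_has : ∀ a ∈ R.back, Has R.out a.tgt
  back : ptrItems R.out R.back = reqItems F rs
  apply_len : A.arcs.length + A.terms.length ≤ rs.length + F.length * (4 * F.length + 8)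
  ops₁_len : A.ops₁.length ≤ 2 * (A.arcs.length + A.terms.length)
  ops₂_len : A.ops₂.length ≤ 2 * (A.arcs.length + A.terms.length)
  up_len : R.opsUp.length ≤ 2 * (A.arcs.length + A.terms.length)
  kids_len : R.opsKids.length + 2 * R.redundant ≤ 2 * (A.arcs.length + A.terms.length)
  uid_len : R.opsUid.length = R.opsKids.length
  out_len : 2 * R.out.length ≤ R.opsKids.length
  back_len : R.opsBack.length ≤ A.arcs.length + A.terms.length
  kids_empty : contents R.opsKids = 0
  peak : ∀ ℓ, ∃ pre, pre <+: R.opsKids ∧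
    (R.out.filter (fun n => n.uid.1 == ℓ)).length ≤ (contents pre).card

/-- The Reduce sweep gives back the arcs that do not start below level `j`. In the balance of the
Apply sweep all items of created nodes start below `j`, so filtering leaves exactly the requests.
The length bounds express everything by the number of arcs of the unreduced output, which is the
number of requests plus twice the number of created nodes. -/
theorem sweep_spec {F : List Node} {S : Set BoolFn} (hF : FileOK F) (hS : CofClosed S) {j k : ℕ}
    (hlev : ∀ n ∈ F, j < n.uid.1 ∧ n.uid.1 ≤ j + k) {rs : List Req}
    (hrs : ∀ r ∈ rs, ReqOK F r.fst r.snd ∧ srcLevel r.src ≤ (j : ℕ) ∧ orSem F r.fst r.snd ∈ S) :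
    SweepSpec F S j k rs (innerApply F rs)
      (innerReduce j k (innerApply F rs).arcs (innerApply F rs).terms) := by
  obtain ⟨g, cr, hA⟩ := innerApply_spec hF hS (rs := rs) (by
    intro r hr
    obtain ⟨h1, h2, h3⟩ := hrs r hr
    refine ⟨h1, fun u hu => ?_, h3⟩
    have := h1.fst_has.below (fun n hn => (hlev n hn).1) u hu
    exact lt_of_le_of_lt h2 (by exact_mod_cast this))
  set A := innerApply F rs with hAdef
  have hU := hA.unreduced hlev (fun r hr => (hrs r hr).2.1)
  have hR := innerReduceSteps_inv hU k le_rfl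
  rw [Nat.sub_self, Nat.add_zero] at hR
  change ReduceInv S j k j g cr A.arcs A.terms (innerReduce j k A.arcs A.terms) at hR
  set R := innerReduce j k A.arcs A.terms with hRdef
  have hW : A.arcs.length + A.terms.length = rs.length + 2 * cr.length := by
    have := congrArg Multiset.card hA.items
    simpa [arcItems, reqItems, childItems, List.length_flatMap, mul_comm] using this
  have hback : ptrItems R.out R.back = reqItems F rs := by
    have h1 : ptrItems R.out R.back = _ := Multiset.coe_eq_coe.2 hR.back
    rw [h1]
    have h2 : A.arcs.filter (fun a => (! decide ((j : WithBot ℕ) < srcLevel a.src)) &&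
        a.tgt.under j) = A.arcs.filter (fun a => decide (¬ (j : WithBot ℕ) < srcLevel a.src)) := by
      refine List.filter_congr fun a ha => ?_
      obtain ⟨u, hu, e, _⟩ := hA.arcs_ok a ha
      have := (hU.level u hu).1
      simp only [e, Ptr.under, this, decide_true, Bool.and_true, decide_not]
    rw [h2, ← List.filter_append]
    have h3 := congrArg (Multiset.filter (fun x : Src × BoolFn => ¬ (j : WithBot ℕ) < srcLevel x.1))
      hA.items
    rw [Multiset.filter_add] at h3
    have h4 : Multiset.filter (fun x : Src × BoolFn => ¬ (j : WithBot ℕ) < srcLevel x.1)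
        (reqItems F rs) = reqItems F rs := by
      rw [Multiset.filter_eq_self]
      intro x hx
      obtain ⟨r, hr, rfl⟩ : ∃ r ∈ rs, (r.src, orSem F r.fst r.snd) = x := by
        simpa [reqItems] using hx
      exact not_lt.2 (hrs r hr).2.1
    have h5 : Multiset.filter (fun x : Src × BoolFn => ¬ (j : WithBot ℕ) < srcLevel x.1)
        (cr.flatMap (childItems g) : List _) = 0 := by
      rw [Multiset.filter_eq_nil]
      intro x hx
      rw [Multiset.mem_coe, List.mem_flatMap] at hx
      obtain ⟨u, hu, hx⟩ := hx
      have := (hU.level u hu).1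
      have h6 : (j : WithBot ℕ) < ((u.1 : ℕ) : WithBot ℕ) := by exact_mod_cast this
      simp only [childItems, List.mem_cons, List.not_mem_nil, or_false] at hx
      rcases hx with rfl | rfl <;> exact not_not.2 h6
    rw [h4, h5, add_zero] at h3
    rw [← h3, arcItems, Multiset.filter_coe, List.filter_map, Multiset.coe_eq_coe]
    exact (List.perm_append_comm.filter _).map _
  have hbl : R.back.length = rs.length := by
    have := congrArg Multiset.card hback
    simpa [ptrItems, reqItems] using this
  have f1 := List.length_filter_le (fun a : Arc => a.tgt.under j) A.arcs
  have f2 := List.length_filter_le (fun a : Arc => decide ((j : WithBot ℕ) < srcLevel a.src)) A.terms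
  have g1 := hA.cr_len
  have g2 := hA.ops₁_len
  have g3 := hA.ops₂_len
  have g4 := hR.up_len
  have g5 := hR.kids_len
  have g6 := hR.back_len
  refine ⟨hR.file, hR.red, hR.level, hR.mem, hR.back_has, hback, ?_, by omega, by omega, by omega,
    by omega, hR.uid_len, hR.out_len, by omega, hR.kids_empty, hR.peak⟩
  rw [hW]
  have : F.length * (4 * F.length + 8) = 2 * (F.length * (2 * F.length + 4)) := by ring
  omega

/-! ## The outer Reduce sweep -/

theorem Obdd.WF.fileOK {O : Obdd} (h : O.WF) : FileOK O.nodes :=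
  ⟨h.sorted, fun n hn u hu => h.ordered n hn u (Or.inl hu), fun n hn u hu => h.ordered n hn u (Or.inr hu),
    fun n hn u hu => h.closed n hn u (Or.inl hu), fun n hn u hu => h.closed n hn u (Or.inr hu)⟩

theorem mem_allArcs {O : Obdd} {a : Arc} : a ∈ O.allArcs ↔ a = ⟨none, O.root⟩ ∨
    ∃ n ∈ O.nodes, ∃ b, a = ⟨some (n.uid, b), if b then n.high else n.low⟩ := by
  unfold Obdd.allArcs
  rw [List.mem_cons, List.mem_flatMap]
  refine or_congr Iff.rfl (exists_congr fun n => and_congr Iff.rfl ?_)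
  simp

theorem mem_arcs {O : Obdd} {a : Arc} : a ∈ O.arcs ↔ a ∈ O.allArcs ∧ a.tgt.isTerm = false := by
  simp [Obdd.arcs, mem_sortBy]

theorem mem_terms {O : Obdd} {a : Arc} : a ∈ O.terms ↔ a ∈ O.allArcs ∧ a.tgt.isTerm = true := by
  simp [Obdd.terms]

/-- Does the pointer lead to a node on level `b` or below? -/
def Ptr.atLeast (b : ℕ) : Ptr → Bool
  | .node u => decide (b ≤ u.1)
  | .term _ => false

/-- The arcs that cross the border above level `b`. -/
def crossing (O : Obdd) (b : ℕ) : List Arc :=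
  O.arcs.filter (fun a => decide (srcLevel a.src < (b : ℕ)) && a.tgt.atLeast b)

/-- Starts and meanings of arcs of `O`. -/
def outerItems (O : Obdd) (X : Finset ℕ) (l : List Arc) : Multiset (Src × BoolFn) :=
  (l.map (fun a => (a.src, den X O.nodes a.tgt)) : List _)

/-- The invariant of the outer Reduce sweep when the levels from `b` on have been processed. -/
structure StateInv (O : Obdd) (X : Finset ℕ) (b : ℕ) (s : State) : Prop where
  file : FileOK s.file
  red : Reduced s.file
  level : ∀ n ∈ s.file, b ≤ n.uid.1 ∧ n.uid.1 < depth O X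
  up_has : ∀ a ∈ s.up, Has s.file a.tgt
  up_stay : ∀ a ∈ s.up, staysUp X b a.src = true
  down_ok : ∀ r ∈ s.down, ReqOK s.file r.fst r.snd
  down_stay : ∀ r ∈ s.down, staysUp X b r.src = false
  items : ptrItems s.file s.up + reqItems s.file s.down = outerItems O X (crossing O b)

theorem level_lt_depth {O : Obdd} (X : Finset ℕ) {n : Node} (hn : n ∈ O.nodes) :
    n.uid.1 < depth O X := by
  have : ∀ l : List Node, n ∈ l → n.uid.1 < (l.map (fun n => n.uid.1 + 1)).foldr max 0 := by
    intro l
    induction l with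
    | nil => intro h; cases h
    | cons m l ih =>
      intro h
      rcases List.mem_cons.1 h with rfl | h
      · simp
      · have := ih h
        simp only [List.map_cons, List.foldr_cons]
        omega
  exact (this _ hn).trans_le (le_max_left _ _)

theorem mem_lt_depth (O : Obdd) {X : Finset ℕ} {j : ℕ} (hj : j ∈ X) : j < depth O X := by
  have : j + 1 ≤ X.sup (fun x => x + 1) := Finset.le_sup (f := fun x => x + 1) hj
  exact this.trans (le_max_right _ _)

/-- After level `ℓ + 1` the next quantified level is `ℓ` or above. So arcs that start on level `ℓ`
wait in the queue of the outer sweep, and arcs that were held back as requests start strictly above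
`ℓ`. If `x_ℓ` itself is quantified, the arcs in the queue start on level `ℓ` or deeper. -/
theorem staysUp_succ_of_eq {X : Finset ℕ} {ℓ : ℕ} {s : Src} (h : srcLevel s = (ℓ : ℕ)) :
    staysUp X (ℓ + 1) s = true := by
  unfold staysUp
  rw [decide_eq_true_eq, h]
  refine Finset.max_le fun x hx => ?_
  exact WithBot.coe_le_coe.2 (Nat.lt_succ_iff.1 (Finset.mem_filter.1 hx).2)

theorem srcLevel_lt_of_not_staysUp {X : Finset ℕ} {ℓ : ℕ} {s : Src}
    (h : staysUp X (ℓ + 1) s = false) : srcLevel s < (ℓ : ℕ) := by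
  unfold staysUp at h
  rw [decide_eq_false_iff_not, not_le] at h
  refine lt_of_lt_of_le h (Finset.max_le fun x hx => ?_)
  exact WithBot.coe_le_coe.2 (Nat.lt_succ_iff.1 (Finset.mem_filter.1 hx).2)

theorem le_srcLevel_of_staysUp {X : Finset ℕ} {ℓ : ℕ} {s : Src} (hℓ : ℓ ∈ X)
    (h : staysUp X (ℓ + 1) s = true) : ((ℓ : ℕ) : WithBot ℕ) ≤ srcLevel s := by
  unfold staysUp at h
  rw [decide_eq_true_eq] at h
  exact (Finset.le_max (Finset.mem_filter.2 ⟨hℓ, Nat.lt_succ_self ℓ⟩)).trans h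

theorem staysUp_succ {X : Finset ℕ} {ℓ : ℕ} (hℓ : ℓ ∉ X) (s : Src) :
    staysUp X (ℓ + 1) s = staysUp X ℓ s := by
  unfold staysUp
  have : X.filter (fun x => x < ℓ + 1) = X.filter (fun x => x < ℓ) := by
    refine Finset.filter_congr fun x hx => ?_
    have : x ≠ ℓ := fun e => hℓ (e ▸ hx)
    omega
  rw [this]

variable {O : Obdd} {X : Finset ℕ}

/-- When the border moves up past level `ℓ`, the arcs that start on this level stop crossing it and
the arcs into this level begin to. The variable order guarantees that the latter start above `ℓ`. -/
theorem crossing_perm (hO : O.WF) (ℓ : ℕ) : (crossing O ℓ).Perm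
    ((crossing O (ℓ + 1)).filter (fun a => decide (srcLevel a.src < (ℓ : ℕ))) ++
      O.arcs.filter (fun a => a.tgt.onLevel ℓ)) := by
  unfold crossing
  rw [List.filter_filter]
  refine filter_perm_append _ _ _ _ ?_ ?_
  · intro a ha
    rcases ht : a.tgt with u | t
    swap
    · simp [Ptr.atLeast, Ptr.onLevel]
    have hs : srcLevel a.src < (u.1 : ℕ) := by
      rcases mem_allArcs.1 (mem_arcs.1 ha).1 with rfl | ⟨n, hn, b, rfl⟩
      · exact WithBot.bot_lt_coe _
      · rw [srcLevel_some]
        have : n.uid.1 < u.1 := by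
          cases b
          · exact hO.fileOK.low_below n hn u ht
          · exact hO.fileOK.high_below n hn u ht
        exact_mod_cast this
    rw [Bool.eq_iff_iff]
    simp only [Ptr.atLeast, Ptr.onLevel, Bool.and_eq_true, Bool.or_eq_true, decide_eq_true_eq,
      beq_iff_eq]
    constructor
    · rintro ⟨h1, h2⟩
      rcases Nat.lt_or_ge ℓ u.1 with h3 | h3
      · refine Or.inl ⟨h1, h1.trans ?_, h3⟩
        exact_mod_cast Nat.lt_succ_self ℓ
      · exact Or.inr (le_antisymm h3 h2)
    · rintro (⟨h1, _, h3⟩ | h1)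
      · exact ⟨h1, by omega⟩
      · rw [← h1]; exact ⟨hs, le_rfl⟩
  · intro a _
    rcases a.tgt with u | t
    · simp only [Ptr.atLeast, Ptr.onLevel, Bool.and_eq_true, decide_eq_true_eq, beq_iff_eq]
      rintro ⟨⟨_, _, h1⟩, h2⟩; omega
    · simp [Ptr.atLeast]

theorem filter_items {β : Type*} (l : List Arc) (φ : Arc → β) (q : Src → Prop)
    [DecidablePred q] : Multiset.filter (fun x : Src × β => q x.1)
      ((l.map (fun a => (a.src, φ a)) : List _) : Multiset _) =
      ((l.filter (fun a => decide (q a.src))).map (fun a => (a.src, φ a)) : List _) := by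
  rw [Multiset.filter_coe, List.filter_map]; rfl

section Level

variable {ℓ : ℕ} {s : State}

/-- The nodes on level `ℓ` with their reduced children. -/
theorem StateInv.levelNodes_ok (hO : O.WF) (h : StateInv O X (ℓ + 1) s) :
    LevelOK ℓ (levelNodes O ℓ s) s.file ∧ ∀ n₀ ∈ O.nodes, n₀.uid.1 = ℓ →
      ∃ n ∈ levelNodes O ℓ s, n.uid = n₀.uid ∧ den ∅ s.file n.low = den X O.nodes n₀.low ∧
        den ∅ s.file n.high = den X O.nodes n₀.high := by
  have hmem : ∀ x : Src × BoolFn, ((∃ a ∈ s.up, (a.src, den ∅ s.file a.tgt) = x) ∨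
      (∃ r ∈ s.down, (r.src, orSem s.file r.fst r.snd) = x)) ↔
      ∃ a ∈ crossing O (ℓ + 1), (a.src, den X O.nodes a.tgt) = x := by
    intro x
    have := congrArg (x ∈ ·) h.items
    simpa [ptrItems, reqItems, outerItems] using this
  have hhas : ∀ a ∈ s.up ++ O.terms, ∀ u b, a.src = some (u, b) → u.1 = ℓ →
      Has s.file a.tgt ∧ ∃ n ∈ O.nodes, n.uid = u ∧
        den ∅ s.file a.tgt = den X O.nodes (if b then n.high else n.low) := by
    intro a ha u b e hu
    rcases List.mem_append.1 ha with ha | ha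
    · refine ⟨h.up_has a ha, ?_⟩
      obtain ⟨a₀, ha₀, e₀⟩ := (hmem _).1 (Or.inl ⟨a, ha, rfl⟩)
      obtain ⟨e1, e2⟩ := Prod.mk.inj e₀
      rcases mem_allArcs.1 (mem_arcs.1 (List.mem_of_mem_filter ha₀)).1 with rfl | ⟨n, hn, b', rfl⟩
      · rw [e] at e1; cases e1
      · rw [e] at e1; cases e1
        exact ⟨n, hn, rfl, e2.symm⟩
    · obtain ⟨ha, ht⟩ := mem_terms.1 ha
      have ht' : ∃ t, a.tgt = .term t := by
        rcases hh : a.tgt with w | t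
        · rw [hh] at ht; cases ht
        · exact ⟨t, rfl⟩
      obtain ⟨t, et⟩ := ht'
      refine ⟨et ▸ Has.term _ _, ?_⟩
      rcases mem_allArcs.1 ha with rfl | ⟨n, hn, b', rfl⟩
      · cases e
      · cases e
        have et : (if b then n.high else n.low) = .term t := et
        refine ⟨n, hn, rfl, ?_⟩
        dsimp only
        rw [et]
        funext v; simp
  have hex : ∀ n ∈ O.nodes, n.uid.1 = ℓ → ∀ b, ∃ a ∈ s.up ++ O.terms, a.src = some (n.uid, b) := by
    intro n hn hl b
    have ha : (⟨some (n.uid, b), if b then n.high else n.low⟩ : Arc) ∈ O.allArcs :=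
      mem_allArcs.2 (Or.inr ⟨n, hn, b, rfl⟩)
    by_cases ht : (if b then n.high else n.low).isTerm = true
    · exact ⟨_, List.mem_append_right _ (mem_terms.2 ⟨ha, ht⟩), rfl⟩
    · rcases hp : (if b then n.high else n.low) with w | t
      swap
      · rw [hp] at ht; exact absurd rfl ht
      have hw : ℓ < w.1 := by
        rw [← hl]
        cases b
        · exact hO.fileOK.low_below n hn w hp
        · exact hO.fileOK.high_below n hn w hp
      have hc : (⟨some (n.uid, b), if b then n.high else n.low⟩ : Arc) ∈ crossing O (ℓ + 1) := by
        refine List.mem_filter.2 ⟨mem_arcs.2 ⟨ha, by simpa using ht⟩, ?_⟩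
        dsimp only
        rw [hp, srcLevel_some, hl]
        simp [Ptr.atLeast, -Nat.cast_add]; omega
      -- The arc crosses the border above `ℓ + 1`, so the invariant places it in the queue or among
      -- the held requests; the latter start strictly above `ℓ`, which excludes them.
      rcases (hmem _).2 ⟨_, hc, rfl⟩ with ⟨a, ha, e⟩ | ⟨r, hr, e⟩
      · exact ⟨a, List.mem_append_left _ ha, (Prod.mk.inj e).1⟩
      · have h1 := h.down_stay r hr
        rw [(Prod.mk.inj e).1, staysUp_succ_of_eq (by rw [srcLevel_some, hl])] at h1
        cases h1
  have hO' := hO.fileOK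
  have hL : ∀ n ∈ levelNodes O ℓ s, n.uid.1 = ℓ ∧ ∃ n₀ ∈ O.nodes, n₀.uid = n.uid := by
    intro n hn
    obtain ⟨h1, a, ha, b, e⟩ := mem_collect hn
    obtain ⟨_, n₀, hn₀, e₀, _⟩ := hhas a ha _ _ e h1
    exact ⟨h1, n₀, hn₀, e₀⟩
  have hchild : ∀ n ∈ levelNodes O ℓ s, ∀ n₀ ∈ O.nodes, n₀.uid = n.uid → ∀ b : Bool,
      Has s.file (if b then n.high else n.low) ∧ den ∅ s.file (if b then n.high else n.low) =
        den X O.nodes (if b then n₀.high else n₀.low) := by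
    intro n hn n₀ hn₀ e₀ b
    have hl := (hL n hn).1
    obtain ⟨a, ha, e, e'⟩ := collect_child hn b (e₀ ▸ hex n₀ hn₀ (by rw [e₀, hl]) b)
    obtain ⟨h1, m, hm, em, h2⟩ := hhas a ha _ _ e hl
    rw [hO'.eq_of_uid hm hn₀ (em.trans e₀.symm)] at h2
    rw [e']; exact ⟨h1, h2⟩
  refine ⟨⟨h.file, h.red, fun n hn => (h.level n hn).1, fun n hn => (hL n hn).1,
    fun n hn m hm e => collect_uid_inj hn hm e, fun n hn => ?_, fun n hn => ?_⟩, ?_⟩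
  · obtain ⟨_, n₀, hn₀, e₀⟩ := hL n hn
    exact (hchild n hn n₀ hn₀ e₀ false).1
  · obtain ⟨_, n₀, hn₀, e₀⟩ := hL n hn
    exact (hchild n hn n₀ hn₀ e₀ true).1
  · intro n₀ hn₀ hl
    obtain ⟨a, ha, e⟩ := hex n₀ hn₀ hl false
    obtain ⟨n, hn, en⟩ := exists_mem_collect (ℓ := ℓ) ha e hl
    exact ⟨n, hn, en, (hchild n hn n₀ hn₀ en.symm false).2, (hchild n hn n₀ hn₀ en.symm true).2⟩

theorem keepReq_ok {F : List Node} {a : Arc} (h : Has F a.tgt) :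
    ReqOK F (keepReq a).fst (keepReq a).snd := orTarget_ok h (Has.term _ _)

theorem orSem_keepReq (F : List Node) (a : Arc) :
    orSem F (keepReq a).fst (keepReq a).snd = den ∅ F a.tgt := by
  refine (orSem_orTarget F _ _).trans ?_
  funext v; simp [orSem]

theorem reqItems_keepReq (F : List Node) (l : List Arc) :
    reqItems F (l.map keepReq) = ptrItems F l := by
  unfold reqItems ptrItems
  rw [List.map_map]
  congr 1
  refine List.map_congr_left fun a _ => ?_
  simp only [Function.comp, orSem_keepReq]
  rfl

theorem target_of_mem (hO : O.WF) {a : Arc} (ha : a ∈ O.arcs) {u : Uid} (e : a.tgt = .node u) :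
    ∃ n ∈ O.nodes, n.uid = u := by
  rcases mem_allArcs.1 (mem_arcs.1 ha).1 with rfl | ⟨n, hn, b, rfl⟩
  · exact hO.root_mem u e
  · cases b
    · exact hO.fileOK.low_has n hn u e
    · exact hO.fileOK.high_has n hn u e

end Level

end NestedSweep

/-! ### One level of the outer Reduce sweep, and the resulting size bounds -/

namespace NestedSweep

open IOModel

variable {O : Obdd} {X : Finset ℕ} {ℓ : ℕ} {s : State}

/-- The requests of the inner Apply sweep. -/
structure RequestsOK (O : Obdd) (X : Finset ℕ) (ℓ : ℕ) (F : List Node) (rs : List Req) : Prop where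
  ok : ∀ r ∈ rs, ReqOK F r.fst r.snd
  items : reqItems F rs = outerItems O X (crossing O ℓ)

theorem RequestsOK.exists_arc {F : List Node} {rs : List Req} (h : RequestsOK O X ℓ F rs) {r : Req}
    (hr : r ∈ rs) : ∃ a ∈ crossing O ℓ, a.src = r.src ∧
      den X O.nodes a.tgt = orSem F r.fst r.snd := by
  have : (r.src, orSem F r.fst r.snd) ∈ reqItems F rs := by
    unfold reqItems
    rw [Multiset.mem_coe, List.mem_map]
    exact ⟨r, hr, rfl⟩
  rw [h.items, outerItems, Multiset.mem_coe, List.mem_map] at this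
  obtain ⟨a, ha, e⟩ := this
  exact ⟨a, ha, Prod.mk.inj e⟩

theorem RequestsOK.srcLevel_le {F : List Node} {rs : List Req} (h : RequestsOK O X ℓ F rs) {r : Req}
    (hr : r ∈ rs) : srcLevel r.src ≤ (ℓ : ℕ) := by
  obtain ⟨a, ha, e, _⟩ := h.exists_arc hr
  have := (List.mem_filter.1 ha).2
  rw [Bool.and_eq_true, decide_eq_true_eq, e] at this
  exact this.1.le

theorem RequestsOK.length_eq {F : List Node} {rs : List Req} (h : RequestsOK O X ℓ F rs) :
    rs.length = (crossing O ℓ).length := by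
  have := congrArg Multiset.card h.items
  simpa [reqItems, outerItems] using this

/-- The requests are those held back from below together with one for each arc into level `ℓ`; arcs
in the outer queue start on level `ℓ` or deeper and contribute nothing. An arc whose target was
redundant is kept as it is, which is right because the disjunction of two equal children is that
child. Hence there are exactly as many requests as arcs of `O` that cross level `ℓ`. -/
theorem StateInv.requests_ok (hO : O.WF) (h : StateInv O X (ℓ + 1) s) (hℓ : ℓ ∈ X) :
    RequestsOK O X ℓ s.file (requestsAt O ℓ s) := by
  obtain ⟨hlev, hnode⟩ := h.levelNodes_ok hO
  set L := levelNodes O ℓ s with hL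
  set φ : Arc → Req := fun a =>
    match (newNodes ℓ L).find? (fun n => a.tgt == .node n.uid) with
    | some n => orReq a.src n.low n.high
    | none => keepReq a with hφ
  have hrs : requestsAt O ℓ s = s.down ++ (forward O.arcs ℓ L).map φ := rfl
  have hφsrc : ∀ a, (φ a).src = a.src := by
    intro a; rw [hφ]; dsimp only; split <;> rfl
  have hφok : ∀ a ∈ O.arcs, ∀ u, a.tgt = .node u → u.1 = ℓ →
      ReqOK s.file (φ ⟨a.src, image ℓ L u⟩).fst (φ ⟨a.src, image ℓ L u⟩).snd ∧
      orSem s.file (φ ⟨a.src, image ℓ L u⟩).fst (φ ⟨a.src, image ℓ L u⟩).snd =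
        den X O.nodes a.tgt := by
    intro a ha u e hu
    obtain ⟨n₀, hn₀, rfl⟩ := target_of_mem hO ha e
    obtain ⟨n, hn, en, e0, e1⟩ := hnode n₀ hn₀ hu
    have hd : den X O.nodes a.tgt = orSem s.file n.low n.high := by
      funext v
      rw [e, hO.fileOK.den_node hn₀, hu, if_pos hℓ, ← e0, ← e1]; rfl
    rw [hd, ← en]
    rcases hlev.image_cases hn with ⟨e2, e3⟩ | ⟨m, hm, e2, e3, e4⟩
    · have hnone : (newNodes ℓ L).find? (fun m => image ℓ L n.uid == .node m.uid) = none := by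
        rw [List.find?_eq_none]
        intro m hm hc
        rw [e3] at hc
        have := (hlev.low_has n hn).below hlev.below m.uid (by simpa using hc)
        rw [(mem_newNodes.1 hm).1] at this
        exact lt_irrefl _ this
      have : φ ⟨a.src, image ℓ L n.uid⟩ = keepReq ⟨a.src, image ℓ L n.uid⟩ := by
        rw [hφ]; dsimp only; rw [hnone]
      rw [this, orSem_keepReq]
      refine ⟨keepReq_ok (by rw [e3]; exact hlev.low_has n hn), ?_⟩
      dsimp only
      rw [e3, ← e2]
      funext v; simp [orSem]
    · obtain ⟨m', hm'⟩ : ∃ m', (newNodes ℓ L).find? (fun m => image ℓ L n.uid == .node m.uid) =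
          some m' := by
        rw [← Option.isSome_iff_exists, List.find?_isSome]
        exact ⟨m, hm, by simp [e2]⟩
      have h1 := List.mem_of_find?_eq_some hm'
      have h2 : m.uid = m'.uid := by
        have := List.find?_some hm'
        rw [e2] at this
        simpa using this
      have h3 := hlev.fileOK.eq_of_uid (List.mem_append_left _ hm) (List.mem_append_left _ h1) h2
      have : φ ⟨a.src, image ℓ L n.uid⟩ = orReq a.src n.low n.high := by
        rw [hφ]; dsimp only; rw [hm', ← h3]; dsimp only; rw [e3, e4]
      rw [this]
      exact ⟨orTarget_ok (hlev.low_has n hn) (hlev.high_has n hn), orSem_orTarget _ _ _⟩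
  have hfw : reqItems s.file ((forward O.arcs ℓ L).map φ) =
      outerItems O X (O.arcs.filter (fun a => a.tgt.onLevel ℓ)) := by
    have := forward_map_perm (ℓ := ℓ) (L := L) O.arcs (fun _ => true)
      (fun a => (a.src, orSem s.file (φ a).fst (φ a).snd)) (fun a => (a.src, den X O.nodes a.tgt))
      (fun a ha u e hu => by rw [(hφok a ha u e hu).2])
    simp only [Bool.true_and, List.filter_true] at this
    unfold reqItems outerItems
    rw [← Multiset.coe_eq_coe.2 this, List.map_map]
    simp only [Function.comp_def, hφsrc]
  refine ⟨fun r hr => ?_, ?_⟩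
  · rw [hrs, List.mem_append] at hr
    rcases hr with hr | hr
    · exact h.down_ok r hr
    · obtain ⟨a, ha, rfl⟩ := List.mem_map.1 hr
      obtain ⟨a', ha', u, e, hu, rfl⟩ := mem_forward ha
      exact (hφok a' ha' u e hu).1
  · rw [hrs, reqItems_append, hfw]
    have e1 : outerItems O X (crossing O ℓ) =
        outerItems O X ((crossing O (ℓ + 1)).filter (fun a => decide (srcLevel a.src < (ℓ : ℕ)))) +
          outerItems O X (O.arcs.filter (fun a => a.tgt.onLevel ℓ)) := by
      unfold outerItems
      rw [Multiset.coe_add, ← List.map_append]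
      exact Multiset.coe_eq_coe.2 ((crossing_perm hO ℓ).map _)
    rw [e1]
    congr 1
    have e2 := congrArg (Multiset.filter (fun x : Src × BoolFn => srcLevel x.1 < (ℓ : ℕ))) h.items
    rw [Multiset.filter_add] at e2
    have e3 : Multiset.filter (fun x : Src × BoolFn => srcLevel x.1 < (ℓ : ℕ))
        (ptrItems s.file s.up) = 0 := by
      rw [Multiset.filter_eq_nil]
      intro x hx
      obtain ⟨a, ha, rfl⟩ : ∃ a ∈ s.up, (a.src, den ∅ s.file a.tgt) = x := by
        simpa [ptrItems] using hx
      exact not_lt.2 (le_srcLevel_of_staysUp hℓ (h.up_stay a ha))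
    have e4 : Multiset.filter (fun x : Src × BoolFn => srcLevel x.1 < (ℓ : ℕ))
        (reqItems s.file s.down) = reqItems s.file s.down := by
      rw [Multiset.filter_eq_self]
      intro x hx
      obtain ⟨r, hr, rfl⟩ : ∃ r ∈ s.down, (r.src, orSem s.file r.fst r.snd) = x := by
        simpa [reqItems] using hx
      exact srcLevel_lt_of_not_staysUp (h.down_stay r hr)
    rw [e3, e4, zero_add] at e2
    rw [e2, outerItems, outerItems]
    exact filter_items _ (fun a => den X O.nodes a.tgt) (fun x => srcLevel x < (ℓ : ℕ))

theorem cofClosed_univ : CofClosed Set.univ := fun _ _ _ _ _ => Set.mem_univ _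

theorem ptrItems_split (F : List Node) (l : List Arc) (q : Src → Bool) :
    ptrItems F (l.filter (fun a => q a.src)) +
      reqItems F ((l.filter (fun a => !q a.src)).map keepReq) = ptrItems F l := by
  rw [reqItems_keepReq, ← ptrItems_append]
  exact ptrItems_perm (List.perm_append_comm.trans (filter_not_perm (fun a : Arc => q a.src) l).symm)

/-- `S` is left open on purpose: the size bounds need only `Set.univ`, whereas the estimate of the
accumulated file of the ladder uses the functions that its quantified diagram can contain. -/
theorem StateInv.sweep (hO : O.WF) (h : StateInv O X (ℓ + 1) s) (hℓ : ℓ ∈ X) {S : Set BoolFn}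
    (hS : CofClosed S) (hmem : ∀ a ∈ crossing O ℓ, den X O.nodes a.tgt ∈ S) :
    SweepSpec s.file S ℓ (depth O X - 1 - ℓ) (requestsAt O ℓ s) (innerApply s.file (requestsAt O ℓ s))
      (innerReduce ℓ (depth O X - 1 - ℓ) (innerApply s.file (requestsAt O ℓ s)).arcs
        (innerApply s.file (requestsAt O ℓ s)).terms) := by
  have hr := h.requests_ok hO hℓ
  refine sweep_spec h.file hS (fun n hn => ?_) fun r hr' => ⟨hr.ok r hr', hr.srcLevel_le hr', ?_⟩
  · have := h.level n hn; omega
  · obtain ⟨a, ha, _, e⟩ := hr.exists_arc hr'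
    rw [← e]; exact hmem a ha

/-- With the inner sweeps, the arcs given back have the starts and meanings of the requests, which
are those of the crossing arcs. Without them, the image of a node means the unquantified combination
of its children, and the balance changes as in `crossing_perm`. Distributing arcs between queue and
held requests by `staysUp` does not affect the balance. -/
theorem StateInv.step (hO : O.WF) (h : StateInv O X (ℓ + 1) s) (hd : ℓ + 1 ≤ depth O X) :
    StateInv O X ℓ (outerLevel O X ℓ s) := by
  by_cases hℓ : ℓ ∈ X
  · have hR := h.sweep hO hℓ cofClosed_univ (fun _ _ => Set.mem_univ _)
    have hr := h.requests_ok hO hℓ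
    set A := innerApply s.file (requestsAt O ℓ s) with hA
    set R := innerReduce ℓ (depth O X - 1 - ℓ) A.arcs A.terms with hRdef
    have e : outerLevel O X ℓ s =
      { file := R.out
        up := R.back.filter (fun a => staysUp X ℓ a.src)
        down := (R.back.filter (fun a => !staysUp X ℓ a.src)).map keepReq } := if_pos hℓ
    rw [e]
    refine ⟨hR.file, hR.red, fun n hn => ?_, fun a ha => hR.back_has a (List.mem_of_mem_filter ha),
      fun a ha => (List.mem_filter.1 ha).2, fun r hr' => ?_, fun r hr' => ?_, ?_⟩
    · have := hR.level n hn; omega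
    · obtain ⟨a, ha, rfl⟩ := List.mem_map.1 hr'
      exact keepReq_ok (hR.back_has a (List.mem_of_mem_filter ha))
    · obtain ⟨a, ha, rfl⟩ := List.mem_map.1 hr'
      have := (List.mem_filter.1 ha).2
      simpa [keepReq, orReq] using this
    · dsimp only
      rw [ptrItems_split R.out R.back (staysUp X ℓ), hR.back, hr.items]
  · obtain ⟨hlev, hnode⟩ := h.levelNodes_ok hO
    set L := levelNodes O ℓ s with hL
    set fw := forward O.arcs ℓ L with hfw
    have e : outerLevel O X ℓ s =
      { file := newNodes ℓ L ++ s.file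
        up := s.up.filter (fun a => srcLevel a.src ≠ (ℓ : ℕ)) ++
          fw.filter (fun a => staysUp X ℓ a.src)
        down := s.down ++ (fw.filter (fun a => !staysUp X ℓ a.src)).map keepReq } := if_neg hℓ
    have hsub : s.file ⊆ newNodes ℓ L ++ s.file := List.subset_append_right _ _
    have himg : ∀ a ∈ O.arcs, ∀ u, a.tgt = .node u → u.1 = ℓ →
        Has (newNodes ℓ L ++ s.file) (image ℓ L u) ∧
        den ∅ (newNodes ℓ L ++ s.file) (image ℓ L u) = den X O.nodes a.tgt := by
      intro a ha u e hu
      obtain ⟨n₀, hn₀, rfl⟩ := target_of_mem hO ha e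
      obtain ⟨n, hn, en, e0, e1⟩ := hnode n₀ hn₀ hu
      rw [← en]
      refine ⟨hlev.image_has hn, ?_⟩
      funext v
      rw [hlev.den_image hn, e0, e1, e, hO.fileOK.den_node hn₀, hu, if_neg hℓ]
      cases v ℓ <;> rfl
    have hfwhas : ∀ a ∈ fw, Has (newNodes ℓ L ++ s.file) a.tgt := by
      intro a ha
      obtain ⟨a', ha', u, e, hu, rfl⟩ := mem_forward ha
      exact (himg a' ha' u e hu).1
    have hok : ∀ r ∈ s.down, orSem (newNodes ℓ L ++ s.file) r.fst r.snd =
        orSem s.file r.fst r.snd := by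
      intro r hr
      have := h.down_ok r hr
      unfold orSem
      rw [hlev.den_append ∅ this.fst_has, hlev.den_append ∅ this.snd_has]
    rw [e]
    refine ⟨hlev.fileOK, hlev.reduced, fun n hn => ?_, fun a ha => ?_, fun a ha => ?_,
      fun r hr => ?_, fun r hr => ?_, ?_⟩
    · rcases List.mem_append.1 hn with hn | hn
      · have := (mem_newNodes.1 hn).1; omega
      · have := h.level n hn; omega
    · rcases List.mem_append.1 ha with ha | ha
      · exact (h.up_has a (List.mem_of_mem_filter ha)).mono hsub
      · exact hfwhas a (List.mem_of_mem_filter ha)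
    · rcases List.mem_append.1 ha with ha | ha
      · rw [← staysUp_succ hℓ]; exact h.up_stay a (List.mem_of_mem_filter ha)
      · exact (List.mem_filter.1 ha).2
    · rcases List.mem_append.1 hr with hr | hr
      · obtain ⟨h1, h2, h3⟩ := h.down_ok r hr
        exact ⟨h1.mono hsub, h2.mono hsub, h3⟩
      · obtain ⟨a, ha, rfl⟩ := List.mem_map.1 hr
        exact keepReq_ok (hfwhas a (List.mem_of_mem_filter ha))
    · rcases List.mem_append.1 hr with hr | hr
      · rw [← staysUp_succ hℓ]; exact h.down_stay r hr
      · obtain ⟨a, ha, rfl⟩ := List.mem_map.1 hr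
        have := (List.mem_filter.1 ha).2
        simpa [keepReq, orReq] using this
    · dsimp only
      rw [ptrItems_append, reqItems_append]
      have e1 := ptrItems_split (newNodes ℓ L ++ s.file) fw (staysUp X ℓ)
      have e2 : ptrItems (newNodes ℓ L ++ s.file) fw =
          outerItems O X (O.arcs.filter (fun a => a.tgt.onLevel ℓ)) := by
        have := forward_map_perm (ℓ := ℓ) (L := L) O.arcs (fun _ => true)
          (fun a => (a.src, den ∅ (newNodes ℓ L ++ s.file) a.tgt))
          (fun a => (a.src, den X O.nodes a.tgt))
          (fun a ha u e hu => by dsimp only; rw [(himg a ha u e hu).2])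
        simp only [Bool.true_and, List.filter_true] at this
        exact Multiset.coe_eq_coe.2 this
      have e3 : reqItems (newNodes ℓ L ++ s.file) s.down = reqItems s.file s.down := by
        unfold reqItems
        rw [List.map_congr_left]
        intro r hr
        rw [hok r hr]
      have e4 : ptrItems (newNodes ℓ L ++ s.file)
          (s.up.filter (fun a => srcLevel a.src ≠ (ℓ : ℕ))) =
          ptrItems s.file (s.up.filter (fun a => srcLevel a.src ≠ (ℓ : ℕ))) := by
        unfold ptrItems
        rw [List.map_congr_left]
        intro a ha
        rw [hlev.den_append ∅ (h.up_has a (List.mem_of_mem_filter ha))]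
      have e5 : outerItems O X (crossing O ℓ) =
          outerItems O X ((crossing O (ℓ + 1)).filter (fun a => decide (srcLevel a.src < (ℓ : ℕ)))) +
            outerItems O X (O.arcs.filter (fun a => a.tgt.onLevel ℓ)) := by
        unfold outerItems
        rw [Multiset.coe_add, ← List.map_append]
        exact Multiset.coe_eq_coe.2 ((crossing_perm hO ℓ).map _)
      have e6 := congrArg (Multiset.filter (fun x : Src × BoolFn => srcLevel x.1 ≠ (ℓ : ℕ))) h.items
      rw [Multiset.filter_add] at e6
      have e7 : Multiset.filter (fun x : Src × BoolFn => srcLevel x.1 ≠ (ℓ : ℕ))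
          (reqItems s.file s.down) = reqItems s.file s.down := by
        rw [Multiset.filter_eq_self]
        intro x hx
        obtain ⟨r, hr, rfl⟩ : ∃ r ∈ s.down, (r.src, orSem s.file r.fst r.snd) = x := by
          simpa [reqItems] using hx
        exact (srcLevel_lt_of_not_staysUp (h.down_stay r hr)).ne
      have e8 : (crossing O (ℓ + 1)).filter (fun a => decide (srcLevel a.src ≠ (ℓ : ℕ))) =
          (crossing O (ℓ + 1)).filter (fun a => decide (srcLevel a.src < (ℓ : ℕ))) := by
        refine List.filter_congr fun a ha => ?_
        have := (List.mem_filter.1 ha).2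
        rw [Bool.and_eq_true, decide_eq_true_eq] at this
        have h1 : srcLevel a.src ≤ (ℓ : ℕ) := by
          have h2 := this.1
          rcases hs : a.src with _ | ⟨u, b⟩
          · exact bot_le
          · rw [hs, srcLevel_some] at h2
            rw [srcLevel_some]
            exact WithBot.coe_le_coe.2 (Nat.lt_succ_iff.1 (WithBot.coe_lt_coe.1 h2))
        rw [decide_eq_decide]
        exact h1.lt_iff_ne.symm
      rw [e7] at e6
      have e9 : Multiset.filter (fun x : Src × BoolFn => srcLevel x.1 ≠ (ℓ : ℕ))
          (ptrItems s.file s.up) = ptrItems s.file (s.up.filter (fun a => srcLevel a.src ≠ (ℓ : ℕ))) :=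
        filter_items _ (fun a => den ∅ s.file a.tgt) (fun x => srcLevel x ≠ (ℓ : ℕ))
      have e10 : Multiset.filter (fun x : Src × BoolFn => srcLevel x.1 ≠ (ℓ : ℕ))
          (outerItems O X (crossing O (ℓ + 1))) = outerItems O X ((crossing O (ℓ + 1)).filter
            (fun a => decide (srcLevel a.src ≠ (ℓ : ℕ)))) :=
        filter_items _ (fun a => den X O.nodes a.tgt) (fun x => srcLevel x ≠ (ℓ : ℕ))
      rw [e9, e10, e8] at e6
      rw [e3, e4, e5, ← e6, ← e2, ← e1]
      abel

theorem stateAfter_inv (hO : O.WF) (i : ℕ) (hi : i ≤ depth O X) :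
    StateInv O X (depth O X - i) (stateAfter O X i) := by
  induction i with
  | zero =>
    have : crossing O (depth O X - 0) = [] := by
      unfold crossing
      rw [List.filter_eq_nil_iff]
      intro a ha
      rcases ht : a.tgt with u | t
      · obtain ⟨n, hn, rfl⟩ := target_of_mem hO ha ht
        have := level_lt_depth X hn
        simp [Ptr.atLeast]; omega
      · simp [Ptr.atLeast]
    refine ⟨FileOK.nil, ⟨by simp [stateAfter], by simp [stateAfter]⟩, by simp [stateAfter],
      by simp [stateAfter], by simp [stateAfter], by simp [stateAfter], by simp [stateAfter], ?_⟩
    rw [this]; rfl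
  | succ i ih =>
    have e : depth O X - i = (depth O X - (i + 1)) + 1 := by omega
    have e' : depth O X - 1 - i = depth O X - (i + 1) := by omega
    have := ih (by omega)
    rw [e] at this
    change StateInv O X _ (outerLevel O X (depth O X - 1 - i) (stateAfter O X i))
    rw [e']
    exact this.step hO (by omega)

theorem stateAt_inv (hO : O.WF) {j : ℕ} (hj : j < depth O X) :
    StateInv O X (j + 1) (stateAt O X j) := by
  have := stateAfter_inv (X := X) hO (depth O X - 1 - j) (by omega)
  rwa [show depth O X - (depth O X - 1 - j) = j + 1 by omega] at this

/-- Two arcs per node and one into the root; the latter is absorbed by a third arc per node, as a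
diagram without nodes has no arc into a node. -/
theorem length_arcs_le (hO : O.WF) : O.arcs.length ≤ 3 * O.size := by
  have h1 : O.arcs.length ≤ O.allArcs.length := by
    unfold Obdd.arcs
    rw [length_sortBy]
    exact List.length_filter_le _ _
  have h2 : O.allArcs.length = 1 + 2 * O.size := by
    simp [Obdd.allArcs, Obdd.size, List.length_flatMap]; omega
  rcases Nat.eq_zero_or_pos O.size with h0 | h0
  · have : O.arcs = [] := by
      rw [List.eq_nil_iff_forall_not_mem]
      intro a ha
      rcases ht : a.tgt with u | t
      · obtain ⟨n, hn, _⟩ := target_of_mem hO ha ht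
        rw [List.length_eq_zero_iff.1 h0] at hn
        cases hn
      · have := (mem_arcs.1 ha).2
        rw [ht] at this; cases this
    simp [this]
  · omega

/-- The sizes of the queues and the files of the inner sweeps. -/
theorem traces_files_le (hO : O.WF) {j : ℕ} (hj : j ∈ X) :
    (∀ ops ∈ traces O X j, ops.length ≤ 24 * (O.size + accumulated O X j ^ 2)) ∧
    ∀ l ∈ fileSizes O X j, l ≤ 24 * (O.size + accumulated O X j ^ 2) := by
  have hI := stateAt_inv hO (mem_lt_depth O hj)
  have hR : SweepSpec _ _ _ _ _ (applyAt O X j) (reduceAt O X j) :=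
    hI.sweep hO hj cofClosed_univ (fun _ _ => Set.mem_univ _)
  have h1 := (hI.requests_ok hO hj).length_eq
  have h2 : (crossing O j).length ≤ O.arcs.length := List.length_filter_le _ _
  have h3 := length_arcs_le hO
  have hT : accumulated O X j = (stateAt O X j).file.length := rfl
  set T := accumulated O X j with hTdef
  have hA := hR.apply_len
  rw [← hT] at hA
  -- With at most 3 N' requests the unreduced output has at most 3 N' + 12 T² arcs. No trace is
  -- longer than twice that, whence the constant 24.
  have h4 : T * (4 * T + 8) ≤ 12 * T ^ 2 := by
    rcases Nat.eq_zero_or_pos T with h | h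
    · simp [h]
    · nlinarith
  have h5 : T ≤ T ^ 2 := Nat.le_self_pow (by norm_num) T
  have a1 := hR.ops₁_len
  have a2 := hR.ops₂_len
  have a3 := hR.up_len
  have a4 := hR.kids_len
  have a5 := hR.uid_len
  have a6 := hR.out_len
  have a7 := hR.back_len
  constructor
  · intro ops hops
    simp only [traces, List.mem_cons, List.not_mem_nil, or_false] at hops
    rcases hops with rfl | rfl | rfl | rfl | rfl | rfl <;> omega
  · intro l hl
    simp only [fileSizes, List.mem_cons, List.not_mem_nil, or_false] at hl
    rcases hl with rfl | rfl | rfl | rfl | rfl <;> omega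

end NestedSweep

namespace IOModel

/-! ## Estimates for `sort` -/

theorem half_le_log {x : ℝ} (hx : 2 ≤ x) : 1 / 2 ≤ Real.log x := by
  have h1 := Real.log_two_gt_d9
  have h2 := Real.log_le_log (by norm_num) hx
  linarith

/-- For arguments from 2 on, log 2 ≤ log x, so a factor 2^a adds at most a · log x. This makes sort
insensitive to constant factors. -/
theorem log_two_pow_mul_le (a : ℕ) {x : ℝ} (hx : 2 ≤ x) :
    Real.log (2 ^ a * x) ≤ (a + 1) * Real.log x := by
  rw [Real.log_mul (by positivity) (by linarith), Real.log_pow]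
  have h2 := Real.log_le_log (by norm_num) hx
  nlinarith [Nat.cast_nonneg (α := ℝ) a]

theorem sortTime_nonneg (n : ℕ) : 0 ≤ sortTime n :=
  mul_nonneg (Nat.cast_nonneg _) (Real.log_natCast_nonneg n)

theorem sortTime_mono {m n : ℕ} (h : m ≤ n) : sortTime m ≤ sortTime n := by
  unfold sortTime
  rcases Nat.eq_zero_or_pos m with rfl | hm
  · have h := sortTime_nonneg n
    unfold sortTime at h
    simpa using h
  · have h1 : (m : ℝ) ≤ n := by exact_mod_cast h
    exact mul_le_mul h1 (Real.log_le_log (by exact_mod_cast hm) h1) (Real.log_natCast_nonneg m)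
      (Nat.cast_nonneg _)

theorem sortTime_two_pow_mul_le (a : ℕ) {n : ℕ} (hn : 2 ≤ n) :
    sortTime (2 ^ a * n) ≤ 2 ^ a * (a + 1) * sortTime n := by
  unfold sortTime
  have h := log_two_pow_mul_le a (x := n) (by exact_mod_cast hn)
  push_cast
  calc (2 ^ a * (n : ℝ)) * Real.log (2 ^ a * n) ≤ (2 ^ a * n) * ((a + 1) * Real.log n) :=
        mul_le_mul_of_nonneg_left h (by positivity)
    _ = _ := by ring

theorem le_two_mul_sortTime {n : ℕ} (hn : 2 ≤ n) : (n : ℝ) ≤ 2 * sortTime n := by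
  unfold sortTime
  have := half_le_log (x := n) (by exact_mod_cast hn)
  nlinarith [Nat.cast_nonneg (α := ℝ) n]

section SortIO

variable {M B : ℕ}

theorem two_le_div (hB : 1 ≤ B) (hM : 2 * B ≤ M) : (2 : ℝ) ≤ (M : ℝ) / B := by
  rw [le_div_iff₀ (by exact_mod_cast hB)]
  exact_mod_cast hM

theorem logb_eq (x : ℝ) : Real.logb ((M : ℝ) / B) x = Real.log x / Real.log ((M : ℝ) / B) := rfl

theorem sortIO_mono (hB : 1 ≤ B) (hM : 2 * B ≤ M) {m n : ℕ} (hm : B ≤ m) (h : m ≤ n) :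
    sortIO M B m ≤ sortIO M B n := by
  have hB' : (0 : ℝ) < B := by exact_mod_cast hB
  have h2 := two_le_div hB hM
  have h1 : (m : ℝ) / B ≤ n / B := by gcongr
  have h3 : 1 ≤ (m : ℝ) / B := by rw [le_div_iff₀ hB']; simpa using (by exact_mod_cast hm : (B : ℝ) ≤ m)
  unfold sortIO
  refine mul_le_mul h1 ?_ (Real.logb_nonneg (by linarith) h3) (by positivity)
  exact Real.logb_le_logb_of_le (by linarith) (by linarith) h1

theorem sortIO_nonneg (hB : 1 ≤ B) (hM : 2 * B ≤ M) {n : ℕ} (hn : B ≤ n) : 0 ≤ sortIO M B n := by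
  have hB' : (0 : ℝ) < B := by exact_mod_cast hB
  have h2 := two_le_div hB hM
  have h3 : 1 ≤ (n : ℝ) / B := by rw [le_div_iff₀ hB']; simpa using (by exact_mod_cast hn : (B : ℝ) ≤ n)
  exact mul_nonneg (by positivity) (Real.logb_nonneg (by linarith) h3)

/-- For n ≥ M the logarithm to base M/B is at least 1. This absorbs the scans of the files. -/
theorem div_le_sortIO (hB : 1 ≤ B) (hM : 2 * B ≤ M) {n : ℕ} (hn : M ≤ n) :
    (n : ℝ) / B ≤ sortIO M B n := by
  have hB' : (0 : ℝ) < B := by exact_mod_cast hB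
  have h2 := two_le_div hB hM
  unfold sortIO
  refine le_mul_of_one_le_right (by positivity) ?_
  rw [← Real.logb_self_eq_one (b := (M : ℝ) / B) (by linarith)]
  exact Real.logb_le_logb_of_le (by linarith) (by linarith) (by gcongr)

theorem sortIO_two_pow_mul_le (hB : 1 ≤ B) (hM : 2 * B ≤ M) (a : ℕ) {n : ℕ} (hn : 2 * B ≤ n) :
    sortIO M B (2 ^ a * n) ≤ 2 ^ a * (a + 1) * sortIO M B n := by
  have hB' : (0 : ℝ) < B := by exact_mod_cast hB
  have h2 := two_le_div hB hM
  have h3 := two_le_div hB hn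
  have h4 := log_two_pow_mul_le a h3
  have h5 := half_le_log h2
  unfold sortIO
  rw [logb_eq, logb_eq]
  push_cast
  rw [mul_div_assoc]
  calc 2 ^ a * ((n : ℝ) / B) * (Real.log (2 ^ a * (n / B)) / Real.log (M / B)) ≤
        2 ^ a * ((n : ℝ) / B) * ((a + 1) * Real.log (n / B) / Real.log (M / B)) := by
        gcongr
    _ = _ := by ring

/-- Inputs that exceed the internal memory by a constant factor only. -/
theorem sortIO_le_of_lt_two_pow_mul (hB : 1 ≤ B) (hM : 2 * B ≤ M) (a : ℕ) {n : ℕ} (hBn : B ≤ n)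
    (hn : n ≤ 2 ^ a * M) : sortIO M B n ≤ (a + 1) * ((n : ℝ) / B) := by
  have hB' : (0 : ℝ) < B := by exact_mod_cast hB
  have h2 := two_le_div hB hM
  have h3 : 1 ≤ (n : ℝ) / B := by rw [le_div_iff₀ hB']; simpa using (by exact_mod_cast hBn : (B : ℝ) ≤ n)
  have h5 := half_le_log h2
  have h6 : (n : ℝ) / B ≤ 2 ^ a * (M / B) := by
    rw [← mul_div_assoc]
    have : (n : ℝ) ≤ 2 ^ a * M := by exact_mod_cast hn
    gcongr
  unfold sortIO
  rw [mul_comm]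
  refine mul_le_mul_of_nonneg_right ?_ (by positivity)
  rw [logb_eq, div_le_iff₀ (by linarith)]
  exact (Real.log_le_log (by linarith) h6).trans (log_two_pow_mul_le a h2)

end SortIO

end IOModel

namespace NestedSweep

open IOModel

/-! ## The upper bounds -/

theorem sum_map_le {β : Type*} (l : List β) (f : β → ℕ) {b : ℝ} (h : ∀ x ∈ l, (f x : ℝ) ≤ b) :
    (((l.map f).sum : ℕ) : ℝ) ≤ l.length * b := by
  induction l with
  | nil => simp
  | cons a l ih =>
    have h1 := h a List.mem_cons_self
    have h2 := ih fun x hx => h x (List.mem_cons_of_mem _ hx)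
    rw [List.map_cons, List.sum_cons, List.length_cons, Nat.cast_add, Nat.cast_succ]
    linarith

theorem ceilDiv_le (l : ℕ) {B : ℕ} (hB : 1 ≤ B) : ((l ⌈/⌉ B : ℕ) : ℝ) ≤ (l : ℝ) / B + 1 := by
  have hB' : (0 : ℝ) < B := by exact_mod_cast hB
  rw [Nat.ceilDiv_eq_add_pred_div]
  refine Nat.cast_div_le.trans ?_
  rw [div_add_one hB'.ne']
  have : l + B - 1 ≤ l + B := Nat.sub_le _ _
  have : ((l + B - 1 : ℕ) : ℝ) ≤ l + B := by exact_mod_cast this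
  gcongr

theorem le_ceilDiv (l : ℕ) {B : ℕ} (hB : 1 ≤ B) : (l : ℝ) / B ≤ ((l ⌈/⌉ B : ℕ) : ℝ) := by
  have hB' : (0 : ℝ) < B := by exact_mod_cast hB
  rw [div_le_iff₀ hB']
  have : l ≤ B • (l ⌈/⌉ B) := le_smul_ceilDiv (by omega)
  rw [smul_eq_mul, mul_comm] at this
  exact_mod_cast this

variable {M B : ℕ} {c C : ℝ} {O : Obdd} {X : Finset ℕ} {j : ℕ}

theorem sweepIOs_le (hB : 1 ≤ B) (hM : 2 * B ≤ M) {P : ExtPQ (M / 8) B} (hP : P.Efficient M c C)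
    (hO : O.WF) (hj : j ∈ X) (hn : M < O.size + accumulated O X j ^ 2) :
    (sweepIOs P O X j : ℝ) ≤
      (6 * (max C 0 * 192) + 5 * 52) * sortIO M B (O.size + accumulated O X j ^ 2) := by
  obtain ⟨h1, h2⟩ := traces_files_le hO hj
  set n := O.size + accumulated O X j ^ 2 with hndef
  have hB' : (0 : ℝ) < B := by exact_mod_cast hB
  -- The length bound 24 n is rounded up to 2^5 n, and 192 = 2^5 · (5 + 1).
  have hs : sortIO M B (2 ^ 5 * n) ≤ 192 * sortIO M B n :=
    (sortIO_two_pow_mul_le hB hM 5 (by omega)).trans (by norm_num)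
  have hs' := div_le_sortIO hB hM hn.le
  have hs1 : (1 : ℝ) ≤ (n : ℝ) / B := by
    rw [le_div_iff₀ hB', one_mul]
    exact_mod_cast (by omega : B ≤ n)
  have e1 : ∀ ops ∈ traces O X j, ((P.run ops).ios : ℝ) ≤ max C 0 * 192 * sortIO M B n := by
    intro ops hops
    refine (hP.ios_le Key ops (2 ^ 5 * n) ((h1 ops hops).trans (by omega)) (by omega)).trans ?_
    have h0 : 0 ≤ sortIO M B (2 ^ 5 * n) := sortIO_nonneg hB hM (by omega)
    -- Nothing is assumed about the sign of `C`, hence `max C 0`.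
    calc C * sortIO M B (2 ^ 5 * n) ≤ max C 0 * sortIO M B (2 ^ 5 * n) :=
          mul_le_mul_of_nonneg_right (le_max_left _ _) h0
      _ ≤ max C 0 * (192 * sortIO M B n) := mul_le_mul_of_nonneg_left hs (le_max_right _ _)
      _ = _ := by ring
  have e2 : ∀ l ∈ fileSizes O X j, ((2 * (l ⌈/⌉ B) : ℕ) : ℝ) ≤ 52 * sortIO M B n := by
    intro l hl
    have h3 := ceilDiv_le l hB
    have h4 : (l : ℝ) ≤ 24 * n := by exact_mod_cast h2 l hl
    have h5 : (l : ℝ) / B ≤ 24 * (n / B) := by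
      rw [← mul_div_assoc]; gcongr
    push_cast
    linarith
  have e3 := sum_map_le _ (fun ops => (P.run ops).ios) e1
  have e4 := sum_map_le _ (fun l => 2 * (l ⌈/⌉ B)) e2
  unfold sweepIOs
  push_cast at e3 e4 ⊢
  simp only [traces, fileSizes, List.length_cons, List.length_nil] at e3 e4 ⊢
  push_cast at e3 e4 ⊢
  linarith

theorem sweepTime_le {P : ExtPQ (M / 8) B} (hP : P.Efficient M c C)
    (hO : O.WF) (hj : j ∈ X) (hn : 2 ≤ O.size + accumulated O X j ^ 2) :
    (sweepTime P O X j : ℝ) ≤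
      (6 * (max C 0 * 192 + 48) + 5 * 96) * sortTime (O.size + accumulated O X j ^ 2) := by
  obtain ⟨h1, h2⟩ := traces_files_le hO hj
  set n := O.size + accumulated O X j ^ 2 with hndef
  have hs : sortTime (2 ^ 5 * n) ≤ 192 * sortTime n :=
    (sortTime_two_pow_mul_le 5 hn).trans (by norm_num)
  have hs' := le_two_mul_sortTime hn
  have e1 : ∀ ops ∈ traces O X j, (((P.run ops).time + ops.length : ℕ) : ℝ) ≤
      (max C 0 * 192 + 48) * sortTime n := by
    intro ops hops
    have h3 := hP.time_le Key ops (2 ^ 5 * n) ((h1 ops hops).trans (by omega)) (by omega)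
    have h4 : (ops.length : ℝ) ≤ 24 * n := by exact_mod_cast h1 ops hops
    have h5 : C * sortTime (2 ^ 5 * n) ≤ max C 0 * (192 * sortTime n) :=
      (mul_le_mul_of_nonneg_right (le_max_left C 0) (sortTime_nonneg _)).trans
        (mul_le_mul_of_nonneg_left hs (le_max_right _ _))
    have h6 := h3.trans h5
    rw [Nat.cast_add]
    linarith
  have e2 : ∀ l ∈ fileSizes O X j, ((2 * l : ℕ) : ℝ) ≤ 96 * sortTime n := by
    intro l hl
    have h4 : (l : ℝ) ≤ 24 * n := by exact_mod_cast h2 l hl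
    push_cast
    linarith
  have e3 := sum_map_le _ (fun ops => (P.run ops).time + ops.length) e1
  have e4 := sum_map_le _ (fun l => 2 * l) e2
  unfold sweepTime
  push_cast at e3 e4 ⊢
  simp only [traces, fileSizes, List.length_cons, List.length_nil] at e3 e4 ⊢
  push_cast at e3 e4 ⊢
  linarith

theorem sweepSpace_le {P : ExtPQ (M / 8) B} (hP : P.Efficient M c C) (hO : O.WF) (hj : j ∈ X) :
    (sweepSpace P O X j : ℝ) ≤
      (6 * (max C 0 * 24) + 5 * 24 + 2) * ((O.size + accumulated O X j ^ 2 : ℕ) : ℝ) := by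
  obtain ⟨h1, h2⟩ := traces_files_le hO hj
  have h0 : ((O.size : ℕ) : ℝ) ≤ ((O.size + accumulated O X j ^ 2 : ℕ) : ℝ) := by
    exact_mod_cast Nat.le_add_right _ _
  set n := O.size + accumulated O X j ^ 2 with hndef
  have e1 : ∀ ops ∈ traces O X j, (((P.run ops).blocks.card * B : ℕ) : ℝ) ≤ max C 0 * 24 * n := by
    intro ops hops
    have h3 := hP.space_le Key ops
    have h4 : (ops.length : ℝ) ≤ 24 * n := by exact_mod_cast h1 ops hops
    have h5 : C * ops.length ≤ max C 0 * (24 * n) :=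
      (mul_le_mul_of_nonneg_right (le_max_left C 0) (Nat.cast_nonneg _)).trans
        (mul_le_mul_of_nonneg_left h4 (le_max_right _ _))
    linarith
  have e2 : ∀ l ∈ fileSizes O X j, ((id l : ℕ) : ℝ) ≤ 24 * n := by
    intro l hl
    exact_mod_cast h2 l hl
  have e3 := sum_map_le _ (fun ops => (P.run ops).blocks.card * B) e1
  have e4 := sum_map_le _ id e2
  rw [List.map_id] at e4
  unfold sweepSpace
  push_cast at e3 e4 ⊢
  simp only [traces, fileSizes, List.length_cons, List.length_nil] at e3 e4 ⊢
  push_cast at e3 e4 h0 ⊢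
  linarith

theorem upper_bounds (c C : ℝ) : ∃ C' : ℝ, ∀ M B : ℕ, 1 ≤ B → 2 * B ≤ M →
    ∀ P : ExtPQ (M / 8) B, P.Efficient M c C →
    ∀ (O : Obdd) (X : Finset ℕ) (j : ℕ), O.WF → j ∈ X →
      (M < O.size + accumulated O X j ^ 2 →
        (sweepIOs P O X j : ℝ) ≤ C' * sortIO M B (O.size + accumulated O X j ^ 2)) ∧
      (2 ≤ O.size + accumulated O X j ^ 2 →
        (sweepTime P O X j : ℝ) ≤ C' * sortTime (O.size + accumulated O X j ^ 2)) ∧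
      (sweepSpace P O X j : ℝ) ≤ C' * ((O.size + accumulated O X j ^ 2 : ℕ) : ℝ) := by
  refine ⟨6 * (max C 0 * 192 + 48) + 5 * 96, fun M B hB hM P hP O X j hO hj => ⟨fun h => ?_,
    fun h => sweepTime_le hP hO hj h, ?_⟩⟩
  · refine (sweepIOs_le hB hM hP hO hj h).trans (mul_le_mul_of_nonneg_right (by linarith) ?_)
    exact sortIO_nonneg hB hM (by omega)
  · refine (sweepSpace_le hP hO hj).trans (mul_le_mul_of_nonneg_right ?_ (Nat.cast_nonneg _))
    have := le_max_right C 0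
    linarith

/-! ## Lower bounds from a large trace -/

theorem single_le_sum_map {β : Type*} {l : List β} (f : β → ℕ) {x : β} (h : x ∈ l) :
    f x ≤ (l.map f).sum :=
  List.single_le_sum (by simp) _ (List.mem_map_of_mem h)

/-- A trace that stores `k` records at some moment and finally deletes all of them, and a file with `k`
records. -/
structure Large (O : Obdd) (X : Finset ℕ) (j k : ℕ) : Prop where
  trace : ∃ ops ∈ traces O X j, contents ops = 0 ∧ ∃ pre, pre <+: ops ∧ k ≤ (contents pre).card
  file : ∃ l ∈ fileSizes O X j, k ≤ l

theorem Large.le_sweepTime {P : ExtPQ (M / 8) B} (hP : P.Efficient M c C) (hc : 0 < c) {k : ℕ}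
    (h : Large O X j k) (hk : 2 ≤ k) (a : ℕ) {n : ℕ} (hn : n ≤ 2 ^ a * k) :
    c / (2 ^ a * (a + 2)) * sortTime n ≤ (sweepTime P O X j : ℝ) := by
  obtain ⟨ops, hops, h0, pre, hpre, hk'⟩ := h.trace
  have h1 := hP.le_time Key pre ops k hpre hk' h0
  have h2 : (P.run ops).time + ops.length ≤ sweepTime P O X j :=
    (single_le_sum_map (fun ops => (P.run ops).time + ops.length) hops).trans (Nat.le_add_right _ _)
  have h3 : ((P.run ops).time : ℝ) ≤ sweepTime P O X j := by
    exact_mod_cast (Nat.le_add_right _ _).trans h2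
  have h4 := (sortTime_mono hn).trans (sortTime_two_pow_mul_le a hk)
  refine le_trans ?_ (h1.trans h3)
  rw [div_mul_eq_mul_div, div_le_iff₀ (by positivity)]
  have h5 : sortTime n ≤ 2 ^ a * (a + 2) * sortTime k := by
    refine h4.trans (mul_le_mul_of_nonneg_right ?_ (sortTime_nonneg _))
    gcongr; norm_num
  nlinarith

/-- From `k = 2 M` on, the lower bound of the queue applies. Below that, n exceeds M by at most a
constant factor, so sort(n) is of order n/B, and scanning the file with `k` records already costs
that much. -/
theorem Large.le_sweepIOs (hB : 1 ≤ B) (hM : 2 * B ≤ M) {P : ExtPQ (M / 8) B}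
    (hP : P.Efficient M c C) (hc : 0 < c) {k : ℕ}
    (h : Large O X j k) (a : ℕ) {n : ℕ} (hMn : M < n) (hn : n ≤ 2 ^ a * k) :
    min c 1 / (2 ^ a * (a + 2)) * sortIO M B n ≤ (sweepIOs P O X j : ℝ) := by
  have hB' : (0 : ℝ) < B := by exact_mod_cast hB
  have hm : 0 < min c 1 := lt_min hc one_pos
  rw [div_mul_eq_mul_div, div_le_iff₀ (by positivity)]
  by_cases hk : 2 * M ≤ k
  · obtain ⟨ops, hops, h0, pre, hpre, hk'⟩ := h.trace
    have h1 := hP.le_ios Key pre ops k hpre hk' h0 hk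
    have h2 : (P.run ops).ios ≤ sweepIOs P O X j :=
      (single_le_sum_map (fun ops => (P.run ops).ios) hops).trans (Nat.le_add_right _ _)
    have h3 : ((P.run ops).ios : ℝ) ≤ sweepIOs P O X j := by exact_mod_cast h2
    have h4 := (sortIO_mono hB hM (by omega) hn).trans
      (sortIO_two_pow_mul_le hB hM a (n := k) (by omega))
    have h6 : 0 ≤ sortIO M B k := sortIO_nonneg hB hM (by omega)
    have h5 : sortIO M B n ≤ 2 ^ a * (a + 2) * sortIO M B k := by
      refine h4.trans (mul_le_mul_of_nonneg_right ?_ h6)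
      gcongr; norm_num
    calc min c 1 * sortIO M B n ≤ min c 1 * (2 ^ a * (a + 2) * sortIO M B k) := by gcongr
      _ ≤ c * (2 ^ a * (a + 2) * sortIO M B k) := by gcongr; exact min_le_left _ _
      _ = (c * sortIO M B k) * (2 ^ a * (a + 2)) := by ring
      _ ≤ _ := by gcongr; exact h1.trans h3
  · obtain ⟨l, hl, hkl⟩ := h.file
    have h2 : 2 * (l ⌈/⌉ B) ≤ sweepIOs P O X j :=
      (single_le_sum_map (fun l => 2 * (l ⌈/⌉ B)) hl).trans (Nat.le_add_left _ _)
    have h3 : 2 * ((l ⌈/⌉ B : ℕ) : ℝ) ≤ sweepIOs P O X j := by exact_mod_cast h2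
    have h4 := le_ceilDiv l hB
    have h5 : (k : ℝ) / B ≤ l / B := by
      have : (k : ℝ) ≤ l := by exact_mod_cast hkl
      gcongr
    have h6 : (0 : ℝ) ≤ k / B := by positivity
    have h7 := sortIO_le_of_lt_two_pow_mul hB hM (a + 1) (n := n) (by omega) (by
      refine hn.trans ?_
      rw [pow_succ, mul_assoc]
      exact Nat.mul_le_mul_left _ (by omega))
    have h8 : (n : ℝ) / B ≤ 2 ^ a * (k / B) := by
      rw [← mul_div_assoc]
      have : (n : ℝ) ≤ 2 ^ a * k := by exact_mod_cast hn
      gcongr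
    push_cast at h7
    have h9 : 0 ≤ sortIO M B n := sortIO_nonneg hB hM (by omega)
    calc min c 1 * sortIO M B n ≤ 1 * sortIO M B n := by gcongr; exact min_le_right _ _
      _ ≤ (a + 1 + 1) * (2 ^ a * (k / B)) := by rw [one_mul]; exact h7.trans (by gcongr)
      _ = (k / B) * (2 ^ a * (a + 2)) := by ring
      _ ≤ _ := by gcongr; linarith

end NestedSweep

namespace NestedSweep

open IOModel

/-! ## A diagram with many arcs into the last level -/

/-- A chain of nodes on the levels `0, …, N`; all high arcs lead to the last one. -/
def chain (N : ℕ) : Obdd where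
  nodes := (List.range (N + 1)).map fun i =>
    ⟨(i, 0), if i < N then .node (i + 1, 0) else .term false,
      if i < N then .node (N, 0) else .term true⟩
  root := .node (0, 0)

theorem chain_size (N : ℕ) : (chain N).size = N + 1 := by
  simp [chain, Obdd.size]

theorem mem_chain {N : ℕ} {n : Node} : n ∈ (chain N).nodes ↔ ∃ i ≤ N,
    n = ⟨(i, 0), if i < N then .node (i + 1, 0) else .term false,
      if i < N then .node (N, 0) else .term true⟩ := by
  simp [chain, eq_comm]

theorem exists_mem_chain {N i : ℕ} (h : i ≤ N) : ∃ n ∈ (chain N).nodes, n.uid = (i, 0) :=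
  ⟨_, mem_chain.2 ⟨i, h, rfl⟩, rfl⟩

theorem chain_wf (N : ℕ) : (chain N).WF where
  sorted := by
    rw [chain, List.pairwise_map]
    exact List.pairwise_lt_range.imp fun h => uidKey_lt.2 (Or.inl h)
  ordered := by
    intro n hn u hu
    obtain ⟨i, hi, rfl⟩ := mem_chain.1 hn
    by_cases h : i < N
    · simp only [h, if_true, Ptr.node.injEq] at hu
      rcases hu with rfl | rfl
      · simp
      · simpa using h
    · simp [h] at hu
  closed := by
    intro n hn u hu
    obtain ⟨i, hi, rfl⟩ := mem_chain.1 hn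
    by_cases h : i < N
    · simp only [h, if_true, Ptr.node.injEq] at hu
      rcases hu with rfl | rfl
      · exact exists_mem_chain h
      · exact exists_mem_chain le_rfl
    · simp [h] at hu
  root_mem := by
    rintro u ⟨⟩
    exact exists_mem_chain (Nat.zero_le N)
  rooted := by
    intro n hn
    obtain ⟨i, hi, rfl⟩ := mem_chain.1 hn
    rcases i with _ | i
    · exact Or.inl rfl
    · refine Or.inr ⟨_, mem_chain.2 ⟨i, by omega, rfl⟩, Or.inl ?_⟩
      simp [show i < N by omega]

theorem depth_chain (N : ℕ) : depth (chain N) {N} = N + 1 := by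
  have h : ∀ l : List Node, (∀ n ∈ l, n.uid.1 ≤ N) →
      (l.map (fun n => n.uid.1 + 1)).foldr max 0 ≤ N + 1 := by
    intro l hl
    induction l with
    | nil => simp
    | cons n l ih =>
      have := hl n List.mem_cons_self
      have := ih fun m hm => hl m (List.mem_cons_of_mem _ hm)
      simp only [List.map_cons, List.foldr_cons]
      omega
  have h1 := h (chain N).nodes (by
    intro n hn
    obtain ⟨i, hi, rfl⟩ := mem_chain.1 hn
    exact hi)
  unfold depth
  rw [Finset.sup_singleton]
  omega

theorem stateAt_chain (N : ℕ) : stateAt (chain N) {N} N = ⟨[], [], []⟩ := by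
  unfold stateAt
  rw [depth_chain, show N + 1 - 1 - N = 0 by omega]
  rfl

theorem accumulated_chain (N : ℕ) : accumulated (chain N) {N} N = 0 := by
  rw [accumulated, stateAt_chain]; rfl

/-- Into the last node lead the N high arcs of the other nodes and one more arc: the low arc of the
node just above it or, for N = 0, the arc into the root. -/
theorem le_length_crossing_chain (N : ℕ) : N + 1 ≤ (crossing (chain N) N).length := by
  let s : Src := if N = 0 then none else some ((N - 1, 0), false)
  let l : List Src := s :: (List.range N).map (fun i => some ((i, 0), true))
  have hl : l.Nodup := by
    refine List.nodup_cons.2 ⟨?_, List.nodup_range.map fun a b h => by simpa using h⟩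
    simp only [s, List.mem_map, not_exists, not_and]
    intro x _
    split_ifs <;> simp
  have hsub : l.map (fun s => (⟨s, .node (N, 0)⟩ : Arc)) ⊆ crossing (chain N) N := by
    intro a ha
    obtain ⟨t, ht, rfl⟩ := List.mem_map.1 ha
    refine List.mem_filter.2 ⟨mem_arcs.2 ⟨mem_allArcs.2 ?_, rfl⟩, ?_⟩
    · rcases List.mem_cons.1 ht with rfl | ht
      · rcases Nat.eq_zero_or_pos N with rfl | h0
        · exact Or.inl rfl
        · refine Or.inr ⟨_, mem_chain.2 ⟨N - 1, by omega, rfl⟩, false, ?_⟩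
          simp only [s, if_neg h0.ne', show N - 1 < N by omega, if_true]
          simp [Nat.sub_add_cancel h0]
      · obtain ⟨i, hi, rfl⟩ := List.mem_map.1 ht
        rw [List.mem_range] at hi
        refine Or.inr ⟨_, mem_chain.2 ⟨i, hi.le, rfl⟩, true, ?_⟩
        simp [hi]
    · have : srcLevel t < ((N : ℕ) : WithBot ℕ) := by
        rcases List.mem_cons.1 ht with rfl | ht
        · simp only [s]
          split_ifs with h0
          · exact WithBot.bot_lt_coe _
          · exact WithBot.coe_lt_coe.2 (by simp; omega)
        · obtain ⟨i, hi, rfl⟩ := List.mem_map.1 ht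
          exact WithBot.coe_lt_coe.2 (List.mem_range.1 hi)
      simp [this, Ptr.atLeast]
  have h2 := (List.Nodup.map (fun a b h => by simpa using h) hl :
    (l.map (fun s => (⟨s, .node (N, 0)⟩ : Arc))).Nodup).subperm hsub
  simpa [l] using h2.length_le

/-- The quantified level is the deepest one, so the accumulated file is empty. The inner Apply sweep
then merely inserts all requests, deletes all of them at the end and outputs each as an arc to a
terminal. -/
theorem large_chain (N : ℕ) : Large (chain N) {N} N (N + 1) := by
  have hj : N ∈ ({N} : Finset ℕ) := Finset.mem_singleton_self N
  have hI := stateAt_inv (chain_wf N) (mem_lt_depth (chain N) hj)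
  have hlen := (hI.requests_ok (chain_wf N) hj).length_eq
  have hk := le_length_crossing_chain N
  rw [← hlen] at hk
  have hA : applyAt (chain N) {N} N =
      innerApply [] (requestsAt (chain N) N (stateAt (chain N) {N} N)) := by
    unfold applyAt; rw [stateAt_chain]
  set rs := requestsAt (chain N) N (stateAt (chain N) {N} N)
  have h1 := contents_insert_deleteMin (α := Key) (l := []) rfl Req.key rs (sortBy Req.key rs)
    (length_sortBy _ _).ge
  refine ⟨⟨(applyAt (chain N) {N} N).ops₁, by simp [traces], ?_⟩,
    (applyAt (chain N) {N} N).terms.length, by simp [fileSizes], ?_⟩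
  · rw [hA]
    exact ⟨h1.1, _, List.prefix_append _ _, hk.trans h1.2⟩
  · rw [hA]
    simpa [innerApply, ApplyState.finish, length_sortBy] using hk

theorem Large.two_le_sweepTime {m B : ℕ} {P : ExtPQ m B} {O : Obdd} {X : Finset ℕ} {j k : ℕ}
    (h : Large O X j k) (hk : 1 ≤ k) : 2 ≤ sweepTime P O X j := by
  obtain ⟨l, hl, hkl⟩ := h.file
  have : 2 * l ≤ sweepTime P O X j :=
    (single_le_sum_map (fun l => 2 * l) hl).trans (Nat.le_add_left _ _)
  omega

theorem Large.two_le_sweepIOs {m B : ℕ} (hB : 1 ≤ B) {P : ExtPQ m B} {O : Obdd} {X : Finset ℕ}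
    {j k : ℕ} (h : Large O X j k) (hk : 1 ≤ k) : 2 ≤ sweepIOs P O X j := by
  obtain ⟨l, hl, hkl⟩ := h.file
  have h1 : 2 * (l ⌈/⌉ B) ≤ sweepIOs P O X j :=
    (single_le_sum_map (fun l => 2 * (l ⌈/⌉ B)) hl).trans (Nat.le_add_left _ _)
  have h2 : l ≤ B • (l ⌈/⌉ B) := le_smul_ceilDiv (by omega)
  have h3 : l ⌈/⌉ B ≠ 0 := by
    intro h0; rw [h0] at h2; simp at h2; omega
  omega

end NestedSweep

namespace NestedSweep

open IOModel

/-! ## A diagram whose quantified diagrams are large -/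

/-- The function `⋁_{k ∈ S} c_{l+k} ∨ ⋁_{i ≤ k < w} a_{l+k} c_{l+k}` of the variables
`a_k = x_{1+2p+k}` and `c_k = x_{1+4p+k}`. -/
def orAnd (p l w : ℕ) (S : Finset ℕ) (i : ℕ) : BoolFn := fun v =>
  decide ((∃ k ∈ S, v (1 + 4 * p + (l + k)) = true) ∨
    ∃ k < w, i ≤ k ∧ v (1 + 2 * p + (l + k)) = true ∧ v (1 + 4 * p + (l + k)) = true)

section OrAnd

variable {p l w : ℕ} {S : Finset ℕ} {i : ℕ}

theorem orAnd_iff {v : ℕ → Bool} : orAnd p l w S i v = true ↔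
    (∃ k ∈ S, v (1 + 4 * p + (l + k)) = true) ∨
    ∃ k < w, i ≤ k ∧ v (1 + 2 * p + (l + k)) = true ∧ v (1 + 4 * p + (l + k)) = true := by
  simp [orAnd]

/-- An input on which the value depends on the variable `a_{l+i}`. -/
def witness (p l i : ℕ) : ℕ → Bool := fun x => decide (x = 1 + 4 * p + (l + i))

/-- Only c_{l+i} is true. Since `i` does not belong to `S`, the value is decided by a_{l+i} alone.
-/
theorem orAnd_witness (hl : l + w ≤ 2 * p) (hS : ∀ k ∈ S, k < i) (hi : i < w) :
    orAnd p l w S i (witness p l i) = false ∧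
      orAnd p l w S i (Function.update (witness p l i) (1 + 2 * p + (l + i)) true) = true := by
  constructor
  · rw [← Bool.not_eq_true, orAnd_iff]
    rintro (⟨k, hk, h⟩ | ⟨k, hk, hik, h, h'⟩)
    · have := hS k hk
      simp [witness] at h; omega
    · simp [witness] at h h'; omega
  · rw [orAnd_iff]
    refine Or.inr ⟨i, hi, le_rfl, by simp, ?_⟩
    rw [Function.update_of_ne (by omega)]
    simp [witness]

/-- Making a_{l+i} true releases the disjunct c_{l+i}, and making it false removes that disjunct.
The set `S` thus records which of the variables a were chosen true. -/
theorem cof_orAnd (hl : l + w ≤ 2 * p) (hS : ∀ k ∈ S, k < i) (hi : i < w) (b : Bool) :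
    cof (orAnd p l w S i) (1 + 2 * p + (l + i)) b =
      orAnd p l w (if b then insert i S else S) (i + 1) := by
  funext v
  rw [cof, Bool.eq_iff_iff, orAnd_iff, orAnd_iff]
  have e1 : ∀ k, k < w → Function.update v (1 + 2 * p + (l + i)) b (1 + 4 * p + (l + k)) =
      v (1 + 4 * p + (l + k)) := fun k hk => Function.update_of_ne (by omega) _ _
  have e2 : ∀ k, k ≠ i → Function.update v (1 + 2 * p + (l + i)) b (1 + 2 * p + (l + k)) =
      v (1 + 2 * p + (l + k)) := fun k hk => Function.update_of_ne (by omega) _ _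
  constructor
  · rintro (⟨k, hk, h⟩ | ⟨k, hk, hik, h, h'⟩)
    · rw [e1 k ((hS k hk).trans hi)] at h
      refine Or.inl ⟨k, ?_, h⟩
      split_ifs
      · exact Finset.mem_insert_of_mem hk
      · exact hk
    · rw [e1 k hk] at h'
      rcases hik.eq_or_lt with rfl | hlt
      · rw [Function.update_self] at h
        subst h
        exact Or.inl ⟨i, Finset.mem_insert_self _ _, h'⟩
      · rw [e2 k hlt.ne'] at h
        exact Or.inr ⟨k, hk, hlt, h, h'⟩
  · rintro (⟨k, hk, h⟩ | ⟨k, hk, hik, h, h'⟩)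
    · have hk' : k ∈ S ∨ k = i ∧ b = true := by
        cases b
        · exact Or.inl hk
        · rcases Finset.mem_insert.1 hk with rfl | hk
          · exact Or.inr ⟨rfl, rfl⟩
          · exact Or.inl hk
      rcases hk' with hk' | ⟨rfl, rfl⟩
      · exact Or.inl ⟨k, hk', by rw [e1 k ((hS k hk').trans hi)]; exact h⟩
      · exact Or.inr ⟨k, hi, le_rfl, by simp, by rw [e1 k hi]; exact h⟩
    · exact Or.inr ⟨k, hk, by omega, by rw [e2 k (by omega)]; exact h, by rw [e1 k hk]; exact h'⟩

theorem orAnd_indep (hl : l + w ≤ 2 * p) (v v' : ℕ → Bool)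
    (h : ∀ x, 1 + 2 * p + (l + i) ≤ x → v x = v' x) (hi : i ≤ 2 * p - l) :
    orAnd p l w S i v = orAnd p l w S i v' := by
  have e : ∀ k, v (1 + 4 * p + (l + k)) = v' (1 + 4 * p + (l + k)) := fun k => h _ (by omega)
  have e' : ∀ k, i ≤ k → v (1 + 2 * p + (l + k)) = v' (1 + 2 * p + (l + k)) :=
    fun k hk => h _ (by omega)
  rw [Bool.eq_iff_iff, orAnd_iff, orAnd_iff]
  refine or_congr (by simp only [e]) (exists_congr fun k => and_congr_right fun _ =>
    and_congr_right fun hk => ?_)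
  rw [e, e' k hk]

/-- The functions that occur in the diagram of `⋁_{k < w} a_{l+k} c_{l+k}`. -/
def orAndFamily (p l w : ℕ) : Set BoolFn :=
  {f | (∃ i ≤ w, ∃ S ⊆ Finset.range i, f = orAnd p l w S i) ∨ f = fun _ => true}

/-- Only cofactors in the variable order are required. For `i < w` the function depends on a_{l+i},
so `ℓ` is at most the level of that variable: below it the cofactor changes nothing, and at it `i`
advances. For `i = w` a disjunction of variables c remains, from which a cofactor removes one
variable or makes everything true. -/
theorem cofClosed_orAndFamily (hl : l + w ≤ 2 * p) : CofClosed (orAndFamily p l w) := by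
  rintro f hf ℓ b hind
  rcases hf with ⟨i, hi, S, hS, rfl⟩ | rfl
  swap
  · exact Or.inr rfl
  have hS' : ∀ k ∈ S, k < i := fun k hk => Finset.mem_range.1 (hS hk)
  rcases hi.lt_or_eq with hi' | rfl
  · -- the function depends on `a_{l+i}`
    have hle : ℓ ≤ 1 + 2 * p + (l + i) := by
      by_contra hlt
      have h := orAnd_witness hl hS' hi'
      rw [hind (Function.update (witness p l i) (1 + 2 * p + (l + i)) true) (witness p l i)
        (fun x hx => Function.update_of_ne (by omega) _ _), h.1] at h
      exact absurd h.2 (by simp)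
    rcases hle.lt_or_eq with hlt | rfl
    · refine Or.inl ⟨i, hi, S, hS, ?_⟩
      funext v
      exact orAnd_indep hl _ _ (fun x hx => Function.update_of_ne (by omega) _ _) (by omega)
    · refine Or.inl ⟨i + 1, hi', if b then insert i S else S, ?_, cof_orAnd hl hS' hi' b⟩
      intro k hk
      have : k ∈ insert i S := by
        split_ifs at hk
        · exact hk
        · exact Finset.mem_insert_of_mem hk
      rcases Finset.mem_insert.1 this with rfl | h
      · simp
      · have := hS' k h
        simp; omega
  · -- only the variables `c_{l+k}` are left
    by_cases hk : ∃ k ∈ S, ℓ = 1 + 4 * p + (l + k)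
    · obtain ⟨k, hk, rfl⟩ := hk
      cases b
      · refine Or.inl ⟨i, le_rfl, S.erase k, (Finset.erase_subset _ _).trans hS, ?_⟩
        funext v
        rw [cof, Bool.eq_iff_iff, orAnd_iff, orAnd_iff]
        refine or_congr ⟨?_, ?_⟩ ⟨?_, ?_⟩
        · rintro ⟨m, hm, h⟩
          have hmk : m ≠ k := by rintro rfl; simp at h
          rw [Function.update_of_ne (by omega)] at h
          exact ⟨m, Finset.mem_erase.2 ⟨hmk, hm⟩, h⟩
        · rintro ⟨m, hm, h⟩
          obtain ⟨hmk, hm⟩ := Finset.mem_erase.1 hm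
          exact ⟨m, hm, by rw [Function.update_of_ne (by omega)]; exact h⟩
        · rintro ⟨m, hm, hm', _⟩; omega
        · rintro ⟨m, hm, hm', _⟩; omega
      · refine Or.inr ?_
        funext v
        rw [cof, orAnd_iff]
        exact Or.inl ⟨k, hk, by simp⟩
    · refine Or.inl ⟨i, le_rfl, S, hS, ?_⟩
      funext v
      rw [cof, Bool.eq_iff_iff, orAnd_iff, orAnd_iff]
      refine or_congr (exists_congr fun m => and_congr_right fun hm => ?_) ⟨?_, ?_⟩
      · rw [Function.update_of_ne (fun e => hk ⟨m, hm, e.symm⟩)]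
      · rintro ⟨m, hm, hm', _⟩; omega
      · rintro ⟨m, hm, hm', _⟩; omega

open Classical in
-- The subsets of the initial segments number 1 + 2 + … + 2^w = 2^(w+1) - 1, and the constant
-- function is one more.
theorem exists_finset_orAndFamily (p l w : ℕ) : ∃ s : Finset BoolFn,
    (∀ f ∈ orAndFamily p l w, f ∈ s) ∧ s.card ≤ 2 ^ (w + 1) := by
  let I : Finset (Σ _ : ℕ, Finset ℕ) := (Finset.range (w + 1)).sigma fun i => (Finset.range i).powerset
  have hI : I.card = 2 ^ (w + 1) - 1 := by
    rw [Finset.card_sigma]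
    simp only [Finset.card_powerset, Finset.card_range]
    exact (Nat.geomSum_eq le_rfl _).trans (by simp)
  refine ⟨insert (fun _ => true) (I.image fun x => orAnd p l w x.2 x.1), ?_, ?_⟩
  · rintro f (⟨i, hi, S, hS, rfl⟩ | rfl)
    · refine Finset.mem_insert_of_mem (Finset.mem_image.2 ⟨⟨i, S⟩, ?_, rfl⟩)
      exact Finset.mem_sigma.2 ⟨Finset.mem_range.2 (Nat.lt_succ_of_le hi), Finset.mem_powerset.2 hS⟩
    · exact Finset.mem_insert_self _ _
  · have h1 := Finset.card_insert_le (fun _ => true : BoolFn) (I.image fun x => orAnd p l w x.2 x.1)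
    have h2 : (I.image fun x => orAnd p l w x.2 x.1).card ≤ I.card := Finset.card_image_le
    have h3 : 0 < 2 ^ (w + 1) := by positivity
    omega

end OrAnd

theorem CofClosed.union {S T : Set BoolFn} (hS : CofClosed S) (hT : CofClosed T) :
    CofClosed (S ∪ T) := fun f hf ℓ b h =>
  hf.elim (fun hf => Or.inl (hS f hf ℓ b h)) fun hf => Or.inr (hT f hf ℓ b h)

/-- In a reduced diagram the level of a node is the first variable on which its function depends. -/
theorem exists_node_of_depends {F : List Node} (hF : FileOK F) (hr : Reduced F) {t : Ptr}
    (ht : Has F t) {ℓ : ℕ}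
    (hind : ∀ v w : ℕ → Bool, (∀ i, ℓ ≤ i → v i = w i) → den ∅ F t v = den ∅ F t w)
    {v : ℕ → Bool} {b : Bool} (hdep : den ∅ F t v ≠ den ∅ F t (Function.update v ℓ b)) :
    ∃ n ∈ F, t = .node n.uid ∧ n.uid.1 = ℓ := by
  rcases t with u | b'
  swap
  · simp at hdep
  obtain ⟨n, hn, rfl⟩ := ht u rfl
  refine ⟨n, hn, rfl, ?_⟩
  rcases lt_trichotomy n.uid.1 ℓ with h | h | h
  -- A node above `ℓ` would not depend on its own variable; its children would have the same meaning
  -- and coincide by canonicity, so the node would be redundant.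
  · refine absurd (den_injective hF hr (hF.low_has n hn) (hF.high_has n hn) ?_) (hr.ne n hn)
    have h0 := hF.cof_node hn false
    have h1 := hF.cof_node hn true
    simp only [Bool.false_eq_true, if_false, if_true] at h0 h1
    rw [← h0, ← h1]
    funext v
    exact hind _ _ fun i hi => by rw [Function.update_of_ne (by omega), Function.update_of_ne (by omega)]
  · exact h
  · refine absurd ?_ hdep
    refine (hF.den_congr (ℓ := ℓ + 1) ?_ fun i hi => ?_).symm
    · rintro u ⟨⟩; exact h
    · rw [Function.update_of_ne (by omega)]

/-- A file of reduced nodes has no more nodes than there are functions. -/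
theorem length_le_card {F : List Node} (hF : FileOK F) (hr : Reduced F) (s : Finset BoolFn)
    (h : ∀ n ∈ F, den ∅ F (.node n.uid) ∈ s) : F.length ≤ s.card := by
  classical
  have hnd : F.Nodup := hF.sorted.imp fun h e => absurd (e ▸ h) (lt_irrefl _)
  rw [← List.toFinset_card_of_nodup hnd]
  refine Finset.card_le_card_of_injOn (fun n => den ∅ F (.node n.uid))
    (fun n hn => h n (by simpa using hn)) ?_
  intro a ha b hb e
  have ha' : a ∈ F := by simpa using ha
  have hb' : b ∈ F := by simpa using hb
  have := den_injective hF hr (has_node ha') (has_node hb') e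
  exact hF.eq_of_uid ha' hb' (by simpa using this)

theorem stateAt_eq {O : Obdd} {X : Finset ℕ} {j : ℕ} (h : j + 1 < depth O X) :
    stateAt O X j = outerLevel O X (j + 1) (stateAt O X (j + 1)) := by
  unfold stateAt
  rw [show depth O X - 1 - j = (depth O X - 1 - (j + 1)) + 1 by omega, stateAfter,
    show depth O X - 1 - (depth O X - 1 - (j + 1)) = j + 1 by omega]

end NestedSweep

/-! ### The ladder: two quantified halves of size O(2^p) whose disjunction needs 2^(2p-1) nodes on
one level -/

namespace NestedSweep

open IOModel

/-- A root, below it two chains on the levels `1, …, p` and `p + 1, …, 2 p` that branch to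
conjunctions of two variables each. -/
def ladder (p : ℕ) : Obdd where
  nodes := (List.range (6 * p + 1)).map fun ℓ =>
    if ℓ = 0 then ⟨(0, 0), .node (1, 0), .node (p + 1, 0)⟩
    else if ℓ ≤ 2 * p then
      ⟨(ℓ, 0), .node (ℓ + 2 * p, 0), if ℓ = p ∨ ℓ = 2 * p then .term false else .node (ℓ + 1, 0)⟩
    else if ℓ ≤ 4 * p then ⟨(ℓ, 0), .term false, .node (ℓ + 2 * p, 0)⟩
    else ⟨(ℓ, 0), .term false, .term true⟩
  root := .node (0, 0)

section Ladder

variable {p : ℕ}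

theorem ladder_size : (ladder p).size = 6 * p + 1 := by
  simp [ladder, Obdd.size]

theorem mem_ladder_zero : ⟨(0, 0), .node (1, 0), .node (p + 1, 0)⟩ ∈ (ladder p).nodes :=
  List.mem_map.2 ⟨0, by simp, by simp⟩

theorem mem_ladder_chain {ℓ : ℕ} (h0 : 1 ≤ ℓ) (h1 : ℓ ≤ 2 * p) :
    ⟨(ℓ, 0), .node (ℓ + 2 * p, 0), if ℓ = p ∨ ℓ = 2 * p then .term false else .node (ℓ + 1, 0)⟩ ∈
      (ladder p).nodes :=
  List.mem_map.2 ⟨ℓ, by simp; omega, by rw [if_neg (by omega), if_pos h1]⟩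

theorem mem_ladder_and {ℓ : ℕ} (h0 : 2 * p < ℓ) (h1 : ℓ ≤ 4 * p) :
    ⟨(ℓ, 0), .term false, .node (ℓ + 2 * p, 0)⟩ ∈ (ladder p).nodes :=
  List.mem_map.2 ⟨ℓ, by simp; omega, by rw [if_neg (by omega), if_neg (by omega), if_pos h1]⟩

theorem mem_ladder_var {ℓ : ℕ} (h0 : 4 * p < ℓ) (h1 : ℓ ≤ 6 * p) :
    ⟨(ℓ, 0), .term false, .term true⟩ ∈ (ladder p).nodes :=
  List.mem_map.2 ⟨ℓ, by simp; omega,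
    by rw [if_neg (by omega), if_neg (by omega), if_neg (by omega)]⟩

theorem ladder_cases {n : Node} (hn : n ∈ (ladder p).nodes) :
    n = ⟨(0, 0), .node (1, 0), .node (p + 1, 0)⟩ ∨
    (∃ ℓ, 1 ≤ ℓ ∧ ℓ ≤ 2 * p ∧ n = ⟨(ℓ, 0), .node (ℓ + 2 * p, 0),
      if ℓ = p ∨ ℓ = 2 * p then .term false else .node (ℓ + 1, 0)⟩) ∨
    (∃ ℓ, 2 * p < ℓ ∧ ℓ ≤ 4 * p ∧ n = ⟨(ℓ, 0), .term false, .node (ℓ + 2 * p, 0)⟩) ∨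
    ∃ ℓ, 4 * p < ℓ ∧ ℓ ≤ 6 * p ∧ n = ⟨(ℓ, 0), .term false, .term true⟩ := by
  obtain ⟨ℓ, hℓ, rfl⟩ := List.mem_map.1 hn
  rw [List.mem_range] at hℓ
  by_cases h0 : ℓ = 0
  · exact Or.inl (if_pos h0)
  rw [if_neg h0]
  by_cases h1 : ℓ ≤ 2 * p
  · exact Or.inr (Or.inl ⟨ℓ, by omega, h1, if_pos h1⟩)
  rw [if_neg h1]
  by_cases h2 : ℓ ≤ 4 * p
  · exact Or.inr (Or.inr (Or.inl ⟨ℓ, by omega, h2, if_pos h2⟩))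
  · exact Or.inr (Or.inr (Or.inr ⟨ℓ, by omega, by omega, if_neg h2⟩))

theorem exists_mem_ladder {ℓ : ℕ} (h : ℓ ≤ 6 * p) : ∃ n ∈ (ladder p).nodes, n.uid = (ℓ, 0) := by
  rcases Nat.eq_zero_or_pos ℓ with rfl | h0
  · exact ⟨_, mem_ladder_zero, rfl⟩
  rcases le_or_gt ℓ (2 * p) with h1 | h1
  · exact ⟨_, mem_ladder_chain h0 h1, rfl⟩
  rcases le_or_gt ℓ (4 * p) with h2 | h2
  · exact ⟨_, mem_ladder_and h1 h2, rfl⟩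
  · exact ⟨_, mem_ladder_var h2 h, rfl⟩

theorem ladder_wf (hp : 1 ≤ p) : (ladder p).WF := by
  have hchild : ∀ n ∈ (ladder p).nodes, ∀ u : Uid, (n.low = .node u ∨ n.high = .node u) →
      ∃ ℓ, u = (ℓ, 0) ∧ n.uid.1 < ℓ ∧ ℓ ≤ 6 * p := by
    intro n hn u hu
    rcases ladder_cases hn with rfl | ⟨ℓ, h1, h2, rfl⟩ | ⟨ℓ, h1, h2, rfl⟩ | ⟨ℓ, h1, h2, rfl⟩
    · simp only [Ptr.node.injEq] at hu
      rcases hu with rfl | rfl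
      · exact ⟨1, rfl, by simp, by omega⟩
      · exact ⟨p + 1, rfl, by simp, by omega⟩
    · rcases hu with hu | hu
      · simp only [Ptr.node.injEq] at hu
        exact ⟨ℓ + 2 * p, hu.symm, by simp; omega, by omega⟩
      · split_ifs at hu
        simp only [Ptr.node.injEq] at hu
        exact ⟨ℓ + 1, hu.symm, by simp, by omega⟩
    · simp only [Ptr.node.injEq, reduceCtorEq, false_or] at hu
      exact ⟨ℓ + 2 * p, hu.symm, by simp; omega, by omega⟩
    · simp at hu
  constructor
  · rw [ladder, List.pairwise_map]
    refine List.pairwise_lt_range.imp fun {a b} h => uidKey_lt.2 (Or.inl ?_)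
    have : ∀ ℓ, (if ℓ = 0 then (⟨(0, 0), .node (1, 0), .node (p + 1, 0)⟩ : Node)
      else if ℓ ≤ 2 * p then
        ⟨(ℓ, 0), .node (ℓ + 2 * p, 0), if ℓ = p ∨ ℓ = 2 * p then .term false else .node (ℓ + 1, 0)⟩
      else if ℓ ≤ 4 * p then ⟨(ℓ, 0), .term false, .node (ℓ + 2 * p, 0)⟩
      else ⟨(ℓ, 0), .term false, .term true⟩).uid.1 = ℓ := by
      intro ℓ
      split_ifs with h0 <;> simp [h0]
    rw [this, this]
    exact h
  · intro n hn u hu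
    obtain ⟨ℓ, rfl, h, _⟩ := hchild n hn u hu
    exact h
  · intro n hn u hu
    obtain ⟨ℓ, rfl, _, h⟩ := hchild n hn u hu
    exact exists_mem_ladder h
  · rintro u ⟨⟩
    exact exists_mem_ladder (Nat.zero_le _)
  · intro n hn
    rcases ladder_cases hn with rfl | ⟨ℓ, h1, h2, rfl⟩ | ⟨ℓ, h1, h2, rfl⟩ | ⟨ℓ, h1, h2, rfl⟩
    · exact Or.inl rfl
    · refine Or.inr ?_
      by_cases e1 : ℓ = 1
      · subst e1; exact ⟨_, mem_ladder_zero, Or.inl rfl⟩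
      by_cases e2 : ℓ = p + 1
      · subst e2; exact ⟨_, mem_ladder_zero, Or.inr rfl⟩
      refine ⟨_, mem_ladder_chain (ℓ := ℓ - 1) (by omega) (by omega), Or.inr ?_⟩
      dsimp only
      rw [if_neg (by omega), Nat.sub_add_cancel h1]
    · refine Or.inr ⟨_, mem_ladder_chain (ℓ := ℓ - 2 * p) (by omega) (by omega), Or.inl ?_⟩
      dsimp only
      rw [Nat.sub_add_cancel h1.le]
    · refine Or.inr ⟨_, mem_ladder_and (ℓ := ℓ - 2 * p) (by omega) (by omega), Or.inr ?_⟩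
      dsimp only
      rw [Nat.sub_add_cancel (by omega)]

theorem den_ladder_and (hp : 1 ≤ p) {ℓ : ℕ} (h1 : 2 * p < ℓ) (h2 : ℓ ≤ 4 * p) (v : ℕ → Bool) :
    den (Finset.range (2 * p + 1)) (ladder p).nodes (.node (ℓ, 0)) v = (v ℓ && v (ℓ + 2 * p)) := by
  have hF := (ladder_wf hp).fileOK
  have e1 := hF.den_node (X := Finset.range (2 * p + 1)) (mem_ladder_and h1 h2) v
  have e2 := hF.den_node (X := Finset.range (2 * p + 1))
    (mem_ladder_var (ℓ := ℓ + 2 * p) (by omega) (by omega)) v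
  rw [if_neg (by simp; omega)] at e1 e2
  dsimp only at e1 e2
  rw [e1]
  cases h : v ℓ
  · simp
  · simp only [if_true, Bool.true_and]
    rw [e2]
    cases v (ℓ + 2 * p) <;> simp

/-- The meaning of the nodes on the two chains. -/
theorem den_ladder_chain (hp : 1 ≤ p) {l : ℕ} (hl : l = 0 ∨ l = p) {i : ℕ} (hi : i < p) :
    den (Finset.range (2 * p + 1)) (ladder p).nodes (.node (1 + l + i, 0)) = orAnd p l p ∅ i := by
  have hF := (ladder_wf hp).fileOK
  obtain ⟨s, hs⟩ : ∃ s, i + s + 1 = p := ⟨p - 1 - i, by omega⟩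
  induction s generalizing i with
  | zero =>
    funext v
    have e := hF.den_node (X := Finset.range (2 * p + 1))
      (mem_ladder_chain (ℓ := 1 + l + i) (by omega) (by omega)) v
    dsimp only at e
    rw [if_pos (show 1 + l + i ∈ Finset.range (2 * p + 1) by simp; omega),
      if_pos (show 1 + l + i = p ∨ 1 + l + i = 2 * p by omega), den_term,
      den_ladder_and hp (ℓ := 1 + l + i + 2 * p) (by omega) (by omega)] at e
    rw [e, Bool.eq_iff_iff, orAnd_iff]
    simp only [Bool.or_false, Bool.and_eq_true, Finset.notMem_empty, false_and, exists_false, false_or]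
    constructor
    · rintro ⟨h, h'⟩
      exact ⟨i, hi, le_rfl, by convert h using 2; omega, by convert h' using 2; omega⟩
    · rintro ⟨k, hk, hk', h, h'⟩
      obtain rfl : k = i := by omega
      exact ⟨by convert h using 2; omega, by convert h' using 2; omega⟩
  | succ s ih =>
    funext v
    have ih := ih (i := i + 1) (by omega) (by omega)
    have e := hF.den_node (X := Finset.range (2 * p + 1))
      (mem_ladder_chain (ℓ := 1 + l + i) (by omega) (by omega)) v
    dsimp only at e
    rw [if_pos (show 1 + l + i ∈ Finset.range (2 * p + 1) by simp; omega),
      if_neg (show ¬ (1 + l + i = p ∨ 1 + l + i = 2 * p) by omega),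
      den_ladder_and hp (ℓ := 1 + l + i + 2 * p) (by omega) (by omega),
      show 1 + l + i + 1 = 1 + l + (i + 1) by omega, ih] at e
    rw [e, Bool.eq_iff_iff, Bool.or_eq_true, orAnd_iff, orAnd_iff]
    simp only [Bool.and_eq_true, Finset.notMem_empty, false_and, exists_false, false_or]
    constructor
    · rintro (⟨h, h'⟩ | ⟨k, hk, hk', h⟩)
      · exact ⟨i, hi, le_rfl, by convert h using 2; omega, by convert h' using 2; omega⟩
      · exact ⟨k, hk, by omega, h⟩
    · rintro ⟨k, hk, hk', h, h'⟩
      rcases hk'.eq_or_lt with rfl | hlt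
      · exact Or.inl ⟨by convert h using 2; omega, by convert h' using 2; omega⟩
      · exact Or.inr ⟨k, hk, hlt, h, h'⟩

theorem den_ladder_root (hp : 1 ≤ p) :
    den (Finset.range (2 * p + 1)) (ladder p).nodes (ladder p).root = orAnd p 0 (2 * p) ∅ 0 := by
  have hF := (ladder_wf hp).fileOK
  funext v
  have e := hF.den_node (X := Finset.range (2 * p + 1)) mem_ladder_zero v
  have e1 := den_ladder_chain hp (l := 0) (Or.inl rfl) (i := 0) hp
  have e2 := den_ladder_chain hp (l := p) (Or.inr rfl) (i := 0) hp
  rw [if_pos (by simp)] at e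
  dsimp only at e
  rw [show p + 1 = 1 + p + 0 by omega, e2, show (1, 0) = (1 + 0 + 0, 0) by rfl, e1] at e
  refine e.trans ?_
  rw [Bool.eq_iff_iff, Bool.or_eq_true, orAnd_iff, orAnd_iff, orAnd_iff]
  simp only [Finset.notMem_empty, false_and, exists_false, false_or, Nat.zero_le, true_and, Nat.zero_add]
  constructor
  · rintro (⟨k, hk, h⟩ | ⟨k, hk, h⟩)
    · exact ⟨k, by omega, h⟩
    · exact ⟨p + k, by omega, h⟩
  · rintro ⟨k, hk, h⟩
    rcases lt_or_ge k p with h' | h'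
    · exact Or.inl ⟨k, h', h⟩
    · exact Or.inr ⟨k - p, by omega, by rwa [Nat.add_sub_cancel' h']⟩

/-- The file at x_0 is the output of the sweeps at x_1. Only the two arcs that leave the root node
cross the border above level 1, and they mean the two halves. All reduced nodes therefore mean
functions of the two associated families, which have at most 2^(p+1) members each, and distinct
nodes mean distinct functions. -/
theorem accumulated_ladder_le (hp : 1 ≤ p) :
    accumulated (ladder p) (Finset.range (2 * p + 1)) 0 ≤ 4 * 2 ^ p := by
  have hO := ladder_wf hp
  have h1 : 1 ∈ Finset.range (2 * p + 1) := by simp; omega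
  have hd := mem_lt_depth (ladder p) h1
  have hI := stateAt_inv hO hd
  have hsw := hI.sweep hO h1
    ((cofClosed_orAndFamily (p := p) (l := 0) (w := p) (by omega)).union
      (cofClosed_orAndFamily (p := p) (l := p) (w := p) (by omega))) (by
    intro a ha
    obtain ⟨ha, hc⟩ := List.mem_filter.1 ha
    rw [Bool.and_eq_true, decide_eq_true_eq] at hc
    rcases mem_allArcs.1 (mem_arcs.1 ha).1 with rfl | ⟨n, hn, b, rfl⟩
    · simp [ladder, Ptr.atLeast] at hc
    · have h0 : n.uid.1 < 1 := WithBot.coe_lt_coe.1 hc.1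
      rcases ladder_cases hn with rfl | ⟨ℓ, h1, h2, rfl⟩ | ⟨ℓ, h1, h2, rfl⟩ | ⟨ℓ, h1, h2, rfl⟩
      · cases b
        · exact Or.inl (Or.inl ⟨0, by omega, ∅, by simp, den_ladder_chain hp (Or.inl rfl) hp⟩)
        · refine Or.inr (Or.inl ⟨0, by omega, ∅, by simp, ?_⟩)
          simp only [if_true]
          rw [add_comm p 1]
          exact den_ladder_chain hp (Or.inr rfl) hp
      · simp at h0; omega
      · simp at h0; omega
      · simp at h0; omega)
  rw [accumulated, stateAt_eq hd, outerLevel, if_pos h1]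
  classical
  obtain ⟨s, hs, hs'⟩ := exists_finset_orAndFamily p 0 p
  obtain ⟨s', hs1, hs1'⟩ := exists_finset_orAndFamily p p p
  refine (length_le_card hsw.file hsw.red (s ∪ s') fun n hn => ?_).trans ?_
  · rcases hsw.mem n hn with h | h
    · exact Finset.mem_union_left _ (hs _ h)
    · exact Finset.mem_union_right _ (hs1 _ h)
  · have := Finset.card_union_le s s'
    rw [pow_succ] at hs' hs1'
    omega

/-- The arc into the root is given back with the meaning of the full disjunction over k < 2 p.
Descending through the variables a, one meets a node on the level of a_i for every subset of the
indices before i, because the function attached to the subset depends on a_i. For i = 2 p - 1 this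
gives 2^(2p-1) nodes on one level, distinct because their functions are. -/
theorem large_ladder (hp : 1 ≤ p) :
    Large (ladder p) (Finset.range (2 * p + 1)) 0 (2 ^ (2 * p - 1)) := by
  have hO := ladder_wf hp
  have h0 : 0 ∈ Finset.range (2 * p + 1) := by simp
  have hI := stateAt_inv hO (mem_lt_depth (ladder p) h0)
  have hsw : SweepSpec _ _ _ _ _ (applyAt (ladder p) (Finset.range (2 * p + 1)) 0)
      (reduceAt (ladder p) (Finset.range (2 * p + 1)) 0) :=
    hI.sweep hO h0 cofClosed_univ (fun _ _ => Set.mem_univ _)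
  have hitems := (hI.requests_ok hO h0).items
  set R := reduceAt (ladder p) (Finset.range (2 * p + 1)) 0 with hR
  have hroot : ∃ t, Has R.out t ∧ den ∅ R.out t = orAnd p 0 (2 * p) ∅ 0 := by
    have : ((none, orAnd p 0 (2 * p) ∅ 0) : Src × BoolFn) ∈ ptrItems R.out R.back := by
      rw [hsw.back, hitems, outerItems, Multiset.mem_coe, List.mem_map]
      refine ⟨⟨none, (ladder p).root⟩, List.mem_filter.2 ⟨mem_arcs.2 ⟨mem_allArcs.2 (Or.inl rfl), rfl⟩, ?_⟩,
        by rw [den_ladder_root hp]⟩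
      simp [srcLevel, ladder, Ptr.atLeast]
    rw [ptrItems, Multiset.mem_coe, List.mem_map] at this
    obtain ⟨a, ha, e⟩ := this
    exact ⟨a.tgt, hsw.back_has a ha, (Prod.mk.inj e).2⟩
  have hnode : ∀ t, Has R.out t → ∀ i < 2 * p, ∀ S ⊆ Finset.range i,
      den ∅ R.out t = orAnd p 0 (2 * p) S i →
      ∃ n ∈ R.out, t = .node n.uid ∧ n.uid.1 = 1 + 2 * p + (0 + i) := by
    intro t ht i hi S hS e
    have hw := orAnd_witness (p := p) (l := 0) (w := 2 * p) (by omega)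
      (fun k hk => Finset.mem_range.1 (hS hk)) hi
    refine exists_node_of_depends hsw.file hsw.red ht (v := witness p 0 i) (b := true) ?_ ?_
    · intro v w h
      rw [e]
      exact orAnd_indep (by omega) v w h (by omega)
    · rw [e, hw.1, hw.2]; simp
  have hall : ∀ i < 2 * p, ∀ S ⊆ Finset.range i,
      ∃ t, Has R.out t ∧ den ∅ R.out t = orAnd p 0 (2 * p) S i := by
    intro i
    induction i with
    | zero =>
      intro _ S hS
      obtain rfl : S = ∅ := by simpa using hS
      exact hroot
    | succ i ih =>
      intro hi S hS
      have hS' : S.erase i ⊆ Finset.range i := by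
        intro k hk
        obtain ⟨h1, h2⟩ := Finset.mem_erase.1 hk
        have := Finset.mem_range.1 (hS h2)
        exact Finset.mem_range.2 (by omega)
      -- The subset `S` is reached from `S.erase i`: take the child of that node selected by whether
      -- `i` belongs to `S`.
      obtain ⟨t, ht, e⟩ := ih (by omega) _ hS'
      obtain ⟨n, hn, rfl, hl⟩ := hnode t ht i (by omega) _ hS' e
      have hc := hsw.file.cof_node hn (decide (i ∈ S))
      rw [e, hl, cof_orAnd (by omega) (fun k hk => Finset.mem_range.1 (hS' hk)) (by omega)] at hc
      refine ⟨_, ?_, hc.symm.trans ?_⟩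
      · split_ifs
        · exact hsw.file.high_has n hn
        · exact hsw.file.low_has n hn
      · by_cases h : i ∈ S
        · simp [h, Finset.insert_erase]
        · simp [h]
  have hcard : 2 ^ (2 * p - 1) ≤
      (R.out.filter (fun n => n.uid.1 == 1 + 2 * p + (0 + (2 * p - 1)))).length := by
    classical
    have hex : ∀ S : Finset ℕ, ∃ n : Node, S ⊆ Finset.range (2 * p - 1) →
        n ∈ R.out.filter (fun n => n.uid.1 == 1 + 2 * p + (0 + (2 * p - 1))) ∧
        den ∅ R.out (.node n.uid) = orAnd p 0 (2 * p) S (2 * p - 1) := by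
      intro S
      by_cases hS : S ⊆ Finset.range (2 * p - 1)
      · obtain ⟨t, ht, e⟩ := hall (2 * p - 1) (by omega) S hS
        obtain ⟨n, hn, rfl, hl⟩ := hnode t ht _ (by omega) S hS e
        exact ⟨n, fun _ => ⟨List.mem_filter.2 ⟨hn, by simp [hl]⟩, e⟩⟩
      · exact ⟨⟨(0, 0), .term true, .term true⟩, fun h => absurd h hS⟩
    choose f hf using hex
    rw [← Finset.card_range (2 * p - 1), ← Finset.card_powerset]
    refine le_trans ?_ (List.toFinset_card_le _)
    refine Finset.card_le_card_of_injOn f (fun S hS => ?_) fun S hS T hT e => ?_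
    · simpa using (hf S (Finset.mem_powerset.1 hS)).1
    · have h1 := (hf S (Finset.mem_powerset.1 hS)).2
      have h2 := (hf T (Finset.mem_powerset.1 hT)).2
      rw [← e, h1] at h2
      ext k
      -- The input in which only c_k is true tests whether `k` belongs to the set.
      have h3 := congrFun h2 (fun x => decide (x = 1 + 4 * p + (0 + k)))
      rw [Bool.eq_iff_iff, orAnd_iff, orAnd_iff] at h3
      have h4 : ∀ U : Finset ℕ, ((∃ m ∈ U, decide (1 + 4 * p + (0 + m) = 1 + 4 * p + (0 + k)) = true) ∨
          ∃ m < 2 * p, 2 * p - 1 ≤ m ∧ decide (1 + 2 * p + (0 + m) = 1 + 4 * p + (0 + k)) = true ∧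
            decide (1 + 4 * p + (0 + m) = 1 + 4 * p + (0 + k)) = true) ↔ k ∈ U := by
        intro U
        constructor
        · rintro (⟨m, hm, h⟩ | ⟨m, hm, _, h, h'⟩)
          · simp at h; exact h ▸ hm
          · simp at h h'; omega
        · intro hk; exact Or.inl ⟨k, hk, by simp⟩
      rwa [h4, h4] at h3
  obtain ⟨pre, hpre, hk⟩ := hsw.peak (1 + 2 * p + (0 + (2 * p - 1)))
  exact ⟨⟨R.opsKids, by simp [traces, hR], hsw.kids_empty, pre, hpre, hcard.trans hk⟩,
    R.out.length, by simp [fileSizes, hR], hcard.trans (List.length_filter_le _ _)⟩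

end Ladder

end NestedSweep

namespace NestedSweep

open IOModel

/-! ## The lower bounds -/

/-- If the ladder had more than n nodes, then n ≤ 6 p and 2^p ≤ (6 p)^d, which fails for large p.
This is what the hypothesis that t is polynomial in n is for; `n₀` is chosen so large that a failure
forces p past the threshold. -/
theorem exists_forall_two_pow_le (d : ℕ) :
    ∃ n₀ : ℕ, 2 ≤ n₀ ∧ ∀ n p : ℕ, n₀ ≤ n → 2 ^ p ≤ n ^ d → 6 * p + 1 ≤ n := by
  have h := tendsto_pow_const_mul_const_pow_of_abs_lt_one d (r := (1 / 2 : ℝ))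
    (by rw [abs_of_pos] <;> norm_num)
  obtain ⟨p₀, hp₀⟩ := Filter.eventually_atTop.1
    (h.eventually (gt_mem_nhds (show (0 : ℝ) < 1 / 6 ^ d by positivity)))
  refine ⟨6 * p₀ + 2, by omega, fun n p hn hp => ?_⟩
  by_contra hlt
  have h1 := hp₀ p (by omega)
  rw [one_div, inv_pow, ← div_eq_mul_inv, div_lt_div_iff₀ (by positivity) (by positivity)] at h1
  have h2 : (2 ^ p : ℝ) ≤ (6 * p) ^ d := by
    have : n ^ d ≤ (6 * p) ^ d := Nat.pow_le_pow_left (by omega) d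
    exact_mod_cast hp.trans this
  rw [mul_pow] at h2
  linarith

theorem sortTime_le_sq (n : ℕ) : sortTime n ≤ (n : ℝ) ^ 2 := by
  unfold sortTime
  have := Real.log_le_self (Nat.cast_nonneg (α := ℝ) n)
  nlinarith [Nat.cast_nonneg (α := ℝ) n]

theorem sortIO_le_sq {M B n : ℕ} (hB : 1 ≤ B) (hM : 2 * B ≤ M) : sortIO M B n ≤ 2 * (n : ℝ) ^ 2 := by
  have hB' : (1 : ℝ) ≤ B := by exact_mod_cast hB
  have hx : (n : ℝ) / B ≤ n := div_le_self (Nat.cast_nonneg _) hB'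
  have hx0 : 0 ≤ (n : ℝ) / B := by positivity
  have hl : Real.log ((n : ℝ) / B) ≤ n := (Real.log_le_self hx0).trans hx
  have hd := half_le_log (two_le_div hB hM)
  unfold sortIO
  rw [logb_eq]
  have h1 : Real.log ((n : ℝ) / B) / Real.log ((M : ℝ) / B) ≤ 2 * n := by
    rw [div_le_iff₀ (by linarith)]
    nlinarith [Nat.cast_nonneg (α := ℝ) n]
  calc (n : ℝ) / B * (Real.log ((n : ℝ) / B) / Real.log ((M : ℝ) / B)) ≤ n / B * (2 * n) :=
        mul_le_mul_of_nonneg_left h1 hx0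
    _ ≤ n * (2 * n) := mul_le_mul_of_nonneg_right hx (by positivity)
    _ = _ := by ring

/-- A bounded number of nodes suffices to sweep at a cost that is a constant fraction of
`sort(n + t²)`. -/
theorem exists_large (d : ℕ) : ∃ n₀ : ℕ, ∀ n t : ℕ, t ≤ n ^ d → 2 ≤ n + t ^ 2 →
    ∃ (O : Obdd) (X : Finset ℕ) (j k : ℕ), O.WF ∧ j ∈ X ∧ O.size ≤ n ∧ accumulated O X j ≤ t ∧
      Large O X j k ∧ 1 ≤ k ∧ (n < n₀ ∨ 2 ≤ k ∧ n + t ^ 2 ≤ 2 ^ 8 * k) := by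
  obtain ⟨n₀, hn₀, h⟩ := exists_forall_two_pow_le d
  refine ⟨n₀, fun n t ht hnt => ?_⟩
  have hn : 1 ≤ n := by
    by_contra hn
    obtain rfl : n = 0 := by omega
    rcases Nat.eq_zero_or_pos d with rfl | hd
    · rw [pow_zero] at ht
      interval_cases t <;> omega
    · rw [zero_pow hd.ne'] at ht
      interval_cases t; omega
  -- The chain serves when n is bounded or dominates. Otherwise 2^(p+2) ≤ t < 2^(p+3) fixes p: the
  -- file of size at most 4 · 2^p respects the bound t, and n + t² ≤ 2 t² < 2^(2p+7) = 2^8 ·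
  -- 2^(2p-1).
  by_cases hcase : n < n₀ ∨ t ^ 2 ≤ 64 * n
  · refine ⟨chain (n - 1), {n - 1}, n - 1, n, chain_wf _, Finset.mem_singleton_self _, ?_, ?_, ?_, hn,
      or_iff_not_imp_left.2 fun hlt => ?_⟩
    · rw [chain_size]; omega
    · rw [accumulated_chain]; exact Nat.zero_le _
    · have := large_chain (n - 1)
      rwa [Nat.sub_add_cancel hn] at this
    · have := hcase.resolve_left hlt
      omega
  · push Not at hcase
    have ht8 : 8 < t := by nlinarith
    have hlog : 3 ≤ Nat.log 2 t := Nat.le_log_of_pow_le (by norm_num) (by omega)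
    obtain ⟨p, hp⟩ : ∃ p, Nat.log 2 t = p + 2 := ⟨Nat.log 2 t - 2, by omega⟩
    have h1 : 2 ^ (p + 2) ≤ t := hp ▸ Nat.pow_log_le_self 2 (by omega)
    have h2 : t < 2 ^ (p + 3) := by
      have := Nat.lt_pow_succ_log_self (b := 2) (by norm_num) t
      rwa [hp] at this
    have hp1 : 1 ≤ p := by omega
    have hsize := h n p hcase.1 ((Nat.pow_le_pow_right (by norm_num) (by omega)).trans (h1.trans ht))
    refine ⟨ladder p, Finset.range (2 * p + 1), 0, 2 ^ (2 * p - 1), ladder_wf hp1, by simp, ?_, ?_,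
      large_ladder hp1, Nat.one_le_two_pow, Or.inr ⟨?_, ?_⟩⟩
    · rw [ladder_size]; exact hsize
    · refine (accumulated_ladder_le hp1).trans (le_trans (le_of_eq ?_) h1)
      rw [pow_add]; ring
    · exact (pow_one 2).symm.le.trans (Nat.pow_le_pow_right (by norm_num) (by omega))
    · have h3 : t ^ 2 < (2 ^ (p + 3)) ^ 2 := Nat.pow_lt_pow_left h2 (by norm_num)
      have h4 : 2 * (2 ^ (p + 3)) ^ 2 = 2 ^ 8 * 2 ^ (2 * p - 1) := by
        rw [← pow_mul, ← pow_add, mul_comm, ← pow_succ]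
        congr 1; omega
      omega

/-- The constant is the smaller of two: one for inputs with a trace of size proportional to n + t²,
and one for n < n₀. In the latter case n + t² ≤ `N`, sort is at most 2 `N`², and the guaranteed cost
of 2 suffices. -/
theorem lower_bounds (c C : ℝ) (hc : 0 < c) (d : ℕ) : ∃ c' : ℝ, 0 < c' ∧ ∀ M B : ℕ, 1 ≤ B →
    2 * B ≤ M → ∀ P : ExtPQ (M / 8) B, P.Efficient M c C →
    ∀ n t : ℕ, t ≤ n ^ d → 2 ≤ n + t ^ 2 →
      ∃ (O : Obdd) (X : Finset ℕ) (j : ℕ), O.WF ∧ j ∈ X ∧ O.size ≤ n ∧ accumulated O X j ≤ t ∧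
        (M < n + t ^ 2 → c' * sortIO M B (n + t ^ 2) ≤ (sweepIOs P O X j : ℝ)) ∧
        c' * sortTime (n + t ^ 2) ≤ (sweepTime P O X j : ℝ) := by
  obtain ⟨n₀, h⟩ := exists_large d
  set N : ℕ := n₀ + (n₀ ^ d) ^ 2 + 1 with hN
  have hN0 : (0 : ℝ) < (N : ℝ) ^ 2 := by positivity
  have hm : 0 < min c 1 := lt_min hc one_pos
  refine ⟨min (min c 1 / (2 ^ 8 * ((8 : ℕ) + 2))) (1 / (N : ℝ) ^ 2), by positivity, ?_⟩
  intro M B hB hM P hP n t ht hnt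
  obtain ⟨O, X, j, k, hO, hj, hsize, hT, hL, hk, hcase⟩ := h n t ht hnt
  refine ⟨O, X, j, hO, hj, hsize, hT, ?_⟩
  have ht0 := sortTime_nonneg (n + t ^ 2)
  rcases hcase with hn | ⟨hk2, hle⟩
  · have hle : n + t ^ 2 ≤ N := by
      have h1 : t ^ 2 ≤ (n₀ ^ d) ^ 2 :=
        Nat.pow_le_pow_left (ht.trans (Nat.pow_le_pow_left hn.le d)) 2
      omega
    have hle' : ((n + t ^ 2 : ℕ) : ℝ) ^ 2 ≤ (N : ℝ) ^ 2 := by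
      have : ((n + t ^ 2 : ℕ) : ℝ) ≤ N := by exact_mod_cast hle
      gcongr
    constructor
    · intro hMn
      have h1 : (2 : ℝ) ≤ sweepIOs P O X j := by exact_mod_cast hL.two_le_sweepIOs hB hk
      have h2 := sortIO_le_sq (n := n + t ^ 2) hB hM
      have h3 : 0 ≤ sortIO M B (n + t ^ 2) := sortIO_nonneg hB hM (by omega)
      refine (mul_le_mul_of_nonneg_right (min_le_right _ _) h3).trans (le_trans ?_ h1)
      rw [one_div_mul_eq_div, div_le_iff₀ hN0]
      linarith
    · have h1 : (2 : ℝ) ≤ sweepTime P O X j := by exact_mod_cast hL.two_le_sweepTime hk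
      have h2 := sortTime_le_sq (n + t ^ 2)
      refine (mul_le_mul_of_nonneg_right (min_le_right _ _) ht0).trans (le_trans ?_ h1)
      rw [one_div_mul_eq_div, div_le_iff₀ hN0]
      linarith
  · constructor
    · intro hMn
      have h3 : 0 ≤ sortIO M B (n + t ^ 2) := sortIO_nonneg hB hM (by omega)
      exact (mul_le_mul_of_nonneg_right (min_le_left _ _) h3).trans (hL.le_sweepIOs hB hM hP hc 8 hMn hle)
    · refine (mul_le_mul_of_nonneg_right ((min_le_left _ _).trans ?_) ht0).trans
        (hL.le_sweepTime hP hc hk2 8 hle)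
      gcongr
      exact min_le_left _ _

end NestedSweep

namespace IOModel

/-! ## Reasoning about programs -/

section Programs

variable {m B : ℕ} {σ τ α : Type} [LinearOrder α]

/-- Sequential composition. -/
def Prog.bind : Prog m B σ → (σ → Prog m B τ) → Prog m B τ
  | .done s, f => f s
  | .move i j k, f => .move i j (k.bind f)
  | .clear i k, f => .clear i (k.bind f)
  | .cmp i j k, f => .cmp i j (fun b => (k b).bind f)
  | .output a p k, f => .output a p (k.bind f)
  | .input a p k, f => .input a p (k.bind f)

/-- The execution of `p` from `c` accesses only blocks below `N`, and the final control state and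
configuration, the number of I/Os and the time satisfy `Q`. -/
def Runs (N : ℕ) (p : Prog m B σ) (c : Config m B α) (Q : σ → Config m B α → ℕ → ℕ → Prop) : Prop :=
  Q (p.exec c).state (p.exec c).cfg (p.exec c).ios (p.exec c).time ∧ ∀ a ∈ (p.exec c).blocks, a < N

variable {N : ℕ} {c : Config m B α} {Q Q' : σ → Config m B α → ℕ → ℕ → Prop}

theorem Runs.mono {p : Prog m B σ} (h : Runs N p c Q) (hQ : ∀ s c' i t, Q s c' i t → Q' s c' i t) :
    Runs N p c Q' := ⟨hQ _ _ _ _ h.1, h.2⟩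

theorem Runs.done {s : σ} (h : Q s c 0 0) : Runs N (.done s) c Q := ⟨h, by simp [Prog.exec]⟩

theorem Runs.move {i j : Fin (m + 2)} {k : Prog m B σ}
    (h : Runs N k { c with mem := Function.update c.mem j (c.mem i) }
      (fun s c' io t => Q s c' io (t + 1))) : Runs N (.move i j k) c Q := h

theorem Runs.clear {i : Fin (m + 2)} {k : Prog m B σ}
    (h : Runs N k { c with mem := Function.update c.mem i ⊤ }
      (fun s c' io t => Q s c' io (t + 1))) : Runs N (.clear i k) c Q := h

theorem Runs.cmp {i j : Fin (m + 2)} {k : Bool → Prog m B σ}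
    (h : Runs N (k (decide (c.mem i ≤ c.mem j))) c (fun s c' io t => Q s c' io (t + 1))) :
    Runs N (.cmp i j k) c Q := h

theorem Runs.output {a : ℕ} {p : Fin B → Fin (m + 2)} {k : Prog m B σ} (ha : a < N)
    (h : Runs N k { c with disk := Function.update c.disk a (fun q => c.mem (p q)) }
      (fun s c' io t => Q s c' (io + 1) (t + B))) : Runs N (.output a p k) c Q :=
  ⟨h.1, fun b hb => (Finset.mem_insert.1 hb).elim (fun e => e ▸ ha) (h.2 b)⟩

theorem Runs.input {a : ℕ} {p : Fin (m + 2) → Option (Fin B)} {k : Prog m B σ} (ha : a < N)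
    (h : Runs N k { c with mem := fun i => ((p i).map (c.disk a)).getD (c.mem i) }
      (fun s c' io t => Q s c' (io + 1) (t + B))) : Runs N (.input a p k) c Q :=
  ⟨h.1, fun b hb => (Finset.mem_insert.1 hb).elim (fun e => e ▸ ha) (h.2 b)⟩

theorem exec_bind (p : Prog m B σ) (f : σ → Prog m B τ) (c : Config m B α) :
    (p.bind f).exec c = ⟨((f (p.exec c).state).exec (p.exec c).cfg).state,
      ((f (p.exec c).state).exec (p.exec c).cfg).cfg,
      (p.exec c).ios + ((f (p.exec c).state).exec (p.exec c).cfg).ios,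
      (p.exec c).time + ((f (p.exec c).state).exec (p.exec c).cfg).time,
      (p.exec c).blocks ∪ ((f (p.exec c).state).exec (p.exec c).cfg).blocks⟩ := by
  induction p generalizing c with
  | done s => simp [Prog.bind, Prog.exec]
  | move i j k ih => simp only [Prog.bind, Prog.exec, ih, add_right_comm]
  | clear i k ih => simp only [Prog.bind, Prog.exec, ih, add_right_comm]
  | cmp i j k ih => simp only [Prog.bind, Prog.exec, ih, add_right_comm]
  | output a p k ih => simp only [Prog.bind, Prog.exec, ih, add_right_comm, Finset.insert_union]
  | input a p k ih => simp only [Prog.bind, Prog.exec, ih, add_right_comm, Finset.insert_union]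

theorem Runs.bind {p : Prog m B σ} {f : σ → Prog m B τ} {R : τ → Config m B α → ℕ → ℕ → Prop}
    (h : Runs N p c Q) (hf : ∀ s c' i t, Q s c' i t →
      Runs N (f s) c' (fun s' c'' i' t' => R s' c'' (i + i') (t + t'))) :
    Runs N (p.bind f) c R := by
  have h2 := hf _ _ _ _ h.1
  unfold Runs
  rw [exec_bind]
  exact ⟨h2.1, fun a ha => (Finset.mem_union.1 ha).elim (h.2 a) (h2.2 a)⟩

/-! ## Searching and merging -/

/-- Binary search: the number of cells in the sorted list that do not exceed the cell `x`. -/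
def rank (x : Fin (m + 2)) (L : List (Fin (m + 2))) : Prog m B ℕ :=
  match h : L[L.length / 2]? with
  | none => .done 0
  | some y => .cmp y x fun b =>
      if b then (rank x (L.drop (L.length / 2 + 1))).bind fun r => .done (L.length / 2 + 1 + r)
      else rank x (L.take (L.length / 2))
termination_by L.length
decreasing_by
  all_goals
    obtain ⟨h, _⟩ := List.getElem?_eq_some_iff.1 h
    simp only [List.length_drop, List.length_take]
    omega

theorem rank_spec (x : Fin (m + 2)) (L : List (Fin (m + 2))) (c : Config m B α)
    (hL : (L.map c.mem).Pairwise (· ≤ ·)) (k : ℕ) (hk : L.length < 2 ^ k) :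
    Runs N (rank x L) c fun r c' i t => c' = c ∧ i = 0 ∧ t ≤ k ∧ r ≤ L.length ∧
      (∀ y ∈ L.take r, c.mem y ≤ c.mem x) ∧ ∀ y ∈ L.drop r, c.mem x ≤ c.mem y := by
  induction hn : L.length using Nat.strong_induction_on generalizing L k with
  | _ n ih =>
  subst hn
  rw [rank]
  split
  · rename_i h
    have h0 : L = [] := by
      rw [List.getElem?_eq_none_iff] at h
      rw [← List.length_eq_zero_iff]; omega
    subst h0
    exact Runs.done (by simp)
  · rename_i y h
    obtain ⟨hlt, hy⟩ := List.getElem?_eq_some_iff.1 h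
    have hk0 : k ≠ 0 := by rintro rfl; rw [pow_zero] at hk; omega
    obtain ⟨k, rfl⟩ := Nat.exists_eq_succ_of_ne_zero hk0
    rw [pow_succ] at hk
    have hsplit : L = L.take (L.length / 2) ++ y :: L.drop (L.length / 2 + 1) := by
      rw [← hy, List.getElem_cons_drop, List.take_append_drop]
    have hL' := hL
    rw [hsplit, List.map_append, List.map_cons, List.pairwise_append, List.pairwise_cons] at hL'
    refine Runs.cmp ?_
    split_ifs with hb
    · rw [decide_eq_true_eq] at hb
      refine Runs.bind (ih _ ?_ _ hL'.2.1.2 k ?_ rfl) ?_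
      · simp only [List.length_drop]; omega
      · simp only [List.length_drop]; omega
      · rintro r c' i t ⟨rfl, rfl, ht, hr, h1, h2⟩
        rw [List.length_drop] at hr
        refine Runs.done ⟨rfl, rfl, by omega, by omega, fun z hz => ?_, fun z hz => ?_⟩
        · have e : L.take (L.length / 2 + 1 + r) =
              L.take (L.length / 2) ++ y :: (L.drop (L.length / 2 + 1)).take r := by
            rw [List.take_add, List.take_add_one, h]; simp
          rw [e, List.mem_append, List.mem_cons] at hz
          rcases hz with hz | rfl | hz
          · exact (hL'.2.2 _ (List.mem_map_of_mem hz) _ List.mem_cons_self).trans hb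
          · exact hb
          · exact h1 z hz
        · rw [← List.drop_drop] at hz
          exact h2 z hz
    · rw [decide_eq_true_eq, not_le] at hb
      refine (ih _ ?_ _ hL'.1 k ?_ rfl).mono ?_
      · simp only [List.length_take]; omega
      · simp only [List.length_take]; omega
      · rintro r c' i t ⟨rfl, rfl, ht, hr, h1, h2⟩
        rw [List.length_take] at hr
        rw [List.take_take, min_eq_left (by omega)] at h1
        refine ⟨rfl, rfl, by omega, by omega, h1, fun z hz => ?_⟩
        rw [hsplit, List.drop_append_of_le_length (by rw [List.length_take]; omega), List.mem_append,
          List.mem_cons] at hz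
        rcases hz with hz | rfl | hz
        · exact h2 z hz
        · exact hb.le
        · exact hb.le.trans (hL'.2.1.1 _ (List.mem_map_of_mem hz))

/-- Merge two sorted lists of cells. -/
def mergeCells : List (Fin (m + 2)) → List (Fin (m + 2)) → Prog m B (List (Fin (m + 2)))
  | [], K => .done K
  | L, [] => .done L
  | x :: L, y :: K => .cmp x y fun b =>
      if b then (mergeCells L (y :: K)).bind fun R => .done (x :: R)
      else (mergeCells (x :: L) K).bind fun R => .done (y :: R)
termination_by L K => L.length + K.length

theorem mergeCells_spec (L K : List (Fin (m + 2))) (c : Config m B α)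
    (hL : (L.map c.mem).Pairwise (· ≤ ·)) (hK : (K.map c.mem).Pairwise (· ≤ ·)) :
    Runs N (mergeCells L K) c fun R c' i t => c' = c ∧ i = 0 ∧ t ≤ L.length + K.length ∧
      R.Perm (L ++ K) ∧ (R.map c.mem).Pairwise (· ≤ ·) := by
  induction hn : L.length + K.length using Nat.strong_induction_on generalizing L K with
  | _ n ih =>
  subst hn
  rcases L with _ | ⟨x, L⟩
  · rw [mergeCells]
    exact Runs.done (by simpa using hK)
  rcases K with _ | ⟨y, K⟩
  · rw [mergeCells]
    · exact Runs.done (by simpa using hL)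
    · simp
  rw [mergeCells]
  simp only [List.map_cons, List.pairwise_cons] at hL hK
  refine Runs.cmp ?_
  split_ifs with hb
  · rw [decide_eq_true_eq] at hb
    refine Runs.bind (ih _ ?_ L (y :: K) hL.2 (by simpa using hK) rfl) ?_
    · simp
    · rintro R c' i t ⟨rfl, rfl, ht, h1, h2⟩
      refine Runs.done ⟨rfl, rfl, ?_, ?_, ?_⟩
      · simp at ht ⊢; omega
      · exact h1.cons x
      · refine List.pairwise_cons.2 ⟨fun z hz => ?_, h2⟩
        obtain ⟨w, hw, rfl⟩ := List.mem_map.1 hz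
        rcases List.mem_append.1 (h1.mem_iff.1 hw) with hw | hw
        · exact hL.1 _ (List.mem_map_of_mem hw)
        · rcases List.mem_cons.1 hw with rfl | hw
          · exact hb
          · exact hb.trans (hK.1 _ (List.mem_map_of_mem hw))
  · rw [decide_eq_true_eq, not_le] at hb
    refine Runs.bind (ih _ ?_ (x :: L) K (by simpa using hL) hK.2 rfl) ?_
    · simp
    · rintro R c' i t ⟨rfl, rfl, ht, h1, h2⟩
      refine Runs.done ⟨rfl, rfl, ?_, ?_, ?_⟩
      · simp at ht ⊢; omega
      · exact (h1.cons y).trans List.perm_middle.symm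
      · refine List.pairwise_cons.2 ⟨fun z hz => ?_, h2⟩
        obtain ⟨w, hw, rfl⟩ := List.mem_map.1 hz
        rcases List.mem_append.1 (h1.mem_iff.1 hw) with hw | hw
        · rcases List.mem_cons.1 hw with rfl | hw
          · exact hb.le
          · exact hb.le.trans (hL.1 _ (List.mem_map_of_mem hw))
        · exact hK.1 _ (List.mem_map_of_mem hw)

end Programs

end IOModel

namespace IOModel

/-! ## Areas of the external memory -/

theorem range_succ_mul (B k : ℕ) :
    List.range ((k + 1) * B) = List.range (k * B) ++ (List.range B).map (fun r => k * B + r) := by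
  rw [Nat.succ_mul, List.range_add]

/-- The number of blocks that hold `l` records. -/
def blocksFor (B l : ℕ) : ℕ := (l + B - 1) / B

theorem le_blocksFor_mul {B : ℕ} (hB : 0 < B) (l : ℕ) : l ≤ blocksFor B l * B := by
  unfold blocksFor
  have := Nat.lt_div_mul_add (a := l + B - 1) hB
  omega

theorem blocksFor_le {B : ℕ} (hB : 0 < B) {l k : ℕ} (h : l ≤ k * B) : blocksFor B l ≤ k := by
  unfold blocksFor
  rw [← Nat.lt_succ_iff, Nat.div_lt_iff_lt_mul hB, Nat.succ_mul]
  omega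

section Areas

variable {m B : ℕ} {α : Type}

/-- Some `k` cells other than the ports and the cells in `used`. -/
def fresh (used : List (Fin (m + 2))) (k : ℕ) : List (Fin (m + 2)) :=
  ((List.finRange (m + 2)).filter (fun i => decide (2 ≤ i.val ∧ i ∉ used))).take k

theorem fresh_nodup (used : List (Fin (m + 2))) (k : ℕ) : (fresh used k).Nodup :=
  ((List.nodup_finRange _).filter _).sublist (List.take_sublist _ _)

theorem mem_fresh {used : List (Fin (m + 2))} {k : ℕ} {i : Fin (m + 2)} (h : i ∈ fresh used k) :
    2 ≤ i.val ∧ i ∉ used := by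
  simpa using (List.mem_filter.1 (List.mem_of_mem_take h)).2

theorem length_fresh {used : List (Fin (m + 2))} {k : ℕ} (h : used.length + k ≤ m) :
    (fresh used k).length = k := by
  unfold fresh
  rw [List.length_take, min_eq_left]
  have h1 : ((List.finRange (m + 2)).filter (fun i => decide (2 ≤ i.val ∧ i ∉ used))).toFinset =
      Finset.univ \ insert 0 (insert 1 used.toFinset) := by
    ext i
    have : 2 ≤ i.val ↔ i ≠ 0 ∧ i ≠ 1 := by
      rw [Ne, Ne, Fin.ext_iff, Fin.ext_iff, Fin.val_zero, Fin.val_one]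
      omega
    simp [this, and_assoc]
  have h2 := List.toFinset_card_of_nodup ((List.nodup_finRange (m + 2)).filter
    (fun i => decide (2 ≤ i.val ∧ i ∉ used)))
  rw [← h2, h1]
  have h3 := Finset.le_card_sdiff (insert 0 (insert 1 used.toFinset)) (Finset.univ : Finset (Fin (m + 2)))
  have h4 : (insert (0 : Fin (m + 2)) (insert 1 used.toFinset)).card ≤ used.length + 2 := by
    have := List.toFinset_card_le used
    exact (Finset.card_insert_le _ _).trans (Nat.succ_le_succ ((Finset.card_insert_le _ _).trans
      (Nat.succ_le_succ this)))
  rw [Finset.card_univ, Fintype.card_fin] at h3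
  omega

variable [NeZero B]

/-- Read a block into fresh cells. -/
def loadBlock (a : ℕ) (used : List (Fin (m + 2))) : Prog m B (List (Fin (m + 2))) :=
  .input a (fun i => if i ∈ fresh used B then some (Fin.ofNat B ((fresh used B).idxOf i)) else none)
    (.done (fresh used B))

/-- The cells of `L` are fresh. -/
def Fresh (used L : List (Fin (m + 2))) : Prop := ∀ i ∈ L, 2 ≤ i.val ∧ i ∉ used

theorem loadBlock_spec [LinearOrder α] {N a : ℕ} (ha : a < N) {used : List (Fin (m + 2))} (hm : used.length + B ≤ m)
    (c : Config m B α) :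
    Runs N (loadBlock a used) c fun K c' i t => i = 1 ∧ t = B ∧ c'.disk = c.disk ∧ Fresh used K ∧
      (∀ i ∈ used, c'.mem i = c.mem i) ∧
      K.map c'.mem = (List.range B).map (fun r => c.disk a (Fin.ofNat B r)) := by
  refine Runs.input ha (Runs.done ⟨rfl, by omega, rfl, fun i => mem_fresh, fun i hi => ?_, ?_⟩)
  · have : i ∉ fresh used B := fun h => (mem_fresh h).2 hi
    simp [this]
  · refine List.ext_getElem (by simp [length_fresh hm]) fun r h1 h2 => ?_
    simp only [List.getElem_map, List.getElem_range]
    rw [if_pos (List.getElem_mem _), (fresh_nodup used B).idxOf_getElem]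
    rfl

variable (d : ℕ)

/-- The record at position `q` of the area of node `v`, which has `2 d` blocks. -/
def rcd (c : Config m B α) (v q : ℕ) : WithTop α := c.disk (v * (2 * d) + q / B) (Fin.ofNat B q)

theorem rcd_add (c : Config m B α) (v k : ℕ) {r : ℕ} (hr : r < B) :
    rcd d c v (k * B + r) = c.disk (v * (2 * d) + k) (Fin.ofNat B r) := by
  have hB : 0 < B := by omega
  unfold rcd
  congr 1
  · rw [mul_comm k B, Nat.mul_add_div hB, Nat.div_eq_of_lt hr, add_zero]
  · simp [Fin.ofNat]

/-- Read the first `k` blocks of the area of node `v`. -/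
def loadBlocks (v : ℕ) (used : List (Fin (m + 2))) : ℕ → Prog m B (List (Fin (m + 2)))
  | 0 => .done []
  | k + 1 => (loadBlocks v used k).bind fun L =>
      (loadBlock (v * (2 * d) + k) (L ++ used)).bind fun K => .done (L ++ K)

theorem loadBlocks_spec [LinearOrder α] {N v : ℕ} (k : ℕ) (hv : v * (2 * d) + k ≤ N) {used : List (Fin (m + 2))}
    (hm : used.length + k * B ≤ m) (c : Config m B α) :
    Runs N (loadBlocks d v used k) c fun L c' i t => i = k ∧ t = k * B ∧ c'.disk = c.disk ∧
      Fresh used L ∧ (∀ i ∈ used, c'.mem i = c.mem i) ∧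
      L.map c'.mem = (List.range (k * B)).map (rcd d c v) := by
  induction k with
  | zero => exact Runs.done (by simp [Fresh])
  | succ k ih =>
    rw [Nat.succ_mul] at hm
    refine Runs.bind (ih (by omega) (by omega)) ?_
    rintro L c' i t ⟨rfl, rfl, hd, hf, hu, hL⟩
    have hlen : L.length = i * B := by simpa using congrArg List.length hL
    refine Runs.bind (loadBlock_spec (by omega) (by rw [List.length_append, hlen]; omega) c') ?_
    rintro K c'' i' t' ⟨rfl, rfl, hd', hf', hu', hK⟩
    refine Runs.done ⟨rfl, ?_, hd'.trans hd, ?_, ?_, ?_⟩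
    · rw [Nat.succ_mul]; rfl
    · intro x hx
      rcases List.mem_append.1 hx with hx | hx
      · exact hf x hx
      · exact ⟨(hf' x hx).1, fun h => (hf' x hx).2 (List.mem_append_right _ h)⟩
    · intro x hx
      rw [hu' x (List.mem_append_right _ hx), hu x hx]
    · rw [List.map_append, range_succ_mul, List.map_append, hK, hd, List.map_map]
      congr 1
      · rw [← hL]
        exact List.map_congr_left fun x hx => hu' x (List.mem_append_left _ hx)
      · refine List.map_congr_left fun r hr => ?_
        exact (rcd_add d c v i (List.mem_range.1 hr)).symm

/-- Write the first `k` blocks of the area of node `v`. -/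
def storeBlocks (v : ℕ) (X : List (Fin (m + 2))) : ℕ → Prog m B Unit
  | 0 => .done ()
  | k + 1 => (storeBlocks v X k).bind fun _ =>
      .output (v * (2 * d) + k) (fun q => X.getD (k * B + q) 0) (.done ())

variable {d}

theorem address_inj {v u j j' : ℕ} (hj : j < 2 * d) (hj' : j' < 2 * d)
    (h : v * (2 * d) + j = u * (2 * d) + j') : v = u ∧ j = j' := by
  have hd : 0 < 2 * d := by omega
  have e : ∀ w i, i < 2 * d → (w * (2 * d) + i) / (2 * d) = w := fun w i hi => by
    rw [mul_comm, Nat.mul_add_div hd, Nat.div_eq_of_lt hi, add_zero]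
  have : v = u := by rw [← e v j hj, ← e u j' hj', h]
  subst this
  exact ⟨rfl, by omega⟩

theorem storeBlocks_spec [LinearOrder α] {N v : ℕ} (X : List (Fin (m + 2))) (k : ℕ) (hk : k ≤ 2 * d)
    (hv : v * (2 * d) + k ≤ N) (c : Config m B α) :
    Runs N (storeBlocks d v X k) c fun _ c' i t => i = k ∧ t = k * B ∧ c'.mem = c.mem ∧
      (∀ q < k * B, rcd d c' v q = c.mem (X.getD q 0)) ∧
      ∀ u, u ≠ v → ∀ q < 2 * (d * B), rcd d c' u q = rcd d c u q := by
  have hB : 0 < B := Nat.pos_of_ne_zero (NeZero.ne B)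
  induction k with
  | zero => exact Runs.done (by simp)
  | succ k ih =>
    refine Runs.bind (ih (by omega) (by omega)) ?_
    rintro _ c' i t ⟨rfl, rfl, hm, h1, h2⟩
    refine Runs.output (by omega) (Runs.done ⟨rfl, ?_, hm, ?_, ?_⟩)
    · rw [Nat.succ_mul, zero_add]
    · intro q hq
      rcases lt_or_ge q (i * B) with hlt | hge
      · rw [← h1 q hlt]
        unfold rcd
        dsimp only
        rw [Function.update_of_ne]
        have : q / B < i := (Nat.div_lt_iff_lt_mul hB).2 hlt
        omega
      · obtain ⟨r, rfl⟩ := Nat.exists_eq_add_of_le hge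
        rw [Nat.succ_mul] at hq
        have hr : r < B := by omega
        rw [rcd_add d _ v i hr]
        dsimp only
        rw [Function.update_self, hm]
        congr 2
        simp [Fin.ofNat, Nat.mod_eq_of_lt hr]
    · intro u hu q hq
      rw [← h2 u hu q hq]
      unfold rcd
      dsimp only
      rw [Function.update_of_ne]
      intro e
      refine hu (address_inj ?_ ?_ e).1
      · rw [Nat.div_lt_iff_lt_mul hB, mul_assoc]; exact hq
      · omega

end Areas

end IOModel

namespace IOModel

/-! ## The tree of nodes -/

/-- Node `u` is a child of node `v` in the tree in which each node has `d` children. -/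
def Ch (d v u : ℕ) : Prop := u ≠ 0 ∧ (u - 1) / d = v

instance (d v u : ℕ) : Decidable (Ch d v u) := inferInstanceAs (Decidable (_ ∧ _))

/-- Proper descendants. -/
abbrev Desc (d : ℕ) : ℕ → ℕ → Prop := Relation.TransGen (Ch d)

/-- Descendants. -/
abbrev DescR (d : ℕ) : ℕ → ℕ → Prop := Relation.ReflTransGen (Ch d)

/-- The children among the first `nb` nodes. -/
def kids (d nb v : ℕ) : List ℕ := (List.range nb).filter (fun u => decide (Ch d v u))

section Tree

variable {d nb u v c c' : ℕ}

theorem mem_kids : u ∈ kids d nb v ↔ u < nb ∧ Ch d v u := by simp [kids]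

theorem kids_nodup : (kids d nb v).Nodup := List.nodup_range.filter _

theorem length_kids_le (hd : 0 < d) : (kids d nb v).length ≤ d := by
  rw [← List.toFinset_card_of_nodup kids_nodup, ← Finset.card_range d]
  refine Finset.card_le_card_of_injOn (fun u => (u - 1) % d) (fun u _ => ?_) fun u hu w hw h => ?_
  · simpa using Nat.mod_lt _ hd
  · obtain ⟨_, hu0, hu⟩ := mem_kids.1 (by simpa using hu : u ∈ kids d nb v)
    obtain ⟨_, hw0, hw⟩ := mem_kids.1 (by simpa using hw : w ∈ kids d nb v)
    have h1 := Nat.div_add_mod (u - 1) d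
    have h2 := Nat.div_add_mod (w - 1) d
    dsimp only at h
    rw [hu, h] at h1
    rw [hw] at h2
    omega

theorem Ch.lt (h : Ch d v u) : v < u := by
  obtain ⟨h0, rfl⟩ := h
  have := Nat.div_le_self (u - 1) d
  omega

theorem Desc.lt (h : Desc d v u) : v < u := by
  induction h with
  | single h => exact h.lt
  | tail _ h ih => exact ih.trans h.lt

theorem DescR.le (h : DescR d v u) : v ≤ u := by
  rcases Relation.reflTransGen_iff_eq_or_transGen.1 h with rfl | h
  · exact le_rfl
  · exact (Desc.lt h).le

theorem desc_iff : Desc d v u ↔ ∃ c, Ch d v c ∧ DescR d c u := Relation.TransGen.head'_iff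

theorem descR_iff : DescR d v u ↔ u = v ∨ Desc d v u := Relation.reflTransGen_iff_eq_or_transGen

theorem desc_iff_tail : Desc d v u ↔ u ≠ 0 ∧ DescR d v ((u - 1) / d) := by
  rw [Desc, Relation.TransGen.tail'_iff]
  constructor
  · rintro ⟨w, hw, h0, rfl⟩; exact ⟨h0, hw⟩
  · rintro ⟨h0, hw⟩; exact ⟨_, hw, h0, rfl⟩

theorem descR_zero (u : ℕ) : DescR d 0 u := by
  induction u using Nat.strong_induction_on with
  | _ u ih =>
    rcases Nat.eq_zero_or_pos u with rfl | h
    · exact Relation.ReflTransGen.refl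
    · have := Nat.div_le_self (u - 1) d
      exact (ih ((u - 1) / d) (by omega)).tail ⟨h.ne', rfl⟩

theorem desc_zero (h : u ≠ 0) : Desc d 0 u := by
  have := descR_iff.1 (descR_zero (d := d) u)
  exact this.resolve_left h

/-- Subtrees of different siblings are disjoint. -/
theorem descR_disjoint (h : Ch d v c) (h' : Ch d v c') (hne : c ≠ c') (h1 : DescR d c u) :
    ¬ DescR d c' u := by
  intro h2
  have hu : Relator.RightUnique (Function.swap (Ch d)) := by
    rintro a b b' ⟨_, rfl⟩ ⟨_, rfl⟩; rfl
  have key : ∀ {a b : ℕ}, Ch d v a → Ch d v b → a ≠ b → ¬ DescR d a b := by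
    intro a b ha hb hne hab
    have hab := (descR_iff.1 hab).resolve_left hne.symm
    have := (desc_iff_tail.1 hab).2
    rw [hb.2] at this
    exact absurd (DescR.le this) (by have := ha.lt; omega)
  rcases Relation.ReflTransGen.total_of_right_unique hu
    (Relation.reflTransGen_swap.2 h1) (Relation.reflTransGen_swap.2 h2) with h3 | h3
  · exact key h' h hne.symm (Relation.reflTransGen_swap.1 h3)
  · exact key h h' hne (Relation.reflTransGen_swap.1 h3)

/-- The ancestors of `u` other than the root, and `u` itself, from the top. -/
def path (d u : ℕ) : List ℕ :=
  if _h : u = 0 then [] else path d ((u - 1) / d) ++ [u]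
termination_by u
decreasing_by
  have := Nat.div_le_self (u - 1) d
  omega

/-- Depth in the tree. -/
def height (d u : ℕ) : ℕ := (path d u).length

theorem path_zero : path d 0 = [] := by rw [path]; simp

theorem path_of_ne (h : u ≠ 0) : path d u = path d ((u - 1) / d) ++ [u] := by
  rw [path]; simp [h]

theorem height_zero : height d 0 = 0 := by simp [height, path_zero]

theorem Ch.height (h : Ch d v u) : height d u = height d v + 1 := by
  rw [IOModel.height, path_of_ne h.1, h.2]; simp [IOModel.height]

theorem mem_path : v ∈ path d u ↔ v ≠ 0 ∧ DescR d v u := by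
  induction u using Nat.strong_induction_on with
  | _ u ih =>
    rcases Nat.eq_zero_or_pos u with rfl | h
    · rw [path_zero]
      simp only [List.not_mem_nil, false_iff, not_and]
      intro h0 h1
      exact h0 (Nat.le_zero.1 (DescR.le h1))
    · have h1 := Nat.div_le_self (u - 1) d
      rw [path_of_ne h.ne', List.mem_append, ih _ (by omega), List.mem_singleton, descR_iff (u := u),
        desc_iff_tail]
      constructor
      · rintro (⟨h2, h3⟩ | rfl)
        · exact ⟨h2, Or.inr ⟨h.ne', h3⟩⟩
        · exact ⟨h.ne', Or.inl rfl⟩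
      · rintro ⟨h2, rfl | ⟨_, h3⟩⟩
        · exact Or.inr rfl
        · exact Or.inl ⟨h2, h3⟩

/-- The number of the parent is at most (u - 1)/d, so each step towards the root divides the number
by d; the final step from a child of the root costs the extra factor d. -/
theorem pow_height_le (hu : u ≠ 0) : d ^ height d u ≤ d * u := by
  induction u using Nat.strong_induction_on with
  | _ u ih =>
    have h1 := Nat.div_le_self (u - 1) d
    have hch : Ch d ((u - 1) / d) u := ⟨hu, rfl⟩
    rw [hch.height, pow_succ]
    rcases Nat.eq_zero_or_pos ((u - 1) / d) with h0 | h0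
    · rw [h0, height_zero, pow_zero, one_mul]
      exact Nat.le_mul_of_pos_right _ (by omega)
    · refine (Nat.mul_le_mul_right d (ih _ (by omega) h0.ne')).trans ?_
      rw [mul_assoc]
      refine Nat.mul_le_mul_left d ?_
      have := Nat.div_mul_le_self (u - 1) d
      omega

end Tree

/-! ## The potential -/

section Potential

variable {d s nb : ℕ}

/-- Some proper descendant is not empty. -/
def Live (d : ℕ) (sz : ℕ → ℕ) (v : ℕ) : Prop := ∃ u, Desc d v u ∧ 0 < sz u

open Classical in
/-- The potential of the sizes of the nodes. -/
noncomputable def potential (d s nb : ℕ) (sz : ℕ → ℕ) : ℕ :=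
  ∑ u ∈ Finset.range nb, height d u * sz u + s * ((Finset.range nb).filter (Live d sz)).card

theorem sum_split {M : Type*} [AddCommMonoid M] {v : ℕ} (hv : v < nb) (f : ℕ → M) :
    ∑ u ∈ Finset.range nb, f u =
      ∑ u ∈ (Finset.range nb).filter (fun u => u ≠ v ∧ ¬ Ch d v u), f u +
        (f v + ∑ u ∈ (kids d nb v).toFinset, f u) := by
  rw [← Finset.sum_filter_add_sum_filter_not (Finset.range nb) (fun u => u ≠ v ∧ ¬ Ch d v u) f]
  congr 1
  have : (Finset.range nb).filter (fun u => ¬ (u ≠ v ∧ ¬ Ch d v u)) =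
      insert v (kids d nb v).toFinset := by
    ext u
    simp only [Finset.mem_filter, Finset.mem_range, Finset.mem_insert, List.mem_toFinset, mem_kids]
    constructor
    · rintro ⟨h1, h2⟩
      by_cases e : u = v
      · exact Or.inl e
      · exact Or.inr ⟨h1, by_contra fun h => h2 ⟨e, h⟩⟩
    · rintro (rfl | ⟨h1, h2⟩)
      · exact ⟨hv, fun h => h.1 rfl⟩
      · exact ⟨h1, fun h => h.2 h2⟩
  rw [this, Finset.sum_insert]
  rw [List.mem_toFinset, mem_kids]
  exact fun h => lt_irrefl _ h.2.lt

variable {β : Type*} [LinearOrder β] {A A' : ℕ → List β} {v : ℕ} {out : List β}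

/-- Records of a node do not exceed those of its descendants. -/
def Heap (d : ℕ) (A : ℕ → List β) : Prop := ∀ v u, Desc d v u → ∀ x ∈ A v, ∀ y ∈ A u, x ≤ y

/-- The contents of all nodes. -/
def total (nb : ℕ) (A : ℕ → List β) : Multiset β := ∑ u ∈ Finset.range nb, (A u : Multiset β)

/-- The node `v` has received the records `out` from its children. -/
structure Pulled (d s nb v : ℕ) (A A' : ℕ → List β) (out : List β) : Prop where
  lt : v < nb
  empty : ∀ u, nb ≤ u → A u = []
  self : A' v = A v ++ out
  kid : ∀ c, Ch d v c → ∃ pre, A c = pre ++ A' c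
  other : ∀ u, u ≠ v → ¬ Ch d v u → A' u = A u
  items : (out : Multiset β) + ∑ c ∈ (kids d nb v).toFinset, (A' c : Multiset β) =
    ∑ c ∈ (kids d nb v).toFinset, (A c : Multiset β)
  out_le : ∀ c, Ch d v c → ∀ x ∈ out, ∀ y ∈ A' c, x ≤ y
  dom : ∀ x ∈ out, ∀ c, Ch d v c → s ≤ (A c).length → ∃ z ∈ A c, x ≤ z
  len : out.length ≤ s
  full : out.length < s → ∀ c, Ch d v c → A' c = []
  good : ∀ c, Ch d v c → s ≤ (A c).length ∨ ¬ Live d (fun u => (A u).length) c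

namespace Pulled

variable (h : Pulled d s nb v A A' out)
include h

theorem mem_out {x : β} (hx : x ∈ out) : ∃ c, Ch d v c ∧ x ∈ A c := by
  have h1 : x ∈ ∑ c ∈ (kids d nb v).toFinset, (A c : Multiset β) := by
    rw [← h.items]; exact Multiset.mem_add.2 (Or.inl hx)
  obtain ⟨c, hc, hx⟩ := Multiset.mem_sum.1 h1
  exact ⟨c, (mem_kids.1 (List.mem_toFinset.1 hc)).2, hx⟩

theorem mem_of_ne {u : ℕ} (hu : u ≠ v) {x : β} (hx : x ∈ A' u) : x ∈ A u := by
  by_cases hc : Ch d v u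
  · obtain ⟨pre, e⟩ := h.kid u hc
    rw [e]; exact List.mem_append_right _ hx
  · rwa [h.other u hu hc] at hx

/-- The delicate case is a record moved to `v` against one that remains deeper than a child `c`. If
`c` began with at least `s` records, `dom` provides one of them that is not smaller than the moved
record, and this one bounds the whole subtree of `c`. Otherwise `good` says that there was nothing
below `c`. -/
theorem heap (hA : Heap d A) : Heap d A' := by
  intro a u hau x hx y hy
  by_cases hu : u = v
  · subst hu
    have ha : a ≠ u := by rintro rfl; exact lt_irrefl _ (Desc.lt hau)
    have hx := h.mem_of_ne ha hx
    rw [h.self, List.mem_append] at hy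
    rcases hy with hy | hy
    · exact hA a u hau x hx y hy
    · obtain ⟨c, hc, hy⟩ := h.mem_out hy
      exact hA a c (hau.tail hc) x hx y hy
  have hy' := h.mem_of_ne hu hy
  by_cases ha : a = v
  · subst ha
    rw [h.self, List.mem_append] at hx
    rcases hx with hx | hx
    · exact hA a u hau x hx y hy'
    · obtain ⟨c, hc, hcu⟩ := desc_iff.1 hau
      rcases descR_iff.1 hcu with rfl | hcu
      · exact h.out_le u hc x hx y hy
      · rcases h.good c hc with hs | hl
        · obtain ⟨z, hz, hxz⟩ := h.dom x hx c hc hs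
          exact hxz.trans (hA c u hcu z hz y hy')
        · exact absurd ⟨u, hcu, List.length_pos_of_mem hy'⟩ hl
  · exact hA a u hau x (h.mem_of_ne ha hx) y hy'

theorem total_eq : total nb A' = total nb A := by
  unfold total
  rw [sum_split (d := d) h.lt, sum_split (d := d) h.lt (fun u => (A u : Multiset β)), h.self,
    ← Multiset.coe_add, add_assoc, h.items]
  congr 1
  refine Finset.sum_congr rfl fun u hu => ?_
  obtain ⟨_, h1, h2⟩ := Finset.mem_filter.1 hu
  rw [h.other u h1 h2]

theorem length_items : out.length + ∑ c ∈ (kids d nb v).toFinset, (A' c).length =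
    ∑ c ∈ (kids d nb v).toFinset, (A c).length := by
  have := congrArg Multiset.card h.items
  simpa using this

theorem live_of_live {u : ℕ} (hu : Live d (fun u => (A' u).length) u) :
    Live d (fun u => (A u).length) u := by
  obtain ⟨w, hw, hpos⟩ := hu
  obtain ⟨x, hx⟩ := List.exists_mem_of_length_pos hpos
  by_cases e : w = v
  · subst e
    rw [h.self, List.mem_append] at hx
    rcases hx with hx | hx
    · exact ⟨w, hw, List.length_pos_of_mem hx⟩
    · obtain ⟨c, hc, hx⟩ := h.mem_out hx
      exact ⟨c, hw.tail hc, List.length_pos_of_mem hx⟩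
  · exact ⟨w, hw, List.length_pos_of_mem (h.mem_of_ne e hx)⟩

/-- A short output means that all children have run empty. A child that began with `s` records would
have supplied `s` of them, so no child had any, and by `good` nothing lies below the children
either. -/
theorem not_live (hlt : out.length < s) : ¬ Live d (fun u => (A' u).length) v := by
  rintro ⟨u, hu, hpos⟩
  obtain ⟨c, hc, hcu⟩ := desc_iff.1 hu
  have h0 := h.full hlt c hc
  rcases descR_iff.1 hcu with rfl | hcu
  · dsimp only at hpos
    rw [h0] at hpos; simp at hpos
  · rcases h.good c hc with hs | hl
    · have hcn : c ∈ (kids d nb v).toFinset := by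
        rw [List.mem_toFinset, mem_kids]
        refine ⟨?_, hc⟩
        by_contra hge
        rw [h.empty c (by omega)] at hs
        simp at hs; omega
      have h1 := h.length_items
      have h2 : ∑ c ∈ (kids d nb v).toFinset, (A' c).length = 0 :=
        Finset.sum_eq_zero fun c hc => by
          rw [h.full hlt c (mem_kids.1 (List.mem_toFinset.1 hc)).2]; rfl
      have h3 := Finset.single_le_sum (f := fun c => (A c).length) (fun _ _ => Nat.zero_le _) hcn
      omega
    · exact hl (h.live_of_live ⟨u, hcu, hpos⟩)

theorem good' : s ≤ (A' v).length ∨ ¬ Live d (fun u => (A' u).length) v := by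
  rcases lt_or_ge out.length s with hlt | hge
  · exact Or.inr (h.not_live hlt)
  · refine Or.inl ?_
    rw [h.self, List.length_append]; omega

/-- Each moved record rises by one level. If `s` records move, the depth term drops by `s`; if fewer
move, `v` has lost all records below it and ceases to be live, which releases `s` as well. -/
theorem potential_add_le (hc : ∃ c, Ch d v c ∧ A c ≠ []) :
    potential d s nb (fun u => (A' u).length) + s ≤ potential d s nb (fun u => (A u).length) := by
  classical
  have h1 := h.length_items
  have e1 : ∑ u ∈ Finset.range nb, height d u * (A' u).length + out.length =
      ∑ u ∈ Finset.range nb, height d u * (A u).length := by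
    rw [sum_split (d := d) h.lt, sum_split (d := d) h.lt (fun u => height d u * (A u).length), h.self]
    have e2 : ∀ A : ℕ → List β, ∑ u ∈ (kids d nb v).toFinset, height d u * (A u).length =
        (height d v + 1) * ∑ u ∈ (kids d nb v).toFinset, (A u).length := by
      intro A
      rw [Finset.mul_sum]
      refine Finset.sum_congr rfl fun u hu => ?_
      rw [(mem_kids.1 (List.mem_toFinset.1 hu)).2.height]
    have e3 : ∑ u ∈ (Finset.range nb).filter (fun u => u ≠ v ∧ ¬ Ch d v u), height d u * (A' u).length =
        ∑ u ∈ (Finset.range nb).filter (fun u => u ≠ v ∧ ¬ Ch d v u), height d u * (A u).length := by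
      refine Finset.sum_congr rfl fun u hu => ?_
      obtain ⟨_, h1, h2⟩ := Finset.mem_filter.1 hu
      rw [h.other u h1 h2]
    rw [e2, e2, e3, ← h1, List.length_append]
    ring
  have hsub : (Finset.range nb).filter (Live d fun u => (A' u).length) ⊆
      (Finset.range nb).filter (Live d fun u => (A u).length) := by
    intro u hu
    rw [Finset.mem_filter] at hu ⊢
    exact ⟨hu.1, h.live_of_live hu.2⟩
  unfold potential
  dsimp only
  rcases lt_or_ge out.length s with hlt | hge
  · have hss : (Finset.range nb).filter (Live d fun u => (A' u).length) ⊂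
        (Finset.range nb).filter (Live d fun u => (A u).length) := by
      refine Finset.ssubset_iff_subset_ne.2 ⟨hsub, fun e => ?_⟩
      obtain ⟨c, hc, hne⟩ := hc
      have : v ∈ (Finset.range nb).filter (Live d fun u => (A u).length) :=
        Finset.mem_filter.2 ⟨Finset.mem_range.2 h.lt, c, Relation.TransGen.single hc,
          List.length_pos_of_ne_nil hne⟩
      rw [← e] at this
      exact h.not_live hlt (Finset.mem_filter.1 this).2
    have := Nat.mul_le_mul_left s (Finset.card_lt_card hss)
    rw [Nat.succ_eq_add_one, Nat.mul_add] at this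
    omega
  · have := Nat.mul_le_mul_left s (Finset.card_le_card hsub)
    omega

end Pulled

end Potential

end IOModel

namespace IOModel

/-! ## Multiway merging -/

section Merge

variable {m B : ℕ} {α : Type} [NeZero B]

/-- The records at the positions from `a` up to `b` of the area of node `v`. -/
def span (d : ℕ) (c : Config m B α) (v a b : ℕ) : List (WithTop α) :=
  ((List.range b).map (rcd d c v)).drop a

/-- Directory of the nodes: node `v` holds the positions from `off v` up to `len v` of its area. -/
structure Dir where
  off : ℕ → ℕ
  len : ℕ → ℕ

/-- The records in node `v`. -/
def node (d : ℕ) (c : Config m B α) (δ : Dir) (v : ℕ) : List (WithTop α) :=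
  span d c v (δ.off v) (δ.len v)

/-- State of a multiway merge: the cells of the merged records, the nodes that still have records in the
order of their first records, a cell list for the current block of each of them, and the directory. -/
structure MState (m : ℕ) where
  out : List (Fin (m + 2))
  heads : List ℕ
  buf : ℕ → List (Fin (m + 2))
  dir : Dir

/-- The cell of the first record of node `u`. -/
def MState.cell (B : ℕ) (st : MState m) (u : ℕ) : Fin (m + 2) := (st.buf u).getD (st.dir.off u % B) 0

/-- Insert the node `u` into the sorted list of nodes. -/
def MState.link (u : ℕ) (st : MState m) : Prog m B (MState m) :=
  (rank (st.cell B u) (st.heads.map (st.cell B))).bind fun r =>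
    .done { st with heads := st.heads.take r ++ u :: st.heads.drop r }

/-- Make the first record of node `u` available, if there is one. -/
def MState.enter (d : ℕ) (used : List (Fin (m + 2))) (force : Bool) (u : ℕ) (st : MState m) :
    Prog m B (MState m) :=
  if st.dir.off u < st.dir.len u then
    if force ∨ st.dir.off u % B = 0 then
      (loadBlock (u * (2 * d) + st.dir.off u / B) (st.out ++ (st.heads.flatMap st.buf ++ used))).bind
        fun K => MState.link u { st with buf := Function.update st.buf u K }
    else st.link u
  else .done st

def MState.enterAll (d : ℕ) (used : List (Fin (m + 2))) : List ℕ → MState m → Prog m B (MState m)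
  | [], st => .done st
  | u :: us, st => (st.enter d used true u).bind (MState.enterAll d used us)

/-- Remove the first record of node `u`. -/
def Dir.advance (δ : Dir) (u : ℕ) : Dir := { δ with off := Function.update δ.off u (δ.off u + 1) }

/-- Remove the first record of node `u`, which is the smallest one. -/
def MState.pop (B : ℕ) (st : MState m) (u : ℕ) (us : List ℕ) : MState m :=
  { st with out := st.out ++ [st.cell B u], heads := us, dir := st.dir.advance u }

def MState.loop (d : ℕ) (used : List (Fin (m + 2))) : ℕ → MState m → Prog m B (MState m)
  | 0, st => .done st
  | n + 1, st =>
    match st.heads with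
    | [] => .done st
    | u :: us => ((st.pop B u us).enter d used false u).bind (MState.loop d used n)

variable {d : ℕ} {c c₀ c' : Config m B α} {v a b u : ℕ}

theorem span_cons (h : a < b) : span d c v a b = rcd d c v a :: span d c v (a + 1) b := by
  unfold span
  rw [List.drop_eq_getElem_cons (by simpa using h)]
  simp

theorem span_of_le (h : b ≤ a) : span d c v a b = [] := by
  simp [span, h]

theorem length_span : (span d c v a b).length = b - a := by simp [span]

theorem span_congr (h : ∀ q < b, rcd d c v q = rcd d c' v q) : span d c v a b = span d c' v a b := by
  unfold span
  rw [List.map_congr_left fun q hq => h q (List.mem_range.1 hq)]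

theorem rcd_congr (h : c.disk = c'.disk) : rcd d c = rcd d c' := by
  funext v q; unfold rcd; rw [h]

theorem node_congr (h : c.disk = c'.disk) : node d c = node d c' := by
  funext δ v; unfold node span; rw [rcd_congr h]

theorem length_node {δ : Dir} : (node d c δ v).length = δ.len v - δ.off v := length_span

theorem node_advance_self {δ : Dir} (h : δ.off u < δ.len u) :
    node d c δ u = rcd d c u (δ.off u) :: node d c (δ.advance u) u := by
  unfold node
  rw [span_cons h]
  simp [Dir.advance]

theorem node_advance_of_ne {δ : Dir} (h : v ≠ u) : node d c (δ.advance u) v = node d c δ v := by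
  unfold node
  simp [Dir.advance, Function.update_of_ne h]

/-- The nodes of `E` that still have records are in the sorted list, and their blocks are cached. -/
structure Heads [LinearOrder α] (d : ℕ) (c : Config m B α) (E : List ℕ) (st : MState m) : Prop where
  nodup : st.heads.Nodup
  mem_iff : ∀ u, u ∈ st.heads ↔ u ∈ E ∧ st.dir.off u < st.dir.len u
  buf : ∀ u ∈ st.heads, (st.buf u).map c.mem =
    (List.range B).map (fun r => c.disk (u * (2 * d) + st.dir.off u / B) (Fin.ofNat B r))
  sorted : (st.heads.map fun u => rcd d c u (st.dir.off u)).Pairwise (· ≤ ·)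

theorem cell_eq {st : MState m} (h : (st.buf u).map c.mem =
    (List.range B).map (fun r => c.disk (u * (2 * d) + st.dir.off u / B) (Fin.ofNat B r))) :
    c.mem (st.cell B u) = rcd d c u (st.dir.off u) := by
  have hlt : st.dir.off u % B < B := Nat.mod_lt _ (Nat.pos_of_ne_zero (NeZero.ne B))
  have hlen : (st.buf u).length = B := by simpa using congrArg List.length h
  have h1 := congrArg (fun l => l[st.dir.off u % B]?) h
  simp only [List.getElem?_map, List.getElem?_range hlt, Option.map_some] at h1
  rw [List.getElem?_eq_getElem (by omega), Option.map_some, Option.some.injEq] at h1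
  unfold MState.cell
  rw [List.getD_eq_getElem _ _ (by omega), h1]
  unfold rcd
  congr 1
  simp [Fin.ofNat]

variable [LinearOrder α] {N : ℕ} {E : List ℕ} {st : MState m} {used : List (Fin (m + 2))} {k : ℕ}

theorem link_spec (h : Heads d c E st) (hu : u ∉ E) (hlt : st.dir.off u < st.dir.len u)
    (hbuf : (st.buf u).map c.mem =
      (List.range B).map (fun r => c.disk (u * (2 * d) + st.dir.off u / B) (Fin.ofNat B r)))
    (hk : st.heads.length < 2 ^ k) :
    Runs N (st.link (B := B) u) c fun st' c' i t => c' = c ∧ i = 0 ∧ t ≤ k ∧ st'.out = st.out ∧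
      st'.dir = st.dir ∧ Heads d c (u :: E) st' := by
  have hcell : ∀ w ∈ st.heads, c.mem (st.cell B w) = rcd d c w (st.dir.off w) :=
    fun w hw => cell_eq (h.buf w hw)
  have hmap : (st.heads.map (st.cell B)).map c.mem =
      st.heads.map fun u => rcd d c u (st.dir.off u) := by
    rw [List.map_map]
    exact List.map_congr_left hcell
  have hs := h.sorted
  have huh : u ∉ st.heads := fun hh => hu ((h.mem_iff u).1 hh).1
  refine Runs.bind (rank_spec _ _ c (by rw [hmap]; exact h.sorted) k (by simpa using hk)) ?_
  rintro r c' i t ⟨rfl, rfl, ht, hr, h1, h2⟩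
  have hperm : (st.heads.take r ++ u :: st.heads.drop r).Perm (u :: st.heads) := by
    refine List.perm_middle.trans ?_
    rw [List.take_append_drop]
  refine Runs.done ⟨rfl, rfl, ht, rfl, rfl, ?_⟩
  constructor
  · exact hperm.nodup_iff.2 (List.nodup_cons.2 ⟨huh, h.nodup⟩)
  · intro w
    rw [hperm.mem_iff, List.mem_cons, List.mem_cons, h.mem_iff]
    constructor
    · rintro (rfl | hw)
      · exact ⟨Or.inl rfl, hlt⟩
      · exact ⟨Or.inr hw.1, hw.2⟩
    · rintro ⟨rfl | hw, hw'⟩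
      · exact Or.inl rfl
      · exact Or.inr ⟨hw, hw'⟩
  · intro w hw
    rcases List.mem_cons.1 (hperm.mem_iff.1 hw) with rfl | hw
    · exact hbuf
    · exact h.buf w hw
  · have key1 : ∀ w ∈ st.heads.take r, rcd d c' w (st.dir.off w) ≤ rcd d c' u (st.dir.off u) := by
      intro w hw
      rw [← cell_eq hbuf, ← hcell w (List.mem_of_mem_take hw)]
      refine h1 _ ?_
      rw [← List.map_take]
      exact List.mem_map_of_mem hw
    have key2 : ∀ w ∈ st.heads.drop r, rcd d c' u (st.dir.off u) ≤ rcd d c' w (st.dir.off w) := by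
      intro w hw
      rw [← cell_eq hbuf, ← hcell w (List.mem_of_mem_drop hw)]
      refine h2 _ ?_
      rw [← List.map_drop]
      exact List.mem_map_of_mem hw
    rw [← List.take_append_drop r st.heads, List.map_append, List.pairwise_append] at hs
    simp only [List.map_append, List.map_cons, List.pairwise_append, List.pairwise_cons,
      List.mem_cons, List.mem_map]
    refine ⟨hs.1, ⟨?_, hs.2.1⟩, ?_⟩
    · rintro _ ⟨w, hw, rfl⟩
      exact key2 w hw
    · rintro _ ⟨w, hw, rfl⟩ y (rfl | ⟨w', hw', rfl⟩)
      · exact key1 w hw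
      · exact (key1 w hw).trans (key2 w' hw')

/-- The current block of a node stays cached while its records are consumed. An I/O is needed only
at the start, when `force` holds, or when the offset has reached the beginning of a block. -/
theorem enter_spec {force : Bool} (h : Heads d c E st) (hu : u ∉ E)
    (hbuf : force = false → st.dir.off u % B ≠ 0 → (st.buf u).map c.mem =
      (List.range B).map (fun r => c.disk (u * (2 * d) + st.dir.off u / B) (Fin.ofNat B r)))
    (hk : st.heads.length < 2 ^ k) (hm : st.out.length + (st.heads.length * B + used.length) + B ≤ m)
    (hN : st.dir.off u < st.dir.len u → u * (2 * d) + st.dir.off u / B < N) :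
    Runs N (st.enter d used force u) c fun st' c' i t => c'.disk = c.disk ∧
      i ≤ (if force ∨ st.dir.off u % B = 0 then 1 else 0) ∧ t ≤ B * i + k ∧ st'.out = st.out ∧
      st'.dir = st.dir ∧ (∀ x ∈ st.out ++ used, c'.mem x = c.mem x) ∧ Heads d c' (u :: E) st' := by
  unfold MState.enter
  split_ifs with hlt hf
  · have hlen : (st.out ++ (st.heads.flatMap st.buf ++ used)).length + B ≤ m := by
      have : (st.heads.flatMap st.buf).length = st.heads.length * B := by
        rw [List.length_flatMap, List.map_congr_left (g := fun _ => B), List.map_const',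
          List.sum_replicate, smul_eq_mul]
        intro w hw
        simpa using congrArg List.length (h.buf w hw)
      rw [List.length_append, List.length_append, this]
      exact hm
    refine Runs.bind (loadBlock_spec (hN hlt) hlen c) ?_
    rintro K c' i t ⟨rfl, rfl, hd, hf', hfr, hK⟩
    have hnu : u ∉ st.heads := fun hh => hu ((h.mem_iff u).1 hh).1
    have hH : Heads d c' E { st with buf := Function.update st.buf u K } := by
      refine ⟨h.nodup, h.mem_iff, fun w hw => ?_, ?_⟩
      · dsimp only at hw ⊢
        rw [Function.update_of_ne (by rintro rfl; exact hnu hw), hd, ← h.buf w hw]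
        refine List.map_congr_left fun x hx => hfr x ?_
        exact List.mem_append_right _ (List.mem_append_left _ (List.mem_flatMap.2 ⟨w, hw, hx⟩))
      · rw [rcd_congr hd]; exact h.sorted
    refine (link_spec hH hu hlt ?_ hk).mono ?_
    · dsimp only
      rw [Function.update_self, hK, hd]
    · rintro st' c'' i t ⟨rfl, rfl, ht, ho, hdir, hH'⟩
      refine ⟨hd, le_rfl, by omega, ho, hdir, fun x hx => hfr x ?_, hH'⟩
      rcases List.mem_append.1 hx with hx | hx
      · exact List.mem_append_left _ hx
      · exact List.mem_append_right _ (List.mem_append_right _ hx)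
  · have hf1 : force = false := by
      cases force
      · rfl
      · exact absurd (Or.inl rfl) hf
    refine (link_spec h hu hlt (hbuf hf1 fun h0 => hf (Or.inr h0)) hk).mono ?_
    rintro st' c' i t ⟨rfl, rfl, ht, ho, hdir, hH⟩
    exact ⟨rfl, le_rfl, by omega, ho, hdir, fun _ _ => rfl, hH⟩
  all_goals
    refine Runs.done ⟨rfl, Nat.zero_le _, by omega, rfl, rfl, fun _ _ => rfl, h.nodup, fun w => ?_, h.buf,
      h.sorted⟩
    rw [h.mem_iff, List.mem_cons]
    constructor
    · rintro ⟨h1, h2⟩; exact ⟨Or.inr h1, h2⟩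
    · rintro ⟨rfl | h1, h2⟩
      · exact absurd h2 hlt
      · exact ⟨h1, h2⟩

end Merge

end IOModel

/-! ### The loop of the multiway merge and its amortized number of block reads -/

namespace IOModel

/-- The remainder `o % B` counts the consumed records of the current block and serves as a
potential: it grows by one with each record and falls back to zero exactly when a block is read. -/
theorem mod_succ_add_le {B : ℕ} (hB : 0 < B) {o i : ℕ} (hi : i ≤ if (o + 1) % B = 0 then 1 else 0) :
    B * i + (o + 1) % B ≤ o % B + 1 := by
  have h1 := Nat.div_add_mod o B
  have h2 := Nat.mod_lt o hB
  by_cases h : o % B + 1 = B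
  · have h3 : (o + 1) % B = 0 := by
      rw [← h1, add_assoc, h, Nat.mul_add_mod, Nat.mod_self]
    rw [if_pos h3] at hi
    have := Nat.mul_le_mul_left B hi
    omega
  · have h3 : (o + 1) % B = o % B + 1 := by
      conv_lhs => rw [← h1, add_assoc, Nat.mul_add_mod]
      exact Nat.mod_eq_of_lt (by omega)
    rw [if_neg (by omega)] at hi
    obtain rfl : i = 0 := by omega
    omega

section Merge

variable {m B : ℕ} {α : Type} [NeZero B] {d s k N : ℕ} {c c' : Config m B α}
  {ks : List ℕ} {used : List (Fin (m + 2))}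

theorem node_suffix {δ₀ δ : Dir} (hlen : δ.len = δ₀.len) {u : ℕ} (hoff : δ₀.off u ≤ δ.off u) :
    ∃ pre, node d c δ₀ u = pre ++ node d c δ u := by
  obtain ⟨e, he⟩ := Nat.exists_eq_add_of_le hoff
  refine ⟨(node d c δ₀ u).take e, ?_⟩
  unfold node span
  rw [hlen, he, ← List.drop_drop, List.take_append_drop]

variable [LinearOrder α]

theorem Heads.congr {E E' : List ℕ} {st : MState m} (h : Heads d c E st) (hE : ∀ u, u ∈ E ↔ u ∈ E') :
    Heads d c E' st := ⟨h.nodup, fun u => by rw [h.mem_iff, hE], h.buf, h.sorted⟩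

theorem Heads.length_le {E : List ℕ} {st : MState m} (h : Heads d c E st) :
    st.heads.length ≤ E.length :=
  (h.nodup.subperm fun u hu => ((h.mem_iff u).1 hu).1).length_le

theorem enterAll_spec (us E : List ℕ) (st : MState m) (c : Config m B α) (h : Heads d c E st)
    (hnd : (us ++ E).Nodup) (hd : us.length + E.length ≤ d) (hk : d < 2 ^ k)
    (hm : st.out.length + used.length + d * B ≤ m)
    (hN : ∀ u ∈ us, st.dir.off u < st.dir.len u → u * (2 * d) + st.dir.off u / B < N) :
    Runs N (MState.enterAll d used us st) c fun st' c' i t => c'.disk = c.disk ∧ i ≤ us.length ∧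
      t ≤ B * i + k * us.length ∧ st'.out = st.out ∧ st'.dir = st.dir ∧
      (∀ x ∈ st.out ++ used, c'.mem x = c.mem x) ∧ Heads d c' (us ++ E) st' := by
  induction us generalizing E st c with
  | nil => exact Runs.done ⟨rfl, by simp, by simp, rfl, rfl, fun _ _ => rfl, h⟩
  | cons u us ih =>
    rw [List.cons_append, List.nodup_cons, List.mem_append, not_or] at hnd
    rw [List.length_cons] at hd
    have hl := h.length_le
    have hm' : (st.heads.length + 1) * B ≤ d * B := Nat.mul_le_mul_right _ (by omega)
    rw [Nat.succ_mul] at hm'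
    refine Runs.bind (enter_spec (k := k) (used := used) (force := true) h hnd.1.2 (by simp) (by omega) (by omega)
      (hN u List.mem_cons_self)) ?_
    rintro st' c' i t ⟨hd', hi, ht, ho, hdir, hf, hH⟩
    simp only [true_or, if_true] at hi
    refine (ih (u :: E) st' c' hH ?_ ?_ ?_ ?_).mono ?_
    · exact (List.perm_middle.nodup_iff).2 (List.nodup_cons.2 ⟨by simp [hnd.1], hnd.2⟩)
    · simp only [List.length_cons]; omega
    · rw [ho]; exact hm
    · rw [hdir]
      exact fun w hw => hN w (List.mem_cons_of_mem _ hw)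
    · rintro st'' c'' i' t' ⟨hd'', hi', ht', ho', hdir', hf', hH'⟩
      refine ⟨hd''.trans hd', ?_, ?_, ho'.trans ho, hdir'.trans hdir, fun x hx => ?_, hH'.congr ?_⟩
      · simp only [List.length_cons]; omega
      · simp only [List.length_cons]
        nlinarith
      · rw [hf' x (by rw [ho]; exact hx), hf x hx]
      · intro w; simp [or_left_comm]

theorem sum_add_eq {M : Type*} [AddCommMonoid M] {S : Finset ℕ} {f f' : ℕ → M} {u : ℕ} (hu : u ∈ S)
    (h : ∀ w ∈ S, w ≠ u → f' w = f w) : ∑ w ∈ S, f' w + f u = ∑ w ∈ S, f w + f' u := by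
  rw [← Finset.add_sum_erase S f hu, ← Finset.add_sum_erase S f' hu,
    Finset.sum_congr rfl fun w hw => h w (Finset.mem_of_mem_erase hw) (Finset.ne_of_mem_erase hw)]
  rw [add_right_comm, add_comm (f' u), add_right_comm, add_comm (f u)]

/-- The records `recs` have been merged, and the directory has changed from `δ₀` to `δ`. -/
structure Merging (d s : ℕ) (c : Config m B α) (ks : List ℕ) (δ₀ δ : Dir) (recs : List (WithTop α)) :
    Prop where
  len_eq : δ.len = δ₀.len
  off_le : ∀ u, δ₀.off u ≤ δ.off u
  off_le' : ∀ u, δ.off u ≤ δ₀.off u + recs.length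
  other : ∀ u, u ∉ ks → δ.off u = δ₀.off u
  items : (recs : Multiset (WithTop α)) + ∑ u ∈ ks.toFinset, (node d c δ u : Multiset (WithTop α)) =
    ∑ u ∈ ks.toFinset, (node d c δ₀ u : Multiset (WithTop α))
  sorted : recs.Pairwise (· ≤ ·)
  le : ∀ x ∈ recs, ∀ u ∈ ks, ∀ y ∈ node d c δ u, x ≤ y
  dom : ∀ x ∈ recs, ∀ u ∈ ks, s ≤ (node d c δ₀ u).length → ∃ z ∈ node d c δ₀ u, x ≤ z

theorem Merging.pop {δ₀ δ : Dir} {recs : List (WithTop α)} (h : Merging d s c ks δ₀ δ recs) {u : ℕ}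
    (hu : u ∈ ks) (hlt : δ.off u < δ.len u)
    (hmin : ∀ w ∈ ks, ∀ y ∈ node d c δ w, rcd d c u (δ.off u) ≤ y) (hs : recs.length < s) :
    Merging d s c ks δ₀ (δ.advance u) (recs ++ [rcd d c u (δ.off u)]) := by
  have hcons := node_advance_self (d := d) (c := c) hlt
  have hsub : ∀ w, ∀ y ∈ node d c (δ.advance u) w, y ∈ node d c δ w := by
    intro w y hy
    by_cases e : w = u
    · subst e; rw [hcons]; exact List.mem_cons_of_mem _ hy
    · rwa [node_advance_of_ne e] at hy
  constructor
  · exact h.len_eq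
  · intro w
    have := h.off_le w
    by_cases e : w = u
    · subst e; simp [Dir.advance]; omega
    · simpa [Dir.advance, Function.update_of_ne e] using this
  · intro w
    have := h.off_le' w
    rw [List.length_append, List.length_singleton]
    by_cases e : w = u
    · subst e; simp [Dir.advance]; omega
    · simp [Dir.advance, Function.update_of_ne e]; omega
  · intro w hw
    have e : w ≠ u := by rintro rfl; exact hw hu
    simpa [Dir.advance, Function.update_of_ne e] using h.other w hw
  · rw [← h.items]
    have e := sum_add_eq (S := ks.toFinset) (f := fun w => (node d c δ w : Multiset (WithTop α)))
      (f' := fun w => (node d c (δ.advance u) w : Multiset (WithTop α))) (List.mem_toFinset.2 hu)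
      (fun w _ hw => by rw [node_advance_of_ne hw])
    rw [hcons, ← Multiset.cons_coe, ← Multiset.singleton_add, ← add_assoc] at e
    have e := add_right_cancel e
    rw [← e, ← Multiset.coe_add, add_assoc, Multiset.coe_singleton]
    congr 1
    exact add_comm _ _
  · refine List.pairwise_append.2 ⟨h.sorted, by simp, fun x hx y hy => ?_⟩
    rw [List.mem_singleton] at hy
    subst hy
    exact h.le x hx u hu _ (by rw [hcons]; exact List.mem_cons_self)
  · intro x hx w hw y hy
    rcases List.mem_append.1 hx with hx | hx
    · exact h.le x hx w hw y (hsub w y hy)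
    · rw [List.mem_singleton] at hx
      subst hx
      exact hmin w hw y (hsub w y hy)
  · intro x hx w hw hsw
    rcases List.mem_append.1 hx with hx | hx
    · exact h.dom x hx w hw hsw
    · rw [List.mem_singleton] at hx
      subst hx
      rw [length_node] at hsw
      have h1 := h.off_le' w
      -- Fewer than `s` records have been merged, so a node that began with `s` of them still has a
      -- first record, and the record being removed does not exceed it.
      have hlen : δ.off w < δ.len w := by rw [h.len_eq]; omega
      have hmem := node_advance_self (d := d) (c := c) hlen
      obtain ⟨pre, e⟩ := node_suffix (d := d) (c := c) h.len_eq (h.off_le w)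
      refine ⟨rcd d c w (δ.off w), ?_, hmin w hw _ ?_⟩
      · rw [e, hmem]; exact List.mem_append_right _ List.mem_cons_self
      · rw [hmem]; exact List.mem_cons_self

/-- The sorted list of heads makes its first entry the minimum of all remaining records. The bound
on the I/Os telescopes through the remainders of the offsets, so B times the number of reads is at
most the number of merged records plus B for each child. The time adds one binary search among the
heads per record. -/
theorem loop_spec (δ₀ : Dir) (hks : ks.Nodup) (hd : ks.length ≤ d) (hk : d < 2 ^ k)
    (hm : s + used.length + d * B ≤ m)
    (hsort : ∀ u ∈ ks, (node d c δ₀ u).Pairwise (· ≤ ·))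
    (hN : ∀ u ∈ ks, ∀ q < δ₀.len u, u * (2 * d) + q / B < N)
    (n : ℕ) (st : MState m) (c₁ : Config m B α) (hc : c₁.disk = c.disk) (h : Heads d c₁ ks st)
    (hM : Merging d s c ks δ₀ st.dir (st.out.map c₁.mem)) (hn : st.out.length + n ≤ s) :
    Runs N (MState.loop d used n st) c₁ fun st' c' i t => c'.disk = c.disk ∧
      (∀ x ∈ used, c'.mem x = c₁.mem x) ∧ Heads d c' ks st' ∧
      Merging d s c ks δ₀ st'.dir (st'.out.map c'.mem) ∧ st'.out.length ≤ st.out.length + n ∧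
      (st'.out.length = st.out.length + n ∨ st'.heads = []) ∧
      B * i + ∑ u ∈ ks.toFinset, st'.dir.off u % B + st.out.length ≤
        st'.out.length + ∑ u ∈ ks.toFinset, st.dir.off u % B ∧
      t ≤ B * i + k * n := by
  have hB : 0 < B := Nat.pos_of_ne_zero (NeZero.ne B)
  induction n generalizing st c₁ with
  | zero => exact Runs.done ⟨hc, fun _ _ => rfl, h, hM, by omega, Or.inl rfl, by omega, by omega⟩
  | succ n ih =>
    unfold MState.loop
    split
    · rename_i h0
      exact Runs.done ⟨hc, fun _ _ => rfl, h, hM, by omega, Or.inr h0, by omega, by omega⟩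
    · rename_i u us h0
      have hnd := h.nodup
      have hso := h.sorted
      rw [h0, List.nodup_cons] at hnd
      rw [h0, List.map_cons, List.pairwise_cons] at hso
      have hu := (h.mem_iff u).1 (by rw [h0]; exact List.mem_cons_self)
      have hcell := cell_eq (h.buf u (by rw [h0]; exact List.mem_cons_self))
      rw [rcd_congr hc] at hcell hso
      have hl := h.length_le
      rw [h0, List.length_cons] at hl
      have hus : ∀ w ∈ us, w ≠ u := fun w hw e => hnd.1 (e ▸ hw)
      have hH : Heads d c₁ (ks.erase u) (st.pop B u us) := by
        refine ⟨hnd.2, fun w => ?_, fun w hw => ?_, ?_⟩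
        · rw [hks.mem_erase_iff]
          have h1 := h.mem_iff w
          rw [h0, List.mem_cons] at h1
          by_cases e : w = u
          · subst e
            simp [MState.pop, hnd.1]
          · simp only [e, false_or] at h1
            simp [MState.pop, h1, e, Dir.advance]
        · have e := hus w hw
          have := h.buf w (by rw [h0]; exact List.mem_cons_of_mem _ hw)
          simpa [MState.pop, Dir.advance, Function.update_of_ne e] using this
        · have : us.map (fun w => rcd d c₁ w ((st.pop B u us).dir.off w)) =
              us.map fun w => rcd d c₁ w (st.dir.off w) :=
            List.map_congr_left fun w hw => by
              simp [MState.pop, Dir.advance, Function.update_of_ne (hus w hw)]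
          show (us.map _).Pairwise _
          rw [this, rcd_congr hc]; exact hso.2
      have hmin : ∀ w ∈ ks, ∀ y ∈ node d c st.dir w, rcd d c u (st.dir.off u) ≤ y := by
        intro w hw y hy
        have hlt : st.dir.off w < st.dir.len w := by
          by_contra hge
          unfold node at hy
          rw [span_of_le (by omega)] at hy
          cases hy
        have hw' := (h.mem_iff w).2 ⟨hw, hlt⟩
        obtain ⟨pre, e⟩ := node_suffix (d := d) (c := c) hM.len_eq (hM.off_le w)
        have hs := hsort w hw
        rw [e, List.pairwise_append, node_advance_self hlt, List.pairwise_cons] at hs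
        have h1 : rcd d c u (st.dir.off u) ≤ rcd d c w (st.dir.off w) := by
          rw [h0, List.mem_cons] at hw'
          rcases hw' with rfl | hw'
          · exact le_rfl
          · exact hso.1 _ (List.mem_map_of_mem hw')
        rw [node_advance_self hlt, List.mem_cons] at hy
        rcases hy with rfl | hy
        · exact h1
        · exact h1.trans (hs.2.1.1 y hy)
      have hM' := hM.pop hu.1 hu.2 hmin (by rw [List.length_map]; omega)
      have hm' : (us.length + 1) * B ≤ d * B := Nat.mul_le_mul_right _ (by omega)
      rw [Nat.succ_mul] at hm'
      have hoff : (st.pop B u us).dir.off u = st.dir.off u + 1 := by simp [MState.pop, Dir.advance]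
      have hout : (st.pop B u us).out.length = st.out.length + 1 := by simp [MState.pop]
      have hdiv := Nat.div_add_mod (st.dir.off u) B
      have hmodlt := Nat.mod_lt (st.dir.off u) hB
      refine Runs.bind (enter_spec (k := k) (used := used) (force := false) (u := u) hH ?_ ?_ ?_ ?_ ?_) ?_
      · exact fun hh => (hks.mem_erase_iff.1 hh).1 rfl
      · intro _ hmod
        rw [hoff] at hmod ⊢
        have e : (st.dir.off u + 1) / B = st.dir.off u / B := by
          rw [Nat.succ_div, if_neg fun hh => hmod (Nat.mod_eq_zero_of_dvd hh), add_zero]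
        rw [e]
        exact h.buf u (by rw [h0]; exact List.mem_cons_self)
      · show us.length < 2 ^ k
        omega
      · show (st.pop B u us).out.length + (us.length * B + used.length) + B ≤ m
        rw [hout]; omega
      · intro hlt
        refine hN u hu.1 _ ?_
        rw [← hM.len_eq]; exact hlt
      · rintro st' c' i t ⟨hd', hi, ht, ho, hdir, hf, hH'⟩
        have hmap : st'.out.map c'.mem = st.out.map c₁.mem ++ [rcd d c u (st.dir.off u)] := by
          rw [ho, List.map_congr_left fun x hx => hf x (List.mem_append_left _ hx)]
          simp [MState.pop, hcell]
        have hout' : st'.out.length = st.out.length + 1 := by rw [ho, hout]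
        refine (ih st' c' (hd'.trans hc) (hH'.congr fun w => ?_) ?_ (by omega)).mono ?_
        · rw [List.mem_cons, hks.mem_erase_iff]
          constructor
          · rintro (rfl | hw)
            · exact hu.1
            · exact hw.2
          · intro hw
            by_cases e : w = u
            · exact Or.inl e
            · exact Or.inr ⟨e, hw⟩
        · rw [hmap, hdir]; exact hM'
        · rintro st'' c'' i' t' ⟨hd'', hf'', hH'', hM'', hle, hor, hio, htime⟩
          have hsum := sum_add_eq (S := ks.toFinset) (f := fun w => st.dir.off w % B)
            (f' := fun w => st'.dir.off w % B) (u := u) (List.mem_toFinset.2 hu.1) (by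
              intro w _ hw
              rw [hdir]
              simp [MState.pop, Dir.advance, Function.update_of_ne hw])
          have hoff' : st'.dir.off u = st.dir.off u + 1 := by rw [hdir, hoff]
          have hstep := mod_succ_add_le hB (o := st.dir.off u) (i := i) (by
            rw [← hoff]; simpa using hi)
          refine ⟨hd'', fun x hx => ?_, hH'', hM'', by omega,
            hor.imp_left fun e => by omega, ?_, ?_⟩
          · rw [hf'' x hx, hf x (List.mem_append_right _ hx)]
          · rw [hoff'] at hsum
            rw [Nat.mul_add]
            omega
          · rw [Nat.mul_add, Nat.mul_succ]; omega

end Merge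

end IOModel

/-! ### Refilling one node from its children -/

namespace IOModel

theorem Pulled.out_ne_nil {β : Type*} [LinearOrder β] {d s nb v : ℕ} {A A' : ℕ → List β} {out : List β}
    (h : Pulled d s nb v A A' out) (hs : 0 < s) (hc : ∃ c, Ch d v c ∧ A c ≠ []) : out ≠ [] := by
  rintro rfl
  obtain ⟨c, hc, hne⟩ := hc
  have h1 := h.length_items
  have h2 : ∑ c ∈ (kids d nb v).toFinset, (A' c).length = 0 :=
    Finset.sum_eq_zero fun c hc => by
      rw [h.full hs c (mem_kids.1 (List.mem_toFinset.1 hc)).2]; rfl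
  have hcn : c ∈ (kids d nb v).toFinset := by
    rw [List.mem_toFinset, mem_kids]
    exact ⟨by_contra fun hge => hne (h.empty c (by omega)), hc⟩
  have h3 := Finset.single_le_sum (f := fun c => (A c).length) (fun _ _ => Nat.zero_le _) hcn
  have h4 := List.length_pos_of_ne_nil hne
  simp only [List.length_nil] at h1
  omega

section Refill

variable {m B : ℕ} {α : Type} [NeZero B]

/-- Move records from the children to the node `v`. -/
def pull (d nb : ℕ) (used : List (Fin (m + 2))) (v : ℕ) (δ : Dir) : Prog m B Dir :=
  (loadBlocks d v used (blocksFor B (δ.len v))).bind fun L =>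
  (MState.enterAll d ((L.take (δ.len v)).drop (δ.off v) ++ used) (kids d nb v)
    ⟨[], [], fun _ => [], δ⟩).bind fun st =>
  (MState.loop d ((L.take (δ.len v)).drop (δ.off v) ++ used) (d * B) st).bind fun st =>
  (storeBlocks d v ((L.take (δ.len v)).drop (δ.off v) ++ st.out)
    (blocksFor B ((L.take (δ.len v)).drop (δ.off v) ++ st.out).length)).bind fun _ =>
  .done ⟨Function.update st.dir.off v 0,
    Function.update st.dir.len v ((L.take (δ.len v)).drop (δ.off v) ++ st.out).length⟩

/-- A heap of sorted nodes in external memory. -/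
structure DiskInv [LinearOrder α] (d nb : ℕ) (c : Config m B α) (δ : Dir) : Prop where
  len_le : ∀ v, δ.len v ≤ 2 * (d * B)
  empty : ∀ v, nb ≤ v → δ.len v = 0
  sorted : ∀ v, (node d c δ v).Pairwise (· ≤ ·)
  heap : Heap d (node d c δ)

theorem span_of_stored {d : ℕ} {c c' : Config m B α} {v : ℕ} {X : List (Fin (m + 2))}
    (h : ∀ q < X.length, rcd d c' v q = c.mem (X.getD q 0)) :
    span d c' v 0 X.length = X.map c.mem := by
  unfold span
  rw [List.drop_zero]
  refine List.ext_getElem (by simp) fun q h1 h2 => ?_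
  have hq : q < X.length := by simpa using h1
  simp only [List.getElem_map, List.getElem_range]
  rw [h q hq, List.getD_eq_getElem _ _ hq]

theorem node_of_loaded {d : ℕ} {c c' : Config m B α} {v k : ℕ} {δ : Dir} {L : List (Fin (m + 2))}
    (h : L.map c'.mem = (List.range (k * B)).map (rcd d c v)) (hk : δ.len v ≤ k * B) :
    ((L.take (δ.len v)).drop (δ.off v)).map c'.mem = node d c δ v := by
  unfold node span
  rw [List.map_drop, List.map_take, h, ← List.map_take, List.take_range, min_eq_left hk]

variable [LinearOrder α] {d k nb v : ℕ} {c c' : Config m B α} {δ : Dir} {used : List (Fin (m + 2))}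

theorem DiskInv.node_eq_nil (h : DiskInv d nb c δ) {u : ℕ} (hu : nb ≤ u) : node d c δ u = [] := by
  rw [← List.length_eq_zero_iff, length_node, h.empty u hu, Nat.zero_sub]

/-- In units of d B the transfers cost 2 for reading `v`, 1 for the first blocks of the children, 2
for the further blocks during the merge and 2 for writing `v`, which makes 7. The term with `k`
counts the binary searches, at most d B of them both for entering the children and in the loop. The
node began with fewer than d B records and receives at most d B, so it fits into its area. -/
theorem pull_spec (hd : 0 < d) (hk : d < 2 ^ k) (hm : 4 * (d * B) ≤ m) (hused : used.length ≤ d * B)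
    (h : DiskInv d nb c δ) (hv : v < nb) (hsz : (node d c δ v).length < d * B)
    (hgood : ∀ u, Ch d v u → d * B ≤ (node d c δ u).length ∨
      ¬ Live d (fun u => (node d c δ u).length) u) :
    Runs (nb * (2 * d)) (pull d nb used v δ) c fun δ' c' i t =>
      (∃ out, Pulled d (d * B) nb v (node d c δ) (node d c' δ') out) ∧ DiskInv d nb c' δ' ∧
      (∀ x ∈ used, c'.mem x = c.mem x) ∧ B * i ≤ 7 * (d * B) ∧ t ≤ 7 * (d * B) + 2 * (k * (d * B)) := by
  have hB : 0 < B := Nat.pos_of_ne_zero (NeZero.ne B)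
  have hBs : d ≤ d * B := Nat.le_mul_of_pos_right d hB
  have hs : 0 < d * B := by omega
  set s := d * B with hsdef
  have hblk : blocksFor B (δ.len v) ≤ 2 * d := blocksFor_le hB (by rw [mul_assoc]; exact h.len_le v)
  have haddr : ∀ u < nb, u * (2 * d) + 2 * d ≤ nb * (2 * d) := by
    intro u hu
    rw [← Nat.succ_mul]
    exact Nat.mul_le_mul_right _ hu
  have hblkB : blocksFor B (δ.len v) * B ≤ 2 * s := by
    rw [hsdef, ← mul_assoc]; exact Nat.mul_le_mul_right _ hblk
  have hks : (kids d nb v).length ≤ d := length_kids_le hd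
  refine Runs.bind (loadBlocks_spec d (v := v) (used := used) (blocksFor B (δ.len v))
    ((Nat.add_le_add_left hblk _).trans (haddr v hv)) (by omega) c) ?_
  rintro L c₁ i₁ t₁ ⟨rfl, rfl, hd₁, hf₁, hu₁, hL⟩
  have hV := node_of_loaded hL (le_blocksFor_mul hB (δ.len v))
  set V := (L.take (δ.len v)).drop (δ.off v) with hVdef
  have hVlen : V.length = (node d c δ v).length := by rw [← hV, List.length_map]
  have hnode₁ : node d c₁ = node d c := node_congr hd₁
  have hUlen : (V ++ used).length < 2 * s := by rw [List.length_append]; omega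
  have hN : ∀ u ∈ kids d nb v, ∀ q < δ.len u, u * (2 * d) + q / B < nb * (2 * d) := by
    intro u hu q hq
    have h1 := h.len_le u
    have h2 : q / B < 2 * d := by
      rw [Nat.div_lt_iff_lt_mul hB, mul_assoc]; omega
    have := haddr u (mem_kids.1 hu).1
    omega
  refine Runs.bind (enterAll_spec (k := k) (used := V ++ used) (kids d nb v) []
    ⟨[], [], fun _ => [], δ⟩ c₁ ⟨by simp, by simp, by simp, by simp⟩ (by simpa using kids_nodup)
    (by simpa using hks) hk (by simp only [List.length_nil]; omega)
    (fun u hu hlt => hN u hu _ hlt)) ?_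
  rintro st₂ c₂ i₂ t₂ ⟨hd₂, hi₂, ht₂, ho₂, hdir₂, hf₂, hH₂⟩
  dsimp only at ho₂ hdir₂ hf₂
  rw [List.append_nil] at hH₂
  have hM₂ : Merging d s c (kids d nb v) δ st₂.dir (st₂.out.map c₂.mem) := by
    rw [ho₂, hdir₂]
    exact ⟨rfl, fun _ => le_rfl, fun _ => Nat.le_add_right _ _, fun _ _ => rfl, by simp, by simp,
      by simp, by simp⟩
  refine Runs.bind (loop_spec (s := s) (k := k) (used := V ++ used) δ kids_nodup hks hk (by omega)
    (fun u _ => h.sorted u) hN (d * B) st₂ c₂ (hd₂.trans hd₁) hH₂ hM₂ (by rw [ho₂]; simp [hsdef])) ?_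
  rintro st₃ c₃ i₃ t₃ ⟨hd₃, hf₃, hH₃, hM₃, hle₃, hor₃, hio₃, ht₃⟩
  simp only [ho₂, List.length_nil, zero_add, add_zero] at hle₃ hor₃ hio₃
  rw [← hsdef] at hle₃ hor₃ ht₃
  have hVmem : V.map c₃.mem = node d c δ v := by
    rw [← hV]
    refine List.map_congr_left fun x hx => ?_
    rw [hf₃ x (List.mem_append_left _ hx), hf₂ x (by simp [hx])]
  set X := V ++ st₃.out with hX
  have hXlen : X.length ≤ 2 * s := by rw [hX, List.length_append]; omega
  have hblk' : blocksFor B X.length ≤ 2 * d :=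
    blocksFor_le hB (by rw [mul_assoc, ← hsdef]; exact hXlen)
  have hblkB' : blocksFor B X.length * B ≤ 2 * s := by
    rw [hsdef, ← mul_assoc]; exact Nat.mul_le_mul_right _ hblk'
  refine Runs.bind (storeBlocks_spec (d := d) (v := v) X (blocksFor B X.length) hblk'
    ((Nat.add_le_add_left hblk' _).trans (haddr v hv)) c₃) ?_
  rintro _ c₄ i₄ t₄ ⟨rfl, rfl, hm₄, hs₄, ho₄⟩
  have hvk : v ∉ kids d nb v := fun hh => lt_irrefl _ (mem_kids.1 hh).2.lt
  set δ' : Dir := ⟨Function.update st₃.dir.off v 0, Function.update st₃.dir.len v X.length⟩ with hδ'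
  have hself : node d c₄ δ' v = node d c δ v ++ st₃.out.map c₃.mem := by
    unfold node at hVmem ⊢
    rw [← hVmem]
    simp only [hδ', Function.update_self]
    rw [span_of_stored (c := c₃) fun q hq => hs₄ q (hq.trans_le (le_blocksFor_mul hB _)), hX,
      List.map_append]
  have hother : ∀ u, u ≠ v → node d c₄ δ' u = node d c st₃.dir u := by
    intro u hu
    unfold node
    simp only [hδ', Function.update_of_ne hu]
    refine span_congr fun q hq => ?_
    rw [hM₃.len_eq] at hq
    rw [ho₄ u hu q (hq.trans_le (h.len_le u)), rcd_congr hd₃]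
  have hpull : Pulled d s nb v (node d c δ) (node d c₄ δ') (st₃.out.map c₃.mem) := by
    have hke : ∀ u, Ch d v u → u ∉ kids d nb v → nb ≤ u := fun u hu hn => by
      by_contra hlt
      exact hn (mem_kids.2 ⟨by omega, hu⟩)
    have hsuf : ∀ u, u ≠ v → ∃ pre, node d c δ u = pre ++ node d c₄ δ' u := fun u hu => by
      rw [hother u hu]; exact node_suffix hM₃.len_eq (hM₃.off_le u)
    have hnil : ∀ u, Ch d v u → u ∉ kids d nb v → node d c₄ δ' u = [] := by
      intro u hu hn
      obtain ⟨pre, e⟩ := hsuf u hu.lt.ne'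
      rw [h.node_eq_nil (hke u hu hn)] at e
      exact (List.append_eq_nil_iff.1 e.symm).2
    refine ⟨hv, fun u hu => h.node_eq_nil hu, hself, fun u hu => hsuf u hu.lt.ne', ?_, ?_, ?_, ?_, ?_, ?_,
      hgood⟩
    · intro u hu hn
      rw [hother u hu]
      unfold node
      rw [hM₃.len_eq, hM₃.other u fun hh => hn (mem_kids.1 hh).2]
    · rw [← hM₃.items]
      congr 1
      refine Finset.sum_congr rfl fun u hu => ?_
      rw [hother u (mem_kids.1 (List.mem_toFinset.1 hu)).2.lt.ne']
    · intro u hu x hx y hy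
      by_cases hn : u ∈ kids d nb v
      · rw [hother u hu.lt.ne'] at hy
        exact hM₃.le x hx u hn y hy
      · rw [hnil u hu hn] at hy; cases hy
    · intro x hx u hu hsu
      refine hM₃.dom x hx u (by_contra fun hn => ?_) hsu
      rw [h.node_eq_nil (hke u hu hn)] at hsu
      simp at hsu; omega
    · rw [List.length_map]; exact hle₃
    · intro hlt u hu
      rw [List.length_map] at hlt
      by_cases hn : u ∈ kids d nb v
      · have h0 := hor₃.resolve_left (by omega)
        have h1 := hH₃.mem_iff u
        rw [h0] at h1
        rw [hother u hu.lt.ne', ← List.length_eq_zero_iff, length_node]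
        have : ¬ st₃.dir.off u < st₃.dir.len u := fun hh => by simpa using h1.2 ⟨hn, hh⟩
        omega
      · exact hnil u hu hn
  have hsum : ∑ u ∈ (kids d nb v).toFinset, st₂.dir.off u % B ≤ s := by
    refine (Finset.sum_le_card_nsmul _ _ B fun u _ => (Nat.mod_lt _ hB).le).trans ?_
    rw [smul_eq_mul, hsdef]
    exact Nat.mul_le_mul_right _ ((List.toFinset_card_le _).trans hks)
  have hi₂' : B * i₂ ≤ s := by
    rw [hsdef, mul_comm]; exact Nat.mul_le_mul_right _ (hi₂.trans hks)
  have hk₂ : k * (kids d nb v).length ≤ k * s := Nat.mul_le_mul_left _ (hks.trans hBs)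
  refine Runs.done ⟨⟨_, hpull⟩, ⟨?_, ?_, ?_, hpull.heap h.heap⟩, ?_, ?_, ?_⟩
  · intro u
    by_cases hu : u = v
    · subst hu; simpa [hδ'] using hXlen
    · simp only [hδ', Function.update_of_ne hu, hM₃.len_eq]; exact h.len_le u
  · intro u hu
    simp only [hδ', Function.update_of_ne (show u ≠ v by omega), hM₃.len_eq]
    exact h.empty u hu
  · intro u
    by_cases hu : u = v
    · subst hu
      rw [hself, List.pairwise_append]
      refine ⟨h.sorted u, hM₃.sorted, fun x hx y hy => ?_⟩
      obtain ⟨w, hw, hy⟩ := hpull.mem_out hy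
      exact h.heap u w (Relation.TransGen.single hw) x hx y hy
    · rw [hother u hu]
      obtain ⟨pre, e⟩ := node_suffix (d := d) (c := c) hM₃.len_eq (hM₃.off_le u)
      have := h.sorted u
      rw [e, List.pairwise_append] at this
      exact this.2.1
  · intro x hx
    rw [hm₄, hf₃ x (List.mem_append_right _ hx), hf₂ x (by simp [hx]), hu₁ x hx]
  · rw [mul_comm] at hblkB hblkB'
    simp only [Nat.mul_add, add_zero]
    omega
  · rw [mul_comm] at hblkB hblkB'
    have h1 := mul_comm B (blocksFor B (δ.len v))
    have h2 := mul_comm B (blocksFor B X.length)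
    omega

end Refill

end IOModel

/-! ### Recursive refilling, paid for by the potential -/

namespace IOModel

theorem live_congr {d : ℕ} {sz sz' : ℕ → ℕ} {v : ℕ} (h : ∀ u, Desc d v u → sz u = sz' u) :
    Live d sz v ↔ Live d sz' v :=
  exists_congr fun u => and_congr_right fun hu => by rw [h u hu]

section Refill

variable {m B : ℕ} {α : Type} [NeZero B]

def forEach (g : ℕ → Dir → Prog m B Dir) : List ℕ → Dir → Prog m B Dir
  | [], δ => .done δ
  | u :: us, δ => (g u δ).bind (forEach g us)

open Classical in
/-- If the node `v` has few records then refill it from its descendants. -/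
noncomputable def refill (d nb : ℕ) (used : List (Fin (m + 2))) : ℕ → ℕ → Dir → Prog m B Dir
  | 0, _, δ => .done δ
  | f + 1, v, δ =>
    if δ.len v - δ.off v < d * B ∧ Live d (fun u => δ.len u - δ.off u) v then
      (forEach (refill d nb used f) (kids d nb v) δ).bind (pull d nb used v)
    else .done δ

variable {d k nb : ℕ} {used : List (Fin (m + 2))}

/-- The sizes of the nodes. -/
def sizes (d : ℕ) (c : Config m B α) (δ : Dir) (v : ℕ) : ℕ := (node d c δ v).length

theorem sizes_eq (c : Config m B α) (δ : Dir) : sizes d c δ = fun v => δ.len v - δ.off v :=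
  funext fun _ => length_node

/-- The node `v` has enough records or contains all records of its subtree, and it is empty only if it
and its descendants were empty. -/
structure Filled (d : ℕ) (c : Config m B α) (δ : Dir) (c' : Config m B α) (δ' : Dir) (v : ℕ) : Prop where
  good : d * B ≤ sizes d c' δ' v ∨ ¬ Live d (sizes d c' δ') v
  pos : 0 < sizes d c δ v ∨ Live d (sizes d c δ) v → 0 < sizes d c' δ' v

theorem Filled.congr {c c' c₁ c₁' : Config m B α} {δ δ' δ₁ δ₁' : Dir} {v : ℕ}
    (h : Filled d c δ c' δ' v) (h1 : ∀ u, DescR d v u → node d c₁ δ₁ u = node d c δ u)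
    (h2 : ∀ u, DescR d v u → node d c₁' δ₁' u = node d c' δ' u) : Filled d c₁ δ₁ c₁' δ₁' v := by
  have e1 : ∀ u, DescR d v u → sizes d c₁ δ₁ u = sizes d c δ u := fun u hu => by
    unfold sizes; rw [h1 u hu]
  have e2 : ∀ u, DescR d v u → sizes d c₁' δ₁' u = sizes d c' δ' u := fun u hu => by
    unfold sizes; rw [h2 u hu]
  have l1 := live_congr (v := v) fun u hu => e1 u hu.to_reflTransGen
  have l2 := live_congr (v := v) fun u hu => e2 u hu.to_reflTransGen
  constructor
  · rw [e2 v .refl, l2]; exact h.good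
  · rw [e1 v .refl, e2 v .refl, l1]; exact h.pos

variable [LinearOrder α]

/-- The heap has been reorganized at a cost that is paid by the potential. -/
structure Moved (d k nb : ℕ) (used : List (Fin (m + 2))) (c : Config m B α) (δ : Dir)
    (c' : Config m B α) (δ' : Dir) (i t : ℕ) : Prop where
  inv : DiskInv d nb c' δ'
  frame : ∀ x ∈ used, c'.mem x = c.mem x
  total_eq : total nb (node d c' δ') = total nb (node d c δ)
  ios : B * i + 7 * potential d (d * B) nb (sizes d c' δ') ≤ 7 * potential d (d * B) nb (sizes d c δ)
  time : t + (7 + 2 * k) * potential d (d * B) nb (sizes d c' δ') ≤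
    (7 + 2 * k) * potential d (d * B) nb (sizes d c δ)

theorem Moved.refl {c : Config m B α} {δ : Dir} (h : DiskInv d nb c δ) : Moved d k nb used c δ c δ 0 0 :=
  ⟨h, fun _ _ => rfl, rfl, by simp, by simp⟩

theorem Moved.trans {c c' c'' : Config m B α} {δ δ' δ'' : Dir} {i i' t t' : ℕ}
    (h : Moved d k nb used c δ c' δ' i t) (h' : Moved d k nb used c' δ' c'' δ'' i' t') :
    Moved d k nb used c δ c'' δ'' (i + i') (t + t') := by
  have h1 := h.ios
  have h2 := h'.ios
  have h3 := h.time
  have h4 := h'.time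
  refine ⟨h'.inv, fun x hx => (h'.frame x hx).trans (h.frame x hx), h'.total_eq.trans h.total_eq, ?_, ?_⟩
  · rw [Nat.mul_add]; omega
  · omega

/-- The subtrees of siblings are disjoint, so refilling one child neither disturbs those already
filled nor anticipates those still to come. -/
theorem forEach_spec {g : ℕ → Dir → Prog m B Dir} {v : ℕ}
    (hg : ∀ u, Ch d v u → ∀ (c : Config m B α) (δ : Dir), DiskInv d nb c δ →
      Runs (nb * (2 * d)) (g u δ) c fun δ' c' i t => Moved d k nb used c δ c' δ' i t ∧
        Filled d c δ c' δ' u ∧ ∀ w, ¬ DescR d u w → node d c' δ' w = node d c δ w)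
    (us : List ℕ) (hus : ∀ u ∈ us, Ch d v u) (hnd : us.Nodup) (c : Config m B α) (δ : Dir)
    (h : DiskInv d nb c δ) :
    Runs (nb * (2 * d)) (forEach g us δ) c fun δ' c' i t => Moved d k nb used c δ c' δ' i t ∧
      (∀ u ∈ us, Filled d c δ c' δ' u) ∧
      ∀ w, (∀ u ∈ us, ¬ DescR d u w) → node d c' δ' w = node d c δ w := by
  induction us generalizing c δ with
  | nil => exact Runs.done ⟨Moved.refl h, by simp, fun _ _ => rfl⟩
  | cons u us ih =>
    rw [List.nodup_cons] at hnd
    have hu := hus u List.mem_cons_self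
    refine Runs.bind (hg u hu c δ h) ?_
    rintro δ₁ c₁ i t ⟨hmv, hfi, hsame⟩
    refine (ih (fun w hw => hus w (List.mem_cons_of_mem _ hw)) hnd.2 c₁ δ₁ hmv.inv).mono ?_
    rintro δ₂ c₂ i' t' ⟨hmv', hfi', hsame'⟩
    have hdisj : ∀ w ∈ us, ∀ x, DescR d w x → ¬ DescR d u x := fun w hw x hx =>
      descR_disjoint (hus w (List.mem_cons_of_mem _ hw)) hu (fun e => hnd.1 (e ▸ hw)) hx
    refine ⟨hmv.trans hmv', ?_, ?_⟩
    · intro w hw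
      rcases List.mem_cons.1 hw with rfl | hw
      · exact hfi.congr (fun _ _ => rfl) fun x hx =>
          hsame' x fun y hy hyx => hdisj y hy x hyx hx
      · exact (hfi' w hw).congr (fun x hx => (hsame x (hdisj w hw x hx)).symm) fun _ _ => rfl
    · intro w hw
      rw [hsame' w fun x hx => hw x (List.mem_cons_of_mem _ hx), hsame w (hw u List.mem_cons_self)]

/-- `f` is fuel: children have larger numbers, so `nb ≤ v + f` persists down the recursion, and when
it runs out there is nothing below `v`. Refilling the children first establishes what `pull_spec`
demands of them, and the subsequent merge is paid for by `Pulled.potential_add_le`. The last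
conclusion records that a refill that really takes place lowers the potential by at least d B, from
which further work can be financed. -/
theorem refill_spec (hd : 0 < d) (hk : d < 2 ^ k) (hm : 4 * (d * B) ≤ m) (hused : used.length ≤ d * B)
    (f v : ℕ) (hf : nb ≤ v + f) (c : Config m B α) (δ : Dir) (h : DiskInv d nb c δ) :
    Runs (nb * (2 * d)) (refill d nb used f v δ) c fun δ' c' i t => Moved d k nb used c δ c' δ' i t ∧
      Filled d c δ c' δ' v ∧ (∀ w, ¬ DescR d v w → node d c' δ' w = node d c δ w) ∧
      (sizes d c δ v < d * B → Live d (sizes d c δ) v → potential d (d * B) nb (sizes d c' δ') + d * B ≤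
        potential d (d * B) nb (sizes d c δ)) := by
  have hB : 0 < B := Nat.pos_of_ne_zero (NeZero.ne B)
  have hs : 0 < d * B := Nat.mul_pos hd hB
  have hz : ∀ (c : Config m B α) (δ : Dir), DiskInv d nb c δ → ∀ u, nb ≤ u → sizes d c δ u = 0 := by
    intro c δ h u hu
    unfold sizes; rw [h.node_eq_nil hu]; rfl
  induction f generalizing v c δ with
  | zero =>
    have hl : ¬ Live d (sizes d c δ) v := by
      rintro ⟨u, hu, hpos⟩
      rw [hz c δ h u (by have := Desc.lt hu; omega)] at hpos
      exact lt_irrefl _ hpos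
    refine Runs.done ⟨Moved.refl h, ⟨Or.inr hl, fun hh => ?_⟩, fun _ _ => rfl,
      fun _ hh => absurd hh hl⟩
    exact hh.resolve_right hl
  | succ f ih =>
    unfold refill
    split_ifs with hcond
    · rw [← sizes_eq c δ, ← length_node (c := c) (d := d)] at hcond
      obtain ⟨hsz, hlive⟩ := hcond
      have hvnb : v < nb := by
        obtain ⟨u, hu, hpos⟩ := hlive
        by_contra hge
        rw [hz c δ h u (by have := Desc.lt hu; omega)] at hpos
        exact lt_irrefl _ hpos
      refine Runs.bind (forEach_spec (k := k) (v := v) (fun u hu c δ h => (ih u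
        (by have := hu.lt; omega) c δ h).mono fun _ _ _ _ hh => ⟨hh.1, hh.2.1, hh.2.2.1⟩) (kids d nb v) (fun u hu => (mem_kids.1 hu).2) kids_nodup c δ h) ?_
      rintro δ₁ c₁ i t ⟨hmv, hfi, hsame⟩
      have hv₁ : node d c₁ δ₁ v = node d c δ v := hsame v fun u hu huv =>
        absurd (DescR.le huv) (by have := (mem_kids.1 hu).2.lt; omega)
      have hgood : ∀ u, Ch d v u → d * B ≤ (node d c₁ δ₁ u).length ∨
          ¬ Live d (fun u => (node d c₁ δ₁ u).length) u := by
        intro u hu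
        by_cases hn : u < nb
        · exact (hfi u (mem_kids.2 ⟨hn, hu⟩)).good
        · refine Or.inr ?_
          rintro ⟨w, hw, hpos⟩
          have : sizes d c₁ δ₁ w = 0 := hz c₁ δ₁ hmv.inv w (by have := Desc.lt hw; omega)
          exact absurd (show 0 < sizes d c₁ δ₁ w from hpos) (by rw [this]; exact lt_irrefl _)
      have hne : ∃ u, Ch d v u ∧ node d c₁ δ₁ u ≠ [] := by
        obtain ⟨w, hw, hpos⟩ := hlive
        obtain ⟨u, hu, huw⟩ := desc_iff.1 hw
        have hun : u < nb := by
          by_contra hge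
          rw [hz c δ h w (by have := DescR.le huw; omega)] at hpos
          exact lt_irrefl _ hpos
        refine ⟨u, hu, List.ne_nil_of_length_pos ((hfi u (mem_kids.2 ⟨hun, hu⟩)).pos ?_)⟩
        rcases descR_iff.1 huw with rfl | huw
        · exact Or.inl hpos
        · exact Or.inr ⟨w, huw, hpos⟩
      refine (pull_spec hd hk hm hused hmv.inv hvnb (by rw [hv₁]; exact hsz) hgood).mono ?_
      rintro δ₂ c₂ i' t' ⟨⟨out, hp⟩, hinv, hfr, hi', ht'⟩
      have hpot := hp.potential_add_le hne
      have hmv' : Moved d k nb used c₁ δ₁ c₂ δ₂ i' t' := by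
        refine ⟨hinv, hfr, hp.total_eq, ?_, ?_⟩
        · unfold sizes; omega
        · unfold sizes
          have h1 := Nat.mul_le_mul_left (7 + 2 * k) hpot
          have h2 : (7 + 2 * k) * (d * B) = 7 * (d * B) + 2 * (k * (d * B)) := by ring
          rw [Nat.mul_add] at h1
          omega
      refine ⟨hmv.trans hmv', ⟨hp.good', fun _ => ?_⟩, fun w hw => ?_, fun _ _ => ?_⟩
      · unfold sizes
        rw [hp.self, List.length_append]
        have := List.length_pos_of_ne_nil (hp.out_ne_nil hs hne)
        omega
      · have hwv : w ≠ v := by rintro rfl; exact hw .refl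
        rw [hp.other w hwv fun hh => hw (.single hh)]
        exact hsame w fun u hu huw => hw (.head (mem_kids.1 hu).2 huw)
      · have := Nat.le_of_mul_le_mul_left ((Nat.le_add_left _ _).trans hmv.ios) (by norm_num)
        exact hpot.trans this
    · rw [← sizes_eq c δ, ← length_node (c := c) (d := d)] at hcond
      refine Runs.done ⟨Moved.refl h, ⟨?_, fun hh => ?_⟩, fun _ _ => rfl,
        fun h1 h2 => absurd ⟨h1, h2⟩ hcond⟩
      · by_contra hh
        push Not at hh
        exact hcond hh
      · rcases hh with hh | hh
        · exact hh
        · by_contra h0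
          exact hcond ⟨by unfold sizes at h0; omega, hh⟩

end Refill

end IOModel

namespace IOModel

/-! ## Inserting a full buffer -/

/-- If `x` exceeded all of `K`, then at least `K.length` elements of the merged list would be
smaller than `x`, and `x` could not be among the first `K.length`. Replacing records by equally many
smallest ones of a merge therefore keeps them below whatever `K` was below. -/
theorem exists_le_of_mem_take {β : Type*} [LinearOrder β] {R L K : List β} (hR : R.Pairwise (· ≤ ·))
    (hp : R.Perm (L ++ K)) {x : β} (hx : x ∈ R.take K.length) : ∃ y ∈ K, x ≤ y := by
  by_contra! hlt
  have h1 : K.length ≤ R.countP (· < x) := by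
    have h2 : K.countP (· < x) = K.length :=
      List.countP_eq_length.2 fun y hy => by simpa using hlt y hy
    rw [hp.countP_eq, List.countP_append]
    omega
  rw [← List.take_append_drop K.length R, List.pairwise_append] at hR
  rw [← List.take_append_drop K.length R, List.countP_append] at h1
  have h2 : (R.drop K.length).countP (· < x) = 0 :=
    List.countP_eq_zero.2 fun y hy => by simpa using hR.2.2 x hx y hy
  have h3 : (R.take K.length).countP (· < x) < (R.take K.length).length := by
    refine lt_of_le_of_ne List.countP_le_length fun e => ?_
    have := List.countP_eq_length.1 e x hx
    simp at this
  rw [List.length_take] at h3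
  omega

theorem total_update {β : Type*} [LinearOrder β] {nb v : ℕ} {A A' : ℕ → List β} (hv : v < nb)
    (h : ∀ u, u ≠ v → A' u = A u) {X X' : Multiset β} (hX : (A' v : Multiset β) + X' = A v + X) :
    total nb A' + X' = total nb A + X := by
  unfold total
  rw [← Finset.add_sum_erase _ _ (Finset.mem_range.2 hv),
    ← Finset.add_sum_erase _ (fun u => (A u : Multiset β)) (Finset.mem_range.2 hv), add_right_comm, hX,
    add_right_comm, Finset.sum_congr rfl fun u hu => by rw [h u (Finset.ne_of_mem_erase hu)]]

section Push

variable {m B : ℕ} {α : Type} [NeZero B]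

/-- Exchange the records in the cells `X` with those in node `v`, which receives the smallest ones. -/
def push (d : ℕ) (used : List (Fin (m + 2))) (v : ℕ) (X : List (Fin (m + 2))) (δ : Dir) :
    Prog m B (List (Fin (m + 2)) × Dir) :=
  (loadBlocks d v (X ++ used) (blocksFor B (δ.len v))).bind fun L =>
  (mergeCells X ((L.take (δ.len v)).drop (δ.off v))).bind fun R =>
  (storeBlocks d v (R.take (δ.len v - δ.off v)) (blocksFor B (δ.len v - δ.off v))).bind fun _ =>
  .done (R.drop (δ.len v - δ.off v),
    ⟨Function.update δ.off v 0, Function.update δ.len v (δ.len v - δ.off v)⟩)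

/-- Push records along the path to node `v`. -/
def pushTo (d : ℕ) (used : List (Fin (m + 2))) (v : ℕ) (X : List (Fin (m + 2))) (δ : Dir) :
    Prog m B (List (Fin (m + 2)) × Dir) :=
  if v = 0 then .done (X, δ)
  else (pushTo d used ((v - 1) / d) X δ).bind fun r => push d used v r.1 r.2
termination_by v
decreasing_by exact lt_of_le_of_lt (Nat.div_le_self _ _) (by omega)

variable [LinearOrder α] {d nb v : ℕ} {c : Config m B α} {δ : Dir} {used X : List (Fin (m + 2))}

/-- Records have been pushed along a path that ends at `v`. -/
structure Pushed (d nb : ℕ) (used X : List (Fin (m + 2))) (c : Config m B α) (δ : Dir) (v : ℕ)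
    (X' : List (Fin (m + 2))) (c' : Config m B α) (δ' : Dir) : Prop where
  inv : DiskInv d nb c' δ'
  cells : ∀ x ∈ X', 2 ≤ x.val
  length_eq : X'.length = X.length
  sorted : (X'.map c'.mem).Pairwise (· ≤ ·)
  frame : ∀ x ∈ used, c'.mem x = c.mem x
  total_eq : total nb (node d c' δ') + (X'.map c'.mem : List _) = total nb (node d c δ) + (X.map c.mem : List _)
  size_eq : ∀ u, δ'.len u - δ'.off u = δ.len u - δ.off u
  root : δ'.len 0 = δ.len 0
  le : ∀ a, DescR d a v → ∀ x ∈ node d c' δ' a, ∀ y ∈ X'.map c'.mem, x ≤ y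

/-- The node keeps its number of records but receives the smallest ones. It stays below its
descendants by `exists_le_of_mem_take`, and above its ancestors because these bound both lists that
are merged. Reading and writing cost 2 d B each, and the merge takes at most 3 d B further units of
time. -/
theorem push_spec (hm : 5 * (d * B) ≤ m) (hused : used.length ≤ 2 * (d * B))
    (h : DiskInv d nb c δ) (hv0 : v ≠ 0) (hv : v < nb) (hX : (X.map c.mem).Pairwise (· ≤ ·))
    (hXl : X.length ≤ d * B) (hXc : ∀ x ∈ X, 2 ≤ x.val)
    (hle : ∀ a, Desc d a v → ∀ x ∈ node d c δ a, ∀ y ∈ X.map c.mem, x ≤ y) :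
    Runs (nb * (2 * d)) (push d used v X δ) c fun r c' i t => Pushed d nb used X c δ v r.1 c' r.2 ∧
      B * i ≤ 4 * (d * B) ∧ t ≤ 7 * (d * B) := by
  have hB : 0 < B := Nat.pos_of_ne_zero (NeZero.ne B)
  have hlen := h.len_le v
  have hblk : ∀ l ≤ 2 * (d * B), blocksFor B l ≤ 2 * d ∧ blocksFor B l * B ≤ 2 * (d * B) := fun l hl => by
    have := blocksFor_le hB (l := l) (k := 2 * d) (by rw [mul_assoc]; exact hl)
    exact ⟨this, by rw [← mul_assoc]; exact Nat.mul_le_mul_right _ this⟩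
  obtain ⟨hb1, hb2⟩ := hblk _ hlen
  obtain ⟨hb3, hb4⟩ := hblk (δ.len v - δ.off v) (by omega)
  have haddr : v * (2 * d) + 2 * d ≤ nb * (2 * d) := by
    rw [← Nat.succ_mul]; exact Nat.mul_le_mul_right _ hv
  refine Runs.bind (loadBlocks_spec d (v := v) (blocksFor B (δ.len v)) (by omega)
    (by rw [List.length_append]; omega) c) ?_
  rintro L c₁ i₁ t₁ ⟨rfl, rfl, hd₁, hf₁, hu₁, hL⟩
  have hV := node_of_loaded hL (le_blocksFor_mul hB (δ.len v))
  have hVf : ∀ x ∈ (L.take (δ.len v)).drop (δ.off v), 2 ≤ x.val := fun x hx =>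
    (hf₁ x (List.mem_of_mem_take (List.mem_of_mem_drop hx))).1
  set V := (L.take (δ.len v)).drop (δ.off v) with hVdef
  have hVl : V.length = δ.len v - δ.off v := by rw [← length_node (d := d) (c := c), ← hV, List.length_map]
  have hX₁ : X.map c₁.mem = X.map c.mem :=
    List.map_congr_left fun x hx => hu₁ x (List.mem_append_left _ hx)
  refine Runs.bind (mergeCells_spec X V c₁ (hX₁ ▸ hX) (hV ▸ h.sorted v)) ?_
  rintro R c₂ i₂ t₂ ⟨rfl, rfl, ht₂, hp, hs⟩
  have hRl : R.length = X.length + V.length := by rw [hp.length_eq, List.length_append]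
  have hRp : (R.map c₂.mem).Perm (X.map c.mem ++ node d c δ v) := by
    have := hp.map c₂.mem
    rwa [List.map_append, hX₁, hV] at this
  rw [← hVl] at hb3 hb4 ⊢
  have htl : (R.take V.length).length = V.length := by rw [List.length_take]; omega
  refine Runs.bind (storeBlocks_spec (d := d) (v := v) (R.take V.length) (blocksFor B V.length) hb3
    (by omega) c₂) ?_
  rintro _ c₃ i₃ t₃ ⟨rfl, rfl, hm₃, hs₃, ho₃⟩
  set δ' : Dir := ⟨Function.update δ.off v 0, Function.update δ.len v V.length⟩ with hδ'
  have hself : node d c₃ δ' v = (R.take V.length).map c₂.mem := by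
    unfold node
    simp only [hδ', Function.update_self]
    rw [← span_of_stored (d := d) (c := c₂) (c' := c₃) (v := v), htl]
    intro q hq
    exact hs₃ q (by rw [htl] at hq; exact hq.trans_le (le_blocksFor_mul hB _))
  have hother : ∀ u, u ≠ v → node d c₃ δ' u = node d c δ u := by
    intro u hu
    unfold node
    simp only [hδ', Function.update_of_ne hu]
    refine span_congr fun q hq => ?_
    rw [ho₃ u hu q (hq.trans_le (h.len_le u)), rcd_congr hd₁]
  have hsp := hs
  rw [← List.take_append_drop V.length R, List.map_append, List.pairwise_append] at hsp
  have hmemR : ∀ y ∈ R.map c₂.mem, y ∈ X.map c.mem ∨ y ∈ node d c δ v := fun y hy =>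
    List.mem_append.1 (hRp.mem_iff.1 hy)
  have hdom : ∀ x ∈ node d c₃ δ' v, ∃ y ∈ node d c δ v, x ≤ y := by
    intro x hx
    refine exists_le_of_mem_take hs hRp ?_
    rw [← hV, List.length_map, ← List.map_take, ← hself]
    exact hx
  have hanc : ∀ a, Desc d a v → ∀ x ∈ node d c₃ δ' a, ∀ y ∈ R.map c₂.mem, x ≤ y := by
    intro a ha x hx y hy
    rw [hother a ha.lt.ne] at hx
    rcases hmemR y hy with hy | hy
    · exact hle a ha x hx y hy
    · exact h.heap a v ha x hx y hy
  have hsize : ∀ u, δ'.len u - δ'.off u = δ.len u - δ.off u := by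
    intro u
    by_cases hu : u = v
    · subst hu; simp [hδ', hVl]
    · simp [hδ', Function.update_of_ne hu]
  refine Runs.done ⟨⟨⟨?_, ?_, ?_, ?_⟩, ?_, ?_, ?_, ?_, ?_, hsize, ?_, ?_⟩, ?_, ?_⟩
  · intro u
    by_cases hu : u = v
    · subst hu; simp only [hδ', Function.update_self]; omega
    · simp only [hδ', Function.update_of_ne hu]; exact h.len_le u
  · intro u hu
    simp only [hδ', Function.update_of_ne (show u ≠ v by omega)]
    exact h.empty u hu
  · intro u
    by_cases hu : u = v
    · subst hu; rw [hself]; exact hsp.1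
    · rw [hother u hu]; exact h.sorted u
  · intro a u hau x hx y hy
    by_cases hu : u = v
    · subst hu
      rw [hself] at hy
      obtain ⟨z, hz, rfl⟩ := List.mem_map.1 hy
      exact hanc a hau x hx _ (List.mem_map_of_mem (List.mem_of_mem_take hz))
    · rw [hother u hu] at hy
      by_cases ha : a = v
      · subst ha
        obtain ⟨z, hz, hxz⟩ := hdom x hx
        exact hxz.trans (h.heap _ u hau z hz y hy)
      · rw [hother a ha] at hx
        exact h.heap a u hau x hx y hy
  · intro x hx
    rcases List.mem_append.1 (hp.mem_iff.1 (List.mem_of_mem_drop hx)) with hx | hx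
    · exact hXc x hx
    · exact hVf x hx
  · rw [List.length_drop]; omega
  · rw [hm₃]; exact hsp.2.1
  · intro x hx
    rw [hm₃, hu₁ x (List.mem_append_right _ hx)]
  · refine total_update hv hother ?_
    rw [hself, hm₃, Multiset.coe_add, ← List.map_append, List.take_append_drop, Multiset.coe_add]
    exact Multiset.coe_eq_coe.2 (hRp.trans List.perm_append_comm)
  · simp [hδ', Function.update_of_ne hv0.symm]
  · intro a ha x hx y hy
    rw [hm₃] at hy
    rcases descR_iff.1 ha with rfl | ha
    · rw [hself] at hx
      exact hsp.2.2 x hx y hy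
    · obtain ⟨z, hz, rfl⟩ := List.mem_map.1 hy
      exact hanc a ha x hx _ (List.mem_map_of_mem (List.mem_of_mem_drop hz))
  · have e1 := mul_comm B (blocksFor B (δ.len v))
    have e2 := mul_comm B (blocksFor B V.length)
    simp only [Nat.mul_add, zero_add, add_zero]
    omega
  · omega

/-- The induction follows the path from the root, where there is nothing to exchange because node 0
is empty. After each exchange the records that travel on are bounded from below by all nodes passed
so far, which is the hypothesis needed for the next exchange. -/
theorem pushTo_spec (hm : 5 * (d * B) ≤ m) (hused : used.length ≤ 2 * (d * B))
    (h : DiskInv d nb c δ) (hroot : δ.len 0 = 0) (hv : v < nb) (hX : (X.map c.mem).Pairwise (· ≤ ·))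
    (hXl : X.length ≤ d * B) (hXc : ∀ x ∈ X, 2 ≤ x.val) :
    Runs (nb * (2 * d)) (pushTo d used v X δ) c fun r c' i t => Pushed d nb used X c δ v r.1 c' r.2 ∧
      B * i ≤ 4 * (d * B) * height d v ∧ t ≤ 7 * (d * B) * height d v := by
  induction v using Nat.strong_induction_on with
  | _ v ih =>
  rw [pushTo]
  split_ifs with hv0
  · subst hv0
    refine Runs.done ⟨⟨h, hXc, rfl, hX, fun _ _ => rfl, rfl, fun _ => rfl, rfl, ?_⟩, by simp, by simp⟩
    intro a ha x hx
    obtain rfl : a = 0 := Nat.le_zero.1 ha.le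
    rw [List.eq_nil_of_length_eq_zero (length_node.trans (by rw [hroot, Nat.zero_sub]))] at hx
    cases hx
  · have hlt : (v - 1) / d < v := lt_of_le_of_lt (Nat.div_le_self _ _) (by omega)
    have hch : Ch d ((v - 1) / d) v := ⟨hv0, rfl⟩
    refine Runs.bind (ih _ hlt (hlt.trans hv)) ?_
    rintro ⟨X₁, δ₁⟩ c₁ i t ⟨hp, hi, ht⟩
    refine (push_spec hm hused hp.inv hv0 hv hp.sorted (hp.length_eq ▸ hXl) hp.cells
      fun a ha => hp.le a (desc_iff_tail.1 ha).2).mono ?_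
    rintro ⟨X₂, δ₂⟩ c₂ i' t' ⟨hp', hi', ht'⟩
    rw [hch.height]
    refine ⟨⟨hp'.inv, hp'.cells, hp'.length_eq.trans hp.length_eq, hp'.sorted,
      fun x hx => (hp'.frame x hx).trans (hp.frame x hx), hp'.total_eq.trans hp.total_eq,
      fun u => (hp'.size_eq u).trans (hp.size_eq u), hp'.root.trans hp.root, hp'.le⟩, ?_, ?_⟩
    · rw [Nat.mul_add, Nat.mul_add, mul_one]; omega
    · rw [Nat.mul_add, mul_one]; omega

end Push

end IOModel

namespace IOModel

/-! ## The priority queue -/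

theorem Runs.mono_blocks {m B : ℕ} {σ α : Type} [LinearOrder α] {N N' : ℕ} {p : Prog m B σ}
    {c : Config m B α} {Q : σ → Config m B α → ℕ → ℕ → Prop} (h : Runs N p c Q) (hN : N ≤ N') :
    Runs N' p c Q := ⟨h.1, fun a ha => (h.2 a ha).trans_le hN⟩

/-- The cells of the insertion buffer and of the deletion buffer, both sorted, and the nodes in external
memory.  Node `0` is always empty, since the deletion buffer takes its place. -/
structure Queue (m : ℕ) where
  ins : List (Fin (m + 2))
  del : List (Fin (m + 2))
  nb : ℕ
  dir : Dir

namespace Queue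

section Programs

variable {m B : ℕ} [NeZero B]

def size (q : Queue m) (v : ℕ) : ℕ := q.dir.len v - q.dir.off v

noncomputable def pot (d B : ℕ) (q : Queue m) : ℕ := potential d (d * B) q.nb q.size

/-- A cell with a smallest record, and the queue without it. -/
def popMin (q : Queue m) : Prog m B (Option (Fin (m + 2) × Queue m)) :=
  match q.ins, q.del with
  | [], [] => .done none
  | x :: I, [] => .done (some (x, { q with ins := I }))
  | [], y :: D => .done (some (y, { q with del := D }))
  | x :: I, y :: D => .cmp x y fun b =>
      .done (some (if b then (x, { q with ins := I }) else (y, { q with del := D })))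

open Classical in
/-- Refill the deletion buffer if it is empty. -/
noncomputable def fix (d : ℕ) (q : Queue m) : Prog m B (Queue m) :=
  if q.del = [] ∧ Live d q.size 0 then
    (refill d q.nb q.ins q.nb 0 q.dir).bind fun δ =>
    (loadBlocks d 0 q.ins (blocksFor B (δ.len 0))).bind fun L =>
    .done { q with
      del := (L.take (δ.len 0)).drop (δ.off 0)
      dir := ⟨Function.update δ.off 0 0, Function.update δ.len 0 0⟩ }
  else .done q

/-- Store the records of the insertion buffer in a new node. -/
def flush (d : ℕ) (q : Queue m) : Prog m B (Queue m) :=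
  (mergeCells q.ins q.del).bind fun R =>
  (pushTo d (R.take q.del.length) ((q.nb - 1) / d) (R.drop q.del.length) q.dir).bind fun r =>
  (storeBlocks d q.nb r.1 (blocksFor B r.1.length)).bind fun _ =>
  .done ⟨[], R.take q.del.length, q.nb + 1,
    ⟨Function.update r.2.off q.nb 0, Function.update r.2.len q.nb r.1.length⟩⟩

/-- Refill the deletion buffer and show the smallest record. -/
noncomputable def restore (d : ℕ) (q : Queue m) : Prog m B (Queue m) :=
  (fix d q).bind fun q => (popMin q).bind fun r =>
    match r with
    | none => .clear 1 (.done q)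
    | some r => .move r.1 1 (.done q)

noncomputable def deleteMin (d : ℕ) (q : Queue m) : Prog m B (Queue m) :=
  (popMin q).bind fun r =>
    match r with
    | none => restore d q
    | some r => restore d r.2

/-- Insert the record in the cell `x`, which is not in use. -/
noncomputable def insertCell (d : ℕ) (x : Fin (m + 2)) (q : Queue m) : Prog m B (Queue m) :=
  .move 0 x <| (rank x q.ins).bind fun r =>
    if q.ins.length + 1 = d * B then
      (flush d { q with ins := q.ins.take r ++ x :: q.ins.drop r }).bind (restore d)
    else restore d { q with ins := q.ins.take r ++ x :: q.ins.drop r }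

noncomputable def insert (d : ℕ) (q : Queue m) : Prog m B (Queue m) :=
  insertCell d ((fresh (q.ins ++ q.del) 1).headD 0) q

end Programs

section Specs

variable {m B : ℕ} [NeZero B] {α : Type}

theorem size_eq {d : ℕ} {c : Config m B α} {q : Queue m} : q.size = sizes d c q.dir :=
  (sizes_eq c q.dir).symm

/-- The deletion buffer is empty only if all nodes are. -/
def Ready (d : ℕ) (c : Config m B α) (q : Queue m) : Prop :=
  q.del = [] → total q.nb (node d c q.dir) = 0

theorem Ready.congr {d : ℕ} {c c' : Config m B α} {q : Queue m} (h : Ready d c q) (hd : c'.disk = c.disk) :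
    Ready d c' q := by
  unfold Ready; rw [node_congr hd]; exact h

variable [LinearOrder α]

/-- The queue `q` stores the records `S`. -/
structure Stores (d : ℕ) (c : Config m B α) (q : Queue m) (S : Multiset (WithTop α)) : Prop where
  disk : DiskInv d q.nb c q.dir
  root : q.dir.len 0 = 0
  nb_pos : 0 < q.nb
  cells : ∀ x ∈ q.ins ++ q.del, 2 ≤ x.val
  ins_le : q.ins.length ≤ d * B
  del_le : q.del.length ≤ 2 * (d * B)
  ins_sorted : (q.ins.map c.mem).Pairwise (· ≤ ·)
  del_sorted : (q.del.map c.mem).Pairwise (· ≤ ·)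
  del_le_total : ∀ x ∈ q.del.map c.mem, ∀ y ∈ total q.nb (node d c q.dir), x ≤ y
  total_eq : (q.ins.map c.mem : Multiset (WithTop α)) + (q.del.map c.mem : List _) +
    total q.nb (node d c q.dir) = S

variable {d N : ℕ} {c c' : Config m B α} {q : Queue m} {S : Multiset (WithTop α)}

theorem Stores.congr (h : Stores d c q S) (hd : c'.disk = c.disk)
    (hm : ∀ x ∈ q.ins ++ q.del, c'.mem x = c.mem x) : Stores d c' q S := by
  have hI : q.ins.map c'.mem = q.ins.map c.mem :=
    List.map_congr_left fun x hx => hm x (List.mem_append_left _ hx)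
  have hD : q.del.map c'.mem = q.del.map c.mem :=
    List.map_congr_left fun x hx => hm x (List.mem_append_right _ hx)
  have hn : node d c' = node d c := node_congr hd
  obtain ⟨⟨h1, h2, h3, h4⟩, h5, h6, h7, h8, h9, h10, h11, h12, h13⟩ := h
  exact ⟨⟨h1, h2, hn ▸ h3, hn ▸ h4⟩, h5, h6, h7, h8, h9, by rwa [hI], by rwa [hD], by rwa [hD, hn],
    by rwa [hI, hD, hn]⟩

theorem inf_eq_of_mem {β : Type*} [LinearOrder β] [OrderTop β] {S : Multiset β} {x : β} (hx : x ∈ S)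
    (h : ∀ y ∈ S, x ≤ y) : S.inf = x :=
  le_antisymm (Multiset.inf_le hx) (Multiset.le_inf.2 h)

theorem Stores.erase_ins {x : Fin (m + 2)} {I : List (Fin (m + 2))} (h : Stores d c q S)
    (hI : q.ins = x :: I) : Stores d c { q with ins := I } (S.erase (c.mem x)) := by
  obtain ⟨h4, h5, h6, h7, h8, h9, h10, h11, h12, h13⟩ := h
  rw [hI] at h7 h8 h10 h13
  refine ⟨h4, h5, h6, fun y hy => h7 y (List.mem_cons_of_mem _ hy), ?_, h9, ?_, h11, h12, ?_⟩
  · simp at h8 ⊢; omega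
  · exact (List.pairwise_cons.1 h10).2
  · rw [← h13, List.map_cons, ← Multiset.cons_coe, Multiset.cons_add, Multiset.cons_add,
      Multiset.erase_cons_head]

theorem Stores.erase_del {x : Fin (m + 2)} {D : List (Fin (m + 2))} (h : Stores d c q S)
    (hD : q.del = x :: D) : Stores d c { q with del := D } (S.erase (c.mem x)) := by
  obtain ⟨h4, h5, h6, h7, h8, h9, h10, h11, h12, h13⟩ := h
  rw [hD] at h7 h9 h11 h12 h13
  refine ⟨h4, h5, h6, fun y hy => h7 y ?_, h8, ?_, h10, ?_, ?_, ?_⟩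
  · rcases List.mem_append.1 hy with hy | hy
    · exact List.mem_append_left _ hy
    · exact List.mem_append_right _ (List.mem_cons_of_mem _ hy)
  · simp at h9 ⊢; omega
  · exact (List.pairwise_cons.1 h11).2
  · exact fun y hy => h12 y (List.mem_cons_of_mem _ hy)
  · rw [← h13, List.map_cons, ← Multiset.cons_coe, Multiset.add_cons, Multiset.cons_add,
      Multiset.erase_cons_head]

/-- The insertion buffer has no order relation to the tree, so the tree is bounded through the
deletion buffer. If that buffer is empty, `Ready` says that the tree is empty too. -/
theorem Stores.inf_ins {x : Fin (m + 2)} {I : List (Fin (m + 2))} (h : Stores d c q S) (hr : Ready d c q)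
    (hI : q.ins = x :: I) (hD : ∀ y ∈ q.del.head?, c.mem x ≤ c.mem y) : S.inf = c.mem x := by
  have h13 := h.total_eq
  have h10 := h.ins_sorted
  rw [hI] at h13 h10
  refine inf_eq_of_mem (by rw [← h13]; simp) fun z hz => ?_
  rw [← h13, Multiset.mem_add, Multiset.mem_add] at hz
  have hdel : ∀ y ∈ q.del.map c.mem, c.mem x ≤ y := by
    intro y hy
    have hs := h.del_sorted
    rcases hq : q.del with _ | ⟨w, D⟩
    · rw [hq] at hy; cases hy
    · rw [hq, List.map_cons] at hy hs
      have := hD w (by rw [hq]; rfl)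
      rcases List.mem_cons.1 hy with rfl | hy
      · exact this
      · exact this.trans ((List.pairwise_cons.1 hs).1 y hy)
  rcases hz with (hz | hz) | hz
  · rw [Multiset.mem_coe, List.map_cons, List.mem_cons] at hz
    rcases hz with rfl | hz
    · exact le_rfl
    · exact (List.pairwise_cons.1 h10).1 z hz
  · exact hdel z hz
  · by_cases hq : q.del = []
    · rw [hr hq] at hz; simp at hz
    · obtain ⟨w, hw⟩ := List.exists_mem_of_ne_nil _ hq
      exact (hdel _ (List.mem_map_of_mem hw)).trans (h.del_le_total _ (List.mem_map_of_mem hw) z hz)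

theorem Stores.inf_del {y : Fin (m + 2)} {D : List (Fin (m + 2))} (h : Stores d c q S)
    (hD : q.del = y :: D) (hI : ∀ x ∈ q.ins.head?, c.mem y ≤ c.mem x) : S.inf = c.mem y := by
  have h13 := h.total_eq
  have h11 := h.del_sorted
  have h12 := h.del_le_total
  rw [hD] at h13 h11 h12
  refine inf_eq_of_mem (by rw [← h13]; simp) fun z hz => ?_
  rw [← h13, Multiset.mem_add, Multiset.mem_add] at hz
  rcases hz with (hz | hz) | hz
  · have hs := h.ins_sorted
    rcases hq : q.ins with _ | ⟨w, I⟩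
    · rw [hq] at hz; simp at hz
    · rw [hq, List.map_cons] at hz hs
      have := hI w (by rw [hq]; rfl)
      rcases List.mem_cons.1 hz with rfl | hz
      · exact this
      · exact this.trans ((List.pairwise_cons.1 hs).1 z hz)
  · rw [Multiset.mem_coe, List.map_cons, List.mem_cons] at hz
    rcases hz with rfl | hz
    · exact le_rfl
    · exact (List.pairwise_cons.1 h11).1 z hz
  · exact h12 _ List.mem_cons_self z hz

theorem popMin_spec (h : Stores d c q S) (hr : Ready d c q) :
    Runs N (popMin q) c fun r c' i t => c' = c ∧ i = 0 ∧ t ≤ 1 ∧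
      match r with
      | none => S = 0
      | some r => S.inf = c.mem r.1 ∧ Stores d c r.2 (S.erase S.inf) ∧ r.2.nb = q.nb ∧
          r.2.size = q.size ∧ r.2.ins.length ≤ q.ins.length := by
  have key1 : ∀ x I, q.ins = x :: I → (∀ y ∈ q.del.head?, c.mem x ≤ c.mem y) →
      S.inf = c.mem x ∧ Stores d c { q with ins := I } (S.erase S.inf) ∧ q.nb = q.nb ∧
          q.size = q.size ∧ I.length ≤ q.ins.length := by
    intro x I hI hD
    have := h.inf_ins hr hI hD
    refine ⟨this, this ▸ h.erase_ins hI, rfl, rfl, ?_⟩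
    rw [hI, List.length_cons]; omega
  have key2 : ∀ y D, q.del = y :: D → (∀ x ∈ q.ins.head?, c.mem y ≤ c.mem x) →
      S.inf = c.mem y ∧ Stores d c { q with del := D } (S.erase S.inf) ∧ q.nb = q.nb ∧
          q.size = q.size ∧ q.ins.length ≤ q.ins.length := by
    intro y D hD hI
    have := h.inf_del hD hI
    exact ⟨this, this ▸ h.erase_del hD, rfl, rfl, le_rfl⟩
  unfold popMin
  split
  · rename_i hI hD
    refine Runs.done ⟨rfl, rfl, by omega, ?_⟩
    rw [← h.total_eq, hr hD, hI, hD]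
    simp
  · rename_i x I hI hD
    exact Runs.done ⟨rfl, rfl, by omega, key1 x I hI (by simp [hD])⟩
  · rename_i y D hI hD
    exact Runs.done ⟨rfl, rfl, by omega, key2 y D hD (by simp [hI])⟩
  · rename_i x I y D hI hD
    refine Runs.cmp ?_
    split_ifs with hb
    · rw [decide_eq_true_eq] at hb
      exact Runs.done ⟨rfl, rfl, by omega, key1 x I hI (by simpa [hD] using hb)⟩
    · rw [decide_eq_true_eq, not_le] at hb
      exact Runs.done ⟨rfl, rfl, by omega, key2 y D hD (by simpa [hI] using hb.le)⟩

end Specs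

end Queue

end IOModel

/-! ### Refilling the deletion buffer and emptying the insertion buffer -/

namespace IOModel

/-- The root has depth 0 and is a proper descendant of no node, so its size does not enter the
potential. Moving its records into the deletion buffer is therefore free. -/
theorem potential_congr {d s nb : ℕ} {sz sz' : ℕ → ℕ} (h : ∀ u, u ≠ 0 → sz u = sz' u) :
    potential d s nb sz = potential d s nb sz' := by
  have hl : Live d sz = Live d sz' :=
    funext fun v => propext (live_congr fun u hu => h u (Nat.ne_of_gt (Nat.zero_lt_of_lt hu.lt)))
  unfold potential
  rw [hl]
  congr 1
  refine Finset.sum_congr rfl fun u _ => ?_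
  rcases eq_or_ne u 0 with rfl | hu
  · rw [height_zero, zero_mul, zero_mul]
  · rw [h u hu]

/-- The increase of the potential by a new node. -/
theorem potential_succ_le {d s nb : ℕ} {sz sz' : ℕ → ℕ} (hnb : 0 < nb) (h : ∀ u, u ≠ nb → sz' u = sz u)
    (h0 : ∀ u, nb ≤ u → sz u = 0) (hs : sz' nb ≤ s) :
    potential d s (nb + 1) sz' ≤ potential d s nb sz + 2 * (s * height d nb) := by
  classical
  have hch : Ch d ((nb - 1) / d) nb := ⟨hnb.ne', rfl⟩
  -- Only proper ancestors of the new node can become live: the root, which `path` omits, and the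
  -- nodes on the path to its parent. Their number is the depth of the new node.
  have hsub : (Finset.range (nb + 1)).filter (Live d sz') ⊆
      (Finset.range nb).filter (Live d sz) ∪ insert 0 (path d ((nb - 1) / d)).toFinset := by
    intro v hv
    obtain ⟨-, u, hu, hpos⟩ := Finset.mem_filter.1 hv
    rw [Finset.mem_union, Finset.mem_filter, Finset.mem_range, Finset.mem_insert, List.mem_toFinset, mem_path]
    by_cases hun : u = nb
    · subst hun
      exact Or.inr ((eq_or_ne v 0).imp_right fun hv0 => ⟨hv0, (desc_iff_tail.1 hu).2⟩)
    · rw [h u hun] at hpos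
      have : u < nb := by
        by_contra hge
        rw [h0 u (by omega)] at hpos
        exact lt_irrefl _ hpos
      exact Or.inl ⟨hu.lt.trans this, u, hu, hpos⟩
  have hcard : ((Finset.range (nb + 1)).filter (Live d sz')).card ≤
      ((Finset.range nb).filter (Live d sz)).card + height d nb := by
    refine (Finset.card_le_card hsub).trans ((Finset.card_union_le _ _).trans ?_)
    rw [hch.height]
    have h1 := Finset.card_insert_le 0 (path d ((nb - 1) / d)).toFinset
    have h2 := List.toFinset_card_le (path d ((nb - 1) / d))
    unfold height
    omega
  have hc := Nat.mul_le_mul_left s hcard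
  have hn := Nat.mul_le_mul_left (height d nb) hs
  rw [mul_comm (height d nb) s] at hn
  unfold potential
  rw [Finset.sum_range_succ, Finset.sum_congr rfl fun u hu => by
    rw [h u (Finset.mem_range.1 hu).ne]]
  rw [Nat.mul_add] at hc
  omega

namespace Queue

section Specs

variable {m B : ℕ} [NeZero B] {α : Type} [LinearOrder α] {d k N : ℕ} {c c' : Config m B α} {q : Queue m}
  {S : Multiset (WithTop α)}

/-- Refilling the root lowers the potential by at least d B, and reading it into the deletion buffer
costs at most 2 d B. This raises the weight of the potential from 7 to 9. -/
theorem fix_spec (hd : 0 < d) (hk : d < 2 ^ k) (hm : 8 * (d * B) ≤ m) (h : Stores d c q S) :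
    Runs ((q.nb - 1) * (4 * d)) (fix d q) c fun q' c' i t => Stores d c' q' S ∧ Ready d c' q' ∧
      q'.nb = q.nb ∧ q'.ins = q.ins ∧ B * i + 9 * pot d B q' ≤ 9 * pot d B q ∧
      t + (9 + 2 * k) * pot d B q' ≤ (9 + 2 * k) * pot d B q := by
  have hB : 0 < B := Nat.pos_of_ne_zero (NeZero.ne B)
  have hsz0 : ∀ u, q.nb ≤ u → q.size u = 0 := fun u hu => by
    rw [size, h.disk.empty u hu, Nat.zero_sub]
  have hroot : q.size 0 = 0 := by rw [size, h.root, Nat.zero_sub]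
  unfold fix
  split_ifs with hcond
  · obtain ⟨hD, hlive⟩ := hcond
    have hnb : 2 ≤ q.nb := by
      obtain ⟨u, hu, hpos⟩ := hlive
      have := hu.lt
      by_contra hge
      rw [hsz0 u (by omega)] at hpos
      exact lt_irrefl _ hpos
    -- A live root requires a second node. So the bound on the accessed blocks can be stated with
    -- `q.nb - 1`, the number of flushed buffers, which is 0 as long as nothing has been written.
    have hN : q.nb * (2 * d) ≤ (q.nb - 1) * (4 * d) := by
      obtain ⟨n, hn⟩ := Nat.exists_eq_add_of_le hnb
      rw [hn, show 2 + n - 1 = 1 + n by omega]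
      nlinarith
    have hs : 0 < d * B := Nat.mul_pos hd hB
    refine Runs.bind ((refill_spec hd hk (by omega) h.ins_le q.nb 0 (by omega) c q.dir h.disk).mono_blocks
      hN) ?_
    rintro δ c₁ i t ⟨hmv, hfi, -, hpot⟩
    rw [← size_eq] at hpot
    have hpot := hpot (by omega) hlive
    have hpos := hfi.pos (Or.inr (size_eq (c := c) ▸ hlive))
    have hmio := hmv.ios
    have hmt := hmv.time
    rw [← size_eq] at hmio hmt
    have hblk : blocksFor B (δ.len 0) ≤ 2 * d :=
      blocksFor_le hB (by rw [mul_assoc]; exact hmv.inv.len_le 0)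
    have hblkB : blocksFor B (δ.len 0) * B ≤ 2 * (d * B) := by
      rw [← mul_assoc]; exact Nat.mul_le_mul_right _ hblk
    have hinl := h.ins_le
    refine Runs.bind (loadBlocks_spec d (v := 0) (blocksFor B (δ.len 0)) (used := q.ins)
      (by have := Nat.mul_le_mul_right (2 * d) hnb; omega) (by omega) c₁) ?_
    rintro L c₂ i₂ t₂ ⟨rfl, rfl, hd₂, hf₂, hu₂, hL⟩
    have hV := node_of_loaded hL (le_blocksFor_mul hB (δ.len 0))
    have hVf : ∀ x ∈ (L.take (δ.len 0)).drop (δ.off 0), 2 ≤ x.val := fun x hx =>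
      (hf₂ x (List.mem_of_mem_take (List.mem_of_mem_drop hx))).1
    set V := (L.take (δ.len 0)).drop (δ.off 0) with hVdef
    have hVl : V.length = sizes d c₁ δ 0 := by unfold sizes; rw [← hV, List.length_map]
    set δ' : Dir := ⟨Function.update δ.off 0 0, Function.update δ.len 0 0⟩ with hδ'
    have hself : node d c₂ δ' 0 = [] := by
      unfold node
      rw [span_of_le (by simp [hδ'])]
    have hother : ∀ u, u ≠ 0 → node d c₂ δ' u = node d c₁ δ u := by
      intro u hu
      rw [node_congr hd₂]
      unfold node
      simp only [hδ', Function.update_of_ne hu]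
    have hpe : potential d (d * B) q.nb (sizes d c₁ δ) =
        pot d B { q with del := V, dir := δ' } := by
      refine potential_congr fun u hu => ?_
      rw [sizes_eq]
      simp [Queue.size, hδ', Function.update_of_ne hu]
    have htot : total q.nb (node d c₂ δ') + (V.map c₂.mem : List _) = total q.nb (node d c q.dir) := by
      rw [← hmv.total_eq]
      have := total_update (A := node d c₁ δ) (A' := node d c₂ δ') (nb := q.nb) (v := 0) (by omega) hother
        (X := 0) (X' := (V.map c₂.mem : List _)) (by rw [hself, hV]; simp)
      rw [this, add_zero]
    have hins : q.ins.map c₂.mem = q.ins.map c.mem :=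
      List.map_congr_left fun x hx => (hu₂ x hx).trans (hmv.frame x hx)
    rw [hpe, show potential d (d * B) q.nb q.size = pot d B q from rfl] at hpot hmio hmt
    refine Runs.done ⟨⟨⟨?_, ?_, ?_, ?_⟩, ?_, h.nb_pos, ?_, h.ins_le, ?_, ?_, ?_, ?_, ?_⟩, ?_, rfl, rfl, ?_, ?_⟩
    · intro u
      by_cases hu : u = 0
      · subst hu; simp [hδ']
      · simp only [hδ', Function.update_of_ne hu]; exact hmv.inv.len_le u
    · intro u hu
      have hu' : q.nb ≤ u := hu
      simp only [hδ', Function.update_of_ne (show u ≠ 0 by omega)]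
      exact hmv.inv.empty u hu
    · intro u
      by_cases hu : u = 0
      · subst hu; rw [hself]; exact List.Pairwise.nil
      · rw [hother u hu]; exact hmv.inv.sorted u
    · intro a u hau x hx y hy
      rw [hother u (Nat.ne_of_gt (Nat.zero_lt_of_lt hau.lt))] at hy
      by_cases ha : a = 0
      · subst ha; rw [hself] at hx; cases hx
      · rw [hother a ha] at hx
        exact hmv.inv.heap a u hau x hx y hy
    · simp [hδ']
    · intro x hx
      rcases List.mem_append.1 hx with hx | hx
      · exact h.cells x (List.mem_append_left _ hx)
      · exact hVf x hx
    · dsimp only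
      rw [hVl, sizes_eq]
      exact (Nat.sub_le _ _).trans (hmv.inv.len_le 0)
    · rw [hins]; exact h.ins_sorted
    · rw [hV]; exact hmv.inv.sorted 0
    · intro x hx y hy
      rw [hV] at hx
      obtain ⟨u, -, hy⟩ := Multiset.mem_sum.1 hy
      by_cases hu : u = 0
      · subst hu; rw [hself] at hy; cases hy
      · rw [hother u hu] at hy
        exact hmv.inv.heap 0 u (desc_zero hu) x hx y hy
    · rw [← h.total_eq, ← htot, hD]
      dsimp only
      rw [hins, add_assoc, add_comm (Multiset.ofList (V.map c₂.mem))]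
      simp
    · intro hnil
      dsimp only at hnil
      rw [hnil, List.length_nil] at hVl
      omega
    · have e := mul_comm B (blocksFor B (δ.len 0))
      simp only [Nat.mul_add, add_zero]
      omega
    · have h1 := Nat.mul_le_mul_left 2 hpot
      have h2 : ∀ x, (9 + 2 * k) * x = (7 + 2 * k) * x + 2 * x := fun x => by ring
      rw [h2, h2]
      omega
  · refine Runs.done ⟨h, fun hD => ?_, rfl, rfl, by omega, by omega⟩
    refine Finset.sum_eq_zero fun u _ => ?_
    rw [Multiset.coe_eq_zero, ← List.length_eq_zero_iff, length_node]
    change q.size u = 0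
    by_cases hu : u = 0
    · rw [hu, hroot]
    · by_contra hne
      exact hcond ⟨hD, u, desc_zero hu, Nat.pos_of_ne_zero hne⟩

/-- Per level of the path, in units of d B: the exchanges and the final write cost 4 transfers, and
the potential grows by 2 with weight 9, which makes 22. For the time, 7 for merging and moving and 2
with weight 9 + 2 k make 25 + 4 k. -/
theorem flush_spec (k : ℕ) (hd : 0 < d) (hm : 8 * (d * B) ≤ m) (h : Stores d c q S)
    (hfull : q.ins.length = d * B) :
    Runs (q.nb * (4 * d)) (flush d q) c fun q' c' i t => Stores d c' q' S ∧ q'.ins = [] ∧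
      q'.nb = q.nb + 1 ∧ B * i + 9 * pot d B q' ≤ 9 * pot d B q + 22 * (d * B * height d q.nb) ∧
      t + (9 + 2 * k) * pot d B q' ≤
        (9 + 2 * k) * pot d B q + (25 + 4 * k) * (d * B * height d q.nb) := by
  have hB : 0 < B := Nat.pos_of_ne_zero (NeZero.ne B)
  have hnb := h.nb_pos
  have hlt : (q.nb - 1) / d < q.nb := lt_of_le_of_lt (Nat.div_le_self _ _) (by omega)
  have hch : Ch d ((q.nb - 1) / d) q.nb := ⟨hnb.ne', rfl⟩
  have hdl := h.del_le
  refine Runs.bind (mergeCells_spec q.ins q.del c h.ins_sorted h.del_sorted) ?_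
  rintro R c₁ i₁ t₁ ⟨rfl, rfl, ht₁, hp, hs⟩
  have hRl : R.length = q.ins.length + q.del.length := by rw [hp.length_eq, List.length_append]
  have hRc : ∀ x ∈ R, 2 ≤ x.val := fun x hx => h.cells x (hp.mem_iff.1 hx)
  have hRp : (R.map c₁.mem).Perm (q.ins.map c₁.mem ++ q.del.map c₁.mem) := by
    have := hp.map c₁.mem
    rwa [List.map_append] at this
  have hsp := hs
  rw [← List.take_append_drop q.del.length R, List.map_append, List.pairwise_append] at hsp
  have htl : (R.take q.del.length).length = q.del.length := by rw [List.length_take]; omega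
  have hxl : (R.drop q.del.length).length = d * B := by rw [List.length_drop]; omega
  -- The deletion buffer keeps its length and only exchanges records for smaller ones, so it remains
  -- below the tree.
  have hdom : ∀ x ∈ (R.take q.del.length).map c₁.mem, ∃ y ∈ q.del.map c₁.mem, x ≤ y := by
    intro x hx
    refine exists_le_of_mem_take hs hRp ?_
    rwa [List.length_map, ← List.map_take]
  have hN : q.nb * (2 * d) + 2 * d ≤ q.nb * (4 * d) := by nlinarith
  refine Runs.bind ((pushTo_spec (used := R.take q.del.length) (X := R.drop q.del.length) (by omega)
    (by omega) h.disk h.root hlt hsp.2.1 (by omega)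
    fun x hx => hRc x (List.mem_of_mem_drop hx)).mono_blocks (by omega)) ?_
  rintro ⟨X, δ⟩ c₂ i₂ t₂ ⟨hpu, hi₂, ht₂⟩
  dsimp only at hpu ⊢
  have hXl : X.length = d * B := hpu.length_eq.trans hxl
  have hblk : blocksFor B X.length ≤ d := blocksFor_le hB hXl.le
  have hblkB : blocksFor B X.length * B ≤ d * B := Nat.mul_le_mul_right _ hblk
  refine Runs.bind (storeBlocks_spec (d := d) (v := q.nb) X (blocksFor B X.length) (by omega)
    (by omega) c₂) ?_
  rintro _ c₃ i₃ t₃ ⟨rfl, rfl, hm₃, hs₃, ho₃⟩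
  set δ' : Dir := ⟨Function.update δ.off q.nb 0, Function.update δ.len q.nb X.length⟩ with hδ'
  have hself : node d c₃ δ' q.nb = X.map c₂.mem := by
    unfold node
    simp only [hδ', Function.update_self]
    exact span_of_stored fun p hp => hs₃ p (hp.trans_le (le_blocksFor_mul hB _))
  have hother : ∀ u, u ≠ q.nb → node d c₃ δ' u = node d c₂ δ u := by
    intro u hu
    unfold node
    simp only [hδ', Function.update_of_ne hu]
    exact span_congr fun p hp => ho₃ u hu p (hp.trans_le (hpu.inv.len_le u))
  have htot : total (q.nb + 1) (node d c₃ δ') =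
      total q.nb (node d c₁ q.dir) + ((R.drop q.del.length).map c₁.mem : List _) := by
    rw [← hpu.total_eq]
    unfold total
    rw [Finset.sum_range_succ, hself, Finset.sum_congr rfl fun u hu => by
      rw [hother u (Finset.mem_range.1 hu).ne]]
  have hdel : (R.take q.del.length).map c₃.mem = (R.take q.del.length).map c₁.mem := by
    rw [hm₃]; exact List.map_congr_left hpu.frame
  have hpot : pot d B ⟨[], R.take q.del.length, q.nb + 1, δ'⟩ ≤
      pot d B q + 2 * (d * B * height d q.nb) := by
    refine potential_succ_le hnb (fun u hu => ?_) (fun u hu => ?_) ?_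
    · simp only [Queue.size, hδ', Function.update_of_ne hu]
      exact hpu.size_eq u
    · rw [Queue.size, h.disk.empty u hu, Nat.zero_sub]
    · simp [Queue.size, hδ', hXl]
  refine Runs.done ⟨⟨⟨?_, ?_, ?_, ?_⟩, ?_, Nat.succ_pos _, ?_, Nat.zero_le _, ?_, List.Pairwise.nil, ?_, ?_, ?_⟩,
    rfl, rfl, ?_, ?_⟩
  · intro u
    by_cases hu : u = q.nb
    · subst hu; simp only [hδ', Function.update_self]; omega
    · simp only [hδ', Function.update_of_ne hu]; exact hpu.inv.len_le u
  · intro u hu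
    have hu' : q.nb + 1 ≤ u := hu
    simp only [hδ', Function.update_of_ne (show u ≠ q.nb by omega)]
    exact hpu.inv.empty u (by omega)
  · intro u
    by_cases hu : u = q.nb
    · subst hu; rw [hself]; exact hpu.sorted
    · rw [hother u hu]; exact hpu.inv.sorted u
  · intro a u hau x hx y hy
    have hlt := hau.lt
    by_cases hu : u = q.nb
    · subst hu
      rw [hself] at hy
      rw [hother a hlt.ne] at hx
      exact hpu.le a (desc_iff_tail.1 hau).2 x hx y hy
    · rw [hother u hu] at hy
      by_cases ha : a = q.nb
      · rw [hpu.inv.node_eq_nil (by omega)] at hy; cases hy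
      · rw [hother a ha] at hx
        exact hpu.inv.heap a u hau x hx y hy
  · simp only [hδ', Function.update_of_ne hnb.ne]
    exact hpu.root.trans h.root
  · intro x hx
    exact hRc x (List.mem_of_mem_take hx)
  · dsimp only; omega
  · rw [hdel]; exact hsp.1
  · intro x hx y hy
    rw [hdel] at hx
    rw [htot, Multiset.mem_add] at hy
    rcases hy with hy | hy
    · obtain ⟨z, hz, hxz⟩ := hdom x hx
      exact hxz.trans (h.del_le_total z hz y hy)
    · exact hsp.2.2 x hx y hy
  · rw [htot, hdel, ← h.total_eq]
    have e : (q.ins.map c₁.mem : Multiset (WithTop α)) + (q.del.map c₁.mem : List _) =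
        ((R.take q.del.length).map c₁.mem : List _) + ((R.drop q.del.length).map c₁.mem : List _) := by
      rw [Multiset.coe_add, Multiset.coe_add, Multiset.coe_eq_coe]
      refine hRp.symm.trans ?_
      rw [← List.map_append, List.take_append_drop]
    rw [e, List.map_nil, Multiset.coe_nil, zero_add, add_assoc, add_comm (total _ _)]
  · have e := mul_comm B (blocksFor B X.length)
    have e2 : 4 * (d * B) * height d ((q.nb - 1) / d) + 4 * (d * B) = 4 * (d * B * height d q.nb) := by
      rw [hch.height]; ring
    simp only [Nat.mul_add, zero_add, add_zero]
    omega
  · have e2 : 7 * (d * B) * height d ((q.nb - 1) / d) + 7 * (d * B) = 7 * (d * B * height d q.nb) := by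
      rw [hch.height]; ring
    have h1 := Nat.mul_le_mul_left (9 + 2 * k) hpot
    have h2 : (9 + 2 * k) * (2 * (d * B * height d q.nb)) + 7 * (d * B * height d q.nb) =
      (25 + 4 * k) * (d * B * height d q.nb) := by ring
    rw [Nat.mul_add] at h1
    omega

end Specs

end Queue

end IOModel

/-! ### The operations of the queue and the amortized cost of a sequence of them -/

namespace IOModel

namespace Queue

section Specs

variable {m B : ℕ} [NeZero B] {α : Type} [LinearOrder α] {d k l N : ℕ} {c c' : Config m B α} {q : Queue m}
  {S : Multiset (WithTop α)}

/-- The queue `q` stores the records `S`, and the output port shows the smallest one. -/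
structure Shows (d : ℕ) (c : Config m B α) (q : Queue m) (S : Multiset (WithTop α)) : Prop where
  stores : Stores d c q S
  ready : Ready d c q
  port : c.mem 1 = S.inf

theorem ne_port {x : Fin (m + 2)} (hx : 2 ≤ x.val) {p : Fin (m + 2)} (hp : p = 0 ∨ p = 1) : x ≠ p := by
  rintro rfl
  rcases hp with rfl | rfl
  · rw [Fin.val_zero] at hx; omega
  · rw [Fin.val_one] at hx; omega

theorem Stores.update_port (h : Stores d c q S) {p : Fin (m + 2)} (hp : p = 0 ∨ p = 1) (y : WithTop α) :
    Stores d { c with mem := Function.update c.mem p y } q S :=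
  h.congr rfl fun x hx => Function.update_of_ne (ne_port (h.cells x hx) hp) _ _

theorem restore_spec (hd : 0 < d) (hk : d < 2 ^ k) (hm : 8 * (d * B) ≤ m) (h : Stores d c q S) :
    Runs ((q.nb - 1) * (4 * d)) (restore d q) c fun q' c' i t => Shows d c' q' S ∧
      q'.nb = q.nb ∧ q'.ins.length = q.ins.length ∧ B * i + 9 * pot d B q' ≤ 9 * pot d B q ∧
      t + (9 + 2 * k) * pot d B q' ≤ (9 + 2 * k) * pot d B q + 2 := by
  refine Runs.bind (fix_spec hd hk hm h) ?_
  rintro q₁ c₁ i t ⟨h₁, hr₁, hnb, hins, hi, ht⟩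
  refine Runs.bind (popMin_spec h₁ hr₁) ?_
  rintro r c₂ i' t' ⟨rfl, rfl, ht', hr⟩
  rcases r with _ | r
  · refine Runs.clear (Runs.done ⟨⟨h₁.update_port (Or.inr rfl) _, hr₁.congr rfl, ?_⟩, hnb, by rw [hins],
      by omega, by omega⟩)
    simp only at hr
    rw [hr]
    simp
  · refine Runs.move (Runs.done ⟨⟨h₁.update_port (Or.inr rfl) _, hr₁.congr rfl, ?_⟩, hnb, by rw [hins],
      by omega, by omega⟩)
    simp only at hr
    rw [hr.1]
    simp

theorem deleteMin_spec (hd : 0 < d) (hk : d < 2 ^ k) (hm : 8 * (d * B) ≤ m) (h : Shows d c q S) :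
    Runs ((q.nb - 1) * (4 * d)) (deleteMin d q) c fun q' c' i t => Shows d c' q' (S.erase S.inf) ∧
      q'.nb = q.nb ∧ q'.ins.length ≤ q.ins.length ∧ B * i + 9 * pot d B q' ≤ 9 * pot d B q ∧
      t + (9 + 2 * k) * pot d B q' ≤ (9 + 2 * k) * pot d B q + 3 := by
  refine Runs.bind (popMin_spec h.stores h.ready) ?_
  rintro r c₁ i t ⟨rfl, rfl, ht, hr⟩
  rcases r with _ | ⟨x, q₁⟩
  · simp only at hr
    subst hr
    refine (restore_spec hd hk hm h.stores).mono ?_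
    rintro q' c' i' t' ⟨h', hnb, hins, hi', ht'⟩
    exact ⟨h', hnb, hins.le, by rw [zero_add]; omega, by omega⟩
  · obtain ⟨-, h₁, hnb₁, hsz, hins₁⟩ := hr
    have hpot : pot d B q₁ = pot d B q := by
      unfold pot; rw [hsz, hnb₁]
    dsimp only at h₁ hnb₁ ⊢
    rw [← hpot, ← hnb₁]
    refine (restore_spec hd hk hm h₁).mono ?_
    rintro q' c' i' t' ⟨h', hnb, hins, hi', ht'⟩
    exact ⟨h', hnb, hins.le.trans hins₁, by rw [zero_add]; omega, by omega⟩

/-- The cost of the insertions of full buffers is proportional to the sum of the depths of the nodes. -/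
def depths (d nb : ℕ) : ℕ := ∑ u ∈ Finset.range nb, height d u

/-- `ins.length + d * B * nb` grows by exactly one whether or not the buffer is flushed, since a
flush trades d B buffered records for one node. This ties the number of nodes to the number of
operations. The number of nodes afterwards depends on the branch and is therefore existential. -/
theorem insertCell_spec (hd : 0 < d) (hk : d < 2 ^ k) (hm : 8 * (d * B) ≤ m) (h : Stores d c q S)
    (hins : q.ins.length < d * B) (hl : q.ins.length < 2 ^ l) {x : Fin (m + 2)} (hx : 2 ≤ x.val)
    (hx' : x ∉ q.ins ++ q.del) :
    ∃ nb, Runs ((nb - 1) * (4 * d)) (insertCell d x q) c fun q' c' i t => Shows d c' q' (c.mem 0 ::ₘ S) ∧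
      q'.nb = nb ∧ q.nb ≤ nb ∧ q'.ins.length < d * B ∧
      q'.ins.length + d * B * q'.nb = q.ins.length + 1 + d * B * q.nb ∧
      B * i + 9 * pot d B q' + 22 * (d * B * depths d q.nb) ≤
        9 * pot d B q + 22 * (d * B * depths d nb) ∧
      t + (9 + 2 * k) * pot d B q' + (25 + 4 * k) * (d * B * depths d q.nb) ≤
        (9 + 2 * k) * pot d B q + (25 + 4 * k) * (d * B * depths d nb) + (l + 3) := by
  set c₁ : Config m B α := { c with mem := Function.update c.mem x (c.mem 0) } with hc₁
  have h₁ : Stores d c₁ q S := h.congr rfl fun y hy => Function.update_of_ne (by rintro rfl; exact hx' hy) _ _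
  have hxm : c₁.mem x = c.mem 0 := Function.update_self _ _ _
  have key : ∀ r ≤ q.ins.length, (∀ y ∈ q.ins.take r, c₁.mem y ≤ c₁.mem x) →
      (∀ y ∈ q.ins.drop r, c₁.mem x ≤ c₁.mem y) →
      Stores d c₁ { q with ins := q.ins.take r ++ x :: q.ins.drop r } (c.mem 0 ::ₘ S) ∧
      (q.ins.take r ++ x :: q.ins.drop r).length = q.ins.length + 1 := by
    intro r hr h1 h2
    have hperm : (q.ins.take r ++ x :: q.ins.drop r).Perm (x :: q.ins) := by
      refine List.perm_middle.trans ?_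
      rw [List.take_append_drop]
    have hlen := hperm.length_eq
    rw [List.length_cons] at hlen
    refine ⟨⟨h₁.disk, h₁.root, h₁.nb_pos, ?_, ?_, h₁.del_le, ?_, h₁.del_sorted, h₁.del_le_total, ?_⟩, hlen⟩
    · intro y hy
      rcases List.mem_append.1 hy with hy | hy
      · rcases List.mem_cons.1 (hperm.mem_iff.1 hy) with rfl | hy
        · exact hx
        · exact h.cells y (List.mem_append_left _ hy)
      · exact h.cells y (List.mem_append_right _ hy)
    · dsimp only; omega
    · have hs := h₁.ins_sorted
      rw [← List.take_append_drop r q.ins, List.map_append, List.pairwise_append] at hs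
      simp only [List.map_append, List.map_cons, List.pairwise_append, List.pairwise_cons,
        List.mem_cons, List.mem_map]
      refine ⟨hs.1, ⟨?_, hs.2.1⟩, ?_⟩
      · rintro _ ⟨w, hw, rfl⟩
        exact h2 w hw
      · rintro _ ⟨w, hw, rfl⟩ y (rfl | ⟨w', hw', rfl⟩)
        · exact h1 w hw
        · exact (h1 w hw).trans (h2 w' hw')
    · have e : (((q.ins.take r ++ x :: q.ins.drop r).map c₁.mem : List _) : Multiset (WithTop α)) =
          c.mem 0 ::ₘ (q.ins.map c₁.mem : List _) := by
        rw [← hxm, Multiset.cons_coe, ← List.map_cons]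
        exact Multiset.coe_eq_coe.2 (hperm.map _)
      dsimp only
      rw [e, Multiset.cons_add, Multiset.cons_add, h₁.total_eq]
  unfold insertCell
  split_ifs with hfull
  · refine ⟨q.nb + 1, Runs.move ?_⟩
    rw [← hc₁]
    refine Runs.bind (rank_spec x q.ins c₁ h₁.ins_sorted l hl) ?_
    rintro r c₂ i t ⟨rfl, rfl, ht, hr, h1, h2⟩
    obtain ⟨h₂, hlen⟩ := key r hr h1 h2
    refine Runs.bind ((flush_spec k hd hm h₂ (hlen.trans hfull)).mono_blocks le_rfl) ?_
    rintro q₁ c₂ i₁ t₁ ⟨h₃, hins₁, hnb₁, hi₁, ht₁⟩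
    have hN : (q₁.nb - 1) * (4 * d) = (q.nb + 1 - 1) * (4 * d) := by rw [hnb₁]
    refine ((restore_spec hd hk hm h₃).mono_blocks hN.le).mono ?_
    rintro q₂ c₃ i₂ t₂ ⟨h₄, hnb₂, hins₂, hi₂, ht₂⟩
    rw [hins₁, List.length_nil] at hins₂
    have hdep : depths d (q.nb + 1) = depths d q.nb + height d q.nb := Finset.sum_range_succ _ _
    change B * i₁ + 9 * pot d B q₁ ≤ 9 * pot d B q + 22 * (d * B * height d q.nb) at hi₁
    change t₁ + (9 + 2 * k) * pot d B q₁ ≤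
      (9 + 2 * k) * pot d B q + (25 + 4 * k) * (d * B * height d q.nb) at ht₁
    refine ⟨h₄, hnb₂.trans hnb₁, Nat.le_succ _, by omega, ?_, ?_, ?_⟩
    · rw [hins₂, hnb₂, hnb₁, hfull]
      dsimp only
      ring
    · rw [hdep, Nat.mul_add (d * B)]
      simp only [Nat.mul_add, zero_add]
      omega
    · rw [hdep, Nat.mul_add (d * B), Nat.mul_add (25 + 4 * k)]
      omega
  · refine ⟨q.nb, Runs.move ?_⟩
    rw [← hc₁]
    refine Runs.bind (rank_spec x q.ins c₁ h₁.ins_sorted l hl) ?_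
    rintro r c₂ i t ⟨rfl, rfl, ht, hr, h1, h2⟩
    obtain ⟨h₂, hlen⟩ := key r hr h1 h2
    refine (restore_spec hd hk hm h₂).mono ?_
    rintro q₂ c₃ i₂ t₂ ⟨h₄, hnb₂, hins₂, hi₂, ht₂⟩
    dsimp only at hnb₂ hins₂
    rw [hlen] at hins₂
    change B * i₂ + 9 * pot d B q₂ ≤ 9 * pot d B q at hi₂
    change t₂ + (9 + 2 * k) * pot d B q₂ ≤ (9 + 2 * k) * pot d B q + 2 at ht₂
    refine ⟨h₄, hnb₂, le_rfl, by omega, by rw [hnb₂, hins₂], ?_, by omega⟩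
    rw [zero_add]
    omega

theorem insert_spec (hd : 0 < d) (hk : d < 2 ^ k) (hm : 8 * (d * B) ≤ m) (h : Stores d c q S)
    (hins : q.ins.length < d * B) (hl : q.ins.length < 2 ^ l) :
    ∃ nb, Runs ((nb - 1) * (4 * d)) (insert d q) c fun q' c' i t => Shows d c' q' (c.mem 0 ::ₘ S) ∧
      q'.nb = nb ∧ q.nb ≤ nb ∧ q'.ins.length < d * B ∧
      q'.ins.length + d * B * q'.nb = q.ins.length + 1 + d * B * q.nb ∧
      B * i + 9 * pot d B q' + 22 * (d * B * depths d q.nb) ≤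
        9 * pot d B q + 22 * (d * B * depths d nb) ∧
      t + (9 + 2 * k) * pot d B q' + (25 + 4 * k) * (d * B * depths d q.nb) ≤
        (9 + 2 * k) * pot d B q + (25 + 4 * k) * (d * B * depths d nb) + (l + 3) := by
  have hdl := h.del_le
  have hlen : (fresh (q.ins ++ q.del) 1).length = 1 := length_fresh (by rw [List.length_append]; omega)
  obtain ⟨x, hx⟩ := List.length_eq_one_iff.1 hlen
  have hmem : x ∈ fresh (q.ins ++ q.del) 1 := by rw [hx]; exact List.mem_singleton_self x
  unfold insert
  rw [hx]
  exact insertCell_spec hd hk hm h hins hl (mem_fresh hmem).1 (mem_fresh hmem).2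

end Specs

end Queue

/-- The priority queue of a heap whose nodes have `d` children. -/
noncomputable def heapQueue (m B d : ℕ) [NeZero B] : ExtPQ m B :=
  ⟨Queue m, ⟨[], [], 1, ⟨fun _ => 0, fun _ => 0⟩⟩, Queue.insert d, Queue.deleteMin d⟩

section Run

open Queue

variable {m B : ℕ} [NeZero B] {α : Type} [LinearOrder α] {d k : ℕ}

/-- The stored records. -/
def stored (ops : List (Op α)) : Multiset (WithTop α) := (contents ops).map WithTop.some

theorem stored_inf (ops : List (Op α)) : (stored ops).inf = least (contents ops) := rfl

theorem stored_insert (ops : List (Op α)) (x : α) : stored (ops ++ [.insert x]) = ↑x ::ₘ stored ops := by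
  unfold stored
  rw [contents_append]
  simp only [List.foldl_cons, List.foldl_nil, Op.apply, Multiset.map_cons]

theorem stored_deleteMin (ops : List (Op α)) :
    stored (ops ++ [.deleteMin]) = (stored ops).erase (stored ops).inf := by
  rw [stored_inf]
  unfold stored
  rw [contents_append]
  simp only [List.foldl_cons, List.foldl_nil]
  by_cases h : contents ops = 0
  · rw [h, apply_deleteMin_zero]; simp
  · obtain ⟨x, -, e⟩ := exists_least_eq h
    rw [apply_deleteMin_of_eq e, e]
    exact Multiset.map_erase _ (fun _ _ => WithTop.coe_inj.1) _ _

/-- State and costs after the operations `ops`. -/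
structure RunInv (d k : ℕ) (ops : List (Op α)) (o : Outcome m B (Queue m) α) : Prop where
  shows : Shows d o.cfg o.state (stored ops)
  ins_lt : o.state.ins.length < d * B
  count : o.state.ins.length + d * B * o.state.nb ≤ ops.length + d * B
  ios : B * o.ios + 9 * pot d B o.state ≤ 22 * (d * B * depths d o.state.nb)
  time : o.time + (9 + 2 * k) * pot d B o.state ≤
    (25 + 4 * k) * (d * B * depths d o.state.nb) + ops.length * (Nat.log 2 ops.length + 5)
  blocks : ∀ a ∈ o.blocks, a < (o.state.nb - 1) * (4 * d)

theorem RunInv.step {ops : List (Op α)} {op : Op α} {o : Outcome m B (Queue m) α} (h : RunInv d k ops o)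
    {p : Prog m B (Queue m)} {c : Config m B α} {nb : ℕ}
    (hr : Runs ((nb - 1) * (4 * d)) p c fun q c' i t => Shows d c' q (stored (ops ++ [op])) ∧
      q.nb = nb ∧ o.state.nb ≤ nb ∧ q.ins.length < d * B ∧
      q.ins.length + d * B * q.nb ≤ o.state.ins.length + 1 + d * B * o.state.nb ∧
      B * i + 9 * pot d B q + 22 * (d * B * depths d o.state.nb) ≤
        9 * pot d B o.state + 22 * (d * B * depths d nb) ∧
      t + (9 + 2 * k) * pot d B q + (25 + 4 * k) * (d * B * depths d o.state.nb) ≤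
        (9 + 2 * k) * pot d B o.state + (25 + 4 * k) * (d * B * depths d nb) +
          (Nat.log 2 ops.length + 1 + 3)) :
    RunInv d k (ops ++ [op]) { p.exec c with
      ios := o.ios + (p.exec c).ios
      time := o.time + (p.exec c).time
      blocks := o.blocks ∪ (p.exec c).blocks } := by
  obtain ⟨h1, h2, h3, h4, h5, h6⟩ := h
  obtain ⟨⟨h7, rfl, h9, h10, h11, h12, h13⟩, h14⟩ := hr
  have hle : ops.length * (Nat.log 2 ops.length + 5) + (Nat.log 2 ops.length + 5) ≤
      (ops ++ [op]).length * (Nat.log 2 (ops ++ [op]).length + 5) := by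
    rw [List.length_append, List.length_singleton, ← Nat.succ_mul]
    exact Nat.mul_le_mul_left _ (Nat.add_le_add_right (Nat.log_mono_right (Nat.le_succ _)) _)
  refine ⟨h7, h10, ?_, ?_, ?_, fun a ha => ?_⟩ <;> dsimp only
  · rw [List.length_append, List.length_singleton]; omega
  · rw [Nat.mul_add]; omega
  · omega
  · rcases Finset.mem_union.1 ha with ha | ha
    · exact (h6 a ha).trans_le (Nat.mul_le_mul_right _ (Nat.sub_le_sub_right h9 1))
    · exact h14 a ha

/-- All costs telescope against the potential and the sum of the depths of the nodes. The insertion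
buffer holds at most as many records as there were operations, so searching it takes logarithmic
time in the number of operations. -/
theorem runInv (hd : 0 < d) (hk : d < 2 ^ k) (hm : 8 * (d * B) ≤ m) (ops : List (Op α)) :
    RunInv d k ops ((heapQueue m B d).run ops) := by
  have hB : 0 < B := Nat.pos_of_ne_zero (NeZero.ne B)
  have hs : 0 < d * B := Nat.mul_pos hd hB
  induction ops using List.reverseRecOn with
  | nil =>
    have hn : ∀ v, node d (⟨fun _ => ⊤, fun _ _ => ⊤⟩ : Config m B α) ⟨fun _ => 0, fun _ => 0⟩ v = [] :=
      fun v => span_of_le le_rfl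
    have ht : total 1 (node d (⟨fun _ => ⊤, fun _ _ => ⊤⟩ : Config m B α) ⟨fun _ => 0, fun _ => 0⟩) = 0 :=
      Finset.sum_eq_zero fun v _ => by rw [hn]; rfl
    have hp : pot d B (⟨[], [], 1, ⟨fun _ => 0, fun _ => 0⟩⟩ : Queue m) = 0 := by
      simp [pot, potential, Live, Queue.size]
    refine ⟨⟨⟨⟨?_, ?_, ?_, ?_⟩, rfl, one_pos, ?_, ?_, ?_, ?_, ?_, ?_, ?_⟩, fun _ => ht, rfl⟩, hs, ?_, ?_, ?_, ?_⟩
    · exact fun v => Nat.zero_le _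
    · exact fun v _ => rfl
    · exact fun v => by
        change (node d (⟨fun _ => ⊤, fun _ _ => ⊤⟩ : Config m B α) ⟨fun _ => 0, fun _ => 0⟩ v).Pairwise _
        rw [hn]; exact List.Pairwise.nil
    · intro v u _ x hx
      change x ∈ node d (⟨fun _ => ⊤, fun _ _ => ⊤⟩ : Config m B α) ⟨fun _ => 0, fun _ => 0⟩ v at hx
      rw [hn] at hx; cases hx
    · intro x hx; cases hx
    · exact Nat.zero_le _
    · exact Nat.zero_le _
    · exact List.Pairwise.nil
    · exact List.Pairwise.nil
    · intro x hx; cases hx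
    · change 0 + 0 + total 1 (node d (⟨fun _ => ⊤, fun _ _ => ⊤⟩ : Config m B α)
        ⟨fun _ => 0, fun _ => 0⟩) = 0
      rw [ht]; rfl
    · change 0 + d * B * 1 ≤ 0 + d * B
      omega
    · change B * 0 + 9 * pot d B (⟨[], [], 1, ⟨fun _ => 0, fun _ => 0⟩⟩ : Queue m) ≤ _
      rw [hp]; exact Nat.zero_le _
    · change 0 + (9 + 2 * k) * pot d B (⟨[], [], 1, ⟨fun _ => 0, fun _ => 0⟩⟩ : Queue m) ≤ _
      rw [hp]; exact Nat.zero_le _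
    · intro a ha
      cases ha
  | append_singleton ops op ih =>
    have hrun : (heapQueue m B d).run (ops ++ [op]) = (heapQueue m B d).step ((heapQueue m B d).run ops) op := by
      unfold ExtPQ.run; rw [List.foldl_append]; rfl
    rw [hrun]
    set o := (heapQueue m B d).run ops with ho
    have h1 := ih.shows
    have hlen : o.state.ins.length ≤ ops.length := by
      have h2 := Nat.le_mul_of_pos_right (d * B) h1.stores.nb_pos
      have h3 := ih.count
      omega
    have hlog : o.state.ins.length < 2 ^ (Nat.log 2 ops.length + 1) :=
      hlen.trans_lt (Nat.lt_pow_succ_log_self (by norm_num) _)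
    rcases op with x | _
    · have h0 : Stores d { o.cfg with mem := Function.update o.cfg.mem 0 (x : WithTop α) } o.state (stored ops) :=
        h1.stores.update_port (Or.inl rfl) _
      obtain ⟨nb, hr⟩ := insert_spec hd hk hm h0 ih.ins_lt hlog
      refine ih.step (nb := nb) (hr.mono ?_)
      rintro q c i t ⟨h7, h8, h9, h10, h11, h12, h13⟩
      dsimp only at h7
      rw [Function.update_self, ← stored_insert] at h7
      exact ⟨h7, h8, h9, h10, h11.le, h12, h13⟩
    · refine ih.step (nb := o.state.nb) ((deleteMin_spec hd hk hm h1).mono ?_)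
      rintro q c i t ⟨h7, h8, h9, h10, h11⟩
      rw [← stored_deleteMin] at h7
      refine ⟨h7, h8, le_rfl, h9.trans_lt ih.ins_lt, ?_, by omega, by omega⟩
      rw [h8]; omega

end Run

end IOModel

namespace IOModel

/-! ## Costs of the priority queue -/

/-- Each of the `f` nodes other than the root has a number at most `f`, hence depth at most 1 +
log_d f by `pow_height_le`. -/
theorem log_mul_depths_le {d : ℕ} (hd : 1 ≤ d) (f : ℕ) :
    Real.log d * Queue.depths d (f + 1) ≤ f * (Real.log d + Real.log f) := by
  unfold Queue.depths
  rw [Finset.sum_range_succ', height_zero, add_zero, Nat.cast_sum, Finset.mul_sum]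
  refine (Finset.sum_le_card_nsmul (Finset.range f) _ (Real.log d + Real.log f) fun u hu => ?_).trans
    (by rw [Finset.card_range, nsmul_eq_mul])
  have hu := Finset.mem_range.1 hu
  have hf : (0 : ℝ) < f := by exact_mod_cast (Nat.zero_lt_of_lt hu)
  have hd' : (0 : ℝ) < d := by exact_mod_cast hd
  have h1 : d ^ height d (u + 1) ≤ d * f :=
    (pow_height_le (Nat.succ_ne_zero u)).trans (Nat.mul_le_mul_left _ hu)
  have h2 : (d : ℝ) ^ height d (u + 1) ≤ d * f := by exact_mod_cast h1
  rw [← Real.log_mul hd'.ne' hf.ne', mul_comm, ← Real.log_pow]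
  exact Real.log_le_log (pow_pos hd' _) h2

theorem natLog_le {n : ℕ} (hn : 1 ≤ n) : (Nat.log 2 n : ℝ) ≤ 2 * Real.log n := by
  have h1 : (2 : ℝ) ^ Nat.log 2 n ≤ n := by exact_mod_cast Nat.pow_log_le_self 2 (by omega)
  have h2 := Real.log_le_log (by positivity) h1
  rw [Real.log_pow] at h2
  have h3 := half_le_log le_rfl
  nlinarith [Nat.cast_nonneg (α := ℝ) (Nat.log 2 n)]

/-- The factor 25 + 4 k is of order log d because k = ⌊log₂ d⌋ + 1. It cancels the denominator log d
of the depth, so the choice of d does not show in the time. -/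
theorem time_depths_le {B d f k : ℕ} (hB : 1 ≤ B) (hd : 2 ≤ d) (hf : d * B * f ≤ k) :
    (((25 + 4 * (Nat.log 2 d + 1)) * (d * B * Queue.depths d (f + 1)) : ℕ) : ℝ) ≤ 66 * sortTime k := by
  have h1 := log_mul_depths_le (d := d) (by omega) f
  have h2 := natLog_le (n := d) (by omega)
  have h3 := half_le_log (x := d) (by exact_mod_cast hd)
  have h4 : (25 + 4 * ((Nat.log 2 d : ℝ) + 1)) ≤ 66 * Real.log d := by linarith
  have hs : (0 : ℝ) ≤ d * B := by positivity
  have h5 : (d : ℝ) * B * (f * (Real.log d + Real.log f)) ≤ sortTime k := by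
    rcases Nat.eq_zero_or_pos f with rfl | hf0
    · simpa using sortTime_nonneg k
    · have hf' : (0 : ℝ) < f := by exact_mod_cast hf0
      have hd' : (0 : ℝ) < d := by exact_mod_cast (by omega : 0 < d)
      have hdf : d * f ≤ k := by nlinarith
      have hk : (d : ℝ) * f ≤ k := by exact_mod_cast hdf
      have hlog := Real.log_le_log (by positivity) hk
      have hcast : (d : ℝ) * B * f ≤ k := by exact_mod_cast hf
      have hlog0 : 0 ≤ Real.log ((d : ℝ) * f) :=
        Real.log_nonneg (by exact_mod_cast Nat.mul_pos (by omega : 0 < d) hf0)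
      rw [← Real.log_mul hd'.ne' hf'.ne', ← mul_assoc]
      exact mul_le_mul hcast hlog hlog0 (Nat.cast_nonneg _)
  push_cast
  calc (25 + 4 * ((Nat.log 2 d : ℝ) + 1)) * (d * B * Queue.depths d (f + 1))
      ≤ 66 * Real.log d * (d * B * Queue.depths d (f + 1)) :=
        mul_le_mul_of_nonneg_right h4 (by positivity)
    _ = 66 * (d * B * (Real.log d * Queue.depths d (f + 1))) := by ring
    _ ≤ 66 * (d * B * (f * (Real.log d + Real.log f))) := by gcongr
    _ ≤ 66 * sortTime k := by linarith

/-- Depths are logarithms to base d, whereas sort uses base M/B. As M/B ≤ d^8, changing the base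
costs a factor 8; the additive 1 in the depth contributes another k/B, which is at most sort(k). -/
theorem ios_depths_le {M B d f k : ℕ} (hB : 1 ≤ B) (hd : 2 ≤ d) (hM : 2 * B ≤ M) (hMd : M ≤ d ^ 8 * B)
    (hf : d * B * f ≤ k) (hk : M ≤ k) :
    (d : ℝ) * Queue.depths d (f + 1) ≤ 9 * sortIO M B k := by
  have hB' : (0 : ℝ) < B := by exact_mod_cast hB
  have h1 := log_mul_depths_le (d := d) (by omega) f
  have h3 := half_le_log (x := d) (by exact_mod_cast hd)
  have h6 := div_le_sortIO hB hM hk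
  have h7 := two_le_div hB hM
  have h8 := half_le_log h7
  have h9 : Real.log ((M : ℝ) / B) ≤ 8 * Real.log d := by
    have : (M : ℝ) / B ≤ (d : ℝ) ^ 8 := by
      rw [div_le_iff₀ hB']; exact_mod_cast hMd
    have := Real.log_le_log (by linarith) this
    rwa [Real.log_pow] at this
  have hkB : (1 : ℝ) ≤ (k : ℝ) / B := by
    have : (M : ℝ) / B ≤ (k : ℝ) / B := by gcongr
    linarith
  have hlogk := Real.log_nonneg hkB
  have h10 : Real.log ((k : ℝ) / B) * (k / B) ≤ 8 * Real.log d * sortIO M B k := by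
    have e : sortIO M B k * Real.log ((M : ℝ) / B) = (k : ℝ) / B * Real.log ((k : ℝ) / B) := by
      unfold sortIO
      rw [logb_eq, mul_assoc, div_mul_cancel₀ _ (by linarith)]
    rw [mul_comm, ← e, mul_comm]
    exact mul_le_mul_of_nonneg_right h9 ((by positivity : (0 : ℝ) ≤ (k : ℝ) / B).trans h6)
  have h5 : (d : ℝ) * (f * (Real.log d + Real.log f)) ≤
      (k : ℝ) / B * (Real.log d + Real.log ((k : ℝ) / B)) := by
    rcases Nat.eq_zero_or_pos f with rfl | hf0
    · simp only [Nat.cast_zero, zero_mul, mul_zero]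
      have := (by linarith : 0 ≤ Real.log d)
      positivity
    · have hf' : (0 : ℝ) < f := by exact_mod_cast hf0
      have hdf : (d : ℝ) * f ≤ (k : ℝ) / B := by
        rw [le_div_iff₀ hB']
        exact_mod_cast (by linarith [mul_right_comm d B f] : d * f * B ≤ k)
      have hff : (f : ℝ) ≤ (k : ℝ) / B := by
        refine le_trans ?_ hdf
        exact le_mul_of_one_le_left hf'.le (by exact_mod_cast (by omega : 1 ≤ d))
      have hlog := Real.log_le_log hf' hff
      have hlog0 : 0 ≤ Real.log (f : ℝ) := Real.log_natCast_nonneg f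
      rw [← mul_assoc]
      exact mul_le_mul hdf (by linarith) (by linarith) (by positivity)
  have h11 : (k : ℝ) / B * Real.log d ≤ Real.log d * sortIO M B k := by
    rw [mul_comm]; exact mul_le_mul_of_nonneg_left h6 (by linarith)
  have h12 : Real.log d * ((d : ℝ) * Queue.depths d (f + 1)) ≤ Real.log d * (9 * sortIO M B k) := by
    calc Real.log d * ((d : ℝ) * Queue.depths d (f + 1))
        = d * (Real.log d * Queue.depths d (f + 1)) := by ring
      _ ≤ d * (f * (Real.log d + Real.log f)) := by gcongr
      _ ≤ (k : ℝ) / B * (Real.log d + Real.log ((k : ℝ) / B)) := h5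
      _ = (k : ℝ) / B * Real.log d + Real.log ((k : ℝ) / B) * (k / B) := by ring
      _ ≤ Real.log d * sortIO M B k + 8 * Real.log d * sortIO M B k := add_le_add h11 h10
      _ = _ := by ring
  exact le_of_mul_le_mul_left h12 (by linarith)

/-! ## Idling -/

section Idle

variable {m B : ℕ} {σ α : Type} [LinearOrder α]

/-- Spend `i` I/Os and `t` units of time. -/
def idle : ℕ → ℕ → σ → Prog m B σ
  | 0, 0, s => .done s
  | 0, t + 1, s => .move 0 0 (idle 0 t s)
  | i + 1, t, s => .input 0 (fun _ => none) (idle i t s)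

theorem exec_idle (i t : ℕ) (s : σ) (c : Config m B α) :
    (idle i t s).exec c = ⟨s, c, i, B * i + t, if i = 0 then ∅ else {0}⟩ := by
  induction i with
  | zero =>
    induction t with
    | zero => simp [idle, Prog.exec]
    | succ t ih =>
      have hc : ({ c with mem := Function.update c.mem 0 (c.mem 0) } : Config m B α) = c := by
        rw [Function.update_eq_self]
      simp only [idle, Prog.exec, hc, ih]
      simp
  | succ i ih =>
    have hc : ({ c with mem := fun j => ((none : Option (Fin B)).map (c.disk 0)).getD (c.mem j) } :
        Config m B α) = c := rfl
    simp only [idle, Prog.exec, hc, ih]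
    congr 1
    · ring
    · rw [if_neg (Nat.succ_ne_zero i)]
      split_ifs <;> simp

/-- The program `p` for operation `n`, followed by a delay. -/
def slow (g h : ℕ → ℕ) (p : Prog m B σ) (n : ℕ) : Prog m B (σ × ℕ) :=
  p.bind fun r => idle (g (n + 1) - g n) (h (n + 1) - h n) (r, n + 1)

theorem exec_slow (g h : ℕ → ℕ) (p : Prog m B σ) (n : ℕ) (c : Config m B α) :
    (slow g h p n).exec c = ⟨((p.exec c).state, n + 1), (p.exec c).cfg, (p.exec c).ios + (g (n + 1) - g n),
      (p.exec c).time + (B * (g (n + 1) - g n) + (h (n + 1) - h n)),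
      (p.exec c).blocks ∪ if g (n + 1) - g n = 0 then ∅ else {0}⟩ := by
  unfold slow
  rw [exec_bind, exec_idle]

/-- The priority queue `P`, slowed down so that the first `n` operations spend `g n` further I/Os and
`h n` further units of time. -/
def ExtPQ.padded (P : ExtPQ m B) (g h : ℕ → ℕ) : ExtPQ m B where
  Ctrl := P.Ctrl × ℕ
  init := (P.init, 0)
  insert s := slow g h (P.insert s.1) s.2
  deleteMin s := slow g h (P.deleteMin s.1) s.2

theorem ExtPQ.run_append_singleton (P : ExtPQ m B) (ops : List (Op α)) (op : Op α) :
    P.run (ops ++ [op]) = P.step (P.run ops) op := by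
  unfold ExtPQ.run; rw [List.foldl_append]; rfl

/-- The delays of the single operations are differences of `g` and of `h`, so they telescope. Idle
I/Os change neither memory nor disk and access block 0 only. -/
theorem ExtPQ.run_padded (P : ExtPQ m B) {g h : ℕ → ℕ} (hg : Monotone g) (hh : Monotone h) (hg0 : g 0 = 0)
    (hh0 : h 0 = 0) (ops : List (Op α)) :
    ((P.padded g h).run ops).state = ((P.run ops).state, ops.length) ∧
    ((P.padded g h).run ops).cfg = (P.run ops).cfg ∧
    ((P.padded g h).run ops).ios = (P.run ops).ios + g ops.length ∧
    ((P.padded g h).run ops).time = (P.run ops).time + (B * g ops.length + h ops.length) ∧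
    ((P.padded g h).run ops).blocks ⊆ (P.run ops).blocks ∪ if g ops.length = 0 then ∅ else {0} := by
  induction ops using List.reverseRecOn with
  | nil => simp [ExtPQ.run, ExtPQ.padded, hg0, hh0]
  | append_singleton ops op ih =>
    obtain ⟨h1, h2, h3, h4, h5⟩ := ih
    rw [ExtPQ.run_append_singleton, ExtPQ.run_append_singleton, List.length_append, List.length_singleton]
    generalize P.run ops = o at *
    generalize (P.padded g h).run ops = o' at *
    obtain ⟨st, c, ios, time, blocks⟩ := o'
    dsimp only at h1 h2 h3 h4 h5
    subst h1 h2 h3 h4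
    have hgn : g ops.length ≤ g (ops.length + 1) := hg (Nat.le_succ _)
    have hhn : h ops.length ≤ h (ops.length + 1) := hh (Nat.le_succ _)
    have hb : ∀ s : Finset ℕ, blocks ∪ (s ∪ if g (ops.length + 1) - g ops.length = 0 then ∅ else {0}) ⊆
        o.blocks ∪ s ∪ if g (ops.length + 1) = 0 then ∅ else {0} := by
      intro s a ha
      have h5 := @h5 a
      simp only [Finset.mem_union] at ha h5 ⊢
      by_cases h0 : g (ops.length + 1) = 0
      · simp only [show g ops.length = 0 by omega, h0] at ha h5 ⊢
        simp only [if_true, Finset.notMem_empty, or_false] at ha h5 ⊢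
        tauto
      · rw [if_neg h0]
        have : ∀ q : Prop, [Decidable q] → a ∈ (if q then ∅ else {0} : Finset ℕ) → a ∈ ({0} : Finset ℕ) := by
          intro q _ hq
          split_ifs at hq
          · simp at hq
          · exact hq
        rcases ha with ha | ha | ha
        · exact (h5 ha).elim (fun h => Or.inl (Or.inl h)) fun h => Or.inr (this _ h)
        · exact Or.inl (Or.inr ha)
        · exact Or.inr (this _ ha)
    have hmul : B * g ops.length + B * (g (ops.length + 1) - g ops.length) = B * g (ops.length + 1) := by
      rw [← Nat.mul_add, Nat.add_sub_cancel' hgn]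
    rcases op with x | _ <;>
      simp only [ExtPQ.step, ExtPQ.padded, exec_slow] <;>
      exact ⟨trivial, trivial, by omega, by omega, hb _⟩

end Idle

end IOModel

/-! ### The choice of the parameters and the existence of I/O-efficient queues -/

namespace IOModel

section Existence

variable {M B d : ℕ}

/-- Number of I/Os for which the first `n` operations are slowed down. -/
noncomputable def idleIOs (M B n : ℕ) : ℕ := if 2 * M ≤ n then Nat.ceil (sortIO M B n) else 0

/-- The threshold 2 M in `idleIOs` is where the required lower bound sets in. It also keeps sort in
the range where it is monotone and non-negative, and it rules out idle access to a block before 2 M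
operations. -/
theorem idleIOs_mono (hB : 1 ≤ B) (hM : 2 * B ≤ M) : Monotone (idleIOs M B) := by
  intro n n' h
  unfold idleIOs
  split_ifs with h1 h2
  · exact Nat.ceil_mono (sortIO_mono hB hM (by omega) h)
  · omega
  · exact Nat.zero_le _
  · exact le_rfl

theorem idleIOs_le (hB : 1 ≤ B) (hM : 2 * B ≤ M) {n k : ℕ} (hn : n ≤ k) (hk : M ≤ k) :
    (idleIOs M B n : ℝ) ≤ 2 * sortIO M B k := by
  have hB' : (0 : ℝ) < B := by exact_mod_cast hB
  have h1 : (1 : ℝ) ≤ (k : ℝ) / B := by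
    rw [one_le_div hB']; exact_mod_cast (by omega : B ≤ k)
  have h2 := h1.trans (div_le_sortIO hB hM hk)
  unfold idleIOs
  split_ifs with h
  · have h3 := Nat.ceil_lt_add_one (sortIO_nonneg hB hM (n := n) (by omega))
    have h4 := sortIO_mono hB hM (m := n) (by omega) hn
    linarith
  · simp only [Nat.cast_zero]; linarith

/-- An I/O takes B units of time, so the idle I/Os must also fit into the time bound; they do
because B · sort(k) is k log(k/B) divided by log(M/B), which is at least 1/2. -/
theorem mul_sortIO_le (hB : 1 ≤ B) (hM : 2 * B ≤ M) {k : ℕ} (hk : M ≤ k) :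
    B * sortIO M B k ≤ 2 * sortTime k := by
  have hB' : (0 : ℝ) < B := by exact_mod_cast hB
  have hB1 : (1 : ℝ) ≤ B := by exact_mod_cast hB
  have hk' : (0 : ℝ) < k := by exact_mod_cast (by omega : 0 < k)
  have h1 := half_le_log (two_le_div hB hM)
  have h2 : Real.log ((k : ℝ) / B) ≤ Real.log k :=
    Real.log_le_log (by positivity) (div_le_self hk'.le hB1)
  have h3 : Real.log ((k : ℝ) / B) / Real.log ((M : ℝ) / B) ≤ 2 * Real.log k := by
    rw [div_le_iff₀ (by linarith)]
    have := Real.log_natCast_nonneg k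
    nlinarith
  have e : B * sortIO M B k = k * (Real.log ((k : ℝ) / B) / Real.log ((M : ℝ) / B)) := by
    unfold sortIO
    rw [logb_eq, ← mul_assoc, mul_div_cancel₀ _ hB'.ne']
  rw [e]
  unfold sortTime
  nlinarith

theorem mul_idleIOs_le (hB : 1 ≤ B) (hM : 2 * B ≤ M) {n k : ℕ} (hn : n ≤ k) (hk : 2 ≤ k) :
    (B : ℝ) * idleIOs M B n ≤ 4 * sortTime k := by
  by_cases h : 2 * M ≤ n
  · have h1 := idleIOs_le hB hM hn (by omega)
    have h2 := mul_sortIO_le hB hM (k := k) (by omega)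
    have h3 : (B : ℝ) * idleIOs M B n ≤ B * (2 * sortIO M B k) := by gcongr
    linarith
  · unfold idleIOs
    rw [if_neg h]
    have := sortTime_nonneg k
    simp only [Nat.cast_zero, mul_zero]
    linarith

/-- The upper bounds come from `runInv` and the estimates of the depths; for the I/Os, 22 · 9 + 2 =
200 includes the delay. The lower bounds follow from the delay alone: a sequence that has stored `k`
records contains at least `k` operations. -/
theorem efficient_heapQueue [NeZero B] (hd : 2 ≤ d) (hM : 2 * B ≤ M) (hMd : M ≤ d ^ 8 * B)
    (hm : 8 * (d * B) ≤ M / 8) :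
    ((heapQueue (M / 8) B d).padded (idleIOs M B) fun n => ⌈sortTime n⌉₊).Efficient M 1 200 := by
  have hB : 1 ≤ B := Nat.one_le_iff_ne_zero.2 (NeZero.ne B)
  have hB' : (0 : ℝ) < B := by exact_mod_cast hB
  have hg := idleIOs_mono hB hM
  have hh : Monotone fun n => ⌈sortTime n⌉₊ := fun n n' h => Nat.ceil_mono (sortTime_mono h)
  have hg0 : idleIOs M B 0 = 0 := if_neg (by omega)
  have hh0 : ⌈sortTime 0⌉₊ = 0 := by simp [sortTime]
  have hpad := fun (α : Type) [LinearOrder α] (ops : List (Op α)) =>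
    (heapQueue (M / 8) B d).run_padded hg hh hg0 hh0 ops
  have hrun := fun (α : Type) [LinearOrder α] (ops : List (Op α)) =>
    runInv (α := α) (by omega) (Nat.lt_pow_succ_log_self (b := 2) (by norm_num) d) hm ops
  have hcount : ∀ (α : Type) [LinearOrder α] (ops : List (Op α)), ∃ f,
      ((heapQueue (M / 8) B d).run ops).state.nb = f + 1 ∧ d * B * f ≤ ops.length := by
    intro α _ ops
    have h1 := (hrun α ops).count
    have h2 := (hrun α ops).shows.stores.nb_pos
    obtain ⟨f, hf⟩ := Nat.exists_eq_succ_of_ne_zero h2.ne'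
    refine ⟨f, hf, ?_⟩
    rw [hf, Nat.succ_eq_add_one, Nat.mul_add, mul_one] at h1
    omega
  constructor
  · intro α _ ops
    rw [(hpad α ops).2.1, inf_lift_eq_least]
    exact (hrun α ops).shows.port
  · intro α _ ops k hk hMk
    obtain ⟨f, hf, hfl⟩ := hcount α ops
    have h1 := (hrun α ops).ios
    rw [hf] at h1
    have h2 := ios_depths_le hB hd hM hMd (hfl.trans hk) hMk.le
    have h3 := idleIOs_le hB hM hk hMk.le
    rw [(hpad α ops).2.2.1]
    have h4 : B * ((heapQueue (M / 8) B d).run ops).ios ≤ B * (22 * (d * Queue.depths d (f + 1))) := by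
      refine (Nat.le_of_add_right_le h1).trans_eq (by ring)
    have h5 : (((heapQueue (M / 8) B d).run ops).ios : ℝ) ≤ 22 * (d * Queue.depths d (f + 1)) := by
      exact_mod_cast Nat.le_of_mul_le_mul_left h4 hB
    push_cast
    linarith
  · intro α _ ops k hk hk2
    obtain ⟨f, hf, hfl⟩ := hcount α ops
    have h1 := Nat.le_of_add_right_le (hrun α ops).time
    rw [hf] at h1
    have h2 := time_depths_le hB hd (hfl.trans hk)
    have h3 := mul_idleIOs_le hB hM hk hk2
    have h4 := le_two_mul_sortTime hk2
    have hk2' : (2 : ℝ) ≤ k := by exact_mod_cast hk2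
    have h5 := Nat.ceil_lt_add_one (sortTime_nonneg ops.length)
    have h6 := sortTime_mono hk
    have h7 : ops.length * (Nat.log 2 ops.length + 5) ≤ k * (Nat.log 2 k + 5) :=
      Nat.mul_le_mul hk (Nat.add_le_add_right (Nat.log_mono_right hk) 5)
    have h8 := natLog_le (n := k) (by omega)
    have h9 : (k : ℝ) * (Nat.log 2 k + 5) ≤ 12 * sortTime k := by
      have : (k : ℝ) * Nat.log 2 k ≤ k * (2 * Real.log k) := by gcongr
      unfold sortTime at h4 ⊢
      linarith
    have h10 : (((heapQueue (M / 8) B d).run ops).time : ℝ) ≤ 66 * sortTime k + 12 * sortTime k := by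
      refine (Nat.cast_le.2 (h1.trans (Nat.add_le_add_left h7 _))).trans ?_
      rw [Nat.cast_add]
      refine add_le_add h2 ?_
      push_cast
      exact h9
    rw [(hpad α ops).2.2.2.1]
    push_cast
    linarith
  · intro α _ ops
    obtain ⟨f, hf, hfl⟩ := hcount α ops
    have h1 := (hrun α ops).blocks
    rw [hf, Nat.add_sub_cancel] at h1
    have h2 : ((heapQueue (M / 8) B d).run ops).blocks.card ≤ f * (4 * d) :=
      (Finset.card_le_card fun a ha => Finset.mem_range.2 (h1 a ha)).trans_eq (Finset.card_range _)
    have h3 := (Finset.card_le_card (hpad α ops).2.2.2.2).trans (Finset.card_union_le _ _)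
    -- The single block used for idling is charged only to sequences of at least 2 M operations, and
    -- these outweigh B records.
    have h4 : (if idleIOs M B ops.length = 0 then ∅ else {0} : Finset ℕ).card * B ≤ ops.length := by
      split_ifs with h
      · simp
      · have : 2 * M ≤ ops.length := by
          by_contra hlt
          exact h (if_neg hlt)
        rw [Finset.card_singleton]; omega
    have h5 := (h3.trans (Nat.add_le_add_right h2 _))
    have h6 := Nat.mul_le_mul_right B h5
    rw [Nat.add_mul] at h6
    have h7 : f * (4 * d) * B = 4 * (d * B * f) := by ring
    have h8 := h6.trans (show _ ≤ 200 * ops.length by omega)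
    exact_mod_cast h8
  · intro α _ pre ops k hpre hk _ hMk
    have h1 := (hk.trans (card_contents_le pre)).trans hpre.length_le
    rw [(hpad α ops).2.2.1, one_mul]
    have h2 := sortIO_mono hB hM (m := k) (by omega) h1
    have h3 : sortIO M B ops.length ≤ (idleIOs M B ops.length : ℝ) := by
      unfold idleIOs
      rw [if_pos (by omega)]
      exact Nat.le_ceil _
    push_cast
    have := Nat.cast_nonneg (α := ℝ) ((heapQueue (M / 8) B d).run ops).ios
    linarith
  · intro α _ pre ops k hpre hk _
    have h1 := (hk.trans (card_contents_le pre)).trans hpre.length_le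
    rw [(hpad α ops).2.2.2.1, one_mul]
    have h2 := sortTime_mono h1
    have h3 := Nat.le_ceil (sortTime ops.length)
    push_cast
    have h4 := Nat.cast_nonneg (α := ℝ) ((heapQueue (M / 8) B d).run ops).time
    have h5 : (0 : ℝ) ≤ B * idleIOs M B ops.length := by positivity
    linarith

/-- I/O-efficient priority queues exist. -/
theorem exists_efficient (hB : 1 ≤ B) (hM : 128 * B ≤ M) :
    ∃ P : ExtPQ (M / 8) B, P.Efficient M 1 200 := by
  have : NeZero B := ⟨by omega⟩
  -- The buffers and the merges fit into 8 d B cells, and M/8 cells are available; M ≥ 128 B makes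
  -- this degree at least 2. Since d ≥ 2, also M ≤ 64 (d + 1) B ≤ 2^7 d B ≤ d^8 B, the comparison of
  -- bases needed for the I/Os.
  set d := M / 8 / (8 * B) with hdef
  have h8 : 0 < 8 * B := by omega
  have hd : 2 ≤ d := by
    rw [hdef, Nat.le_div_iff_mul_le h8]; omega
  have hm : d * (8 * B) ≤ M / 8 := Nat.div_mul_le_self _ _
  have hlt : M / 8 < (d + 1) * (8 * B) := (Nat.div_lt_iff_lt_mul h8).1 (Nat.lt_succ_self _)
  refine ⟨_, efficient_heapQueue (d := d) hd (by omega) ?_ (by linarith)⟩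
  have h1 : M ≤ 64 * ((d + 1) * B) := by
    have e : (d + 1) * (8 * B) = 8 * ((d + 1) * B) := by ring
    omega
  have h2 : 64 * (d + 1) ≤ 2 ^ 7 * d := by omega
  have h3 : 2 ^ 7 * d ≤ d ^ 8 := by
    rw [pow_succ d 7]; exact Nat.mul_le_mul_right _ (Nat.pow_le_pow_left hd 7)
  calc M ≤ 64 * (d + 1) * B := by rw [mul_assoc]; exact h1
    _ ≤ d ^ 8 * B := Nat.mul_le_mul_right _ (h2.trans h3)

end Existence

end IOModel

theorem mainTheorem2 :
    -- I/O-efficient priority queues exist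
    (∃ (K : ℕ) (c C : ℝ), 0 < c ∧ ∀ M B : ℕ, 1 ≤ B → K * B ≤ M →
      ∃ P : IOModel.ExtPQ (M / 8) B, P.Efficient M c C) ∧
    -- and with any of them, the inner sweeps have the claimed worst-case cost
    (∀ c C : ℝ, 0 < c →
      -- upper bounds, for each invocation
      (∃ C' : ℝ, ∀ M B : ℕ, 1 ≤ B → 2 * B ≤ M →
        ∀ P : IOModel.ExtPQ (M / 8) B, P.Efficient M c C →
        ∀ (O : NestedSweep.Obdd) (X : Finset ℕ) (j : ℕ), O.WF → j ∈ X →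
          (M < O.size + NestedSweep.accumulated O X j ^ 2 →
            (NestedSweep.sweepIOs P O X j : ℝ) ≤
              C' * IOModel.sortIO M B (O.size + NestedSweep.accumulated O X j ^ 2)) ∧
          (2 ≤ O.size + NestedSweep.accumulated O X j ^ 2 →
            (NestedSweep.sweepTime P O X j : ℝ) ≤
              C' * IOModel.sortTime (O.size + NestedSweep.accumulated O X j ^ 2)) ∧
          (NestedSweep.sweepSpace P O X j : ℝ) ≤
              C' * ((O.size + NestedSweep.accumulated O X j ^ 2 : ℕ) : ℝ)) ∧
      -- matching lower bounds in the worst case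
      (∀ d : ℕ, ∃ c' : ℝ, 0 < c' ∧ ∀ M B : ℕ, 1 ≤ B → 2 * B ≤ M →
        ∀ P : IOModel.ExtPQ (M / 8) B, P.Efficient M c C →
        ∀ n t : ℕ, t ≤ n ^ d → 2 ≤ n + t ^ 2 →
          ∃ (O : NestedSweep.Obdd) (X : Finset ℕ) (j : ℕ), O.WF ∧ j ∈ X ∧
            O.size ≤ n ∧ NestedSweep.accumulated O X j ≤ t ∧
            (M < n + t ^ 2 →
              c' * IOModel.sortIO M B (n + t ^ 2) ≤ (NestedSweep.sweepIOs P O X j : ℝ)) ∧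
            c' * IOModel.sortTime (n + t ^ 2) ≤ (NestedSweep.sweepTime P O X j : ℝ))) := by
  exact ⟨⟨128, 1, 200, one_pos, fun _ _ hB hM => IOModel.exists_efficient hB hM⟩,
    fun c C hc => ⟨NestedSweep.upper_bounds c C, NestedSweep.lower_bounds c C hc⟩⟩
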